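/- Let $(\mathcal V,\otimes,I)$ be a complete and cocomplete, locally small, symmetric monoidal closed category, let $U=\mathcal V(I,-)\colon\mathcal V\to\mathrm{Set}$ and let $F\colon\mathrm{Set}\to\mathcal V$, $F(A)=\coprod_A I$, be its left adjoint. **Templicial objects.** For a set $S$, let $\mathrm{Quiv}_S$ be the category of families $(Q(a,b))_{a,b\in S}$ of objects of $\mathcal V$, with the monoidal product $(Q\otimes_S P)(a,b)=\coprod_{c\in S}Q(a,c)\otimes P(c,b)$ and its unit $I_S$. Let $\mathbf\Delta_f$ be the category of the posets $[n]=\{0<\dots<n\}$, $n\ge 0$, and order morphisms preserving both endpoints, monoidal by $[m]+[n]=[m+n]$ (identifying the last element of $[m]$ with the first element of $[n]$). A templicial object is a pair $(X,S)$ of a set $S$ and a strongly unital colax monoidal functor $X\colon\mathbf\Delta_f^{op}\to\mathrm{Quiv}_S$, that is, one whose counit $X_0\to I_S$ is an isomorphism. A morphism $(X,S)\to(Y,S')$ is a map $f\colon S\to S'$ with a monoidal natural transformation $f_!X\to Y$, where $f_!$ is the left adjoint of $f^*\colon\mathrm{Quiv}_{S'}\to\mathrm{Quiv}_S$, $f^*(Q)(a,b)=Q(f(a),f(b))$.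 They form a category $\mathrm{ts}\mathcal V$. For a simplicial set $K$, let $\tilde F(K)$ be the templicial object with vertex set $K_0$ and $\tilde F(K)_n(a,b)=F(K_n(a,b))$, where $K_n(a,b)$ is the set of $n$-simplices with first vertex $a$ and last vertex $b$, with comultiplication $x\mapsto(x|_{[0,k]},x|_{[k,k+l]})$; this is a functor $\tilde F\colon\mathrm{SSet}\to\mathrm{ts}\mathcal V$. **Necklaces.** Let $\mathrm{Nec}$ be the category of necklaces: the objects are pairs $(T,p)$ with $p\ge0$ and $\{0,p\}\subseteq T\subseteq[p]$, and a morphism $(T,p)\to(U,q)$ is a morphism $f\colon[p]\to[q]$ of $\mathbf\Delta_f$ with $U\subseteq f(T)$. It is monoidal by concatenation $T\vee U$, with unit $([0],0)$. A necklace category is a small category enriched in $\mathcal V^{\mathrm{Nec}^{op}}$ with the Day convolution; they form a category $\mathcal V\mathrm{Cat}_{\mathrm{Nec}}$. A templicial object $X$ gives a necklace category $X^{nec}$ with object set $S$ and, for $T=\{0<t_1<\dots<t_{k-1}<p\}$, $X^{nec}(a,b)_T=X_T(a,b)$, where $X_T=X_{t_1}\otimes_S X_{t_2-t_1}\otimes_S\dots\otimes_S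 X_{p-t_{k-1}}$ ($X_T=I_S$ for $p=0$), functorial in $T$ through the comultiplications and structure maps of $X$ and with composition induced by concatenation. **Nerve and categorification.** Let $S\mathcal V$ be the category of simplicial objects of $\mathcal V$ with the pointwise monoidal structure, $\mathcal V\mathrm{Cat}_\Delta$ the category of small $S\mathcal V$-enriched categories, and $[-,-]$ the $\mathcal V$-valued hom of $S\mathcal V$. For a necklace $(T,p)$ let $\mathcal P_T=\{W\mid T\subseteq W\subseteq[p]\}$, ordered by inclusion, with nerve $N(\mathcal P_T)$. Let $\mathfrak n\colon\mathcal V\mathrm{Cat}_\Delta\to\mathcal V\mathrm{Cat}_{\mathrm{Nec}}$ be the functor that keeps the objects, with $\mathfrak n(\mathcal C)(A,B)_T=[FN(\mathcal P_T),\mathcal C(A,B)]$ and composition induced by that of $\mathcal C$ and the isomorphisms $\mathcal P_{T\vee U}\cong\mathcal P_T\times\mathcal P_U$. **Quasi-categories in $\mathcal V$.** A templicial object $(X,S)$ is a quasi-category in $\mathcal V$ if for all $a,b\in S$ and $0<j<n$, every morphism $\tilde F(\Lambda^n_j)^{nec}(0,n)\to X^{nec}(a,b)$ in $\mathcal V^{\mathrm{Nec}^{op}}$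 extends along $\tilde F(\Lambda^n_j)^{nec}(0,n)\to\tilde F(\Delta^n)^{nec}(0,n)$. **Theorem.** 1. The functor $(-)^{nec}\colon\mathrm{ts}\mathcal V\to\mathcal V\mathrm{Cat}_{\mathrm{Nec}}$ has a right adjoint $(-)^{temp}$, and $\mathfrak n$ has a left adjoint $\mathfrak s$. The functor $\mathfrak s$ is computed by weighted colimits: for every necklace category $\mathcal D$, the unit $\eta\colon\mathcal D\to\mathfrak n(\mathfrak s(\mathcal D))$ is bijective on objects and exhibits $\mathfrak s(\mathcal D)(\eta A,\eta B)$ as the colimit of $T\mapsto FN(\mathcal P_T)$ weighted by $\mathcal D(A,B)$, for all objects $A,B$ of $\mathcal D$. Hence the templicial homotopy coherent nerve $N^{hc}_{\mathcal V}=(-)^{temp}\circ\mathfrak n\colon\mathcal V\mathrm{Cat}_\Delta\to\mathrm{ts}\mathcal V$ is right adjoint to the categorification $\mathfrak C_{\mathcal V}=\mathfrak s\circ(-)^{nec}$. 2. If $\mathcal V=\mathrm{Set}$ with the cartesian product, then $\tilde F\colon\mathrm{SSet}\to\mathrm{ts}\,\mathrm{Set}$ is an equivalence of categories, and under it $N^{hc}_{\mathcal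 V}$ is the classical homotopy coherent nerve: $N^{hc}_{\mathrm{Set}}\cong\tilde F\circ N^{hc}$, where $N^{hc}(\mathcal C)_n$ is the set of simplicial functors $\mathfrak C[\Delta^n]\to\mathcal C$. 3. Let $\mathcal C$ be a small $S\mathcal V$-enriched category whose underlying simplicial category is locally Kan, that is, the simplicial set $U(\mathcal C(A,B))$ is a Kan complex for all objects $A,B$. Then $N^{hc}_{\mathcal V}(\mathcal C)$ is a quasi-category in $\mathcal V$. -/

import Mathlib

open CategoryTheory MonoidalCategory Limits Opposite

universe u v

set_option linter.unusedSectionVars false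

noncomputable section

namespace HCNerve

/-! ## Finite intervals -/

/-- The category of finite intervals: its objects are the posets `[n] = {0 < ... < n}`. -/
structure FInt where
  /-- the last element of the interval -/
  len : ℕ

/-- A morphism `[m] ⟶ [n]` of finite intervals is an order preserving map `{0,…,m} → {0,…,n}` that
preserves both endpoints. It is encoded by its unique extension to a map `ℕ → ℕ` which is a
translation from `m` onwards (see `FInt.Hom.equivOrderHom`). -/
@[ext]
structure FInt.Hom (m n : ℕ) where
  /-- the underlying map -/
  toFun : ℕ → ℕ
  mono : Monotone toFun
  map_zero : toFun 0 = 0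
  map_add : ∀ i, toFun (m + i) = n + i

namespace FInt

instance (m n : ℕ) : CoeFun (Hom m n) fun _ ↦ ℕ → ℕ := ⟨Hom.toFun⟩

namespace Hom

lemma map_last {m n : ℕ} (f : Hom m n) : f m = n := f.map_add 0

lemma map_le {m n : ℕ} (f : Hom m n) {i : ℕ} (h : i ≤ m) : f i ≤ n :=
  (f.mono h).trans_eq f.map_last

lemma map_of_le {m n : ℕ} (f : Hom m n) {i : ℕ} (h : m ≤ i) : f i = n + (i - m) := by
  obtain ⟨k, rfl⟩ := Nat.exists_eq_add_of_le h
  rw [f.map_add, Nat.add_sub_cancel_left]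

/-- The identity. -/
def id (m : ℕ) : Hom m m := ⟨fun i ↦ i, monotone_id, rfl, fun _ ↦ rfl⟩

/-- Composition, in diagrammatic order. -/
def comp {m n p : ℕ} (f : Hom m n) (g : Hom n p) : Hom m p where
  toFun i := g (f i)
  mono := g.mono.comp f.mono
  map_zero := by rw [f.map_zero, g.map_zero]
  map_add i := by rw [f.map_add, g.map_add]

/-- The sum `f + g`, which is `f` on `[m]`, followed by `g` on `[n]`. -/
def add {m m' n n' : ℕ} (f : Hom m m') (g : Hom n n') : Hom (m + n) (m' + n') where
  toFun i := if i ≤ m then f i else m' + g (i - m)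
  mono i j h := by
    dsimp only
    split_ifs with h1 h2 h2
    · exact f.mono h
    · exact (f.map_le h1).trans (Nat.le_add_right _ _)
    · omega
    · exact Nat.add_le_add_left (g.mono (by omega)) _
  map_zero := by simp [f.map_zero]
  map_add i := by
    have h := g.map_add i
    have h0 := g.map_last
    have h1 := g.map_zero
    split_ifs with h2
    · obtain rfl : n = 0 := by omega
      obtain rfl : i = 0 := by omega
      simpa [h1 ▸ h0.symm] using f.map_last
    · rw [show m + n + i - m = n + i by omega, h]; omega

/-- The map `[m] → [n]` with underlying map the identity, for an equality `m = n`. -/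
def cast {m n : ℕ} (h : m = n) : Hom m n := ⟨fun i ↦ i, monotone_id, rfl, fun _ ↦ by rw [h]⟩

/-- Morphisms of finite intervals are the same thing as endpoint preserving order morphisms. -/
def equivOrderHom (m n : ℕ) :
    Hom m n ≃ {f : Fin (m + 1) →o Fin (n + 1) // f 0 = 0 ∧ f (Fin.last m) = Fin.last n} where
  toFun f := ⟨⟨fun i ↦ ⟨f i, Nat.lt_succ_of_le (f.map_le (Nat.le_of_lt_succ i.2))⟩,
    fun _ _ h ↦ f.mono h⟩, Fin.ext f.map_zero, Fin.ext f.map_last⟩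
  invFun f :=
    { toFun i := if h : i ≤ m then f.1 ⟨i, Nat.lt_succ_of_le h⟩ else n + (i - m)
      mono i j h := by
        dsimp only
        split_ifs with h1 h2 h2
        · exact f.1.monotone h
        · have := (f.1 ⟨i, Nat.lt_succ_of_le h1⟩).2
          omega
        · omega
        · omega
      map_zero := by simpa using congrArg Fin.val f.2.1
      map_add i := by
        have := congrArg Fin.val f.2.2
        split_ifs with h
        · obtain rfl : i = 0 := by omega
          exact this
        · omega }
  left_inv f := by
    ext i
    dsimp
    split_ifs with h
    · rfl
    · rw [f.map_of_le (by omega)]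
  right_inv f := by
    ext i
    simp [Nat.le_of_lt_succ i.2]

end Hom

instance : Category FInt where
  Hom m n := Hom m.len n.len
  id m := Hom.id m.len
  comp := Hom.comp

@[ext]
lemma hom_ext {m n : FInt} {f g : m ⟶ n} (h : ∀ i, f.toFun i = g.toFun i) : f = g :=
  Hom.ext (funext h)

/-- The morphism `[m] ⟶ [n]` that is the identity on underlying maps, for an equality `m = n`. -/
def homCast {m n : FInt} (h : m.len = n.len) : m ⟶ n := Hom.cast h

/-- The isomorphism `[m] ≅ [n]` that is the identity on underlying maps, for an equality `m = n`. -/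
def isoCast {m n : FInt} (h : m.len = n.len) : m ≅ n where
  hom := homCast h
  inv := homCast h.symm

instance : MonoidalCategoryStruct FInt where
  tensorObj m n := ⟨m.len + n.len⟩
  tensorUnit := ⟨0⟩
  tensorHom f g := Hom.add f g
  whiskerLeft m _ _ g := Hom.add (Hom.id m.len) g
  whiskerRight f n := Hom.add f (Hom.id n.len)
  associator _ _ _ := isoCast (Nat.add_assoc _ _ _)
  leftUnitor _ := isoCast (Nat.zero_add _)
  rightUnitor _ := isoCast (Nat.add_zero _)

@[simp] lemma id_toFun (m : FInt) (i : ℕ) : (𝟙 m : m ⟶ m).toFun i = i := rfl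
@[simp] lemma comp_toFun {m n p : FInt} (f : m ⟶ n) (g : n ⟶ p) (i : ℕ) :
    (f ≫ g).toFun i = g.toFun (f.toFun i) := rfl
@[simp] lemma homCast_toFun {m n : FInt} (h : m.len = n.len) (i : ℕ) :
    (homCast h : m ⟶ n).toFun i = i := rfl
@[simp] lemma isoCast_hom_toFun {m n : FInt} (h : m.len = n.len) (i : ℕ) :
    (isoCast h).hom.toFun i = i := rfl
@[simp] lemma isoCast_inv_toFun {m n : FInt} (h : m.len = n.len) (i : ℕ) :
    (isoCast h).inv.toFun i = i := rfl
@[simp] lemma tensorObj_len (m n : FInt) : (m ⊗ n).len = m.len + n.len := rfl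
@[simp] lemma tensorUnit_len : (𝟙_ FInt).len = 0 := rfl
lemma tensorHom_toFun {m m' n n' : FInt} (f : m ⟶ m') (g : n ⟶ n') (i : ℕ) :
    (f ⊗ₘ g).toFun i = if i ≤ m.len then f.toFun i else m'.len + g.toFun (i - m.len) := rfl
lemma whiskerLeft_toFun (m : FInt) {n n' : FInt} (g : n ⟶ n') (i : ℕ) :
    (m ◁ g).toFun i = if i ≤ m.len then i else m.len + g.toFun (i - m.len) := rfl
lemma whiskerRight_toFun {m m' : FInt} (f : m ⟶ m') (n : FInt) (i : ℕ) :
    (f ▷ n).toFun i = if i ≤ m.len then f.toFun i else m'.len + (i - m.len) := rfl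
@[simp] lemma associator_hom (m n p : FInt) (i : ℕ) : (α_ m n p).hom.toFun i = i := rfl
@[simp] lemma associator_inv (m n p : FInt) (i : ℕ) : (α_ m n p).inv.toFun i = i := rfl
@[simp] lemma leftUnitor_hom (m : FInt) (i : ℕ) : (λ_ m).hom.toFun i = i := rfl
@[simp] lemma leftUnitor_inv (m : FInt) (i : ℕ) : (λ_ m).inv.toFun i = i := rfl
@[simp] lemma rightUnitor_hom (m : FInt) (i : ℕ) : (ρ_ m).hom.toFun i = i := rfl
@[simp] lemma rightUnitor_inv (m : FInt) (i : ℕ) : (ρ_ m).inv.toFun i = i := rfl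

lemma toFun_zero {m n : FInt} (f : m ⟶ n) : f.toFun 0 = 0 := Hom.map_zero f
lemma toFun_len {m n : FInt} (f : m ⟶ n) : f.toFun m.len = n.len := Hom.map_last f
lemma toFun_le {m n : FInt} (f : m ⟶ n) {i : ℕ} (h : i ≤ m.len) : f.toFun i ≤ n.len :=
  Hom.map_le f h
lemma toFun_of_le {m n : FInt} (f : m ⟶ n) {i : ℕ} (h : m.len ≤ i) :
    f.toFun i = n.len + (i - m.len) := Hom.map_of_le f h
lemma le_toFun {m n : FInt} (f : m ⟶ n) {i : ℕ} (h : m.len ≤ i) : n.len ≤ f.toFun i := by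
  rw [toFun_of_le f h]; omega

instance : MonoidalCategory FInt := MonoidalCategory.ofTensorHom
  (id_tensorHom_id := fun m n ↦ by ext i; simp [tensorHom_toFun]; omega)
  (id_tensorHom := fun m n n' g ↦ by rfl)
  (tensorHom_id := fun f n ↦ by rfl)
  (tensorHom_comp_tensorHom := fun {m m' m'' n n' n''} f f' g g' ↦ by
    ext i
    simp only [comp_toFun, tensorHom_toFun]
    split_ifs with h1 h2 h2
    · rfl
    · exact absurd (toFun_le f h1) h2
    · have : f'.toFun (i - m.len) = 0 := by omega
      rw [this, toFun_zero, Nat.add_zero, toFun_len]; rfl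
    · congr 2; omega)
  (associator_naturality := fun {m n p m' n' p'} f g h ↦ by
    ext i
    simp only [comp_toFun, tensorHom_toFun, associator_hom, tensorObj_len]
    split_ifs with h1 h2 h3 h3
    · rfl
    · rfl
    · omega
    · omega
    · omega
    · rw [Nat.add_assoc, Nat.sub_sub])
  (leftUnitor_naturality := fun {m n} f ↦ by
    ext i
    simp only [comp_toFun, tensorHom_toFun, leftUnitor_hom, tensorUnit_len, id_toFun]
    split_ifs with h
    · obtain rfl : i = 0 := by omega
      rw [toFun_zero]
    · simp)
  (rightUnitor_naturality := fun {m n} f ↦ by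
    ext i
    simp only [comp_toFun, tensorHom_toFun, rightUnitor_hom, tensorUnit_len, id_toFun]
    split_ifs with h
    · rfl
    · rw [toFun_of_le f (by omega)])
  (pentagon := fun m n p q ↦ by
    ext i
    simp only [comp_toFun, tensorHom_toFun, associator_hom, tensorObj_len, id_toFun]
    split_ifs <;> omega)
  (triangle := fun m n ↦ by
    ext i
    simp only [comp_toFun, tensorHom_toFun, associator_hom, tensorObj_len, id_toFun,
      leftUnitor_hom, rightUnitor_hom, tensorUnit_len]
    split_ifs <;> omega)

end FInt

/-! ## Necklaces -/

/-- The set of joints of the wedge `Δ^{n₁} ∨ ⋯ ∨ Δ^{nₖ}`, that is the set of partial sums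
`{0, n₁, n₁ + n₂, …, n₁ + ⋯ + nₖ}`. -/
def joints : List ℕ → Set ℕ
  | [] => {0}
  | b :: l => insert 0 ((b + ·) '' joints l)

lemma zero_mem_joints : ∀ l, 0 ∈ joints l
  | [] => rfl
  | _ :: _ => Set.mem_insert _ _

lemma sum_mem_joints : ∀ l : List ℕ, l.sum ∈ joints l
  | [] => rfl
  | b :: l => Or.inr ⟨l.sum, sum_mem_joints l, by simp⟩

lemma le_sum_of_mem_joints : ∀ {l : List ℕ} {i : ℕ}, i ∈ joints l → i ≤ l.sum
  | [], _, h => le_of_eq h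
  | _ :: _, _, Or.inl h => by rw [h]; exact Nat.zero_le _
  | b :: l, _, Or.inr ⟨j, hj, h⟩ => by
    have := le_sum_of_mem_joints hj
    simp only [List.sum_cons, ← h]; omega

lemma mem_joints_append : ∀ {l l' : List ℕ} {i : ℕ},
    i ∈ joints (l ++ l') ↔ i ∈ joints l ∨ ∃ j ∈ joints l', l.sum + j = i
  | [], l', i => by
    refine ⟨fun h ↦ Or.inr ⟨i, h, by simp⟩, ?_⟩
    rintro (h | ⟨j, hj, rfl⟩)
    · exact h ▸ zero_mem_joints _
    · simpa using hj
  | b :: l, l', i => by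
    simp only [List.cons_append, joints, Set.mem_insert_iff, Set.mem_image, mem_joints_append,
      List.sum_cons]
    constructor
    · rintro (h | ⟨j, hj | ⟨k, hk, rfl⟩, rfl⟩)
      · exact Or.inl (Or.inl h)
      · exact Or.inl (Or.inr ⟨j, hj, rfl⟩)
      · exact Or.inr ⟨k, hk, by omega⟩
    · rintro ((h | ⟨j, hj, rfl⟩) | ⟨k, hk, rfl⟩)
      · exact Or.inl h
      · exact Or.inr ⟨j, Or.inl hj, rfl⟩
      · exact Or.inr ⟨_, Or.inr ⟨k, hk, rfl⟩, by omega⟩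

/-- A necklace `Δ^{n₁} ∨ ⋯ ∨ Δ^{nₖ}` with `n₁, …, nₖ > 0` (and `k ≥ 0`), given by the list
`n₁, …, nₖ`. It has vertices `[p]` with `p = n₁ + ⋯ + nₖ`, and is determined by its set of joints
`{0 < p} ⊆ T ⊆ [p]`. -/
structure Nec where
  /-- the dimensions of the beads -/
  beads : List ℕ
  pos : ∀ b ∈ beads, 0 < b

namespace Nec

/-- The last vertex `p` of a necklace `(T, p)`. -/
def len (T : Nec) : ℕ := T.beads.sum

/-- A map of necklaces `(T, p) ⟶ (U, q)` (given by their lists of beads) is a morphism `f : [p] ⟶ [q]` of finite intervals such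
that `U ⊆ f(T)`. -/
@[ext]
structure Hom (T U : List ℕ) where
  /-- the underlying map on vertices -/
  vert : FInt.Hom T.sum U.sum
  joints_subset : joints U ⊆ vert '' joints T

/-- The identity map of a necklace. -/
def Hom.id (T : List ℕ) : Hom T T := ⟨FInt.Hom.id T.sum, fun i hi ↦ ⟨i, hi, rfl⟩⟩

/-- Composition of maps of necklaces, in diagrammatic order. -/
def Hom.comp {T U W : List ℕ} (f : Hom T U) (g : Hom U W) : Hom T W :=
  ⟨f.vert.comp g.vert, fun i hi ↦ by
    obtain ⟨j, hj, rfl⟩ := g.joints_subset hi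
    obtain ⟨k, hk, rfl⟩ := f.joints_subset hj
    exact ⟨k, hk, rfl⟩⟩

instance : Category Nec where
  Hom T U := Hom T.beads U.beads
  id T := Hom.id T.beads
  comp := Hom.comp

/-- The functor sending a necklace to its interval of vertices. -/
def vertices : Nec ⥤ FInt where
  obj T := ⟨T.len⟩
  map f := f.vert

instance : vertices.Faithful where
  map_injective h := Hom.ext h

/-- The map of necklaces which is the identity on vertices. -/
def Hom.cast {T U : List ℕ} (h : T = U) : Hom T U :=
  ⟨FInt.Hom.cast (congrArg List.sum h), fun i hi ↦ ⟨i, h ▸ hi, rfl⟩⟩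

/-- The wedge of two maps of necklaces. -/
def Hom.wedge {T T' U U' : List ℕ} (f : Hom T T') (g : Hom U U') : Hom (T ++ U) (T' ++ U') where
  vert := ((FInt.Hom.cast List.sum_append).comp (FInt.Hom.add f.vert g.vert)).comp
    (FInt.Hom.cast List.sum_append.symm)
  joints_subset i hi := by
    obtain h | ⟨j, hj, rfl⟩ := mem_joints_append.1 hi
    · obtain ⟨k, hk, rfl⟩ := f.joints_subset h
      exact ⟨k, mem_joints_append.2 (Or.inl hk), if_pos (le_sum_of_mem_joints hk)⟩
    · obtain ⟨k, hk, rfl⟩ := g.joints_subset hj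
      refine ⟨T.sum + k, mem_joints_append.2 (Or.inr ⟨k, hk, rfl⟩), ?_⟩
      change (if T.sum + k ≤ T.sum then f.vert (T.sum + k) else
        T'.sum + g.vert (T.sum + k - T.sum)) = T'.sum + g.vert k
      rw [Nat.add_sub_cancel_left]
      split_ifs with h
      · obtain rfl : k = 0 := by omega
        rw [g.vert.map_zero]; exact f.vert.map_last
      · rfl

/-- The isomorphism of necklaces which is the identity on vertices. -/
def isoCast {T U : Nec} (h : T.beads = U.beads) : T ≅ U where
  hom := Hom.cast h
  inv := Hom.cast h.symm

/-- The wedge of two necklaces. -/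
def wedge (T U : Nec) : Nec where
  beads := T.beads ++ U.beads
  pos b hb := (List.mem_append.1 hb).elim (T.pos b) (U.pos b)

lemma wedge_len (T U : Nec) : (wedge T U).len = T.len + U.len := List.sum_append

instance : MonoidalCategoryStruct Nec where
  tensorObj := wedge
  tensorUnit := ⟨[], by simp⟩
  tensorHom := Hom.wedge
  whiskerLeft T _ _ g := Hom.wedge (Hom.id T.beads) g
  whiskerRight f U := Hom.wedge f (Hom.id U.beads)
  associator _ _ _ := isoCast (List.append_assoc _ _ _)
  leftUnitor _ := isoCast (List.nil_append _)
  rightUnitor _ := isoCast (List.append_nil _)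

/-- The monoidal category of necklaces with the wedge. -/
instance : MonoidalCategory Nec := Monoidal.induced vertices
  { μIso := fun T U ↦ FInt.isoCast (wedge_len T U).symm
    εIso := Iso.refl _
    whiskerLeft_eq := fun _ _ _ _ ↦ rfl
    whiskerRight_eq := fun _ _ ↦ rfl
    tensorHom_eq := fun _ _ ↦ rfl
    associator_eq := fun T U W ↦ by
      ext i
      have h := wedge_len T U
      let e := if i ≤ (wedge T U).len then i else T.len + U.len + (i - (wedge T U).len)
      have he : e = i := by dsimp only [e]; split_ifs <;> omega
      change i = if e ≤ T.len then e else T.len + (e - T.len)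
      split_ifs <;> omega
    leftUnitor_eq := fun T ↦ by
      ext i
      change i = if i ≤ 0 then i else 0 + (i - 0)
      split_ifs <;> omega
    rightUnitor_eq := fun T ↦ by
      ext i
      change i = if i ≤ T.len then i else T.len + (i - T.len)
      split_ifs <;> omega }

/-- The simplex `Δ^n` as a necklace. -/
def simplex (n : ℕ) (hn : 0 < n) : Nec := ⟨[n], by simpa⟩

end Nec

/-! ## Quivers -/

section Sigma

variable {V : Type v} [Category.{u} V] [MonoidalCategory V] [SymmetricCategory V]
  [MonoidalClosed V] [HasColimits V] {J : Type u} (f : J → V) {Y Z : V}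

/-- The tensor product with `Z` of a coproduct is a coproduct. -/
def isColimitTensorRight : IsColimit ((tensorRight Z).mapCocone (Cofan.mk (∐ f) (Sigma.ι f))) :=
  isColimitOfPreserves _ (coproductIsCoproduct f)

/-- The tensor product with `Z` of a coproduct is a coproduct. -/
def isColimitTensorLeft : IsColimit ((tensorLeft Z).mapCocone (Cofan.mk (∐ f) (Sigma.ι f))) :=
  isColimitOfPreserves _ (coproductIsCoproduct f)

/-- A morphism out of `(∐ f) ⊗ Z` from its components. -/
def descR (g : ∀ j, f j ⊗ Z ⟶ Y) : (∐ f) ⊗ Z ⟶ Y :=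
  (isColimitTensorRight f).desc ⟨Y, Discrete.natTrans fun j ↦ g j.as⟩

/-- A morphism out of `Z ⊗ (∐ f)` from its components. -/
def descL (g : ∀ j, Z ⊗ f j ⟶ Y) : Z ⊗ (∐ f) ⟶ Y :=
  (isColimitTensorLeft f).desc ⟨Y, Discrete.natTrans fun j ↦ g j.as⟩

variable {f}

@[simp] lemma ι_descR (g : ∀ j, f j ⊗ Z ⟶ Y) (j : J) : Sigma.ι f j ▷ Z ≫ descR f g = g j :=
  (isColimitTensorRight f).fac _ ⟨j⟩

@[simp] lemma ι_descR_assoc (g : ∀ j, f j ⊗ Z ⟶ Y) (j : J)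
    {K : _} (k : _ ⟶ K) :
    Sigma.ι f j ▷ Z ≫ descR f g ≫ k =
      g j ≫ k := by
  rw [reassoc_of% ι_descR]

@[simp] lemma ι_descL (g : ∀ j, Z ⊗ f j ⟶ Y) (j : J) : Z ◁ Sigma.ι f j ≫ descL f g = g j :=
  (isColimitTensorLeft f).fac _ ⟨j⟩

@[simp] lemma ι_descL_assoc (g : ∀ j, Z ⊗ f j ⟶ Y) (j : J)
    {K : _} (k : _ ⟶ K) :
    Z ◁ Sigma.ι f j ≫ descL f g ≫ k =
      g j ≫ k := by
  rw [reassoc_of% ι_descL]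

lemma sigmaR_ext {g h : (∐ f) ⊗ Z ⟶ Y} (w : ∀ j, Sigma.ι f j ▷ Z ≫ g = Sigma.ι f j ▷ Z ≫ h) :
    g = h :=
  (isColimitTensorRight f).hom_ext fun j ↦ w j.as

lemma sigmaL_ext {g h : Z ⊗ (∐ f) ⟶ Y} (w : ∀ j, Z ◁ Sigma.ι f j ≫ g = Z ◁ Sigma.ι f j ≫ h) :
    g = h :=
  (isColimitTensorLeft f).hom_ext fun j ↦ w j.as

end Sigma

/-- A `V`-enriched quiver with set of vertices `S`. -/
structure Quiv (V : Type v) (S : Type u) where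
  /-- the object of arrows from `a` to `b` -/
  hom : S → S → V

namespace Quiv

variable {V : Type v} [Category.{u} V] {S : Type u}

/-- A morphism of quivers with the same vertices. -/
@[ext]
structure Hom (Q P : Quiv V S) where
  /-- the component at a pair of vertices -/
  app (a b : S) : Q.hom a b ⟶ P.hom a b

instance : Category (Quiv V S) where
  Hom := Hom
  id Q := ⟨fun _ _ ↦ 𝟙 _⟩
  comp f g := ⟨fun a b ↦ f.app a b ≫ g.app a b⟩

@[ext]
lemma hom_ext {Q P : Quiv V S} {f g : Q ⟶ P} (h : ∀ a b, f.app a b = g.app a b) : f = g :=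
  Hom.ext (by ext a b; exact h a b)

@[simp] lemma id_app (Q : Quiv V S) (a b : S) : (𝟙 Q : Q ⟶ Q).app a b = 𝟙 _ := rfl

@[simp] lemma comp_app {Q P R : Quiv V S} (f : Q ⟶ P) (g : P ⟶ R) (a b : S) :
    (f ≫ g).app a b = f.app a b ≫ g.app a b := rfl

@[simp] lemma comp_app_assoc {Q P R : Quiv V S} (f : Q ⟶ P) (g : P ⟶ R) (a b : S)
    {K : _} (k : _ ⟶ K) :
    (f ≫ g).app a b ≫ k =
      f.app a b ≫ g.app a b ≫ k := by
  rw [reassoc_of% comp_app]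

/-- An isomorphism of quivers from its components. -/
@[simps]
def isoMk {Q P : Quiv V S} (e : ∀ a b, Q.hom a b ≅ P.hom a b) : Q ≅ P where
  hom := ⟨fun a b ↦ (e a b).hom⟩
  inv := ⟨fun a b ↦ (e a b).inv⟩

variable [MonoidalCategory V] [HasColimits V]

/-- The unit quiver: `I` if `a = b` and the initial object otherwise, written uniformly as the
coproduct of copies of `I` indexed by the proofs of `a = b`. -/
def unit (V : Type v) [Category.{u} V] [MonoidalCategory V] [HasColimits V] (S : Type u) :
    Quiv V S where
  hom a b := ∐ fun _ : ULift.{u} (PLift (a = b)) ↦ 𝟙_ V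

/-- The tensor product `(Q ⊗_S P)(a, b) = ∐_c Q(a, c) ⊗ P(c, b)`. -/
def tensor (Q P : Quiv V S) : Quiv V S where
  hom a b := ∐ fun c : S ↦ Q.hom a c ⊗ P.hom c b

/-- The inclusion of `I` in the unit quiver at `(a, b)` if `a = b`. -/
def unitι {a b : S} (h : a = b) : 𝟙_ V ⟶ (unit V S).hom a b :=
  Sigma.ι (fun _ : ULift.{u} (PLift (a = b)) ↦ 𝟙_ V) ⟨⟨h⟩⟩

/-- The inclusion of `Q(a, c) ⊗ P(c, b)` in `(Q ⊗_S P)(a, b)`. -/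
def ι (Q P : Quiv V S) (a c b : S) : Q.hom a c ⊗ P.hom c b ⟶ (tensor Q P).hom a b :=
  Sigma.ι (fun c : S ↦ Q.hom a c ⊗ P.hom c b) c

/-- A morphism out of `(Q ⊗_S P)(a, b)` from its components. -/
def desc {Q P : Quiv V S} {a b : S} {Y : V} (g : ∀ c, Q.hom a c ⊗ P.hom c b ⟶ Y) :
    (tensor Q P).hom a b ⟶ Y :=
  Sigma.desc g

/-- A morphism out of the unit quiver at `(a, b)`. -/
def unitDesc {a b : S} {Y : V} (g : a = b → (𝟙_ V ⟶ Y)) : (unit V S).hom a b ⟶ Y :=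
  Sigma.desc fun h ↦ g h.down.down

@[simp] lemma ι_desc {Q P : Quiv V S} {a b : S} {Y : V} (g : ∀ c, Q.hom a c ⊗ P.hom c b ⟶ Y) (c : S) :
    ι Q P a c b ≫ desc g = g c :=
  Sigma.ι_desc _ _

@[simp] lemma ι_desc_assoc {Q P : Quiv V S} {a b : S} {Y : V} (g : ∀ c, Q.hom a c ⊗ P.hom c b ⟶ Y) (c : S)
    {K : _} (k : _ ⟶ K) :
    ι Q P a c b ≫ desc g ≫ k =
      g c ≫ k := by
  rw [reassoc_of% ι_desc]

@[simp] lemma unitι_desc {a b : S} {Y : V} (g : a = b → (𝟙_ V ⟶ Y)) (h : a = b) :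
    unitι h ≫ unitDesc g = g h :=
  Sigma.ι_desc _ _

@[simp] lemma unitι_desc_assoc {a b : S} {Y : V} (g : a = b → (𝟙_ V ⟶ Y)) (h : a = b)
    {K : _} (k : _ ⟶ K) :
    unitι h ≫ unitDesc g ≫ k =
      g h ≫ k := by
  rw [reassoc_of% unitι_desc]

lemma tensor_ext {Q P : Quiv V S} {a b : S} {Y : V} {g h : (tensor Q P).hom a b ⟶ Y}
    (w : ∀ c, ι Q P a c b ≫ g = ι Q P a c b ≫ h) : g = h :=
  Sigma.hom_ext _ _ w

lemma unit_ext {a b : S} {Y : V} {g h : (unit V S).hom a b ⟶ Y}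
    (w : ∀ e : a = b, unitι e ≫ g = unitι e ≫ h) : g = h :=
  Sigma.hom_ext _ _ fun e ↦ w e.down.down

variable [SymmetricCategory V] [MonoidalClosed V]

section

variable {Q P : Quiv V S} {a b : S} {Y Z : V}

/-- A morphism out of `(Q ⊗_S P)(a, b) ⊗ Z` from its components. -/
def descTR (g : ∀ c, (Q.hom a c ⊗ P.hom c b) ⊗ Z ⟶ Y) : (tensor Q P).hom a b ⊗ Z ⟶ Y :=
  descR _ g

/-- A morphism out of `Z ⊗ (Q ⊗_S P)(a, b)` from its components. -/
def descTL (g : ∀ c, Z ⊗ (Q.hom a c ⊗ P.hom c b) ⟶ Y) : Z ⊗ (tensor Q P).hom a b ⟶ Y :=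
  descL _ g

/-- A morphism out of `I_S(a, b) ⊗ Z` from its components. -/
def descUR (g : a = b → (𝟙_ V ⊗ Z ⟶ Y)) : (unit V S).hom a b ⊗ Z ⟶ Y :=
  descR _ fun h ↦ g h.down.down

/-- A morphism out of `Z ⊗ I_S(a, b)` from its components. -/
def descUL (g : a = b → (Z ⊗ 𝟙_ V ⟶ Y)) : Z ⊗ (unit V S).hom a b ⟶ Y :=
  descL _ fun h ↦ g h.down.down

@[simp] lemma ι_descTR (g : ∀ c, (Q.hom a c ⊗ P.hom c b) ⊗ Z ⟶ Y) (c : S) :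
    ι Q P a c b ▷ Z ≫ descTR g = g c :=
  ι_descR _ _

@[simp] lemma ι_descTR_assoc (g : ∀ c, (Q.hom a c ⊗ P.hom c b) ⊗ Z ⟶ Y) (c : S)
    {K : _} (k : _ ⟶ K) :
    ι Q P a c b ▷ Z ≫ descTR g ≫ k =
      g c ≫ k := by
  rw [reassoc_of% ι_descTR]

@[simp] lemma ι_descTL (g : ∀ c, Z ⊗ (Q.hom a c ⊗ P.hom c b) ⟶ Y) (c : S) :
    Z ◁ ι Q P a c b ≫ descTL g = g c :=
  ι_descL _ _

@[simp] lemma ι_descTL_assoc (g : ∀ c, Z ⊗ (Q.hom a c ⊗ P.hom c b) ⟶ Y) (c : S)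
    {K : _} (k : _ ⟶ K) :
    Z ◁ ι Q P a c b ≫ descTL g ≫ k =
      g c ≫ k := by
  rw [reassoc_of% ι_descTL]

@[simp] lemma ι_descUR (g : a = b → (𝟙_ V ⊗ Z ⟶ Y)) (h : a = b) : unitι h ▷ Z ≫ descUR g = g h :=
  ι_descR (f := fun _ : ULift.{u} (PLift (a = b)) ↦ 𝟙_ V) (fun h ↦ g h.down.down) ⟨⟨h⟩⟩

@[simp] lemma ι_descUR_assoc (g : a = b → (𝟙_ V ⊗ Z ⟶ Y)) (h : a = b)
    {K : _} (k : _ ⟶ K) :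
    unitι h ▷ Z ≫ descUR g ≫ k =
      g h ≫ k := by
  rw [reassoc_of% ι_descUR]

@[simp] lemma ι_descUL (g : a = b → (Z ⊗ 𝟙_ V ⟶ Y)) (h : a = b) : Z ◁ unitι h ≫ descUL g = g h :=
  ι_descL (f := fun _ : ULift.{u} (PLift (a = b)) ↦ 𝟙_ V) (fun h ↦ g h.down.down) ⟨⟨h⟩⟩

@[simp] lemma ι_descUL_assoc (g : a = b → (Z ⊗ 𝟙_ V ⟶ Y)) (h : a = b)
    {K : _} (k : _ ⟶ K) :
    Z ◁ unitι h ≫ descUL g ≫ k =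
      g h ≫ k := by
  rw [reassoc_of% ι_descUL]

lemma tensorR_ext {g h : (tensor Q P).hom a b ⊗ Z ⟶ Y}
    (w : ∀ c, ι Q P a c b ▷ Z ≫ g = ι Q P a c b ▷ Z ≫ h) : g = h :=
  sigmaR_ext w

lemma tensorL_ext {g h : Z ⊗ (tensor Q P).hom a b ⟶ Y}
    (w : ∀ c, Z ◁ ι Q P a c b ≫ g = Z ◁ ι Q P a c b ≫ h) : g = h :=
  sigmaL_ext w

lemma unitR_ext {g h : (unit V S).hom a b ⊗ Z ⟶ Y}
    (w : ∀ e : a = b, unitι e ▷ Z ≫ g = unitι e ▷ Z ≫ h) : g = h :=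
  sigmaR_ext fun e ↦ w e.down.down

lemma tensorRR_ext {W : V} {g h : ((tensor Q P).hom a b ⊗ Z) ⊗ W ⟶ Y}
    (w : ∀ c, ι Q P a c b ▷ Z ▷ W ≫ g = ι Q P a c b ▷ Z ▷ W ≫ h) : g = h := by
  rw [← cancel_epi (α_ _ _ _).inv]
  exact tensorR_ext fun c ↦ by simp [w c]

lemma unitLR_ext {W : V} {g h : (W ⊗ (unit V S).hom a b) ⊗ Z ⟶ Y}
    (w : ∀ e : a = b, (W ◁ unitι e) ▷ Z ≫ g = (W ◁ unitι e) ▷ Z ≫ h) : g = h := by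
  rw [← cancel_epi ((β_ _ _).hom ▷ Z), ← cancel_epi (α_ _ _ _).inv]
  refine unitR_ext fun e ↦ ?_
  have := congrArg (fun t ↦ (α_ _ _ _).inv ≫ (β_ _ _).hom ▷ Z ≫ t) (w e)
  simpa [← comp_whiskerRight_assoc] using this

lemma unitL_ext {g h : Z ⊗ (unit V S).hom a b ⟶ Y}
    (w : ∀ e : a = b, Z ◁ unitι e ≫ g = Z ◁ unitι e ≫ h) : g = h :=
  sigmaL_ext fun e ↦ w e.down.down

end

/-- The tensor product of two quiver morphisms. -/
def tensorMap {Q Q' P P' : Quiv V S} (f : Q ⟶ Q') (g : P ⟶ P') : tensor Q P ⟶ tensor Q' P' :=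
  ⟨fun a b ↦ desc fun c ↦ (f.app a c ⊗ₘ g.app c b) ≫ ι Q' P' a c b⟩

instance : MonoidalCategoryStruct (Quiv V S) where
  tensorObj := tensor
  tensorUnit := unit V S
  tensorHom := tensorMap
  whiskerLeft Q _ _ g := tensorMap (𝟙 Q) g
  whiskerRight f P := tensorMap f (𝟙 P)
  associator Q P R := isoMk fun a b ↦
    { hom := desc fun d ↦ descTR fun c ↦
        (α_ _ _ _).hom ≫ Q.hom a c ◁ ι P R c d b ≫ ι Q (tensor P R) a c b
      inv := desc fun c ↦ descTL fun d ↦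
        (α_ _ _ _).inv ≫ ι Q P a c d ▷ R.hom d b ≫ ι (tensor Q P) R a d b
      hom_inv_id := tensor_ext fun d ↦ tensorR_ext fun c ↦ by simp
      inv_hom_id := tensor_ext fun c ↦ tensorL_ext fun d ↦ by simp }
  leftUnitor Q := isoMk fun a b ↦
    { hom := desc fun c ↦ descUR fun h ↦ (λ_ _).hom ≫ eqToHom (by rw [h])
      inv := (λ_ _).inv ≫ unitι rfl ▷ _ ≫ ι (unit V S) Q a a b
      hom_inv_id := tensor_ext fun c ↦ unitR_ext fun h ↦ by subst h; simp
      inv_hom_id := by simp }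
  rightUnitor Q := isoMk fun a b ↦
    { hom := desc fun c ↦ descUL fun h ↦ (ρ_ _).hom ≫ eqToHom (by rw [h])
      inv := (ρ_ _).inv ≫ _ ◁ unitι rfl ≫ ι Q (unit V S) a b b
      hom_inv_id := tensor_ext fun c ↦ unitL_ext fun h ↦ by subst h; simp
      inv_hom_id := by simp }

section

variable {Q Q' P P' R : Quiv V S} {a b c d : S}

@[simp] lemma ι_tensorHom (f : Q ⟶ Q') (g : P ⟶ P') :
    ι Q P a c b ≫ (f ⊗ₘ g).app a b = (f.app a c ⊗ₘ g.app c b) ≫ ι Q' P' a c b :=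
  ι_desc _ _

@[simp] lemma ι_tensorHom_assoc (f : Q ⟶ Q') (g : P ⟶ P')
    {K : _} (k : _ ⟶ K) :
    ι Q P a c b ≫ (f ⊗ₘ g).app a b ≫ k =
      (f.app a c ⊗ₘ g.app c b) ≫ ι Q' P' a c b ≫ k := by
  rw [reassoc_of% ι_tensorHom]

@[simp] lemma ι_whiskerLeft (Q : Quiv V S) (g : P ⟶ P') :
    ι Q P a c b ≫ (Q ◁ g).app a b = _ ◁ g.app c b ≫ ι Q P' a c b :=
  (ι_desc _ _).trans (by simp)

@[simp] lemma ι_whiskerLeft_assoc (Q : Quiv V S) (g : P ⟶ P')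
    {K : _} (k : _ ⟶ K) :
    ι Q P a c b ≫ (Q ◁ g).app a b ≫ k =
      _ ◁ g.app c b ≫ ι Q P' a c b ≫ k := by
  rw [reassoc_of% ι_whiskerLeft]

@[simp] lemma ι_whiskerRight (f : Q ⟶ Q') (P : Quiv V S) :
    ι Q P a c b ≫ (f ▷ P).app a b = f.app a c ▷ _ ≫ ι Q' P a c b :=
  (ι_desc _ _).trans (by simp)

@[simp] lemma ι_whiskerRight_assoc (f : Q ⟶ Q') (P : Quiv V S)
    {K : _} (k : _ ⟶ K) :
    ι Q P a c b ≫ (f ▷ P).app a b ≫ k =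
      f.app a c ▷ _ ≫ ι Q' P a c b ≫ k := by
  rw [reassoc_of% ι_whiskerRight]

@[simp] lemma ι_associator_hom :
    ι Q P a c d ▷ R.hom d b ≫ ι (Q ⊗ P) R a d b ≫ (α_ Q P R).hom.app a b =
      (α_ _ _ _).hom ≫ Q.hom a c ◁ ι P R c d b ≫ ι Q (P ⊗ R) a c b :=
  (congrArg _ (ι_desc _ _)).trans (ι_descTR _ _)

@[simp] lemma ι_associator_hom_assoc 
    {K : _} (k : _ ⟶ K) :
    ι Q P a c d ▷ R.hom d b ≫ ι (Q ⊗ P) R a d b ≫ (α_ Q P R).hom.app a b ≫ k =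
      (α_ _ _ _).hom ≫ Q.hom a c ◁ ι P R c d b ≫ ι Q (P ⊗ R) a c b ≫ k := by
  rw [reassoc_of% ι_associator_hom]

lemma ι_associator_whiskerRight (Z : V) :
    ι Q P a c d ▷ R.hom d b ▷ Z ≫ ι (Q ⊗ P) R a d b ▷ Z ≫ (α_ Q P R).hom.app a b ▷ Z =
      (α_ _ _ _).hom ▷ Z ≫ (Q.hom a c ◁ ι P R c d b) ▷ Z ≫ ι Q (P ⊗ R) a c b ▷ Z := by
  simp only [← comp_whiskerRight, ι_associator_hom]

lemma ι_associator_whiskerRight_assoc (Z : V)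
    {K : _} (k : _ ⟶ K) :
    ι Q P a c d ▷ R.hom d b ▷ Z ≫ ι (Q ⊗ P) R a d b ▷ Z ≫ (α_ Q P R).hom.app a b ▷ Z ≫ k =
      (α_ _ _ _).hom ▷ Z ≫ (Q.hom a c ◁ ι P R c d b) ▷ Z ≫ ι Q (P ⊗ R) a c b ▷ Z ≫ k := by
  rw [reassoc_of% ι_associator_whiskerRight]

lemma ι_associator_whiskerLeft (Z : V) :
    Z ◁ ι Q P a c d ▷ R.hom d b ≫ Z ◁ ι (Q ⊗ P) R a d b ≫ Z ◁ (α_ Q P R).hom.app a b =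
      Z ◁ (α_ _ _ _).hom ≫ Z ◁ Q.hom a c ◁ ι P R c d b ≫ Z ◁ ι Q (P ⊗ R) a c b := by
  simp only [← whiskerLeft_comp, ι_associator_hom]

lemma ι_associator_whiskerLeft_assoc (Z : V)
    {K : _} (k : _ ⟶ K) :
    Z ◁ ι Q P a c d ▷ R.hom d b ≫ Z ◁ ι (Q ⊗ P) R a d b ≫ Z ◁ (α_ Q P R).hom.app a b ≫ k =
      Z ◁ (α_ _ _ _).hom ≫ Z ◁ Q.hom a c ◁ ι P R c d b ≫ Z ◁ ι Q (P ⊗ R) a c b ≫ k := by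
  rw [reassoc_of% ι_associator_whiskerLeft]

@[simp] lemma ι_leftUnitor_hom (h : a = c) :
    unitι h ▷ Q.hom c b ≫ ι (𝟙_ _) Q a c b ≫ (λ_ Q).hom.app a b =
      (λ_ _).hom ≫ eqToHom (by rw [h]) :=
  (congrArg _ (ι_desc _ _)).trans (ι_descUR _ _)

@[simp] lemma ι_leftUnitor_hom_assoc (h : a = c)
    {K : _} (k : _ ⟶ K) :
    unitι h ▷ Q.hom c b ≫ ι (𝟙_ _) Q a c b ≫ (λ_ Q).hom.app a b ≫ k =
      (λ_ _).hom ≫ eqToHom (by rw [h]) ≫ k := by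
  rw [reassoc_of% ι_leftUnitor_hom]

@[simp] lemma ι_rightUnitor_hom (h : c = b) :
    Q.hom a c ◁ unitι h ≫ ι Q (𝟙_ _) a c b ≫ (ρ_ Q).hom.app a b =
      (ρ_ _).hom ≫ eqToHom (by rw [h]) :=
  (congrArg _ (ι_desc _ _)).trans (ι_descUL _ _)

@[simp] lemma ι_rightUnitor_hom_assoc (h : c = b)
    {K : _} (k : _ ⟶ K) :
    Q.hom a c ◁ unitι h ≫ ι Q (𝟙_ _) a c b ≫ (ρ_ Q).hom.app a b ≫ k =
      (ρ_ _).hom ≫ eqToHom (by rw [h]) ≫ k := by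
  rw [reassoc_of% ι_rightUnitor_hom]

end

lemma ι_whiskerRight_tensorHom {Q Q' P P' : Quiv V S} {a c d : S} {Y Z : V} (f : Q ⟶ Q')
    (g : P ⟶ P') (h : Y ⟶ Z) :
    ι Q P a c d ▷ Y ≫ ((f ⊗ₘ g).app a d ⊗ₘ h) =
      ((f.app a c ⊗ₘ g.app c d) ⊗ₘ h) ≫ ι Q' P' a c d ▷ Z := by
  rw [← tensorHom_id, ← tensorHom_id, tensorHom_comp_tensorHom, tensorHom_comp_tensorHom,
    ι_tensorHom, Category.id_comp, Category.comp_id]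

lemma ι_whiskerRight_tensorHom_assoc {Q Q' P P' : Quiv V S} {a c d : S} {Y Z : V} (f : Q ⟶ Q')
    (g : P ⟶ P') (h : Y ⟶ Z)
    {K : _} (k : _ ⟶ K) :
    ι Q P a c d ▷ Y ≫ ((f ⊗ₘ g).app a d ⊗ₘ h) ≫ k =
      ((f.app a c ⊗ₘ g.app c d) ⊗ₘ h) ≫ ι Q' P' a c d ▷ Z ≫ k := by
  rw [reassoc_of% ι_whiskerRight_tensorHom]

lemma ι_whiskerLeft_tensorHom {Q Q' P P' : Quiv V S} {a c d : S} {Y Z : V} (f : Q ⟶ Q')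
    (g : P ⟶ P') (h : Y ⟶ Z) :
    Y ◁ ι Q P a c d ≫ (h ⊗ₘ (f ⊗ₘ g).app a d) =
      (h ⊗ₘ (f.app a c ⊗ₘ g.app c d)) ≫ Z ◁ ι Q' P' a c d := by
  rw [← id_tensorHom, ← id_tensorHom, tensorHom_comp_tensorHom, tensorHom_comp_tensorHom,
    ι_tensorHom, Category.id_comp, Category.comp_id]

lemma ι_whiskerLeft_tensorHom_assoc {Q Q' P P' : Quiv V S} {a c d : S} {Y Z : V} (f : Q ⟶ Q')
    (g : P ⟶ P') (h : Y ⟶ Z)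
    {K : _} (k : _ ⟶ K) :
    Y ◁ ι Q P a c d ≫ (h ⊗ₘ (f ⊗ₘ g).app a d) ≫ k =
      (h ⊗ₘ (f.app a c ⊗ₘ g.app c d)) ≫ Z ◁ ι Q' P' a c d ≫ k := by
  rw [reassoc_of% ι_whiskerLeft_tensorHom]

/-- The monoidal category of quivers. -/
instance : MonoidalCategory (Quiv V S) := MonoidalCategory.ofTensorHom
  (id_tensorHom_id := fun Q P ↦ by
    ext a b; refine tensor_ext fun c ↦ ?_; simp; exact (Category.comp_id _).symm)
  (tensorHom_comp_tensorHom := fun f f' g g' ↦ by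
    ext a b; refine tensor_ext fun c ↦ ?_; simp)
  (associator_naturality := fun {Q P R Q' P' R'} f g h ↦ by
    ext a b; refine tensor_ext fun d ↦ tensorR_ext fun c ↦ ?_
    simp only [comp_app, ι_tensorHom_assoc, ι_associator_hom_assoc, ι_tensorHom]
    erw [ι_whiskerRight_tensorHom_assoc, ι_associator_hom, ι_whiskerLeft_tensorHom_assoc]
    simp)
  (leftUnitor_naturality := fun f ↦ by
    ext a b; refine tensor_ext fun c ↦ unitR_ext fun h ↦ ?_
    subst h; simp
    erw [← whisker_exchange_assoc, ι_leftUnitor_hom]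
    simp)
  (rightUnitor_naturality := fun f ↦ by
    ext a b; refine tensor_ext fun c ↦ unitL_ext fun h ↦ ?_
    subst h; simp
    erw [whisker_exchange_assoc, ι_rightUnitor_hom]
    simp)
  (pentagon := fun Q P R T ↦ by
    ext a b
    refine tensor_ext fun e ↦ tensorR_ext fun d ↦ tensorRR_ext fun c ↦ ?_
    simp only [comp_app, ι_tensorHom_assoc, id_app, tensorHom_id]
    erw [ι_associator_whiskerRight_assoc, ι_associator_hom_assoc, ι_tensorHom]
    erw [ι_associator_hom_assoc (Q := Q ⊗ P) (P := R) (R := T)]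
    erw [associator_naturality_left_assoc, ← whisker_exchange_assoc]
    erw [ι_associator_hom (Q := Q) (P := P) (R := R ⊗ T)]
    simp only [id_app, id_tensorHom]
    erw [associator_naturality_middle_assoc, ι_associator_whiskerLeft_assoc]
    erw [associator_naturality_right_assoc]
    rw [pentagon_assoc]
    )
  (triangle := fun Q P ↦ by
    ext a b; refine tensor_ext fun d ↦ tensorR_ext fun c ↦ unitLR_ext fun h ↦ ?_
    subst h
    simp
    erw [Iso.inv_hom_id_assoc, ← whiskerLeft_comp_assoc, ← whiskerLeft_comp_assoc,
      Category.assoc, ι_leftUnitor_hom]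
    have := ι_rightUnitor_hom (Q := Q) (a := a) (rfl : c = c)
    erw [associator_inv_naturality_middle_assoc, ← comp_whiskerRight_assoc,
      ← comp_whiskerRight_assoc]
    erw [Category.assoc, this]
    simp)

end Quiv

/-! ## The necklaces of a templicial object -/

/-- The initial part `[a] ⟶ [f(a)]` of a morphism of finite intervals. -/
def FInt.Hom.front {a n m : ℕ} (f : FInt.Hom (a + n) m) : FInt.Hom a (f a) where
  toFun i := if i ≤ a then f i else f a + (i - a)
  mono i j h := by
    dsimp only
    split_ifs with h1 h2 h2
    · exact f.mono h
    · exact (f.mono h1).trans (Nat.le_add_right _ _)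
    · omega
    · omega
  map_zero := by simp [f.map_zero]
  map_add i := by
    split_ifs with h
    · obtain rfl : i = 0 := by omega
      rfl
    · omega

/-- The final part of a morphism of finite intervals, from `a` onwards. -/
def FInt.Hom.back {a n m r : ℕ} (f : FInt.Hom (a + n) m) (h : f a + r = m) : FInt.Hom n r where
  toFun i := f (a + i) - f a
  mono i j h := Nat.sub_le_sub_right (f.mono (Nat.add_le_add_left h a)) _
  map_zero := by simp
  map_add i := by rw [← Nat.add_assoc, f.map_add]; omega

lemma FInt.Hom.front_apply {a n m : ℕ} (f : FInt.Hom (a + n) m) {i : ℕ} (h : i ≤ a) :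
    f.front i = f i := if_pos h

/-- A morphism of finite intervals is determined by its values on `[m]`. -/
lemma FInt.Hom.ext_of_le {m n : ℕ} {f g : FInt.Hom m n} (h : ∀ i ≤ m, f i = g i) : f = g := by
  ext i
  by_cases hi : i ≤ m
  · exact h i hi
  · rw [f.map_of_le (by omega), g.map_of_le (by omega)]

/-- `Cut U c R` witnesses that the necklace with beads `U` can be cut in its first bead at the
vertex `c`, with remaining part the necklace with beads `R`. -/
inductive Cut (U : List ℕ) (c : ℕ) (R : List ℕ) : Type
  | zero (hc : c = 0) (hR : U = R)
  | exact (hc : 0 < c) (hU : U = c :: R)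
  | mid (r : ℕ) (U' : List ℕ) (hc : 0 < c) (hr : 0 < r) (hU : U = (c + r) :: U')
      (hR : R = r :: U')

namespace Cut

variable {U R : List ℕ} {c : ℕ}

lemma add_sum (κ : Cut U c R) : c + R.sum = U.sum := by
  cases κ with
  | zero hc hR => rw [hc, hR, Nat.zero_add]
  | exact hc hU => rw [hU, List.sum_cons]
  | mid r U' hc hr hU hR => rw [hU, hR, List.sum_cons, List.sum_cons, Nat.add_assoc]

lemma pos (κ : Cut U c R) (h : ∀ b ∈ U, 0 < b) : ∀ b ∈ R, 0 < b := by
  cases κ with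
  | zero hc hR => exact hR ▸ h
  | exact hc hU => exact fun b hb ↦ h b (hU ▸ List.mem_cons_of_mem _ hb)
  | mid r U' hc hr hU hR =>
    subst hU hR
    intro b hb
    obtain rfl | hb := List.mem_cons.1 hb
    · exact hr
    · exact h b (List.mem_cons_of_mem _ hb)

lemma mem_joints (κ : Cut U c R) {j : ℕ} (h : j ∈ joints R) : j = 0 ∨ c + j ∈ joints U := by
  cases κ with
  | zero hc hR => exact Or.inr (by rwa [hc, hR, Nat.zero_add])
  | exact hc hU => exact Or.inr (hU ▸ Or.inr ⟨_, h, rfl⟩)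
  | mid r U' hc hr hU hR =>
    subst hU hR
    obtain h | ⟨i, hi, rfl⟩ := h
    · exact Or.inl h
    · exact Or.inr (Or.inr ⟨i, hi, Nat.add_assoc _ _ _⟩)

lemma mem_joints_right (κ : Cut U c R) {i : ℕ} (h : c + i ∈ joints U) : i ∈ joints R := by
  cases κ with
  | zero hc hR => rwa [hc, hR, Nat.zero_add] at h
  | exact hc hU =>
    subst hU
    obtain h | ⟨j, hj, h⟩ := h
    · omega
    · obtain rfl : j = i := Nat.add_left_cancel h
      exact hj
  | mid r U' hc hr hU hR =>
    subst hU hR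
    obtain h | ⟨j, hj, h⟩ := h
    · omega
    · exact Or.inr ⟨j, hj, by dsimp only at h ⊢; omega⟩

lemma right_unique {R' : List ℕ} (κ : Cut U c R) (κ' : Cut U c R') : R = R' := by
  cases κ with
  | zero hc hR => cases κ' with
    | zero hc' hR' => exact hR.symm.trans hR'
    | exact => omega
    | mid => omega
  | exact hc hU => cases κ' with
    | zero hc' hR' => omega
    | exact hc' hU' => exact (List.cons.inj (hU.symm.trans hU')).2
    | mid r' U'' hc' hr' hU' hR' => have := (List.cons.inj (hU.symm.trans hU')).1; omega
  | mid r U' hc hr hU hR => cases κ' with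
    | zero hc' hR' => omega
    | exact hc' hU' => have := (List.cons.inj (hU.symm.trans hU')).1; omega
    | mid r' U'' hc' hr' hU' hR' =>
      have := List.cons.inj (hU.symm.trans hU')
      rw [hR, hR', this.2, show r = r' by omega]

instance : Subsingleton (Cut U c R) where
  allEq κ κ' := by
    cases κ with
    | zero hc hR => cases κ' with
      | zero hc' hR' => rfl
      | exact => omega
      | mid => omega
    | exact hc hU => cases κ' with
      | zero hc' hR' => omega
      | exact hc' hU' => rfl
      | mid r' U'' hc' hr' hU' hR' => have := (List.cons.inj (hU.symm.trans hU')).1; omega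
    | mid r U' hc hr hU hR => cases κ' with
      | zero hc' hR' => omega
      | exact hc' hU' => have := (List.cons.inj (hU.symm.trans hU')).1; omega
      | mid r' U'' hc' hr' hU' hR' =>
        obtain ⟨rfl, rfl⟩ := List.cons.inj (hR.symm.trans hR')
        rfl

/-- Cutting a wedge in its first part. -/
def append (U' : List ℕ) : Cut U c R → Cut (U ++ U') c (R ++ U')
  | zero hc hR => zero hc (hR ▸ rfl)
  | exact hc hU => exact hc (hU ▸ rfl)
  | mid r U'' hc hr hU hR => mid r (U'' ++ U') hc hr (hU ▸ rfl) (hR ▸ rfl)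

/-- The cut at a vertex of the first bead. -/
def ofLe (b : ℕ) (U : List ℕ) (c : ℕ) (hc : c ≤ b) : Σ R, Cut (b :: U) c R :=
  if h : c = 0 then ⟨b :: U, zero h rfl⟩
  else if h' : c = b then ⟨U, exact (by omega) (by rw [h'])⟩
  else ⟨(b - c) :: U, mid (b - c) U (by omega) (by omega) (by rw [Nat.add_sub_cancel' hc]) rfl⟩

end Cut

namespace Nec.Hom

lemma map_bead_le {a b : ℕ} {T U : List ℕ} (f : Nec.Hom (a :: T) (b :: U)) (hb : 0 < b) :
    f.vert a ≤ b := by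
  obtain ⟨k, rfl | ⟨i, -, rfl⟩, hk⟩ := f.joints_subset
    (show b ∈ joints (b :: U) from Or.inr ⟨0, zero_mem_joints _, rfl⟩)
  · rw [f.vert.map_zero] at hk; omega
  · exact (f.vert.mono (Nat.le_add_right _ _)).trans (hk.trans (Nat.add_zero b)).le

/-- The cut of the target of a map of necklaces at the image of the first bead of the source. -/
def cut {a : ℕ} {T : List ℕ} : ∀ {U : List ℕ} (f : Nec.Hom (a :: T) U) (_ : ∀ b ∈ U, 0 < b),
    Σ R, Cut U (f.vert a) R
  | [], f, _ => ⟨[], Cut.zero (Nat.le_zero.1 (f.vert.map_le (Nat.le_add_right a T.sum))) rfl⟩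
  | b :: U, f, h => Cut.ofLe b U _ (f.map_bead_le (h b (List.mem_cons_self ..)))

/-- The restriction of a map of necklaces to all but the first bead. -/
def back {a : ℕ} {T U R : List ℕ} (f : Nec.Hom (a :: T) U) (κ : Cut U (f.vert a) R) :
    Nec.Hom T R where
  vert := FInt.Hom.back f.vert κ.add_sum
  joints_subset j hj := by
    obtain rfl | h := κ.mem_joints hj
    · exact ⟨0, zero_mem_joints _, FInt.Hom.map_zero _⟩
    · obtain ⟨k, rfl | ⟨i, hi, rfl⟩, hk⟩ := f.joints_subset h
      · rw [f.vert.map_zero] at hk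
        obtain rfl : j = 0 := by omega
        exact ⟨0, zero_mem_joints _, FInt.Hom.map_zero _⟩
      · refine ⟨i, hi, ?_⟩
        change f.vert (a + i) - f.vert a = j
        exact Nat.sub_eq_of_eq_add (hk.trans (Nat.add_comm _ _))

lemma target_nil {U : List ℕ} (f : Nec.Hom [] U) (h : ∀ b ∈ U, 0 < b) : U = [] := by
  cases U with
  | nil => rfl
  | cons b U =>
    have h1 := h b (List.mem_cons_self ..)
    have h2 : f.vert 0 = b + U.sum := f.vert.map_last
    rw [f.vert.map_zero] at h2; omega

end Nec.Hom

section Necklaces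

section

variable {C : Type v} [Category.{u} C] [MonoidalCategory C]

lemma monoidal_aux₁ {A B Z : C} (f : 𝟙_ C ⟶ B) :
    ((ρ_ A).inv ≫ A ◁ f) ▷ Z ≫ (α_ _ _ _).hom = A ◁ ((λ_ Z).inv ≫ f ▷ Z) := by
  simp

lemma monoidal_aux₂ {A B P Z : C} (f : 𝟙_ C ⟶ B) (s : P ⟶ A ⊗ Z) :
    s ≫ ((λ_ A).inv ≫ f ▷ A) ▷ Z ≫ (α_ _ _ _).hom = ((λ_ P).inv ≫ f ▷ P) ≫ B ◁ s := by
  simp [← whisker_exchange]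

lemma monoidal_aux₃ {A D E F P R Z : C} {p : A ⟶ D ⊗ R} {q : D ⟶ P ⊗ E} {s : A ⟶ P ⊗ F}
    {t : F ⟶ E ⊗ R} (h : p ≫ q ▷ R ≫ (α_ _ _ _).hom = s ≫ P ◁ t) :
    (p ▷ Z ≫ (α_ _ _ _).hom) ≫ q ▷ (R ⊗ Z) ≫ (α_ _ _ _).hom =
      (s ▷ Z ≫ (α_ _ _ _).hom) ≫ P ◁ (t ▷ Z ≫ (α_ _ _ _).hom) := by
  have := congrArg (fun k ↦ k ▷ Z ≫ (α_ _ _ _).hom ≫ P ◁ (α_ _ _ _).hom) h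
  simpa using this

lemma monoidal_aux₄ {A B C₁ D E F K N P R Q : C} {s₃ : A ⟶ B ⊗ R} {k : B ⟶ C₁} {d : C₁ ⟶ D ⊗ E}
    {s₂ : A ⟶ D ⊗ F} {s₄ : F ⟶ E ⊗ R} {a : C₁ ⟶ K} {d' : K ⟶ P ⊗ Q} {x : D ⟶ P} {y : E ⟶ Q}
    {n : R ⟶ N} (hs : s₃ ≫ (k ≫ d) ▷ R ≫ (α_ _ _ _).hom = s₂ ≫ D ◁ s₄)
    (hn : a ≫ d' = d ≫ (x ⊗ₘ y)) :
    (s₃ ≫ ((k ≫ a) ⊗ₘ n)) ≫ d' ▷ N ≫ (α_ _ _ _).hom = s₂ ≫ (x ⊗ₘ (s₄ ≫ (y ⊗ₘ n))) := by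
  have h1 : (x ⊗ₘ (s₄ ≫ (y ⊗ₘ n))) = D ◁ s₄ ≫ (x ⊗ₘ (y ⊗ₘ n)) := by
    rw [← id_tensorHom, tensorHom_comp_tensorHom, Category.id_comp]
  have h2 : ((k ≫ a) ⊗ₘ n) ≫ d' ▷ N = (k ≫ d) ▷ R ≫ ((x ⊗ₘ y) ⊗ₘ n) := by
    rw [← tensorHom_id, ← tensorHom_id, tensorHom_comp_tensorHom, tensorHom_comp_tensorHom,
      Category.assoc, Category.assoc, hn, Category.comp_id, Category.id_comp]
  rw [h1, ← reassoc_of% hs, ← associator_naturality, Category.assoc, reassoc_of% h2]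

end

variable {W : Type v} [Category.{u} W] [MonoidalCategory W] (X : FIntᵒᵖ ⥤ W)

/-- The value of `X` at `[n]`. -/
abbrev bead (n : ℕ) : W := X.obj (op ⟨n⟩)

/-- The morphism `X_n ⟶ X_m` for a morphism `[m] ⟶ [n]` of finite intervals. -/
abbrev beadMap {m n : ℕ} (f : FInt.Hom m n) : bead X n ⟶ bead X m :=
  X.map (Quiver.Hom.op (show FInt.mk m ⟶ FInt.mk n from f))

lemma beadMap_id (m : ℕ) : beadMap X (FInt.Hom.id m) = 𝟙 _ := X.map_id (op ⟨m⟩)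

lemma beadMap_comp {m n p : ℕ} (f : FInt.Hom m n) (g : FInt.Hom n p) :
    beadMap X (f.comp g) = beadMap X g ≫ beadMap X f := X.map_comp _ _

/-- The object `X_{n₁} ⊗ ⋯ ⊗ X_{nₖ}` for the necklace `Δ^{n₁} ∨ ⋯ ∨ Δ^{nₖ}`. -/
def necObj : List ℕ → W
  | [] => 𝟙_ W
  | b :: U => bead X b ⊗ necObj U

variable [X.OplaxMonoidal] [IsIso (Functor.OplaxMonoidal.η X)]

/-- The comultiplication `X_{m+n} ⟶ X_m ⊗ X_n`. -/
def comul (m n : ℕ) : bead X (m + n) ⟶ bead X m ⊗ bead X n :=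
  Functor.OplaxMonoidal.δ X (op ⟨m⟩) (op ⟨n⟩)

/-- The inverse `I ⟶ X_0` of the counit. -/
def unitInv : 𝟙_ W ⟶ bead X 0 := inv (Functor.OplaxMonoidal.η X)

/-- The morphism `X_U ⟶ X_c ⊗ X_R` for a cut of a necklace `U` at the vertex `c`. -/
def split : ∀ {U : List ℕ} {c : ℕ} {R : List ℕ}, Cut U c R → (necObj X U ⟶ bead X c ⊗ necObj X R)
  | _, _, _, .zero rfl rfl => (λ_ _).inv ≫ unitInv X ▷ _
  | _, _, _, .exact _ rfl => 𝟙 _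
  | _, _, _, .mid r U' _ _ rfl rfl => comul X _ r ▷ necObj X U' ≫ (α_ _ _ _).hom

/-- The morphism `X_U ⟶ X_T` associated to a map of necklaces `f : T ⟶ U`. If `a` is the first
bead of `T`, then it is the composite `X_U ⟶ X_{f(a)} ⊗ X_R ⟶ X_a ⊗ X_T'`, where `T'` and `R` are
the remaining parts of `T` and `U` beyond the vertices `a` and `f(a)`. -/
def necMap : ∀ {T U : List ℕ} (_ : Nec.Hom T U) (_ : ∀ b ∈ U, 0 < b), necObj X U ⟶ necObj X T
  | [], _, f, h => eqToHom (by rw [f.target_nil h])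
  | _ :: _, _, f, h => split X (f.cut h).2 ≫
      (beadMap X f.vert.front ⊗ₘ necMap (f.back (f.cut h).2) ((f.cut h).2.pos h))

lemma necMap_cons {a : ℕ} {T U R : List ℕ} (f : Nec.Hom (a :: T) U) (h : ∀ b ∈ U, 0 < b)
    (κ : Cut U (f.vert a) R) : necMap X f h =
      split X κ ≫ (beadMap X f.vert.front ⊗ₘ necMap X (f.back κ) (κ.pos h)) := by
  have h1 : R = (f.cut h).1 := κ.right_unique (f.cut h).2
  subst h1
  have h2 : κ = (f.cut h).2 := Subsingleton.elim _ _
  subst h2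
  rfl

/-- Version of `necMap_cons` with more flexible components. -/
lemma necMap_cons' {a c : ℕ} {T U R : List ℕ} (f : Nec.Hom (a :: T) U) (h : ∀ b ∈ U, 0 < b)
    (κ : Cut U c R) (hc : f.vert a = c) (g : FInt.Hom a c) (hg : ∀ i ≤ a, g i = f.vert i)
    (k : Nec.Hom T R) (hk : ∀ i ≤ T.sum, c + k.vert i = f.vert (a + i)) : necMap X f h =
      split X κ ≫ (beadMap X g ⊗ₘ necMap X k (κ.pos h)) := by
  subst hc
  rw [necMap_cons X f h κ]
  congr 3
  · exact FInt.Hom.ext_of_le fun i hi ↦ (f.vert.front_apply hi).trans (hg i hi).symm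
  · refine Nec.Hom.ext (FInt.Hom.ext_of_le fun i hi ↦ ?_)
    change f.vert (a + i) - f.vert a = k.vert i
    have := hk i hi
    exact Nat.sub_eq_of_eq_add (this.symm.trans (Nat.add_comm _ _))

lemma necMap_nil (f : Nec.Hom [] []) (h) : necMap X f h = 𝟙 _ := rfl

lemma necMap_id : ∀ (T : List ℕ) (h : ∀ b ∈ T, 0 < b), necMap X (Nec.Hom.id T) h = 𝟙 _
  | [], _ => rfl
  | a :: T, h => by
    rw [necMap_cons' X (Nec.Hom.id (a :: T)) h (.exact (h a (List.mem_cons_self ..)) rfl) rfl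
      (FInt.Hom.id a) (fun _ _ ↦ rfl) (Nec.Hom.id T) (fun _ _ ↦ rfl), necMap_id, beadMap_id]
    exact (Category.id_comp _).trans (id_tensorHom_id _ _)

lemma comul_natural {m m' n n' : ℕ} (f : FInt.Hom m m') (g : FInt.Hom n n') :
    beadMap X (f.add g) ≫ comul X m n = comul X m' n' ≫ (beadMap X f ⊗ₘ beadMap X g) :=
  (Functor.OplaxMonoidal.δ_natural X (X := op ⟨m'⟩) (Y := op ⟨m⟩) (X' := op ⟨n'⟩) (Y' := op ⟨n⟩)
    (Quiver.Hom.op (show FInt.mk m ⟶ FInt.mk m' from f))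
    (Quiver.Hom.op (show FInt.mk n ⟶ FInt.mk n' from g))).symm

lemma comul_assoc (m n p : ℕ) :
    comul X (m + n) p ≫ comul X m n ▷ _ ≫ (α_ _ _ _).hom =
      beadMap X (FInt.Hom.cast (Nat.add_assoc m n p).symm) ≫ comul X m (n + p) ≫
        _ ◁ comul X n p :=
  Functor.OplaxMonoidal.associativity (F := X) (op ⟨m⟩) (op ⟨n⟩) (op ⟨p⟩)

lemma comul_zero_left (n : ℕ) : comul X 0 n =
    beadMap X (FInt.Hom.cast (Nat.zero_add n).symm) ≫ (λ_ _).inv ≫ unitInv X ▷ _ := by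
  have h : (λ_ (bead X n)).inv = beadMap X (FInt.Hom.cast (Nat.zero_add n)) ≫ comul X 0 n ≫
      Functor.OplaxMonoidal.η X ▷ _ := Functor.OplaxMonoidal.left_unitality (F := X) (op ⟨n⟩)
  have h' : beadMap X (FInt.Hom.cast (Nat.zero_add n).symm) ≫
    beadMap X (FInt.Hom.cast (Nat.zero_add n)) = 𝟙 _ :=
    (beadMap_comp X _ _).symm.trans (beadMap_id X _)
  rw [h, unitInv, Category.assoc, Category.assoc, ← comp_whiskerRight, IsIso.hom_inv_id,
    reassoc_of% h', id_whiskerRight]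
  exact (Category.comp_id _).symm

lemma comul_zero_right (n : ℕ) : comul X n 0 = (ρ_ _).inv ≫ _ ◁ unitInv X := by
  have h : (ρ_ (bead X n)).inv = beadMap X (FInt.Hom.id n) ≫ comul X n 0 ≫
      _ ◁ Functor.OplaxMonoidal.η X := Functor.OplaxMonoidal.right_unitality (F := X) (op ⟨n⟩)
  change comul X n 0 = (ρ_ (bead X n)).inv ≫ _ ◁ unitInv X
  rw [h, beadMap_id, Category.id_comp, unitInv, Category.assoc, ← whiskerLeft_comp,
    IsIso.hom_inv_id, whiskerLeft_id]
  exact (Category.comp_id _).symm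

lemma beadMap_eq_id {m : ℕ} (f : FInt.Hom m m) (h : ∀ i ≤ m, f i = i) : beadMap X f = 𝟙 _ := by
  rw [show f = FInt.Hom.id m from FInt.Hom.ext_of_le h, beadMap_id]

lemma comul_zero_right' (n : ℕ) : beadMap X (FInt.Hom.cast (Nat.add_zero n)) ≫ comul X n 0 =
    (ρ_ (bead X n)).inv ≫ _ ◁ unitInv X :=
  (congrArg (· ≫ comul X n 0) (beadMap_eq_id X _ (fun _ _ ↦ rfl))).trans
    ((Category.id_comp _).trans (comul_zero_right X n))

lemma split_mid {b c r : ℕ} (U' : List ℕ) (hb : c + r = b) (hc : 0 < c) (hr : 0 < r) :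
    split X (.mid r U' hc hr (by rw [hb]) rfl : Cut (b :: U') c (r :: U')) =
      (beadMap X (FInt.Hom.cast hb) ≫ comul X c r) ▷ necObj X U' ≫ (α_ _ _ _).hom := by
  subst hb
  rw [beadMap_eq_id X _ (fun _ _ ↦ rfl), Category.id_comp]
  rfl

lemma Cut.right_unique₂ {U R R' S : List ℕ} {c e n : ℕ} (κ₂ : Cut U c R) (κ₄ : Cut R e S)
    (κ₃ : Cut U n R') (h : n = c + e) : R' = S := by
  cases κ₂ with
  | zero hc hR =>
    subst hc hR
    obtain rfl : n = e := by omega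
    exact κ₃.right_unique κ₄
  | exact hc hU =>
    cases κ₄ with
    | zero he hS =>
      subst hU hS
      obtain rfl : n = c := by omega
      exact κ₃.right_unique (.exact hc rfl)
    | exact he =>
      cases κ₃ with
      | zero => omega
      | exact hn hU' => have := (List.cons.inj (hU.symm.trans hU')).1; omega
      | mid r' U'' hc' hr' hU' hR' => have := (List.cons.inj (hU.symm.trans hU')).1; omega
    | mid r V he =>
      cases κ₃ with
      | zero => omega
      | exact hn hU' => have := (List.cons.inj (hU.symm.trans hU')).1; omega
      | mid r' U'' hc' hr' hU' hR' => have := (List.cons.inj (hU.symm.trans hU')).1; omega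
  | mid r V hc hr hU hR =>
    subst hU hR
    cases κ₄ with
    | zero he hS =>
      obtain rfl : n = c := by omega
      exact (κ₃.right_unique (.mid r V hc hr rfl rfl)).trans hS
    | exact he hU' =>
      obtain ⟨rfl, rfl⟩ := List.cons.inj hU'
      exact κ₃.right_unique (.exact (by omega) (by rw [h]))
    | mid r' V' he hr' hU' hS =>
      obtain ⟨rfl, rfl⟩ := List.cons.inj hU'
      exact (κ₃.right_unique (.mid r' V (by omega) hr' (by rw [h, Nat.add_assoc]) rfl)).trans
        hS.symm

/-- Cutting twice. -/
lemma split_split {U R S : List ℕ} {c e n : ℕ} (κ₂ : Cut U c R) (κ₄ : Cut R e S)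
    (κ₃ : Cut U n S) (h : c + e = n) :
    split X κ₃ ≫ (beadMap X (FInt.Hom.cast h) ≫ comul X c e) ▷ _ ≫ (α_ _ _ _).hom =
      split X κ₂ ≫ _ ◁ split X κ₄ := by
  cases κ₂ with
  | zero hc hR =>
    cases hc; cases hR
    obtain rfl : e = n := by omega
    obtain rfl : κ₃ = κ₄ := Subsingleton.elim _ _
    have h' : beadMap X (FInt.Hom.cast h) ≫
      beadMap X (FInt.Hom.cast (Nat.zero_add e).symm) = 𝟙 _ :=
      (beadMap_comp X _ _).symm.trans (beadMap_id X _)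
    rw [comul_zero_left, reassoc_of% h']
    exact monoidal_aux₂ _ _
  | exact hc hU =>
    cases κ₄ with
    | zero he hS =>
      cases hU; cases hS; cases he
      obtain rfl : c = n := by omega
      obtain rfl : κ₃ = .exact hc rfl := Subsingleton.elim _ _
      exact congrArg (split X _ ≫ ·) ((congrArg (fun k ↦ k ▷ _ ≫ (α_ _ _ _).hom)
        (comul_zero_right' X c)).trans (monoidal_aux₁ _))
    | exact he =>
      cases κ₃ with
      | zero => omega
      | exact hn hU' => have := (List.cons.inj (hU.symm.trans hU')).1; omega
      | mid r' U'' hc' hr' hU' hR' => have := (List.cons.inj (hU.symm.trans hU')).1; omega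
    | mid r V he =>
      cases κ₃ with
      | zero => omega
      | exact hn hU' => have := (List.cons.inj (hU.symm.trans hU')).1; omega
      | mid r' U'' hc' hr' hU' hR' => have := (List.cons.inj (hU.symm.trans hU')).1; omega
  | mid r V hc hr hU hR =>
    cases hU; cases hR
    cases κ₄ with
    | zero he hS =>
      cases hS; cases he
      obtain rfl : c = n := by omega
      obtain rfl : κ₃ = .mid r V hc hr rfl rfl := Subsingleton.elim _ _
      exact congrArg (split X _ ≫ ·) ((congrArg (fun k ↦ k ▷ _ ≫ (α_ _ _ _).hom)
        (comul_zero_right' X c)).trans (monoidal_aux₁ _))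
    | exact he hU' =>
      obtain ⟨rfl, rfl⟩ := List.cons.inj hU'
      obtain rfl : κ₃ = .exact (by omega) (by rw [h]) := Subsingleton.elim _ _
      subst h
      rw [beadMap_eq_id X _ (fun _ _ ↦ rfl), Category.id_comp]
      exact (Category.id_comp _).trans
        ((Category.comp_id _).symm.trans (congrArg (_ ≫ ·) (whiskerLeft_id _ _).symm))
    | mid r' V' he hr' hU' hS =>
      obtain ⟨rfl, rfl⟩ := List.cons.inj hU'
      cases hS; cases h
      obtain rfl : κ₃ = .mid r' V (by omega) hr' (by rw [Nat.add_assoc]) rfl :=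
        Subsingleton.elim _ _
      rw [split_mid X V (Nat.add_assoc c e r'), beadMap_eq_id X (FInt.Hom.cast rfl) (fun _ _ ↦ rfl)]
      rw [Category.id_comp]
      refine monoidal_aux₃ ?_
      rw [Category.assoc, comul_assoc, ← reassoc_of% beadMap_comp, beadMap_eq_id X _ (fun _ _ ↦ rfl),
        Category.id_comp]

/-- Compatibility of `necMap` with cutting. -/
lemma necMap_split : ∀ {U S R Q : List ℕ} {c e : ℕ} (g : Nec.Hom U S) (h : ∀ b ∈ S, 0 < b)
    (κ₁ : Cut U c R) (κ₂ : Cut S e Q) (g₁ : FInt.Hom c e) (_ : ∀ i ≤ c, g₁ i = g.vert i)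
    (g₂ : Nec.Hom R Q) (_ : ∀ i ≤ R.sum, e + g₂.vert i = g.vert (c + i)),
    necMap X g h ≫ split X κ₁ = split X κ₂ ≫ (beadMap X g₁ ⊗ₘ necMap X g₂ (κ₂.pos h))
  | U, S, R, Q, c, e, g, h, κ₁, κ₂, g₁, h₁, g₂, h₂ => by
    have hc : g.vert c = e := (h₁ c le_rfl).symm.trans g₁.map_last
    cases κ₁ with
    | zero hc' hR =>
      cases hc'; cases hR
      obtain rfl : e = 0 := hc.symm.trans g.vert.map_zero
      obtain rfl : S = Q := (Cut.zero rfl rfl : Cut S 0 S).right_unique κ₂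
      obtain rfl : κ₂ = .zero rfl rfl := Subsingleton.elim _ _
      obtain rfl : g₂ = g := Nec.Hom.ext (FInt.Hom.ext_of_le fun i hi ↦ by
        have := h₂ i hi
        rwa [Nat.zero_add, Nat.zero_add] at this)
      rw [beadMap_eq_id X g₁ (fun i hi ↦ by
        obtain rfl : i = 0 := by omega
        exact g₁.map_zero)]
      simp [split, ← whisker_exchange]
    | exact hc' hU =>
      cases hU
      exact (Category.comp_id _).trans (necMap_cons' X g h κ₂ hc g₁ h₁ g₂ h₂)
    | mid r U' hc' hr hU hR =>
      cases hU; cases hR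
      obtain ⟨S', κ₃⟩ := g.cut h
      obtain ⟨S'', κ₄⟩ := g₂.cut (κ₂.pos h)
      have hv : g.vert (c + r) = e + g₂.vert r := (h₂ r (Nat.le_add_right r U'.sum)).symm
      obtain rfl : S' = S'' := Cut.right_unique₂ κ₂ κ₄ κ₃ hv
      have hg := necMap_cons' X g h κ₃ rfl ((g₁.add g₂.vert.front).comp (.cast hv.symm))
        (fun i hi ↦ by
          change (if i ≤ c then g₁ i else e + (if i - c ≤ r then g₂.vert (i - c) else _)) = _
          split_ifs with h3 h4
          · exact h₁ i h3
          · rw [h₂ _ (h4.trans (Nat.le_add_right r U'.sum)), Nat.add_sub_cancel' (by omega)]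
          · omega) (g₂.back κ₄) (fun i hi ↦ by
          change g.vert (c + r) + (g₂.vert (r + i) - g₂.vert r) = _
          have := h₂ (r + i) (Nat.add_le_add_left hi r)
          have := g₂.vert.mono (Nat.le_add_right r i)
          rw [Nat.add_assoc, ← h₂ (r + i) (Nat.add_le_add_left hi r), hv]
          omega)
      rw [hg, necMap_cons X g₂ _ κ₄, beadMap_comp]
      exact monoidal_aux₄ (split_split X κ₂ κ₄ κ₃ hv.symm) (comul_natural X g₁ g₂.vert.front)

/-- The functoriality of `necMap`. -/
lemma necMap_comp : ∀ {T U S : List ℕ} (f : Nec.Hom T U) (g : Nec.Hom U S)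
    (hU : ∀ b ∈ U, 0 < b) (hS : ∀ b ∈ S, 0 < b),
    necMap X (f.comp g) hS = necMap X g hS ≫ necMap X f hU
  | [], U, S, f, g, hU, hS => by
    obtain rfl := f.target_nil hU
    obtain rfl := g.target_nil hS
    rw [necMap_nil, necMap_nil, necMap_nil, Category.id_comp]
  | a :: T, U, S, f, g, hU, hS => by
    obtain ⟨R, κ₁⟩ := f.cut hU
    obtain ⟨Q, κ₂⟩ := (f.comp g).cut hS
    let g₁ : FInt.Hom (f.vert a) ((f.comp g).vert a) :=
      ⟨fun i ↦ if i ≤ f.vert a then g.vert i else (f.comp g).vert a + (i - f.vert a),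
        by
          intro i j h
          dsimp only
          split_ifs with h1 h2 h2
          · exact g.vert.mono h
          · exact (g.vert.mono h1).trans (Nat.le_add_right _ _)
          · omega
          · omega,
        by simp [g.vert.map_zero],
        fun i ↦ by
          split_ifs with h
          · obtain rfl : i = 0 := by omega
            rfl
          · omega⟩
    have hg₁ : ∀ i ≤ f.vert a, g₁ i = g.vert i := fun i hi ↦ if_pos hi
    let g₂ : Nec.Hom R Q :=
      { vert :=
          { toFun i := g.vert (f.vert a + i) - (f.comp g).vert a
            mono i j h := Nat.sub_le_sub_right (g.vert.mono (Nat.add_le_add_left h _)) _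
            map_zero := Nat.sub_self _
            map_add i := by
              have h1 := κ₁.add_sum
              have h2 := κ₂.add_sum
              have h3 := g.vert.map_add i
              rw [← Nat.add_assoc, h1, h3]; omega }
        joints_subset j hj := by
          obtain rfl | h := κ₂.mem_joints hj
          · exact ⟨0, zero_mem_joints _, Nat.sub_self _⟩
          · obtain ⟨w, hw, hw'⟩ := g.joints_subset h
            obtain ⟨k, rfl | ⟨i, hi, rfl⟩, rfl⟩ := f.joints_subset hw
            · rw [f.vert.map_zero, g.vert.map_zero] at hw'
              obtain rfl : j = 0 := by omega
              exact ⟨0, zero_mem_joints _, Nat.sub_self _⟩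
            · have hle := f.vert.mono (Nat.le_add_right a i)
              refine ⟨f.vert (a + i) - f.vert a, κ₁.mem_joints_right ?_, ?_⟩
              · rwa [Nat.add_sub_cancel' hle]
              · change g.vert (f.vert a + (f.vert (a + i) - f.vert a)) - _ = j
                rw [Nat.add_sub_cancel' hle]
                exact Nat.sub_eq_of_eq_add (hw'.trans (Nat.add_comm _ _)) }
    have hg₂ : ∀ i ≤ R.sum, (f.comp g).vert a + g₂.vert i = g.vert (f.vert a + i) := fun i hi ↦
      Nat.add_sub_cancel' (g.vert.mono (Nat.le_add_right _ _))
    have e₁ := necMap_cons' X (f.comp g) hS κ₂ rfl (f.vert.front.comp g₁)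
      (fun i hi ↦ (hg₁ _ (f.vert.front.map_le hi)).trans
        (congrArg g.vert (f.vert.front_apply hi)))
      ((f.back κ₁).comp g₂) (fun i hi ↦ (hg₂ _ ((f.back κ₁).vert.map_le hi)).trans
        (congrArg g.vert (Nat.add_sub_cancel' (f.vert.mono (Nat.le_add_right a i)))))
    have e₂ := necMap_split X g hS κ₁ κ₂ g₁ hg₁ g₂ hg₂
    refine e₁.trans ?_
    rw [necMap_comp (f.back κ₁) g₂ (κ₁.pos hU) (κ₂.pos hS), beadMap_comp,
      ← tensorHom_comp_tensorHom]
    exact (Category.assoc _ _ _).symm.trans ((congrArg (· ≫ _) e₂.symm).trans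
      ((Category.assoc _ _ _).trans (congrArg (_ ≫ ·) (necMap_cons X f hU κ₁).symm)))

end Necklaces

section

variable {C : Type v} [Category.{u} C] [MonoidalCategory C]

lemma wedge_aux₁ {B P Q S : C} (w : P ⊗ S ⟶ Q) (f : 𝟙_ C ⟶ B) :
    w ≫ (λ_ Q).inv ≫ f ▷ Q = ((λ_ P).inv ≫ f ▷ P) ▷ S ≫ (α_ _ _ _).hom ≫ B ◁ w := by
  have : (λ_ (P ⊗ S)).inv ≫ 𝟙_ C ◁ w ≫ f ▷ Q = (λ_ (P ⊗ S)).inv ≫ f ▷ (P ⊗ S) ≫ B ◁ w := by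
    rw [← whisker_exchange]
  simpa using this

lemma wedge_aux₂ {A D E K P S : C} (d : A ⟶ D ⊗ E) (w : P ⊗ S ⟶ K) :
    ((α_ A P S).hom ≫ A ◁ w) ≫ d ▷ K ≫ (α_ _ _ _).hom =
      (d ▷ P ≫ (α_ _ _ _).hom) ▷ S ≫ (α_ _ _ _).hom ≫ D ◁ ((α_ _ _ _).hom ≫ E ◁ w) := by
  have : (α_ A P S).hom ≫ A ◁ w ≫ d ▷ K ≫ (α_ _ _ _).hom =
    (α_ A P S).hom ≫ d ▷ _ ≫ _ ◁ w ≫ (α_ _ _ _).hom := by rw [whisker_exchange_assoc]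
  simpa using this

lemma wedge_aux₃ {A D K R S S' T U P Z : C} {w : U ⊗ S ⟶ P} {s' : P ⟶ D ⊗ K} {s : U ⟶ D ⊗ R}
    {w' : R ⊗ S ⟶ K} {x : D ⟶ A} {n : R ⟶ T} {k : K ⟶ Z} {g : S ⟶ S'} {w'' : T ⊗ S' ⟶ Z}
    (h : w ≫ s' = s ▷ S ≫ (α_ _ _ _).hom ≫ D ◁ w') (h' : w' ≫ k = (n ⊗ₘ g) ≫ w'') :
    w ≫ s' ≫ (x ⊗ₘ k) = ((s ≫ (x ⊗ₘ n)) ⊗ₘ g) ≫ (α_ _ _ _).hom ≫ A ◁ w'' := by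
  have h1 : D ◁ w' ≫ (x ⊗ₘ k) = (x ⊗ₘ (n ⊗ₘ g)) ≫ A ◁ w'' := by
    rw [← id_tensorHom, ← id_tensorHom, tensorHom_comp_tensorHom, tensorHom_comp_tensorHom, h',
      Category.id_comp, Category.comp_id]
  have h2 : ((s ≫ (x ⊗ₘ n)) ⊗ₘ g) = s ▷ S ≫ ((x ⊗ₘ n) ⊗ₘ g) := by
    rw [← tensorHom_id, tensorHom_comp_tensorHom, Category.id_comp]
  rw [reassoc_of% h, h1, h2, Category.assoc, associator_naturality_assoc]

lemma wedge_aux₄ {A K P Q R S T Z : C} {p : T ⊗ P ⟶ Q} {q : Q ⊗ S ⟶ Z} {r : P ⊗ S ⟶ R}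
    {s : T ⊗ R ⟶ K} {m : K ⟶ Z}
    (h : p ▷ S ≫ q = (α_ _ _ _).hom ≫ T ◁ r ≫ s ≫ m) :
    ((α_ A T P).hom ≫ A ◁ p) ▷ S ≫ (α_ _ _ _).hom ≫ A ◁ q =
      (α_ _ _ _).hom ≫ (A ⊗ T) ◁ r ≫ ((α_ _ _ _).hom ≫ A ◁ s) ≫ A ◁ m := by
  have := congrArg (fun k ↦ (α_ A T P).hom ▷ S ≫ (α_ _ _ _).hom ≫ A ◁ k) h
  simpa using this

lemma wedge_aux₅ {A P Q : C} {p : P ⊗ 𝟙_ C ⟶ Q} {m : P ⟶ Q} (h : p = (ρ_ _).hom ≫ m) :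
    (α_ _ _ _).hom ≫ A ◁ p = (ρ_ _).hom ≫ A ◁ m := by
  rw [h]
  simp

end

section Wedge

variable {W : Type v} [Category.{u} W] [MonoidalCategory W] (X : FIntᵒᵖ ⥤ W)

/-- The isomorphism `X_T ⊗ X_U ⟶ X_{T ∨ U}`. -/
def necWedge : ∀ T U : List ℕ, necObj X T ⊗ necObj X U ⟶ necObj X (T ++ U)
  | [], _ => (λ_ _).hom
  | a :: T, U => (α_ _ _ _).hom ≫ bead X a ◁ necWedge T U

variable [X.OplaxMonoidal] [IsIso (Functor.OplaxMonoidal.η X)]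

lemma necMap_cast {T U : List ℕ} (e : T = U) (h : ∀ b ∈ U, 0 < b) :
    necMap X (Nec.Hom.cast e) h = eqToHom (by rw [e]) := by
  subst e
  exact necMap_id X _ h

lemma necMap_cast_cons (a : ℕ) {T U : List ℕ} (e : T = U) (h : ∀ b ∈ U, 0 < b)
    (h' : ∀ b ∈ a :: U, 0 < b) :
    necMap X (Nec.Hom.cast (congrArg (a :: ·) e)) h' = bead X a ◁ necMap X (Nec.Hom.cast e) h := by
  rw [necMap_cast, necMap_cast]
  subst e
  simp
  rfl

lemma split_append {U R : List ℕ} {c : ℕ} (κ : Cut U c R) (S : List ℕ) :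
    necWedge X U S ≫ split X (κ.append S) =
      split X κ ▷ _ ≫ (α_ _ _ _).hom ≫ _ ◁ necWedge X R S := by
  cases κ with
  | zero hc hR => cases hc; cases hR; exact wedge_aux₁ _ _
  | exact hc hU =>
    cases hU
    exact (Category.comp_id _).trans
      ((congrArg (· ≫ _) (id_whiskerRight _ _)).trans (Category.id_comp _)).symm
  | mid r U' hc hr hU hR => cases hU; cases hR; exact wedge_aux₂ _ _

lemma necWedge_natural : ∀ {T T' U U' : List ℕ} (f : Nec.Hom T T') (g : Nec.Hom U U')
    (hT : ∀ b ∈ T', 0 < b) (hU : ∀ b ∈ U', 0 < b) (h : ∀ b ∈ T' ++ U', 0 < b),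
    necWedge X T' U' ≫ necMap X (f.wedge g) h = (necMap X f hT ⊗ₘ necMap X g hU) ≫ necWedge X T U
  | [], T', U, U', f, g, hT, hU, h => by
    obtain rfl := f.target_nil hT
    have e : f.wedge g = g := Nec.Hom.ext (FInt.Hom.ext_of_le fun i hi ↦ by
      change (if i ≤ 0 then f.vert i else 0 + g.vert (i - 0)) = _
      split_ifs with h
      · obtain rfl : i = 0 := by omega
        rw [f.vert.map_zero, g.vert.map_zero]
      · simp)
    rw [e, necMap_nil, id_tensorHom]
    exact (leftUnitor_naturality _).symm
  | a :: T, T', U, U', f, g, hT, hU, h => by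
    obtain ⟨R, κ⟩ := f.cut hT
    have e : (f.wedge g).vert a = f.vert a := if_pos (Nat.le_add_right a T.sum)
    have e₁ := necMap_cons' X (f.wedge g) h (κ.append U') e f.vert.front
      (fun i hi ↦ (f.vert.front_apply hi).trans
        (if_pos (hi.trans (Nat.le_add_right a T.sum))).symm) ((f.back κ).wedge g) (fun i hi ↦ by
          change f.vert a + (if i ≤ T.sum then f.vert (a + i) - f.vert a else
            R.sum + g.vert (i - T.sum)) = if a + i ≤ (a + T.sum) then f.vert (a + i) else
              T'.sum + g.vert (a + i - (a + T.sum))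
          have h1 := κ.add_sum
          have h2 := f.vert.mono (Nat.le_add_right a i)
          rw [Nat.add_sub_add_left]
          split_ifs <;> omega)
    refine (congrArg (_ ≫ ·) e₁).trans ((wedge_aux₃ (split_append X κ U')
      (necWedge_natural (f.back κ) g (κ.pos hT) hU _)).trans ?_)
    rw [necMap_cons X f hT κ]
    rfl

lemma necWedge_assoc : ∀ (T U S : List ℕ) (h : ∀ b ∈ T ++ (U ++ S), 0 < b),
    necWedge X T U ▷ _ ≫ necWedge X (T ++ U) S = (α_ _ _ _).hom ≫ _ ◁ necWedge X U S ≫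
      necWedge X T (U ++ S) ≫ necMap X (Nec.Hom.cast (List.append_assoc T U S)) h
  | [], U, S, h => by
    rw [necMap_cast]
    change (λ_ _).hom ▷ _ ≫ necWedge X U S = (α_ _ _ _).hom ≫ _ ◁ necWedge X U S ≫ (λ_ _).hom ≫ 𝟙 _
    simp
  | a :: T, U, S, h => by
    have hb := fun b hb ↦ h b (List.mem_cons_of_mem _ hb)
    exact (wedge_aux₄ (necWedge_assoc T U S hb)).trans
      (congrArg (fun k ↦ (α_ _ _ _).hom ≫ _ ◁ necWedge X U S ≫ necWedge X (a :: T) (U ++ S) ≫ k)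
        (necMap_cast_cons X a (List.append_assoc T U S) hb h).symm)

lemma necWedge_nil : ∀ (T : List ℕ) (h : ∀ b ∈ T, 0 < b),
    necWedge X T [] = (ρ_ _).hom ≫ necMap X (Nec.Hom.cast (List.append_nil T)) h
  | [], h => by
    rw [necMap_cast]
    exact unitors_equal.trans (Category.comp_id _).symm
  | a :: T, h => by
    have hb := fun b hb ↦ h b (List.mem_cons_of_mem _ hb)
    exact (wedge_aux₅ (necWedge_nil T hb)).trans
      (congrArg (_ ≫ ·) (necMap_cast_cons X a (List.append_nil T) hb h).symm)

end Wedge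

section Functoriality

section

variable {C : Type v} {D : Type*} [Category.{u} C] [Category* D] [MonoidalCategory C]
  [MonoidalCategory D] (G : D ⥤ C) [G.LaxMonoidal]

open Functor.LaxMonoidal

lemma func_aux₁ {A B : C} {P Q : D} {k : 𝟙_ C ⟶ A} {f : A ⟶ G.obj P} {l : 𝟙_ D ⟶ P}
    {n : B ⟶ G.obj Q} (h : k ≫ f = ε G ≫ G.map l) :
    ((λ_ B).inv ≫ k ▷ B) ≫ (f ⊗ₘ n) ≫ μ G P Q = n ≫ G.map ((λ_ Q).inv ≫ l ▷ Q) := by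
  have h1 : k ▷ B ≫ (f ⊗ₘ n) = 𝟙_ C ◁ n ≫ ε G ▷ _ ≫ G.map l ▷ _ := by
    rw [← tensorHom_id, tensorHom_comp_tensorHom, h, Category.id_comp, ← comp_whiskerRight,
      ← id_tensorHom, ← tensorHom_id, tensorHom_comp_tensorHom, Category.id_comp, Category.comp_id]
  rw [Category.assoc, reassoc_of% h1, μ_natural_left, ← leftUnitor_inv_naturality_assoc,
    G.map_comp, ← left_unitality_inv_assoc]

lemma func_aux₂ {A B C₁ U : C} {P Q R S : D} {d : A ⟶ B ⊗ C₁} {d' : S ⟶ P ⊗ Q} {x : B ⟶ G.obj P}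
    {y : C₁ ⟶ G.obj Q} {n : U ⟶ G.obj R} {z : A ⟶ G.obj S}
    (h : z ≫ G.map d' = d ≫ (x ⊗ₘ y) ≫ μ G P Q) :
    (d ▷ U ≫ (α_ _ _ _).hom) ≫ (x ⊗ₘ ((y ⊗ₘ n) ≫ μ G Q R)) ≫ μ G P (Q ⊗ R) =
      ((z ⊗ₘ n) ≫ μ G S R) ≫ G.map (d' ▷ R ≫ (α_ _ _ _).hom) := by
  have h1 : (x ⊗ₘ ((y ⊗ₘ n) ≫ μ G Q R)) = (x ⊗ₘ (y ⊗ₘ n)) ≫ _ ◁ μ G Q R := by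
    rw [← id_tensorHom, tensorHom_comp_tensorHom, Category.comp_id]
  have h2 : d ▷ U ≫ ((x ⊗ₘ y) ⊗ₘ n) ≫ μ G P Q ▷ _ = (z ⊗ₘ n) ≫ G.map d' ▷ _ := by
    rw [← tensorHom_id, ← tensorHom_id, ← tensorHom_id, tensorHom_comp_tensorHom,
      tensorHom_comp_tensorHom, tensorHom_comp_tensorHom, h, Category.id_comp, Category.comp_id]
  rw [h1, Category.assoc, Category.assoc, ← associator_naturality_assoc, ← associativity,
    reassoc_of% h2, G.map_comp, Category.assoc, μ_natural_left_assoc]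

lemma func_aux₃ {A B C₁ U E : C} {P Q R S : D} {d : A ⟶ B ⊗ C₁} {x : B ⟶ G.obj P} {b : B ⟶ U}
    {y : C₁ ⟶ G.obj Q} {m : C₁ ⟶ E} {x' : U ⟶ G.obj R} {y' : E ⟶ G.obj S} {b' : P ⟶ R}
    {m' : Q ⟶ S} {K : D} {z : A ⟶ G.obj K} {s : K ⟶ P ⊗ Q}
    (h : d ≫ (x ⊗ₘ y) ≫ μ G P Q = z ≫ G.map s)
    (h₁ : b ≫ x' = x ≫ G.map b') (h₂ : m ≫ y' = y ≫ G.map m') :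
    (d ≫ (b ⊗ₘ m)) ≫ (x' ⊗ₘ y') ≫ μ G R S = z ≫ G.map (s ≫ (b' ⊗ₘ m')) := by
  rw [Category.assoc, tensorHom_comp_tensorHom_assoc, h₁, h₂, ← tensorHom_comp_tensorHom,
    Category.assoc, μ_natural, G.map_comp, reassoc_of% h]

lemma func_aux₅ {U : C} {U' : D} {n : U ⟶ G.obj U'} :
    (λ_ U).hom ≫ n = (ε G ⊗ₘ n) ≫ μ G (𝟙_ D) U' ≫ G.map (λ_ U').hom := by
  rw [← leftUnitor_naturality, left_unitality, ← id_tensorHom, ← tensorHom_id,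
    tensorHom_comp_tensorHom_assoc, Category.id_comp, Category.comp_id]

lemma func_aux₆ {A B : C} {P Q P' Q' K : D} {a : A ⟶ G.obj P} {n : B ⟶ G.obj Q} {b : P ⟶ P'}
    {m : Q ⟶ Q'} {t : P' ⊗ Q' ⟶ K} :
    ((a ≫ G.map b) ⊗ₘ (n ≫ G.map m)) ≫ μ G P' Q' ≫ G.map t =
      ((a ⊗ₘ n) ≫ μ G P Q) ≫ G.map ((b ⊗ₘ m) ≫ t) := by
  rw [← tensorHom_comp_tensorHom, Category.assoc, μ_natural_assoc, G.map_comp, Category.assoc]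

lemma func_aux₄ {A P U S : C} {P' U' S' A' : D} {w : P ⊗ U ⟶ S} {w' : P' ⊗ U' ⟶ S'}
    {a : A ⟶ G.obj A'} {p : P ⟶ G.obj P'} {n : U ⟶ G.obj U'} {s : S ⟶ G.obj S'}
    (h : w ≫ s = (p ⊗ₘ n) ≫ μ G P' U' ≫ G.map w') :
    ((α_ A P U).hom ≫ A ◁ w) ≫ (a ⊗ₘ s) ≫ μ G A' S' =
      (((a ⊗ₘ p) ≫ μ G A' P') ⊗ₘ n) ≫ μ G _ U' ≫ G.map ((α_ A' P' U').hom ≫ A' ◁ w') := by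
  have h1 : A ◁ w ≫ (a ⊗ₘ s) = (a ⊗ₘ (p ⊗ₘ n)) ≫ _ ◁ μ G P' U' ≫ _ ◁ G.map w' := by
    rw [← id_tensorHom, ← id_tensorHom, ← id_tensorHom, tensorHom_comp_tensorHom,
      tensorHom_comp_tensorHom, tensorHom_comp_tensorHom, h]
    simp
  have h2 : (((a ⊗ₘ p) ≫ μ G A' P') ⊗ₘ n) = ((a ⊗ₘ p) ⊗ₘ n) ≫ μ G A' P' ▷ _ := by
    rw [← tensorHom_id, tensorHom_comp_tensorHom, Category.comp_id]
  rw [Category.assoc, reassoc_of% h1, h2, μ_natural_right, G.map_comp, Category.assoc,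
    ← associator_naturality_assoc, associativity_assoc]

end

variable {C : Type v} {D : Type*} [Category.{u} C] [Category* D] [MonoidalCategory C]
  [MonoidalCategory D] {X : FIntᵒᵖ ⥤ C} {Y : FIntᵒᵖ ⥤ D} {G : D ⥤ C} [G.LaxMonoidal]
  (τ : X ⟶ Y ⋙ G)

/-- The component of `τ` at `[n]`. -/
abbrev beadApp (n : ℕ) : bead X n ⟶ G.obj (bead Y n) := τ.app (op ⟨n⟩)

/-- The morphism `X_T ⟶ G(Y_T)` induced by a transformation `τ : X ⟶ Y ⋙ G`. -/
def necApp : ∀ T : List ℕ, necObj X T ⟶ G.obj (necObj Y T)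
  | [] => Functor.LaxMonoidal.ε G
  | a :: T => (beadApp τ a ⊗ₘ necApp T) ≫ Functor.LaxMonoidal.μ G _ _

lemma necApp_wedge : ∀ T U : List ℕ, necWedge X T U ≫ necApp τ (T ++ U) =
    (necApp τ T ⊗ₘ necApp τ U) ≫ Functor.LaxMonoidal.μ G _ _ ≫ G.map (necWedge Y T U)
  | [], _ => func_aux₅ G
  | _ :: T, U => func_aux₄ G (necApp_wedge T U)

variable [X.OplaxMonoidal] [IsIso (Functor.OplaxMonoidal.η X)] [Y.OplaxMonoidal]
  [IsIso (Functor.OplaxMonoidal.η Y)]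

lemma necApp_split (hδ : ∀ m n : ℕ, beadApp τ (m + n) ≫ G.map (comul Y m n) =
      comul X m n ≫ (beadApp τ m ⊗ₘ beadApp τ n) ≫ Functor.LaxMonoidal.μ G _ _)
    (hη : unitInv X ≫ beadApp τ 0 = Functor.LaxMonoidal.ε G ≫ G.map (unitInv Y))
    {U R : List ℕ} {c : ℕ} (κ : Cut U c R) :
    split X κ ≫ (beadApp τ c ⊗ₘ necApp τ R) ≫ Functor.LaxMonoidal.μ G _ _ =
      necApp τ U ≫ G.map (split Y κ) := by
  cases κ with
  | zero hc hR => cases hc; cases hR; exact func_aux₁ G hη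
  | exact hc hU =>
    cases hU
    exact (Category.id_comp _).trans
      ((congrArg (_ ≫ ·) (G.map_id _)).trans (Category.comp_id _)).symm
  | mid r U' hc hr hU hR => cases hU; cases hR; exact func_aux₂ G (hδ c r)

lemma necApp_natural (hδ : ∀ m n : ℕ, beadApp τ (m + n) ≫ G.map (comul Y m n) =
      comul X m n ≫ (beadApp τ m ⊗ₘ beadApp τ n) ≫ Functor.LaxMonoidal.μ G _ _)
    (hη : unitInv X ≫ beadApp τ 0 = Functor.LaxMonoidal.ε G ≫ G.map (unitInv Y)) : ∀ {T U : List ℕ} (f : Nec.Hom T U) (h : ∀ b ∈ U, 0 < b),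
    necMap X f h ≫ necApp τ T = necApp τ U ≫ G.map (necMap Y f h)
  | [], U, f, h => by
    obtain rfl := f.target_nil h
    rw [necMap_nil, necMap_nil, G.map_id, Category.id_comp, Category.comp_id]
  | a :: T, U, f, h => by
    obtain ⟨R, κ⟩ := f.cut h
    rw [necMap_cons X f h κ, necMap_cons Y f h κ]
    exact func_aux₃ G (necApp_split τ hδ hη κ) (τ.naturality _)
      (necApp_natural hδ hη (f.back κ) (κ.pos h))

end Functoriality

/-! ## Templicial objects -/

namespace Quiv

variable {V : Type v} [Category.{u} V] {S T R : Type u}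

/-- The functor `f^*` restricting quivers along a map of vertices `f`. It is right adjoint to the
functor `f_!` with `f_!(Q)(x, y) = ∐_{f(a) = x, f(b) = y} Q(a, b)`. -/
@[simps]
def pullback (f : S → T) : Quiv V T ⥤ Quiv V S where
  obj P := ⟨fun a b ↦ P.hom (f a) (f b)⟩
  map g := ⟨fun a b ↦ g.app (f a) (f b)⟩

variable [MonoidalCategory V] [HasColimits V] [SymmetricCategory V] [MonoidalClosed V]

section

variable (f : S → T)

/-- The unit `I_S ⟶ f^* I_T`. -/
def pullbackε : 𝟙_ (Quiv V S) ⟶ (pullback f).obj (𝟙_ (Quiv V T)) :=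
  ⟨fun _ _ ↦ unitDesc fun h ↦ unitι (congrArg f h)⟩

/-- The tensorator `f^* Q ⊗_S f^* P ⟶ f^* (Q ⊗_T P)`. -/
def pullbackμ (Q P : Quiv V T) :
    (pullback f).obj Q ⊗ (pullback f).obj P ⟶ (pullback f).obj (Q ⊗ P) :=
  ⟨fun a b ↦ desc fun c ↦ ι Q P (f a) (f c) (f b)⟩

lemma ι_pullbackμ (Q P : Quiv V T) (a c b : S) :
    ι ((pullback f).obj Q) ((pullback f).obj P) a c b ≫ (pullbackμ f Q P).app a b =
      ι Q P (f a) (f c) (f b) :=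
  ι_desc _ _

lemma unitι_pullbackε {a b : S} (h : a = b) :
    unitι h ≫ (pullbackε (V := V) f).app a b = unitι (congrArg f h) :=
  unitι_desc (fun h ↦ unitι (congrArg f h)) h

/-- The canonical lax monoidal structure on `f^*`; its mate is the colax structure on `f_!`. -/
instance : (pullback (V := V) f).LaxMonoidal where
  ε := pullbackε f
  μ := pullbackμ f
  μ_natural_left {Q Q'} g P := by
    ext a b
    refine tensor_ext fun c ↦ ?_
    rw [comp_app, comp_app, reassoc_of% ι_pullbackμ]
    erw [ι_whiskerRight_assoc, ι_pullbackμ, ι_whiskerRight]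
    rfl
  μ_natural_right {Q Q'} P g := by
    ext a b
    refine tensor_ext fun c ↦ ?_
    rw [comp_app, comp_app, reassoc_of% ι_pullbackμ]
    erw [ι_whiskerLeft_assoc, ι_pullbackμ, ι_whiskerLeft]
    rfl
  associativity Q P R := by
    ext a b
    refine tensor_ext fun d ↦ tensorR_ext fun c ↦ ?_
    simp only [comp_app]
    erw [ι_whiskerRight_assoc, ι_associator_hom_assoc, reassoc_of% ι_pullbackμ,
      ι_whiskerLeft_assoc, ι_pullbackμ, ← comp_whiskerRight_assoc, ι_pullbackμ, ι_associator_hom,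
      ← whiskerLeft_comp_assoc, ι_pullbackμ]
    rfl
  left_unitality Q := by
    ext a b
    refine tensor_ext fun c ↦ unitR_ext fun h ↦ ?_
    simp only [comp_app]
    erw [ι_leftUnitor_hom, ι_whiskerRight_assoc, reassoc_of% ι_pullbackμ,
      ← comp_whiskerRight_assoc, unitι_pullbackε, ι_leftUnitor_hom]
    rfl
  right_unitality Q := by
    ext a b
    refine tensor_ext fun c ↦ unitL_ext fun h ↦ ?_
    simp only [comp_app]
    erw [ι_rightUnitor_hom, ι_whiskerLeft_assoc, reassoc_of% ι_pullbackμ,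
      ← whiskerLeft_comp_assoc, unitι_pullbackε]
    exact (ι_rightUnitor_hom (Q := Q) (congrArg f h)).symm

end

lemma pullbackμ_comp (f : S → T) (g : T → R) (Q P : Quiv V R) :
    pullbackμ (g ∘ f) Q P =
      pullbackμ f ((pullback g).obj Q) ((pullback g).obj P) ≫
        (pullback f).map (pullbackμ g Q P) := by
  ext a b
  refine tensor_ext fun c ↦ (ι_pullbackμ (g ∘ f) Q P a c b).trans ?_
  have h := ι_pullbackμ f ((pullback g).obj Q) ((pullback g).obj P) a c b
  exact ((Category.assoc _ _ _).symm.trans ((congrArg (· ≫ _) h).trans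
    (ι_pullbackμ g Q P (f a) (f c) (f b)))).symm

lemma pullbackε_comp (f : S → T) (g : T → R) :
    pullbackε (V := V) (g ∘ f) = pullbackε f ≫ (pullback f).map (pullbackε g) := by
  ext a b
  refine unit_ext fun h ↦ (unitι_pullbackε (g ∘ f) h).trans ?_
  exact ((Category.assoc _ _ _).symm.trans ((congrArg (· ≫ _) (unitι_pullbackε f h)).trans
    (unitι_pullbackε g (congrArg f h)))).symm

lemma pullbackμ_id (Q P : Quiv V S) : pullbackμ id Q P = 𝟙 (Q ⊗ P) := by
  ext a b
  refine tensor_ext fun c ↦ (ι_pullbackμ id Q P a c b).trans ?_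
  exact (Category.comp_id _).symm

lemma pullbackε_id : pullbackε (V := V) (id : S → S) = 𝟙 (𝟙_ (Quiv V S)) := by
  ext a b
  refine unit_ext fun h ↦ (unitι_pullbackε id h).trans ?_
  exact (Category.comp_id _).symm

end Quiv

/-- A templicial object of `V`: a set `S` of vertices and a strongly unital colax monoidal functor
from the opposite of the category of finite intervals to the category of quivers on `S`. -/
structure Templicial (V : Type v) [Category.{u} V] [MonoidalCategory V] [HasColimits V]
    [SymmetricCategory V] [MonoidalClosed V] where
  /-- the set of vertices -/
  S : Type u
  /-- the underlying functor -/
  X : FIntᵒᵖ ⥤ Quiv V S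
  [oplax : X.OplaxMonoidal]
  [unital : IsIso (Functor.OplaxMonoidal.η X)]

namespace Templicial

variable {V : Type v} [Category.{u} V] [MonoidalCategory V] [HasColimits V]
  [SymmetricCategory V] [MonoidalClosed V]

instance (X : Templicial V) : X.X.OplaxMonoidal := X.oplax
instance (X : Templicial V) : IsIso (Functor.OplaxMonoidal.η X.X) := X.unital

/-- A morphism of templicial objects `X ⟶ Y`: a map `f` on vertices and a monoidal natural
transformation `f_! X ⟶ Y`, given by its mate `X ⟶ f^* Y`. -/
structure Hom (X Y : Templicial V) where
  /-- the map on vertices -/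
  map : X.S → Y.S
  /-- the natural transformation -/
  app : X.X ⟶ Y.X ⋙ Quiv.pullback map
  app_comul : ∀ m n : ℕ, beadApp app (m + n) ≫ (Quiv.pullback map).map (comul Y.X m n) =
    comul X.X m n ≫ (beadApp app m ⊗ₘ beadApp app n) ≫
      Functor.LaxMonoidal.μ (Quiv.pullback map) _ _
  app_counit : Functor.OplaxMonoidal.η X.X ≫ Functor.LaxMonoidal.ε (Quiv.pullback map) =
    app.app (𝟙_ _) ≫ (Quiv.pullback map).map (Functor.OplaxMonoidal.η Y.X)

lemma Hom.ext' {X Y : Templicial V} {map : X.S → Y.S} {app app' : X.X ⟶ Y.X ⋙ Quiv.pullback map}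
    {h₁ h₂ h₁' h₂'} (h : ∀ n a b, (app.app n).app a b = (app'.app n).app a b) :
    (⟨map, app, h₁, h₂⟩ : Hom X Y) = ⟨map, app', h₁', h₂'⟩ := by
  congr
  ext n a b
  exact h n a b

/-- The identity morphism. -/
def Hom.id (X : Templicial V) : Hom X X where
  map := _root_.id
  app := 
    { app := fun n ↦ 𝟙 (X.X.obj n)
      naturality := fun _ _ _ ↦ (Category.comp_id _).trans (Category.id_comp _).symm }
  app_comul m n := by
    have h₁ : comul X.X m n ≫ (𝟙 (bead X.X m) ⊗ₘ 𝟙 (bead X.X n)) ≫ 𝟙 _ = comul X.X m n := by simp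
    exact (Category.id_comp _).trans (h₁.symm.trans (congrArg
      (fun k : bead X.X m ⊗ bead X.X n ⟶ bead X.X m ⊗ bead X.X n ↦ comul X.X m n ≫
        (𝟙 (bead X.X m) ⊗ₘ 𝟙 (bead X.X n)) ≫ k) (Quiv.pullbackμ_id _ _).symm))
  app_counit :=
    (congrArg (fun k : 𝟙_ (Quiv V X.S) ⟶ 𝟙_ (Quiv V X.S) ↦ Functor.OplaxMonoidal.η X.X ≫ k)
      Quiv.pullbackε_id).trans ((Category.comp_id _).trans (Category.id_comp _).symm)

/-- Composition of morphisms, in diagrammatic order. -/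
def Hom.comp {X Y Z : Templicial V} (f : Hom X Y) (g : Hom Y Z) : Hom X Z where
  map := g.map ∘ f.map
  app :=
    { app := fun n ↦ f.app.app n ≫ (Quiv.pullback f.map).map (g.app.app n)
      naturality := fun m n h ↦ by
        have h₁ := f.app.naturality h
        have h₂ := congrArg (Quiv.pullback f.map).map (g.app.naturality h)
        rw [Functor.map_comp, Functor.map_comp] at h₂
        exact (Category.assoc _ _ _).symm.trans ((congrArg (· ≫ _) h₁).trans
          ((Category.assoc _ _ _).trans ((congrArg (_ ≫ ·) h₂).trans
            (Category.assoc _ _ _).symm))) }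
  app_comul m n := by
    have h₁ := f.app_comul m n
    have h₂ := congrArg (Quiv.pullback f.map).map (g.app_comul m n)
    rw [Functor.map_comp, Functor.map_comp, Functor.map_comp] at h₂
    refine (Category.assoc _ _ _).trans ((congrArg (_ ≫ ·) h₂).trans ?_)
    rw [reassoc_of% h₁, ← Functor.LaxMonoidal.μ_natural_assoc, tensorHom_comp_tensorHom_assoc]
    exact congrArg (fun k ↦ _ ≫ _ ≫ k) (Quiv.pullbackμ_comp f.map g.map _ _).symm
  app_counit := by
    have h₁ := f.app_counit
    have h₂ := congrArg (Quiv.pullback f.map).map g.app_counit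
    rw [Functor.map_comp, Functor.map_comp] at h₂
    refine Eq.trans ?_ ((congrArg (_ ≫ ·) h₂).trans (Category.assoc _ _ _).symm)
    rw [← reassoc_of% h₁]
    exact congrArg (_ ≫ ·) (Quiv.pullbackε_comp f.map g.map)

/-- The category of templicial objects of `V`. -/
instance : Category (Templicial V) where
  Hom := Hom
  id := Hom.id
  comp := Hom.comp
  id_comp f := Hom.ext' fun n a b ↦ Category.id_comp ((f.app.app n).app a b)
  comp_id f := Hom.ext' fun n a b ↦ Category.comp_id ((f.app.app n).app a b)
  assoc f g h := Hom.ext' fun n a b ↦ Category.assoc ((f.app.app n).app a b)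
    ((g.app.app n).app _ _) ((h.app.app n).app _ _)

end Templicial

/-! ## Necklace categories -/

/-- A (small) necklace category: a category enriched in the category of functors `Necᵒᵖ ⥤ V` with
the Day convolution. By the universal property of the Day convolution, the composition
`C(A, B) ⊗_Day C(B, C) ⟶ C(A, C)` amounts to morphisms `C(A, B)_T ⊗ C(B, C)_U ⟶ C(A, C)_{T ∨ U}`
natural in `T` and `U`, and an identity amounts to a morphism from `I` to the value of `C(A, A)` at
the monoidal unit `Δ^0` of necklaces. -/
structure NecCat (V : Type v) [Category.{u} V] [MonoidalCategory V] where
  /-- the set of objects -/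
  Obj : Type u
  /-- the functor of morphisms -/
  hom : Obj → Obj → Necᵒᵖ ⥤ V
  /-- the identities -/
  id (A : Obj) : 𝟙_ V ⟶ (hom A A).obj (op (𝟙_ Nec))
  /-- the composition -/
  comp (A B C : Obj) (T U : Nec) :
    (hom A B).obj (op T) ⊗ (hom B C).obj (op U) ⟶ (hom A C).obj (op (T ⊗ U))
  comp_natural (A B C : Obj) {T T' U U' : Nec} (f : T ⟶ T') (g : U ⟶ U') :
    ((hom A B).map f.op ⊗ₘ (hom B C).map g.op) ≫ comp A B C T U =
      comp A B C T' U' ≫ (hom A C).map (f ⊗ₘ g).op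
  id_comp (A B : Obj) (T : Nec) :
    id A ▷ _ ≫ comp A A B (𝟙_ Nec) T = (λ_ _).hom ≫ (hom A B).map (λ_ T).hom.op
  comp_id (A B : Obj) (T : Nec) :
    _ ◁ id B ≫ comp A B B T (𝟙_ Nec) = (ρ_ _).hom ≫ (hom A B).map (ρ_ T).hom.op
  assoc (A B C D : Obj) (T U S : Nec) :
    comp A B C T U ▷ _ ≫ comp A C D (T ⊗ U) S = (α_ _ _ _).hom ≫ _ ◁ comp B C D U S ≫
      comp A B D T (U ⊗ S) ≫ (hom A D).map (α_ T U S).hom.op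

namespace NecCat

variable {V : Type v} [Category.{u} V] [MonoidalCategory V]

/-- A functor of necklace categories. -/
structure Hom (C D : NecCat V) where
  /-- the map on objects -/
  obj : C.Obj → D.Obj
  /-- the transformations on morphisms -/
  app (A B : C.Obj) : C.hom A B ⟶ D.hom (obj A) (obj B)
  map_id (A : C.Obj) : C.id A ≫ (app A A).app _ = D.id (obj A)
  map_comp (A B E : C.Obj) (T U : Nec) : C.comp A B E T U ≫ (app A E).app _ =
    ((app A B).app _ ⊗ₘ (app B E).app _) ≫ D.comp (obj A) (obj B) (obj E) T U

lemma Hom.ext' {C D : NecCat V} {obj : C.Obj → D.Obj}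
    {app app' : ∀ A B : C.Obj, C.hom A B ⟶ D.hom (obj A) (obj B)} {h₁ h₂ h₁' h₂'}
    (h : ∀ A B T, (app A B).app T = (app' A B).app T) :
    (⟨obj, app, h₁, h₂⟩ : Hom C D) = ⟨obj, app', h₁', h₂'⟩ := by
  congr
  ext A B T
  exact h A B T

/-- The category of necklace categories. -/
instance : Category (NecCat V) where
  Hom := Hom
  id C :=
    { obj := fun A ↦ A
      app := fun _ _ ↦ 𝟙 _
      map_id := fun _ ↦ Category.comp_id _
      map_comp := fun _ _ _ _ _ ↦ by simp }
  comp F G :=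
    { obj := fun A ↦ G.obj (F.obj A)
      app := fun A B ↦ F.app A B ≫ G.app _ _
      map_id := fun A ↦ by
        rw [NatTrans.comp_app, reassoc_of% F.map_id, G.map_id]
      map_comp := fun A B E T U ↦ by
        rw [NatTrans.comp_app, reassoc_of% F.map_comp, G.map_comp, tensorHom_comp_tensorHom_assoc]
        rfl }
  id_comp F := Hom.ext' fun _ _ _ ↦ Category.id_comp _
  comp_id F := Hom.ext' fun _ _ _ ↦ Category.comp_id _
  assoc F G H := Hom.ext' fun _ _ _ ↦ Category.assoc _ _ _

end NecCat

section Nec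

variable {V : Type v} [Category.{u} V] [MonoidalCategory V] [HasColimits V]
  [SymmetricCategory V] [MonoidalClosed V]

open Quiv

/-- The object `X_T(a, b)`, as a functor of the necklace `T`. -/
def necHom (X : Templicial V) (a b : X.S) : Necᵒᵖ ⥤ V where
  obj T := (necObj X.X T.unop.beads).hom a b
  map {T U} f := (necMap X.X f.unop T.unop.pos).app a b
  map_id T := by
    have h := necMap_id X.X T.unop.beads T.unop.pos
    exact congrArg (fun k ↦ Quiv.Hom.app k a b) h
  map_comp {T U S} f g := by
    have h := necMap_comp X.X g.unop f.unop U.unop.pos T.unop.pos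
    exact congrArg (fun k ↦ Quiv.Hom.app k a b) h

/-- The necklace category `X^nec` of a templicial object, with `X^nec(a, b)_T = X_T(a, b)`. -/
def necCat (X : Templicial V) : NecCat V where
  Obj := X.S
  hom := necHom X
  id a := unitι rfl
  comp a b c T U := ι _ _ a b c ≫ (necWedge X.X T.beads U.beads).app a c
  comp_natural a b c {T T' U U'} f g := by
    have h := necWedge_natural X.X f g T'.pos U'.pos (T' ⊗ U').pos
    have h' := congrArg (fun k ↦ ι _ _ a b c ≫ Quiv.Hom.app k a c) h
    refine Eq.trans ?_ (h'.symm.trans (Category.assoc _ _ _).symm)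
    exact (Category.assoc _ _ _).symm.trans ((congrArg (· ≫ _) (ι_tensorHom _ _).symm).trans
      (Category.assoc _ _ _))
  id_comp a b T := by
    have h := congrArg (fun k ↦ Quiv.Hom.app k a b) (necMap_id X.X T.beads T.pos)
    exact (ι_leftUnitor_hom (Q := necObj X.X T.beads) (b := b) (rfl : a = a)).trans
      (congrArg ((λ_ _).hom ≫ ·) h.symm)
  comp_id a b T := by
    have h := congrArg (fun k ↦ (necObj X.X T.beads).hom a b ◁ unitι (rfl : b = b) ≫
      ι (necObj X.X T.beads) (𝟙_ _) a b b ≫ Quiv.Hom.app k a b) (necWedge_nil X.X T.beads T.pos)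
    refine h.trans ((congrArg (_ ≫ ·) (Category.assoc _ _ _).symm).trans ?_)
    refine (Category.assoc _ _ _).symm.trans (congrArg (· ≫ _) ?_)
    exact (ι_rightUnitor_hom (Q := necObj X.X T.beads) (rfl : b = b)).trans (Category.comp_id _)
  assoc a b c d T U S := by
    have h := congrArg (fun k ↦ ι (necObj X.X T.beads) (necObj X.X U.beads) a b c ▷ _ ≫
      ι (necObj X.X T.beads ⊗ necObj X.X U.beads) (necObj X.X S.beads) a c d ≫ Quiv.Hom.app k a d)
      (necWedge_assoc X.X T.beads U.beads S.beads (T ⊗ (U ⊗ S)).pos)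
    simp only [Quiv.comp_app, ι_whiskerRight_assoc, ι_associator_hom_assoc,
      ι_whiskerLeft_assoc] at h
    refine Eq.trans ?_ (h.trans ?_)
    · exact (congrArg (· ≫ _) (comp_whiskerRight _ _ _)).trans (Category.assoc _ _ _)
    · exact congrArg (_ ≫ ·) ((Category.assoc _ _ _).symm.trans
        ((congrArg (· ≫ _) (whiskerLeft_comp _ _ _).symm).trans
          (congrArg (_ ≫ ·) (Category.assoc _ _ _).symm)))

lemma Templicial.Hom.app_unitInv {X Y : Templicial V} (f : Templicial.Hom X Y) :
    unitInv X.X ≫ beadApp f.app 0 =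
      Functor.LaxMonoidal.ε (Quiv.pullback f.map) ≫ (Quiv.pullback f.map).map (unitInv Y.X) := by
  have h : unitInv X.X ≫ (Functor.OplaxMonoidal.η X.X ≫
      Functor.LaxMonoidal.ε (Quiv.pullback f.map)) ≫ (Quiv.pullback f.map).map (unitInv Y.X) =
    unitInv X.X ≫ (f.app.app (𝟙_ _) ≫ (Quiv.pullback f.map).map (Functor.OplaxMonoidal.η Y.X)) ≫
      (Quiv.pullback f.map).map (unitInv Y.X) := by rw [f.app_counit]
  rw [Category.assoc, Category.assoc, ← Functor.map_comp, unitInv, unitInv,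
    IsIso.inv_hom_id_assoc, IsIso.hom_inv_id, CategoryTheory.Functor.map_id] at h
  exact ((h.trans (congrArg (_ ≫ ·) (Category.comp_id _)))).symm

lemma necApp_id (X : Templicial V) : ∀ T : List ℕ,
    necApp (Templicial.Hom.id X).app T = 𝟙 (necObj X.X T)
  | [] => Quiv.pullbackε_id
  | a :: T => by
    have h := necApp_id X T
    have h₁ : (𝟙 (bead X.X a) ⊗ₘ 𝟙 (necObj X.X T)) ≫ 𝟙 (bead X.X a ⊗ necObj X.X T) = 𝟙 _ := by simp
    refine Eq.trans ?_ h₁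
    refine Eq.trans (congrArg (fun k : necObj X.X T ⟶ necObj X.X T ↦
      (𝟙 (bead X.X a) ⊗ₘ k) ≫ Quiv.pullbackμ _root_.id _ _) h) ?_
    exact congrArg (fun k : bead X.X a ⊗ necObj X.X T ⟶ bead X.X a ⊗ necObj X.X T ↦
      (𝟙 (bead X.X a) ⊗ₘ 𝟙 (necObj X.X T)) ≫ k) (Quiv.pullbackμ_id _ _)

lemma necApp_comp {X Y Z : Templicial V} (f : Templicial.Hom X Y) (g : Templicial.Hom Y Z) :
    ∀ T : List ℕ, necApp (Templicial.Hom.comp f g).app T =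
      necApp f.app T ≫ (Quiv.pullback f.map).map (necApp g.app T)
  | [] => Quiv.pullbackε_comp f.map g.map
  | a :: T => by
    have h := necApp_comp f g T
    refine Eq.trans ?_ (func_aux₆ (Quiv.pullback f.map) (a := beadApp f.app a) (n := necApp f.app T)
      (b := beadApp g.app a) (m := necApp g.app T)
      (t := Functor.LaxMonoidal.μ (Quiv.pullback g.map) (bead Z.X a) (necObj Z.X T)))
    exact congrArg₂ (fun k l ↦ (beadApp (Templicial.Hom.comp f g).app a ⊗ₘ k) ≫ l) h
      (Quiv.pullbackμ_comp f.map g.map _ _)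

/-- The functor `(-)^nec`. -/
def nec : Templicial V ⥤ NecCat V where
  obj := necCat
  map {X Y} f :=
    { obj := f.map
      app a b :=
        { app := fun T ↦ (necApp f.app T.unop.beads).app a b
          naturality := fun T U h ↦ congrArg (fun k ↦ Quiv.Hom.app k a b)
            (necApp_natural f.app f.app_comul f.app_unitInv h.unop T.unop.pos) }
      map_id a := unitι_pullbackε f.map (rfl : a = a)
      map_comp a b c T U := by
        have h := congrArg (fun k ↦ ι _ _ a b c ≫ Quiv.Hom.app k a c)
          (necApp_wedge f.app T.beads U.beads)
        refine (Category.assoc _ _ _).trans (h.trans ?_)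
        have h₁ := ι_tensorHom (a := a) (b := c) (c := b) (necApp f.app T.beads)
          (necApp f.app U.beads)
        have h₂ := ι_pullbackμ f.map (necObj Y.X T.beads) (necObj Y.X U.beads) a b c
        refine (Category.assoc _ _ _).symm.trans ((congrArg (· ≫ _) h₁).trans
          ((Category.assoc _ _ _).trans (congrArg (_ ≫ ·) ?_)))
        exact (Category.assoc _ _ _).symm.trans (congrArg (· ≫ _) h₂) }
  map_id X := NecCat.Hom.ext' fun a b T ↦
    congrArg (fun k ↦ Quiv.Hom.app k a b) (necApp_id X T.unop.beads)
  map_comp f g := NecCat.Hom.ext' fun a b T ↦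
    congrArg (fun k ↦ Quiv.Hom.app k a b) (necApp_comp f g T.unop.beads)

end Nec

/-! ## Simplicially enriched categories and their necklace categories -/

/-- A small category enriched in `W`. -/
structure SmallEnrichedCat (W : Type v) [Category.{u} W] [MonoidalCategory W] where
  /-- the set of objects -/
  Obj : Type u
  [enriched : EnrichedCategory W Obj]

namespace SmallEnrichedCat

variable {W : Type v} [Category.{u} W] [MonoidalCategory W]

instance (C : SmallEnrichedCat W) : EnrichedCategory W C.Obj := C.enriched

/-- The category of small enriched categories and enriched functors. -/
instance : Category (SmallEnrichedCat W) where
  Hom C D := EnrichedFunctor W C.Obj D.Obj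
  id C := EnrichedFunctor.id W C.Obj
  comp F G := EnrichedFunctor.comp W F G
  id_comp _ := EnrichedFunctor.ext _ (fun _ ↦ rfl) fun _ _ ↦
    (Category.comp_id _).trans (Category.id_comp _)
  comp_id _ := EnrichedFunctor.ext _ (fun _ ↦ rfl) fun _ _ ↦
    (Category.comp_id _).trans (Category.comp_id _)
  assoc _ _ _ := EnrichedFunctor.ext _ (fun _ ↦ rfl) fun _ _ ↦
    (Category.comp_id _).trans (Category.assoc _ _ _)

end SmallEnrichedCat

section Weighted

variable {V : Type v} [Category.{u} V] [HasLimits V]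

/-- The weighted limit `{K, Y} = ∫_n (Y_n)^{K_n}` of a simplicial object `Y` with weight a simplicial
set `K`, as the conical limit of the `Y_n` over the category of elements `x ∈ K_n`. In a monoidal
closed category with coproducts, it is the object of morphisms `[F(K), Y]` where
`F(K)_n = ∐_{K_n} I`. -/
def wlim (K : SSet.{0}) (Y : SimplicialObject V) : V :=
  limit (CategoryOfElements.π K ⋙ Y)

/-- The projections of the weighted limit. -/
def wπ (K : SSet.{0}) (Y : SimplicialObject V) (n : SimplexCategoryᵒᵖ) (x : K.obj n) :
    wlim K Y ⟶ Y.obj n :=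
  limit.π (CategoryOfElements.π K ⋙ Y) ⟨n, x⟩

variable {K L : SSet.{0}} {Y Z : SimplicialObject V}

lemma wπ_map {n m : SimplexCategoryᵒᵖ} (f : n ⟶ m) (x : K.obj n) :
    wπ K Y n x ≫ Y.map f = wπ K Y m (K.map f x) :=
  limit.w (CategoryOfElements.π K ⋙ Y)
    (show K.elementsMk n x ⟶ K.elementsMk m (K.map f x) from ⟨f, rfl⟩)

/-- Morphisms into a weighted limit from their components. -/
def wlift {A : V} (g : ∀ n, K.obj n → (A ⟶ Y.obj n))
    (h : ∀ n m (f : n ⟶ m) (x : K.obj n), g n x ≫ Y.map f = g m (K.map f x)) : A ⟶ wlim K Y :=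
  limit.lift (CategoryOfElements.π K ⋙ Y)
    { pt := A
      π :=
        { app := fun x ↦ g x.1 x.2
          naturality := fun x y f ↦ by
            have := h _ _ f.1 x.2
            rw [f.2] at this
            exact (Category.id_comp _).trans this.symm } }

lemma wlift_π {A : V} (g : ∀ n, K.obj n → (A ⟶ Y.obj n)) (h) (n : SimplexCategoryᵒᵖ)
    (x : K.obj n) : wlift (Y := Y) g h ≫ wπ K Y n x = g n x :=
  limit.lift_π _ _

lemma wlim_ext {A : V} {g h : A ⟶ wlim K Y} (w : ∀ n x, g ≫ wπ K Y n x = h ≫ wπ K Y n x) : g = h :=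
  limit.hom_ext fun x ↦ w x.1 x.2

/-- Functoriality of the weighted limit. -/
def wmap (k : L ⟶ K) (y : Y ⟶ Z) : wlim K Y ⟶ wlim L Z :=
  wlift (fun n x ↦ wπ K Y n (k.app n x) ≫ y.app n) fun n m f x ↦ by
    have h : k.app m (L.map f x) = K.map f (k.app n x) := NatTrans.naturality_apply k f x
    rw [Category.assoc, ← y.naturality, h, reassoc_of% wπ_map]

lemma wmap_π (k : L ⟶ K) (y : Y ⟶ Z) (n : SimplexCategoryᵒᵖ) (x : L.obj n) :
    wmap k y ≫ wπ L Z n x = wπ K Y n (k.app n x) ≫ y.app n :=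
  wlift_π _ _ _ _

end Weighted

/-- The poset of sets `S` of vertices of a necklace `(T, p)` with `T ⊆ S ⊆ [p]`. -/
def NecPoset (T : Nec) : Type := {S : Set ℕ // joints T.beads ⊆ S ∧ S ⊆ Set.Iic T.len}

namespace NecPoset

instance (T : Nec) : PartialOrder (NecPoset T) := inferInstanceAs (PartialOrder (Subtype _))

/-- The order preserving map `S ↦ f(S)` for a map of necklaces `f`. -/
def map {T U : Nec} (f : T ⟶ U) : NecPoset T ⥤ NecPoset U :=
  Monotone.functor (f := fun S ↦ ⟨f.vert '' S.1,
    f.joints_subset.trans (Set.image_mono S.2.1), by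
      rintro _ ⟨i, hi, rfl⟩
      exact f.vert.map_le (S.2.2 hi)⟩) fun _ _ h ↦ Set.image_mono h

/-- The first component of the isomorphism of posets from the one of `T ∨ U` to the product of those
of `T` and `U`. -/
def fst (T U : Nec) : NecPoset (T ⊗ U) ⥤ NecPoset T :=
  Monotone.functor (f := fun S ↦ ⟨S.1 ∩ Set.Iic T.len,
    fun _ hi ↦ ⟨S.2.1 (mem_joints_append.2 (Or.inl hi)), le_sum_of_mem_joints hi⟩,
    Set.inter_subset_right⟩) fun _ _ h ↦ Set.inter_subset_inter_left _ h

/-- The second component of the isomorphism of posets from the one of `T ∨ U` to the product of those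
of `T` and `U`. -/
def snd (T U : Nec) : NecPoset (T ⊗ U) ⥤ NecPoset U :=
  Monotone.functor (f := fun S ↦ ⟨{j | T.len + j ∈ S.1},
    fun _ hi ↦ S.2.1 (mem_joints_append.2 (Or.inr ⟨_, hi, rfl⟩)), fun j hj ↦ by
      have h := S.2.2 hj
      rw [Set.mem_Iic] at h ⊢
      have h' := Nec.wedge_len T U
      exact Nat.le_of_add_le_add_left (h.trans_eq h')⟩) fun _ _ h _ hj ↦ h hj

/-- The functors `fst` and `snd` do form an isomorphism of posets. -/
def splitIso (T U : Nec) : NecPoset (T ⊗ U) ≃o NecPoset T × NecPoset U where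
  toFun S := ((fst T U).obj S, (snd T U).obj S)
  invFun S := ⟨S.1.1 ∪ (T.len + ·) '' S.2.1, by
    intro i hi
    obtain h | ⟨j, hj, rfl⟩ := mem_joints_append.1 hi
    · exact Or.inl (S.1.2.1 h)
    · exact Or.inr ⟨j, S.2.2.1 hj, rfl⟩, by
    have h' : (T ⊗ U).len = T.len + U.len := Nec.wedge_len T U
    rintro i (h | ⟨j, hj, rfl⟩)
    · have := S.1.2.2 h
      simp only [Set.mem_Iic] at this ⊢; omega
    · have := S.2.2.2 hj
      simp only [Set.mem_Iic] at this ⊢; omega⟩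
  left_inv S := by
    apply Subtype.ext
    ext i
    constructor
    · rintro (h | ⟨j, hj, rfl⟩)
      · exact h.1
      · exact hj
    · intro hi
      by_cases h : i ≤ T.len
      · exact Or.inl ⟨hi, h⟩
      · refine Or.inr ⟨i - T.len, ?_, by dsimp only; omega⟩
        change T.len + (i - T.len) ∈ S.1
        rwa [Nat.add_sub_cancel' (by omega)]
  right_inv S := by
    refine Prod.ext (Subtype.ext ?_) (Subtype.ext ?_)
    · ext i
      constructor
      · rintro ⟨h | ⟨j, hj, rfl⟩, hi⟩
        · exact h
        · simp only [Set.mem_Iic] at hi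
          obtain rfl : j = 0 := by omega
          exact S.1.2.1 (sum_mem_joints T.beads)
      · exact fun hi ↦ ⟨Or.inl hi, S.1.2.2 hi⟩
    · ext j
      constructor
      · rintro (h | ⟨i, hi, h⟩)
        · have := S.1.2.2 h
          simp only [Set.mem_Iic] at this
          obtain rfl : j = 0 := by omega
          exact S.2.2.1 (zero_mem_joints U.beads)
        · obtain rfl : i = j := Nat.add_left_cancel h
          exact hi
      · exact fun hj ↦ Or.inr ⟨j, hj, rfl⟩
  map_rel_iff' {S S'} := by
    constructor
    · intro h i hi
      by_cases hT : i ≤ T.len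
      · exact (h.1 ⟨hi, hT⟩).1
      · have h1 : i - T.len ∈ ((snd T U).obj S).1 := by
          change T.len + (i - T.len) ∈ S.1
          rwa [Nat.add_sub_cancel' (by omega)]
        have h2 : T.len + (i - T.len) ∈ S'.1 := h.2 h1
        rwa [Nat.add_sub_cancel' (by omega)] at h2
    · exact fun h ↦ ⟨(fst T U).monotone h, (snd T U).monotone h⟩

lemma functor_eq {P Q : Type} [PartialOrder P] [PartialOrder Q] {F G : P ⥤ Q}
    (h : ∀ x, F.obj x = G.obj x) : F = G :=
  CategoryTheory.Functor.ext h fun _ _ _ ↦ Subsingleton.elim _ _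

end NecPoset

section Coherent

variable {V : Type v} [Category.{u} V] [MonoidalCategory V] [HasLimits V]

/-- The simplicial object of morphisms. -/
abbrev SmallEnrichedCat.sHom (C : SmallEnrichedCat (SimplicialObject V)) (A B : C.Obj) :
    SimplicialObject V := A ⟶[SimplicialObject V] B

/-- The weight `N(P_T)` of a necklace `T`. -/
abbrev weight (T : Nec) : SSet.{0} := nerve (NecPoset T)

/-- Composition of a simplex of a nerve with a functor. -/
abbrev push {P Q : Type} [PartialOrder P] [PartialOrder Q] (F : P ⥤ Q) {n : SimplexCategoryᵒᵖ}
    (x : (nerve P).obj n) : (nerve Q).obj n := (nerveMap F).app n x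

lemma push_eq {P Q R S : Type} [PartialOrder P] [PartialOrder Q] [PartialOrder R]
    [PartialOrder S] {F : P ⥤ Q} {G : Q ⥤ S} {F' : P ⥤ R} {G' : R ⥤ S}
    (h : ∀ a, G.obj (F.obj a) = G'.obj (F'.obj a)) {n : SimplexCategoryᵒᵖ} (x : (nerve P).obj n) :
    push G (push F x) = push G' (push F' x) := by
  have h' : F ⋙ G = F' ⋙ G' := NecPoset.functor_eq h
  exact congrArg (fun H ↦ push H x) h'

lemma push_eq' {P Q R : Type} [PartialOrder P] [PartialOrder Q] [PartialOrder R]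
    {F : P ⥤ Q} {G : Q ⥤ R} {F' : P ⥤ R} (h : ∀ a, G.obj (F.obj a) = F'.obj a)
    {n : SimplexCategoryᵒᵖ} (x : (nerve P).obj n) : push G (push F x) = push F' x := by
  have h' : F ⋙ G = F' := NecPoset.functor_eq h
  exact congrArg (fun H ↦ push H x) h'

lemma push_id {P : Type} [PartialOrder P] {F : P ⥤ P} (h : ∀ a, F.obj a = a)
    {n : SimplexCategoryᵒᵖ} (x : (nerve P).obj n) : push F x = x := by
  have h' : F = 𝟭 P := NecPoset.functor_eq h
  exact congrArg (fun H ↦ push H x) h'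

lemma push_map {P Q : Type} [PartialOrder P] [PartialOrder Q] (F : P ⥤ Q)
    {n m : SimplexCategoryᵒᵖ} (f : n ⟶ m) (x : (nerve P).obj n) :
    push F ((nerve P).map f x) = (nerve Q).map f (push F x) :=
  NatTrans.naturality_apply (nerveMap F) f x

/-- The functor `𝔫(Y)` of a simplicial object `Y`, with `𝔫(Y)_T = [F(N(P_T)), Y]`. -/
def nObj (Y : SimplicialObject V) : Necᵒᵖ ⥤ V where
  obj T := wlim (weight T.unop) Y
  map f := wmap (nerveMap (NecPoset.map f.unop)) (𝟙 Y)
  map_id T := wlim_ext fun n x ↦ by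
    rw [wmap_π, NatTrans.id_app, Category.comp_id, Category.id_comp]
    exact congrArg (wπ _ Y n) (push_id (fun a ↦ Subtype.ext (Set.image_id _)) x)
  map_comp f g := wlim_ext fun n x ↦ by
    rw [wmap_π, Category.assoc, wmap_π]
    simp only [NatTrans.id_app, Category.comp_id]
    rw [wmap_π, NatTrans.id_app, Category.comp_id]
    exact congrArg (wπ _ Y n)
      (push_eq' (fun a ↦ Subtype.ext (Set.image_image _ _ _)) x).symm

/-- The projections of `𝔫(Y)_T`. -/
def nπ (Y : SimplicialObject V) (T : Nec) (n : SimplexCategoryᵒᵖ) (x : (weight T).obj n) :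
    (nObj Y).obj (op T) ⟶ Y.obj n := wπ _ Y n x

lemma nπ_natural (Y : SimplicialObject V) (T : Nec) {n m : SimplexCategoryᵒᵖ} (f : n ⟶ m)
    (x : (weight T).obj n) : nπ Y T n x ≫ Y.map f = nπ Y T m ((weight T).map f x) :=
  wπ_map f x

lemma nObj_ext {Y : SimplicialObject V} {T : Nec} {A : V} {g h : A ⟶ (nObj Y).obj (op T)}
    (w : ∀ n x, g ≫ nπ Y T n x = h ≫ nπ Y T n x) : g = h :=
  wlim_ext w

lemma nObj_map_π (Y : SimplicialObject V) {T U : Nec} (f : T ⟶ U) (n : SimplexCategoryᵒᵖ)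
    (x : (weight T).obj n) :
    (nObj Y).map f.op ≫ nπ Y T n x = nπ Y U n (push (NecPoset.map f) x) :=
  (wmap_π _ _ _ _).trans (Category.comp_id _)

/-- The functor `𝔫` on morphisms, at a necklace. -/
def nMapApp {Y Z : SimplicialObject V} (y : Y ⟶ Z) (T : Nec) :
    (nObj Y).obj (op T) ⟶ (nObj Z).obj (op T) :=
  wmap (𝟙 _) y

lemma nMapApp_π {Y Z : SimplicialObject V} (y : Y ⟶ Z) (T : Nec) (n : SimplexCategoryᵒᵖ)
    (x : (weight T).obj n) : nMapApp y T ≫ nπ Z T n x = nπ Y T n x ≫ y.app n :=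
  wmap_π _ _ _ _

/-- The functor `𝔫` on morphisms. -/
def nMap {Y Z : SimplicialObject V} (y : Y ⟶ Z) : nObj Y ⟶ nObj Z where
  app T := nMapApp y T.unop
  naturality T U f := by
    obtain ⟨T⟩ := T
    obtain ⟨U⟩ := U
    obtain ⟨f⟩ := f
    refine nObj_ext fun n x ↦ ?_
    have h₁ := nObj_map_π Y f n x
    have h₂ := nObj_map_π Z f n x
    have h₃ := nMapApp_π y T n (push (NecPoset.map f) x)
    rw [Category.assoc, Category.assoc]
    exact (congrArg (_ ≫ ·) (nMapApp_π y U n x)).trans ((Category.assoc _ _ _).symm.trans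
      ((congrArg (· ≫ _) h₁).trans (h₃.symm.trans (congrArg (_ ≫ ·) h₂.symm))))

lemma nMap_π {Y Z : SimplicialObject V} (y : Y ⟶ Z) (T : Nec) (n : SimplexCategoryᵒᵖ)
    (x : (weight T).obj n) : (nMap y).app (op T) ≫ nπ Z T n x = nπ Y T n x ≫ y.app n :=
  nMapApp_π y T n x

variable (C : SmallEnrichedCat (SimplicialObject V))

/-- The identities of `C` at simplicial level `n`. -/
def idAt (A : C.Obj) (n : SimplexCategoryᵒᵖ) : 𝟙_ V ⟶ (C.sHom A A).obj n :=
  (eId (SimplicialObject V) A).app n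

/-- The composition of `C` at simplicial level `n`. -/
def compAt (A B D : C.Obj) (n : SimplexCategoryᵒᵖ) :
    (C.sHom A B).obj n ⊗ (C.sHom B D).obj n ⟶ (C.sHom A D).obj n :=
  (eComp (SimplicialObject V) A B D).app n

lemma idAt_natural (A : C.Obj) {n m : SimplexCategoryᵒᵖ} (f : n ⟶ m) :
    idAt C A n ≫ (C.sHom A A).map f = idAt C A m :=
  ((eId (SimplicialObject V) A).naturality f).symm.trans (Category.id_comp _)

lemma compAt_natural (A B D : C.Obj) {n m : SimplexCategoryᵒᵖ} (f : n ⟶ m) :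
    compAt C A B D n ≫ (C.sHom A D).map f =
      ((C.sHom A B).map f ⊗ₘ (C.sHom B D).map f) ≫ compAt C A B D m :=
  ((eComp (SimplicialObject V) A B D).naturality f).symm

lemma id_compAt (A B : C.Obj) (n : SimplexCategoryᵒᵖ) :
    idAt C A n ▷ _ ≫ compAt C A A B n = (λ_ _).hom := by
  have h := NatTrans.congr_app (e_id_comp (SimplicialObject V) A B) n
  rw [← cancel_epi (λ_ _).inv, Iso.inv_hom_id]
  exact h

lemma compAt_id (A B : C.Obj) (n : SimplexCategoryᵒᵖ) :
    _ ◁ idAt C B n ≫ compAt C A B B n = (ρ_ _).hom := by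
  have h := NatTrans.congr_app (e_comp_id (SimplicialObject V) A B) n
  rw [← cancel_epi (ρ_ _).inv, Iso.inv_hom_id]
  exact h

lemma compAt_assoc (A B D E : C.Obj) (n : SimplexCategoryᵒᵖ) :
    compAt C A B D n ▷ _ ≫ compAt C A D E n =
      (α_ _ _ _).hom ≫ _ ◁ compAt C B D E n ≫ compAt C A B E n := by
  have h := NatTrans.congr_app (e_assoc (SimplicialObject V) A B D E) n
  rw [← cancel_epi (α_ _ _ _).inv, Iso.inv_hom_id_assoc]
  exact h

/-- The identities of `𝔫(C)`. -/
def nId (A : C.Obj) : 𝟙_ V ⟶ (nObj (C.sHom A A)).obj (op (𝟙_ Nec)) :=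
  wlift (fun n _ ↦ idAt C A n) fun _ _ f _ ↦ idAt_natural C A f

lemma nId_π (A : C.Obj) (n : SimplexCategoryᵒᵖ) (x : (weight (𝟙_ Nec)).obj n) :
    nId C A ≫ nπ _ _ n x = idAt C A n :=
  wlift_π _ _ _ _

/-- The composition of `𝔫(C)`, induced by the composition of `C` and the isomorphism from
`P_{T ∨ U}` to the product of `P_T` and `P_U`. -/
def nComp (A B D : C.Obj) (T U : Nec) :
    (nObj (C.sHom A B)).obj (op T) ⊗ (nObj (C.sHom B D)).obj (op U) ⟶
      (nObj (C.sHom A D)).obj (op (T ⊗ U)) :=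
  wlift (fun n x ↦ (nπ _ T n (push (NecPoset.fst T U) x) ⊗ₘ
      nπ _ U n (push (NecPoset.snd T U) x)) ≫ compAt C A B D n) fun n m f x ↦ by
    rw [Category.assoc, compAt_natural, tensorHom_comp_tensorHom_assoc, nπ_natural, nπ_natural]
    exact congrArg₂ (fun p q ↦ (nπ _ T m p ⊗ₘ nπ _ U m q) ≫ compAt C A B D m)
      (push_map _ f x).symm (push_map _ f x).symm

lemma nComp_π (A B D : C.Obj) (T U : Nec)
    (n : SimplexCategoryᵒᵖ) (x : (weight (T ⊗ U)).obj n) :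
    nComp C A B D T U ≫ nπ _ _ n x = (nπ _ T n (push (NecPoset.fst T U) x) ⊗ₘ
      nπ _ U n (push (NecPoset.snd T U) x)) ≫ compAt C A B D n :=
  wlift_π _ _ _ _

namespace NecPoset

lemma fst_map {T T' U U' : Nec} (f : T ⟶ T') (g : U ⟶ U') (S : NecPoset (T ⊗ U)) :
    (fst T' U').obj ((map (f ⊗ₘ g)).obj S) = (map f).obj ((fst T U).obj S) := by
  refine Subtype.ext (Set.ext fun i ↦ ⟨?_, ?_⟩)
  · rintro ⟨⟨k, hk, rfl⟩, hi⟩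
    change (if k ≤ T.len then f.vert k else T'.len + g.vert (k - T.len)) ≤ T'.len at hi
    change (if k ≤ T.len then f.vert k else T'.len + g.vert (k - T.len)) ∈ f.vert '' _
    split_ifs at hi ⊢ with h
    · exact ⟨k, ⟨hk, h⟩, rfl⟩
    · rw [show g.vert (k - T.len) = 0 by omega]
      exact ⟨T.len, ⟨S.2.1 (mem_joints_append.2 (Or.inl (sum_mem_joints T.beads))), Set.mem_Iic.2 le_rfl⟩,
        f.vert.map_last⟩
  · rintro ⟨k, ⟨hk, h⟩, rfl⟩
    exact ⟨⟨k, hk, if_pos h⟩, f.vert.map_le h⟩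

lemma snd_map {T T' U U' : Nec} (f : T ⟶ T') (g : U ⟶ U') (S : NecPoset (T ⊗ U)) :
    (snd T' U').obj ((map (f ⊗ₘ g)).obj S) = (map g).obj ((snd T U).obj S) := by
  refine Subtype.ext (Set.ext fun i ↦ ⟨?_, ?_⟩)
  · rintro ⟨k, hk, hi⟩
    change (if k ≤ T.len then f.vert k else T'.len + g.vert (k - T.len)) = T'.len + i at hi
    split_ifs at hi with h
    · have h' : f.vert k ≤ T'.len := f.vert.map_le h
      obtain rfl : i = 0 := by omega
      exact ⟨0, S.2.1 (mem_joints_append.2 (Or.inl (sum_mem_joints T.beads))), g.vert.map_zero⟩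
    · refine ⟨k - T.len, ?_, Nat.add_left_cancel hi⟩
      change T.len + (k - T.len) ∈ S.1
      rwa [Nat.add_sub_cancel' (by omega)]
  · rintro ⟨k, hk, rfl⟩
    refine ⟨T.len + k, hk, ?_⟩
    change (if T.len + k ≤ T.len then f.vert (T.len + k) else
      T'.len + g.vert (T.len + k - T.len)) = T'.len + g.vert k
    rw [Nat.add_sub_cancel_left]
    split_ifs with h
    · obtain rfl : k = 0 := by omega
      rw [g.vert.map_zero]
      exact f.vert.map_last
    · rfl

lemma snd_unit (T : Nec) (S : NecPoset (𝟙_ Nec ⊗ T)) :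
    (snd (𝟙_ Nec) T).obj S = (map (λ_ T).hom).obj S := by
  refine Subtype.ext (Set.ext fun i ↦ ⟨?_, ?_⟩)
  · intro hi
    exact ⟨0 + i, hi, Nat.zero_add i⟩
  · rintro ⟨k, hk, rfl⟩
    change 0 + k ∈ S.1
    rwa [Nat.zero_add]

lemma fst_unit (T : Nec) (S : NecPoset (T ⊗ 𝟙_ Nec)) :
    (fst T (𝟙_ Nec)).obj S = (map (ρ_ T).hom).obj S := by
  refine Subtype.ext (Set.ext fun i ↦ ⟨?_, ?_⟩)
  · exact fun hi ↦ ⟨i, hi.1, rfl⟩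
  · rintro ⟨k, hk, rfl⟩
    have h : k ≤ (T ⊗ 𝟙_ Nec).len := S.2.2 hk
    exact ⟨hk, h.trans_eq ((Nec.wedge_len T (𝟙_ Nec)).trans (Nat.add_zero _))⟩

lemma fst_fst (T U R : Nec) (S : NecPoset ((T ⊗ U) ⊗ R)) :
    (fst T U).obj ((fst (T ⊗ U) R).obj S) = (fst T (U ⊗ R)).obj ((map (α_ T U R).hom).obj S) := by
  refine Subtype.ext (Set.ext fun i ↦ ⟨?_, ?_⟩)
  · exact fun hi ↦ ⟨⟨i, hi.1.1, rfl⟩, hi.2⟩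
  · rintro ⟨⟨k, hk, rfl⟩, hi⟩
    have h := Nec.wedge_len T U
    exact ⟨⟨hk, (show k ≤ T.len from hi).trans ((Nat.le_add_right _ _).trans_eq h.symm)⟩, hi⟩

lemma snd_fst (T U R : Nec) (S : NecPoset ((T ⊗ U) ⊗ R)) :
    (snd T U).obj ((fst (T ⊗ U) R).obj S) =
      (fst U R).obj ((snd T (U ⊗ R)).obj ((map (α_ T U R).hom).obj S)) := by
  have h : (T ⊗ U).len = T.len + U.len := Nec.wedge_len T U
  refine Subtype.ext (Set.ext fun i ↦ ⟨?_, ?_⟩)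
  · rintro ⟨hi, hi'⟩
    refine ⟨⟨T.len + i, hi, rfl⟩, ?_⟩
    rw [Set.mem_Iic] at hi' ⊢
    omega
  · rintro ⟨⟨k, hk, hki⟩, hi⟩
    obtain rfl : k = T.len + i := hki
    refine ⟨hk, ?_⟩
    rw [Set.mem_Iic] at hi ⊢
    omega

lemma snd_snd (T U R : Nec) (S : NecPoset ((T ⊗ U) ⊗ R)) :
    (snd (T ⊗ U) R).obj S =
      (snd U R).obj ((snd T (U ⊗ R)).obj ((map (α_ T U R).hom).obj S)) := by
  have h : (T ⊗ U).len = T.len + U.len := Nec.wedge_len T U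
  refine Subtype.ext (Set.ext fun i ↦ ⟨?_, ?_⟩)
  · intro hi
    refine ⟨(T ⊗ U).len + i, hi, ?_⟩
    change (T ⊗ U).len + i = T.len + (U.len + i)
    omega
  · rintro ⟨k, hk, hki⟩
    obtain rfl : k = T.len + (U.len + i) := hki
    change (T ⊗ U).len + i ∈ S.1
    rwa [h, Nat.add_assoc]

end NecPoset

/-- The necklace category `𝔫(C)` of a simplicially enriched category. -/
def nCat : NecCat V where
  Obj := C.Obj
  hom A B := nObj (C.sHom A B)
  id := nId C
  comp := nComp C
  comp_natural A B D T T' U U' f g := nObj_ext fun n x ↦ by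
    rw [Category.assoc, Category.assoc, nComp_π, nObj_map_π, nComp_π,
      tensorHom_comp_tensorHom_assoc, nObj_map_π, nObj_map_π,
      push_eq (NecPoset.fst_map f g), push_eq (NecPoset.snd_map f g)]
  id_comp A B T := nObj_ext fun n x ↦ by
    rw [Category.assoc, Category.assoc, nComp_π, nObj_map_π]
    have h : nId C A ▷ _ ≫ (nπ _ (𝟙_ Nec) n (push (NecPoset.fst (𝟙_ Nec) T) x) ⊗ₘ
        nπ _ T n (push (NecPoset.snd (𝟙_ Nec) T) x)) =
      𝟙_ V ◁ nπ _ T n (push (NecPoset.snd (𝟙_ Nec) T) x) ≫ idAt C A n ▷ (C.sHom A B).obj n := by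
      rw [← tensorHom_id, tensorHom_comp_tensorHom, nId_π, Category.id_comp,
        MonoidalCategory.tensorHom_def']
    rw [reassoc_of% h, id_compAt, leftUnitor_naturality]
    exact congrArg (fun p ↦ (λ_ _).hom ≫ nπ _ T n p)
      (congrArg (fun F ↦ push F x) (NecPoset.functor_eq (NecPoset.snd_unit T)))
  comp_id A B T := nObj_ext fun n x ↦ by
    rw [Category.assoc, Category.assoc, nComp_π, nObj_map_π]
    have h : _ ◁ nId C B ≫ (nπ _ T n (push (NecPoset.fst T (𝟙_ Nec)) x) ⊗ₘ
        nπ _ (𝟙_ Nec) n (push (NecPoset.snd T (𝟙_ Nec)) x)) =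
      nπ _ T n (push (NecPoset.fst T (𝟙_ Nec)) x) ▷ 𝟙_ V ≫ (C.sHom A B).obj n ◁ idAt C B n := by
      rw [← id_tensorHom, tensorHom_comp_tensorHom, nId_π, Category.id_comp,
        MonoidalCategory.tensorHom_def]
    rw [reassoc_of% h, compAt_id, rightUnitor_naturality]
    exact congrArg (fun p ↦ (ρ_ _).hom ≫ nπ _ T n p)
      (congrArg (fun F ↦ push F x) (NecPoset.functor_eq (NecPoset.fst_unit T)))
  assoc A B D E T U S := nObj_ext fun n x ↦ by
    simp only [Category.assoc]
    rw [nComp_π, nObj_map_π, nComp_π]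
    have h₁ : nComp C A B D T U ▷ _ ≫ (nπ _ (T ⊗ U) n (push (NecPoset.fst (T ⊗ U) S) x) ⊗ₘ
        nπ _ S n (push (NecPoset.snd (T ⊗ U) S) x)) =
      ((nπ _ T n (push (NecPoset.fst T U) (push (NecPoset.fst (T ⊗ U) S) x)) ⊗ₘ
        nπ _ U n (push (NecPoset.snd T U) (push (NecPoset.fst (T ⊗ U) S) x))) ⊗ₘ
          nπ (C.sHom D E) S n (push (NecPoset.snd (T ⊗ U) S) x)) ≫ compAt C A B D n ▷ _ := by
      rw [← tensorHom_id, ← tensorHom_id, tensorHom_comp_tensorHom, tensorHom_comp_tensorHom,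
        nComp_π, Category.id_comp, Category.comp_id]
    have h₂ : ∀ y : (weight (T ⊗ (U ⊗ S))).obj n, _ ◁ nComp C B D E U S ≫
        (nπ (C.sHom A B) T n (push (NecPoset.fst T (U ⊗ S)) y) ⊗ₘ
          nπ _ (U ⊗ S) n (push (NecPoset.snd T (U ⊗ S)) y)) =
      (nπ _ T n (push (NecPoset.fst T (U ⊗ S)) y) ⊗ₘ
        (nπ _ U n (push (NecPoset.fst U S) (push (NecPoset.snd T (U ⊗ S)) y)) ⊗ₘ
          nπ _ S n (push (NecPoset.snd U S) (push (NecPoset.snd T (U ⊗ S)) y)))) ≫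
            _ ◁ compAt C B D E n := by
      intro y
      rw [← id_tensorHom, ← id_tensorHom, tensorHom_comp_tensorHom, tensorHom_comp_tensorHom,
        nComp_π, Category.id_comp, Category.comp_id]
    rw [reassoc_of% h₁, reassoc_of% h₂, compAt_assoc, associator_naturality_assoc]
    have e₁ := push_eq (NecPoset.fst_fst T U S) x
    have e₂ : push (NecPoset.snd T U) (push (NecPoset.fst (T ⊗ U) S) x) =
      push (NecPoset.fst U S) (push (NecPoset.snd T (U ⊗ S))
        (push (NecPoset.map (α_ T U S).hom) x)) :=
      push_eq (F' := NecPoset.map (α_ T U S).hom ⋙ NecPoset.snd T (U ⊗ S))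
        (NecPoset.snd_fst T U S) x
    have e₃ : push (NecPoset.snd (T ⊗ U) S) x =
      push (NecPoset.snd U S) (push (NecPoset.snd T (U ⊗ S))
        (push (NecPoset.map (α_ T U S).hom) x)) :=
      (push_eq' (F := NecPoset.map (α_ T U S).hom ⋙ NecPoset.snd T (U ⊗ S))
        (fun a ↦ (NecPoset.snd_snd T U S a).symm) x).symm
    rw [e₁, e₂, e₃]

lemma nId_natural {D : SmallEnrichedCat (SimplicialObject V)}
    (F : EnrichedFunctor (SimplicialObject V) C.Obj D.Obj) (A : C.Obj) :
    nId C A ≫ (nMap (F.map A A)).app (op (𝟙_ Nec)) = nId D (F.obj A) := nObj_ext fun n x ↦ by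
  have h : idAt C A n ≫ (F.map A A).app n = idAt D (F.obj A) n :=
    NatTrans.congr_app (F.map_id A) n
  rw [Category.assoc, nMap_π, reassoc_of% nId_π, nId_π, h]

lemma nComp_natural {D : SmallEnrichedCat (SimplicialObject V)}
    (F : EnrichedFunctor (SimplicialObject V) C.Obj D.Obj) (A B E : C.Obj) (T U : Nec) :
    nComp C A B E T U ≫ (nMap (F.map A E)).app (op (T ⊗ U)) =
      ((nMap (F.map A B)).app (op T) ⊗ₘ (nMap (F.map B E)).app (op U)) ≫
        nComp D (F.obj A) (F.obj B) (F.obj E) T U := nObj_ext fun n x ↦ by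
  have h : compAt C A B E n ≫ (F.map A E).app n =
    ((F.map A B).app n ⊗ₘ (F.map B E).app n) ≫ compAt D _ _ _ n :=
    NatTrans.congr_app (F.map_comp A B E) n
  rw [Category.assoc, Category.assoc, nMap_π, reassoc_of% nComp_π, nComp_π, h,
    tensorHom_comp_tensorHom_assoc, tensorHom_comp_tensorHom_assoc, nMap_π, nMap_π]

/-- The functor `𝔫`. -/
def nFunctor : SmallEnrichedCat (SimplicialObject V) ⥤ NecCat V where
  obj := nCat
  map {C D} F :=
    { obj := F.obj
      app A B := nMap (F.map A B)
      map_id := nId_natural C F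
      map_comp := nComp_natural C F }
  map_id C := NecCat.Hom.ext' fun A B T ↦ nObj_ext fun n x ↦
    (nMap_π _ T.unop n x).trans ((Category.comp_id _).trans (Category.id_comp _).symm)
  map_comp F G := NecCat.Hom.ext' fun A B T ↦ nObj_ext fun n x ↦ by
    have h₁ := nMap_π (F.map A B) T.unop n x
    have h₂ := nMap_π (G.map (F.obj A) (F.obj B)) T.unop n x
    refine (nMap_π (F.map A B ≫ G.map (F.obj A) (F.obj B)) T.unop n x).trans ?_
    refine Eq.trans ?_ ((congrArg (_ ≫ ·) h₂).symm.trans (Category.assoc _ _ _).symm)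
    exact (Category.assoc _ _ _).symm.trans ((congrArg (· ≫ _) h₁.symm).trans (Category.assoc _ _ _))

end Coherent

/-! ## The templicial object of a simplicial set -/

section Simp

/-- The morphism `[m] ⟶ [n]` of the simplex category induced by an order preserving `φ : ℕ → ℕ`. -/
def simplexHom {m n : ℕ} (φ : ℕ → ℕ) (hφ : Monotone φ) (h : φ m ≤ n) :
    SimplexCategory.mk m ⟶ SimplexCategory.mk n :=
  SimplexCategory.Hom.mk ⟨fun i ↦ ⟨φ i, Nat.lt_succ_of_le ((hφ (Nat.le_of_lt_succ i.2)).trans h)⟩,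
    fun _ _ hij ↦ hφ hij⟩

variable (K : SSet.{u})

/-- The set of `n`-simplices. -/
abbrev simp (n : ℕ) : Type u := K.obj (op (SimplexCategory.mk n))

variable {K}

/-- The restriction of a simplex along an order preserving map. -/
def restr {m n : ℕ} (φ : ℕ → ℕ) (hφ : Monotone φ) (h : φ m ≤ n) (x : simp K n) : simp K m :=
  K.map (simplexHom φ hφ h).op x

lemma restr_restr {m n p : ℕ} {φ ψ : ℕ → ℕ} (hφ : Monotone φ) (hψ : Monotone ψ) (h : φ m ≤ n)
    (h' : ψ n ≤ p) (x : simp K p) : restr φ hφ h (restr ψ hψ h' x) =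
      restr (fun i ↦ ψ (φ i)) (hψ.comp hφ) ((hψ h).trans h') x :=
  (CategoryTheory.Functor.map_comp_apply K (simplexHom ψ hψ h').op (simplexHom φ hφ h).op x).symm

lemma restr_congr {m n : ℕ} {φ ψ : ℕ → ℕ} (hφ : Monotone φ) (hψ : Monotone ψ) (h : φ m ≤ n)
    (h' : ψ m ≤ n) (x : simp K n) (e : ∀ i ≤ m, φ i = ψ i) : restr φ hφ h x = restr ψ hψ h' x := by
  have : simplexHom φ hφ h = simplexHom ψ hψ h' := by
    ext i
    exact e i (Nat.le_of_lt_succ i.2)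
  rw [restr, restr, this]

lemma restr_id {n : ℕ} {φ : ℕ → ℕ} (hφ : Monotone φ) (h : φ n ≤ n) (x : simp K n)
    (e : ∀ i ≤ n, φ i = i) : restr φ hφ h x = x := by
  have : simplexHom φ hφ h = 𝟙 _ := by
    ext i
    exact e i (Nat.le_of_lt_succ i.2)
  rw [restr, this]
  exact CategoryTheory.Functor.map_id_apply K _ x

lemma restr_restr_eq {m n p : ℕ} {φ ψ χ : ℕ → ℕ} (hφ : Monotone φ) (hψ : Monotone ψ)
    (hχ : Monotone χ) (h : φ m ≤ n) (h' : ψ n ≤ p) (h'' : χ m ≤ p) (x : simp K p)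
    (e : ∀ i ≤ m, ψ (φ i) = χ i) : restr φ hφ h (restr ψ hψ h' x) = restr χ hχ h'' x :=
  (restr_restr hφ hψ h h' x).trans (restr_congr _ _ _ _ _ e)

lemma restr_restr_congr {m n n' p : ℕ} {φ ψ φ' ψ' : ℕ → ℕ} (hφ : Monotone φ) (hψ : Monotone ψ)
    (hφ' : Monotone φ') (hψ' : Monotone ψ') (h₁ : φ m ≤ n) (h₂ : ψ n ≤ p) (h₃ : φ' m ≤ n')
    (h₄ : ψ' n' ≤ p) (x : simp K p) (e : ∀ i ≤ m, ψ (φ i) = ψ' (φ' i)) :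
    restr φ hφ h₁ (restr ψ hψ h₂ x) = restr φ' hφ' h₃ (restr ψ' hψ' h₄ x) :=
  (restr_restr_eq hφ hψ (hψ'.comp hφ') h₁ h₂ ((hψ' h₃).trans h₄) x e).trans
    (restr_restr hφ' hψ' h₃ h₄ x).symm

lemma restr_natural {L : SSet.{u}} (k : K ⟶ L) {m n : ℕ} (φ : ℕ → ℕ) (hφ : Monotone φ)
    (h : φ m ≤ n) (x : simp K n) : k.app _ (restr φ hφ h x) = restr φ hφ h (k.app _ x) :=
  NatTrans.naturality_apply k _ x

/-- The vertices of a simplex. -/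
def vertex {n : ℕ} (x : simp K n) (i : ℕ) (hi : i ≤ n) : simp K 0 :=
  restr (fun _ ↦ i) monotone_const hi x

lemma vertex_restr {m n : ℕ} {φ : ℕ → ℕ} (hφ : Monotone φ) (h : φ m ≤ n) (x : simp K n) (i : ℕ)
    (hi : i ≤ m) : vertex (restr φ hφ h x) i hi = vertex x (φ i) ((hφ hi).trans h) :=
  restr_restr _ _ _ _ _

lemma vertex_natural {L : SSet.{u}} (k : K ⟶ L) {n : ℕ} (x : simp K n) (i : ℕ) (hi : i ≤ n) :
    k.app _ (vertex x i hi) = vertex (k.app _ x) i hi :=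
  restr_natural k _ _ _ _

/-- The set `K_n(a, b)` of `n`-simplices with first vertex `a` and last vertex `b`. -/
@[ext]
structure Simp (K : SSet.{u}) (n : ℕ) (a b : simp K 0) : Type u where
  /-- the simplex -/
  val : simp K n
  first : vertex val 0 (Nat.zero_le n) = a
  last : vertex val n le_rfl = b

namespace Simp

/-- Restriction along a morphism of finite intervals. -/
def map {m n : ℕ} (f : FInt.Hom m n) {a b : simp K 0} (x : Simp K n a b) : Simp K m a b where
  val := restr f f.mono f.map_last.le x.val
  first := (vertex_restr _ _ _ _ _).trans ((restr_congr _ _ _ _ _ fun _ _ ↦ f.map_zero).trans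
    x.first)
  last := (vertex_restr _ _ _ _ _).trans ((restr_congr _ _ _ _ _ fun _ _ ↦ f.map_last).trans
    x.last)

/-- The vertex `m` of an `(m + n)`-simplex. -/
def middle (m n : ℕ) {a b : simp K 0} (x : Simp K (m + n) a b) : simp K 0 :=
  vertex x.val m (Nat.le_add_right m n)

/-- The initial part of a simplex. -/
def left (m n : ℕ) {a b : simp K 0} (x : Simp K (m + n) a b) : Simp K m a (x.middle m n) where
  val := restr (fun i ↦ i) monotone_id (Nat.le_add_right m n) x.val
  first := (vertex_restr _ _ _ _ _).trans x.first
  last := vertex_restr _ _ _ _ _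

/-- The final part of a simplex. -/
def right (m n : ℕ) {a b : simp K 0} (x : Simp K (m + n) a b) : Simp K n (x.middle m n) b where
  val := restr (fun i ↦ m + i) (fun _ _ h ↦ Nat.add_le_add_left h m) le_rfl x.val
  first := (vertex_restr _ _ _ _ _)
  last := (vertex_restr _ _ _ _ _).trans x.last

/-- The image of a simplex under a map of simplicial sets. -/
def image {L : SSet.{u}} (k : K ⟶ L) {n : ℕ} {a b : simp K 0} (x : Simp K n a b) :
    Simp L n (k.app _ a) (k.app _ b) where
  val := k.app _ x.val
  first := (vertex_natural k _ _ _).symm.trans (congrArg _ x.first)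
  last := (vertex_natural k _ _ _).symm.trans (congrArg _ x.last)

lemma map_val {m n : ℕ} (f : FInt.Hom m n) {a b : simp K 0} (x : Simp K n a b) :
    (x.map f).val = restr f f.mono f.map_last.le x.val := rfl

lemma left_val (m n : ℕ) {a b : simp K 0} (x : Simp K (m + n) a b) :
    (x.left m n).val = restr (fun i ↦ i) monotone_id (Nat.le_add_right m n) x.val := rfl

lemma right_val (m n : ℕ) {a b : simp K 0} (x : Simp K (m + n) a b) :
    (x.right m n).val =
      restr (fun i ↦ m + i) (fun _ _ h ↦ Nat.add_le_add_left h m) le_rfl x.val := rfl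

lemma image_val {L : SSet.{u}} (k : K ⟶ L) {n : ℕ} {a b : simp K 0} (x : Simp K n a b) :
    (x.image k).val = k.app _ x.val := rfl

/-- A vertex as a `0`-simplex. -/
def point (a : simp K 0) : Simp K 0 a a where
  val := a
  first := restr_id _ _ _ fun _ hi ↦ (Nat.le_zero.1 hi).symm
  last := restr_id _ _ _ fun _ hi ↦ (Nat.le_zero.1 hi).symm

lemma eq_of_zero {a b : simp K 0} (x : Simp K 0 a b) : a = b := x.first.symm.trans x.last

end Simp

end Simp

namespace Quiv

variable {V : Type v} [Category.{u} V] [MonoidalCategory V] [HasColimits V]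

/-- The quiver `F(Q)` freely generated by sets `Q(a, b)`, with `F(Q)(a, b) = ∐_{Q(a, b)} I`. -/
def free (V : Type v) [Category.{u} V] [MonoidalCategory V] [HasColimits V] {S : Type u}
    (Q : S → S → Type u) : Quiv V S :=
  ⟨fun a b ↦ ∐ fun _ : Q a b ↦ 𝟙_ V⟩

variable {S : Type u} {Q Q' : S → S → Type u}

/-- The generators of the free quiver. -/
def gen {a b : S} (x : Q a b) : 𝟙_ V ⟶ (free V Q).hom a b := Sigma.ι (fun _ : Q a b ↦ 𝟙_ V) x

/-- Morphisms out of a free quiver at `(a, b)`. -/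
def freeDesc {a b : S} {Y : V} (g : Q a b → (𝟙_ V ⟶ Y)) : (free V Q).hom a b ⟶ Y := Sigma.desc g

@[simp] lemma gen_desc {a b : S} {Y : V} (g : Q a b → (𝟙_ V ⟶ Y)) (x : Q a b) :
    gen x ≫ freeDesc g = g x := Sigma.ι_desc _ _

lemma free_ext {P : Quiv V S} {f g : free V Q ⟶ P}
    (h : ∀ a b (x : Q a b), gen x ≫ f.app a b = gen x ≫ g.app a b) : f = g := by
  ext a b
  exact Sigma.hom_ext _ _ (h a b)

variable [SymmetricCategory V] [MonoidalClosed V] {P P' R R' : Quiv V S}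

/-- The product of two elements in a tensor product of quivers. -/
def mul {a c b : S} (p : 𝟙_ V ⟶ P.hom a c) (q : 𝟙_ V ⟶ R.hom c b) : 𝟙_ V ⟶ (P ⊗ R).hom a b :=
  (λ_ _).inv ≫ (p ⊗ₘ q) ≫ ι P R a c b

lemma mul_tensorHom {a c b : S} (p : 𝟙_ V ⟶ P.hom a c) (q : 𝟙_ V ⟶ R.hom c b) (f : P ⟶ P')
    (g : R ⟶ R') : mul p q ≫ (f ⊗ₘ g).app a b = mul (p ≫ f.app _ _) (q ≫ g.app _ _) := by
  simp only [mul, Category.assoc, ι_tensorHom, tensorHom_comp_tensorHom_assoc]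

lemma mul_whiskerLeft {a c b : S} (p : 𝟙_ V ⟶ P.hom a c) (q : 𝟙_ V ⟶ R.hom c b)
    (g : R ⟶ R') : mul p q ≫ (P ◁ g).app a b = mul p (q ≫ g.app _ _) := by
  rw [← id_tensorHom, mul_tensorHom, id_app, Category.comp_id]

lemma mul_whiskerRight {a c b : S} (p : 𝟙_ V ⟶ P.hom a c) (q : 𝟙_ V ⟶ R.hom c b) (f : P ⟶ P') :
    mul p q ≫ (f ▷ R).app a b = mul (p ≫ f.app _ _) q := by
  rw [← tensorHom_id, mul_tensorHom, id_app, Category.comp_id]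

lemma mul_assoc {T : Quiv V S} {a c d b : S} (p : 𝟙_ V ⟶ P.hom a c) (q : 𝟙_ V ⟶ R.hom c d)
    (r : 𝟙_ V ⟶ T.hom d b) :
    mul (mul p q) r ≫ (α_ P R T).hom.app a b = mul p (mul q r) := by
  have h₁ : (mul p q ⊗ₘ r) = (λ_ _).inv ▷ _ ≫ ((p ⊗ₘ q) ⊗ₘ r) ≫ ι P R a c d ▷ _ := by
    rw [← tensorHom_id, ← tensorHom_id, tensorHom_comp_tensorHom, tensorHom_comp_tensorHom,
      Category.id_comp, Category.comp_id]
    rfl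
  have h₂ : (p ⊗ₘ mul q r) = _ ◁ (λ_ _).inv ≫ (p ⊗ₘ (q ⊗ₘ r)) ≫ _ ◁ ι R T c d b := by
    rw [← id_tensorHom, ← id_tensorHom, tensorHom_comp_tensorHom, tensorHom_comp_tensorHom,
      Category.id_comp, Category.comp_id]
    rfl
  have h₃ : mul (mul p q) r ≫ (α_ P R T).hom.app a b =
      (λ_ _).inv ≫ (mul p q ⊗ₘ r) ≫ ι (P ⊗ R) T a d b ≫ (α_ P R T).hom.app a b := by
    simp only [mul, Category.assoc]
  have h₄ : mul p (mul q r) = (λ_ _).inv ≫ (p ⊗ₘ mul q r) ≫ ι P (R ⊗ T) a c b := rfl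
  rw [h₃, h₄, h₁, h₂]
  simp only [Category.assoc]
  rw [ι_associator_hom, associator_naturality_assoc]
  simp [unitors_inv_equal]

lemma mul_leftUnitor {a b : S} (p : 𝟙_ V ⟶ P.hom a b) :
    mul (unitι rfl) p ≫ (λ_ P).hom.app a b = p := by
  have h : (unitι (rfl : a = a) ⊗ₘ p) = 𝟙_ V ◁ p ≫ unitι rfl ▷ _ := by
    rw [MonoidalCategory.tensorHom_def']
  rw [mul, Category.assoc, Category.assoc, h, Category.assoc]
  erw [ι_leftUnitor_hom]
  simp

lemma mul_rightUnitor {a b : S} (p : 𝟙_ V ⟶ P.hom a b) :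
    mul p (unitι rfl) ≫ (ρ_ P).hom.app a b = p := by
  have h : (p ⊗ₘ unitι (rfl : b = b)) = p ▷ 𝟙_ V ≫ _ ◁ unitι rfl := by
    rw [MonoidalCategory.tensorHom_def]
  rw [mul, Category.assoc, Category.assoc, h, Category.assoc]
  erw [ι_rightUnitor_hom]
  simp [unitors_inv_equal]

lemma leftUnitor_inv_mul {a b : S} (p : 𝟙_ V ⟶ P.hom a b) :
    p ≫ (λ_ P).inv.app a b = mul (unitι rfl) p := by
  have h : (λ_ P).hom.app a b ≫ (λ_ P).inv.app a b = 𝟙 _ :=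
    congrArg (fun k ↦ Quiv.Hom.app k a b) (λ_ P).hom_inv_id
  have h' := congrArg (· ≫ (λ_ P).inv.app a b) (mul_leftUnitor p)
  exact h'.symm.trans ((Category.assoc _ _ _).trans ((congrArg (_ ≫ ·) h).trans
    (Category.comp_id _)))

lemma rightUnitor_inv_mul {a b : S} (p : 𝟙_ V ⟶ P.hom a b) :
    p ≫ (ρ_ P).inv.app a b = mul p (unitι rfl) := by
  have h : (ρ_ P).hom.app a b ≫ (ρ_ P).inv.app a b = 𝟙 _ :=
    congrArg (fun k ↦ Quiv.Hom.app k a b) (ρ_ P).hom_inv_id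
  have h' := congrArg (· ≫ (ρ_ P).inv.app a b) (mul_rightUnitor p)
  exact h'.symm.trans ((Category.assoc _ _ _).trans ((congrArg (_ ≫ ·) h).trans
    (Category.comp_id _)))

lemma chain₂ {A B C D : V} {x : A ⟶ B} {f : B ⟶ C} {g : C ⟶ D} {y z} (h₁ : x ≫ f = y)
    (h₂ : y ≫ g = z) : x ≫ f ≫ g = z := by rw [← h₂, ← h₁, Category.assoc]

lemma chain₃ {A B C D E : V} {x : A ⟶ B} {f : B ⟶ C} {g : C ⟶ D} {h : D ⟶ E} {y z w}
    (h₁ : x ≫ f = y) (h₂ : y ≫ g = z) (h₃ : z ≫ h = w) : x ≫ f ≫ g ≫ h = w := by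
  rw [← h₃, ← h₂, ← h₁, Category.assoc, Category.assoc]

lemma mul_pullbackμ {T : Type u} (f : S → T) {P R : Quiv V T} {a c b : S}
    (p : 𝟙_ V ⟶ P.hom (f a) (f c)) (q : 𝟙_ V ⟶ R.hom (f c) (f b)) :
    mul (P := (pullback f).obj P) (R := (pullback f).obj R) p q ≫ (pullbackμ f P R).app a b =
      mul (P := P) (R := R) p q := by
  simp only [mul, Category.assoc]
  exact congrArg (fun k ↦ (λ_ _).inv ≫ (p ⊗ₘ q) ≫ k) (ι_pullbackμ f P R a c b)

end Quiv

section

variable {V : Type v} [Category.{u} V] [MonoidalCategory V] [HasColimits V]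
  [SymmetricCategory V] [MonoidalClosed V] {K L : SSet.{u}}

open Quiv

lemma mul_gen_congr {m n : ℕ} {a c c' b : simp K 0} {x : Simp K m a c} {y : Simp K n c b}
    {x' : Simp K m a c'} {y' : Simp K n c' b} (hx : x.val = x'.val) (hy : y.val = y'.val) :
    mul (V := V) (gen x) (gen y) = mul (gen x') (gen y') := by
  have hc : c = c' := by rw [← x.last, ← x'.last, hx]
  subst hc
  rw [Simp.ext hx, Simp.ext hy]

lemma mul_gen_congr₃ {m n p : ℕ} {a c c' d d' b : simp K 0} {x : Simp K m a c} {y : Simp K n c d}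
    {z : Simp K p d b} {x' : Simp K m a c'} {y' : Simp K n c' d'} {z' : Simp K p d' b}
    (hx : x.val = x'.val) (hy : y.val = y'.val) (hz : z.val = z'.val) :
    mul (V := V) (gen x) (mul (gen y) (gen z)) = mul (gen x') (mul (gen y') (gen z')) := by
  have hc : c = c' := by rw [← x.last, ← x'.last, hx]
  have hd : d = d' := by rw [← y.last, ← y'.last, hy]
  subst hc hd
  rw [Simp.ext hx, Simp.ext hy, Simp.ext hz]

lemma unit_mul_gen_congr {n : ℕ} {a c b : simp K 0} (h : a = c) {y : Simp K n c b}
    {x : Simp K n a b} (e : y.val = x.val) :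
    mul (V := V) (unitι h) (gen y) = mul (unitι rfl) (gen x) := by
  subst h
  rw [Simp.ext e]

lemma mul_unit_gen_congr {n : ℕ} {a c b : simp K 0} (h : c = b) {y : Simp K n a c}
    {x : Simp K n a b} (e : y.val = x.val) :
    mul (V := V) (gen y) (unitι h) = mul (gen x) (unitι rfl) := by
  subst h
  rw [Simp.ext e]

variable (V K)

/-- The functor underlying the templicial object of a simplicial set `K`, which sends `[n]` to the
quiver with `F(K)_n(a, b) = ∐_{K_n(a, b)} I`. -/
def freeFunctor : FIntᵒᵖ ⥤ Quiv V (simp K 0) where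
  obj n := free V (Simp K n.unop.len)
  map f := ⟨fun _ _ ↦ freeDesc fun x ↦ gen (x.map f.unop)⟩
  map_id n := free_ext fun a b x ↦ by
    refine (gen_desc _ x).trans (Eq.trans ?_ (Category.comp_id _).symm)
    exact congrArg gen (Simp.ext (restr_id _ _ _ fun _ _ ↦ rfl))
  map_comp f g := free_ext fun a b x ↦ by
    refine (gen_desc _ x).trans (Eq.trans ?_ (((Category.assoc _ _ _).symm.trans
      (congrArg (· ≫ _) (gen_desc (fun x ↦ gen (Simp.map f.unop x)) x))).trans
        (gen_desc (fun x ↦ gen (Simp.map g.unop x)) _)).symm)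
    refine congrArg gen (Simp.ext (Eq.symm ?_))
    simp only [Simp.map_val]
    exact restr_restr_eq _ _ _ _ _ _ _ fun _ _ ↦ rfl

variable {K}

lemma gen_map {m n : FInt} (f : m ⟶ n) {a b : simp K 0} (x : Simp K n.len a b) :
    gen x ≫ ((freeFunctor V K).map f.op).app a b = gen (x.map f) := gen_desc _ x

variable (K)

/-- The comultiplication, which splits a simplex in two. -/
def freeδ (m n : FIntᵒᵖ) :
    (freeFunctor V K).obj (m ⊗ n) ⟶ (freeFunctor V K).obj m ⊗ (freeFunctor V K).obj n :=
  ⟨fun _ _ ↦ freeDesc fun x : Simp K (m.unop.len + n.unop.len) _ _ ↦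
    mul (gen (x.left _ _)) (gen (x.right _ _))⟩

lemma gen_δ (m n : FInt) {a b : simp K 0} (x : Simp K (m.len + n.len) a b) :
    gen x ≫ (freeδ V K (op m) (op n)).app a b = mul (gen (x.left _ _)) (gen (x.right _ _)) :=
  gen_desc _ x

/-- The counit, which is an isomorphism. -/
def freeη : (freeFunctor V K).obj (𝟙_ _) ≅ 𝟙_ (Quiv V (simp K 0)) where
  hom := ⟨fun _ _ ↦ freeDesc fun x : Simp K 0 _ _ ↦ unitι x.eq_of_zero⟩
  inv := ⟨fun a b ↦ unitDesc fun h ↦ gen (h ▸ Simp.point a)⟩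
  hom_inv_id := free_ext fun a b x ↦ by
    have h₁ : gen (V := V) x ≫ freeDesc (fun x : Simp K 0 a b ↦ unitι x.eq_of_zero) =
      unitι x.eq_of_zero := gen_desc _ x
    have h₂ : unitι x.eq_of_zero ≫ unitDesc (fun h : a = b ↦ gen (V := V) (h ▸ Simp.point a)) =
      gen x := by
      rw [unitι_desc]
      obtain rfl := x.eq_of_zero
      refine congrArg gen (Simp.ext ?_)
      exact x.first.symm.trans (restr_id _ _ _ fun _ hi ↦ (Nat.le_zero.1 hi).symm)
    exact (Category.assoc _ _ _).symm.trans ((congrArg (· ≫ _) h₁).trans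
      (h₂.trans (Category.comp_id _).symm))
  inv_hom_id := by
    ext a b
    refine unit_ext fun h ↦ ?_
    subst h
    have h₁ : unitι rfl ≫ unitDesc (fun h : a = a ↦ gen (V := V) (h ▸ Simp.point a)) =
      gen (Simp.point a) := unitι_desc _ _
    have h₂ : gen (V := V) (Simp.point a) ≫
      freeDesc (fun x : Simp K 0 a a ↦ unitι x.eq_of_zero) = unitι rfl := gen_desc _ _
    exact (Category.assoc _ _ _).symm.trans ((congrArg (· ≫ _) h₁).trans
      (h₂.trans (Category.comp_id _).symm))

lemma gen_η {a b : simp K 0} (x : Simp K 0 a b) :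
    gen x ≫ (freeη V K).hom.app a b = unitι x.eq_of_zero := gen_desc _ x

instance : (freeFunctor V K).OplaxMonoidal where
  η := (freeη V K).hom
  δ := freeδ V K
  δ_natural_left {m m'} f n := free_ext fun a b x ↦ by
    obtain ⟨m⟩ := m
    obtain ⟨m'⟩ := m'
    obtain ⟨n⟩ := n
    obtain ⟨f⟩ := f
    have h₁ := gen_δ V K m n x
    have h₂ := gen_map V (f ▷ n) x
    have h₃ := gen_δ V K m' n (Simp.map (f ▷ n) x)
    have h₄ := gen_map V f (Simp.left _ _ x)
    refine (Category.assoc _ _ _).symm.trans ((congrArg (· ≫ _) h₁).trans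
      ((mul_whiskerRight _ _ _).trans ?_))
    refine Eq.trans ?_ ((Category.assoc _ _ _).symm.trans ((congrArg (· ≫ _) h₂).trans h₃)).symm
    refine (congrArg (mul · _) h₄).trans (mul_gen_congr ?_ ?_)
    · rw [Simp.map_val, Simp.left_val, Simp.left_val, Simp.map_val]
      exact restr_restr_congr _ _ _ _ _ _ _ _ _ fun i hi ↦ (if_pos hi).symm
    · rw [Simp.right_val, Simp.right_val, Simp.map_val]
      refine (restr_restr_eq _ _ _ _ _ _ _ fun i hi ↦ ?_).symm
      change (if m'.len + i ≤ m'.len then f.toFun (m'.len + i) else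
        m.len + (m'.len + i - m'.len)) = m.len + i
      split_ifs with h
      · obtain rfl : i = 0 := by omega
        exact f.map_last
      · omega
  δ_natural_right {m m'} n f := free_ext fun a b x ↦ by
    obtain ⟨m⟩ := m
    obtain ⟨m'⟩ := m'
    obtain ⟨n⟩ := n
    obtain ⟨f⟩ := f
    have h₁ := gen_δ V K n m x
    have h₂ := gen_map V (n ◁ f) x
    have h₃ := gen_δ V K n m' (Simp.map (n ◁ f) x)
    have h₄ := gen_map V f (Simp.right _ _ x)
    refine (Category.assoc _ _ _).symm.trans ((congrArg (· ≫ _) h₁).trans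
      ((mul_whiskerLeft _ _ _).trans ?_))
    refine Eq.trans ?_ ((Category.assoc _ _ _).symm.trans ((congrArg (· ≫ _) h₂).trans h₃)).symm
    refine (congrArg (mul _ ·) h₄).trans (mul_gen_congr ?_ ?_)
    · rw [Simp.left_val, Simp.left_val, Simp.map_val]
      exact (restr_restr_eq _ _ _ _ _ _ _ fun i hi ↦ if_pos hi).symm
    · rw [Simp.map_val, Simp.right_val, Simp.right_val, Simp.map_val]
      refine restr_restr_congr _ _ _ _ _ _ _ _ _ fun i hi ↦ ?_
      change n.len + f.toFun i = (if n.len + i ≤ n.len then n.len + i else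
        n.len + f.toFun (n.len + i - n.len))
      split_ifs with h
      · obtain rfl : i = 0 := by omega
        rw [f.map_zero]
      · rw [Nat.add_sub_cancel_left]
  oplax_associativity m n p := free_ext fun a b x ↦ by
    obtain ⟨m⟩ := m
    obtain ⟨n⟩ := n
    obtain ⟨p⟩ := p
    have h₁ := gen_δ V K (m ⊗ n) p x
    have h₂ := gen_δ V K m n (x.left (m ⊗ n).len p.len)
    have h₃ := gen_map V (α_ m n p).inv x
    have h₄ := gen_δ V K m (n ⊗ p) (Simp.map (α_ m n p).inv x)
    have h₅ := gen_δ V K n p (Simp.right m.len (n ⊗ p).len (Simp.map (α_ m n p).inv x))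
    have h₆ := mul_gen_congr₃ (V := V)
      (x := (x.left (m ⊗ n).len p.len).left m.len n.len)
      (y := (x.left (m ⊗ n).len p.len).right m.len n.len)
      (z := x.right (m ⊗ n).len p.len)
      (x' := Simp.left m.len (n ⊗ p).len (Simp.map (α_ m n p).inv x))
      (y' := Simp.left n.len p.len (Simp.right m.len (n ⊗ p).len (Simp.map (α_ m n p).inv x)))
      (z' := Simp.right n.len p.len (Simp.right m.len (n ⊗ p).len (Simp.map (α_ m n p).inv x)))
      (by
        rw [Simp.left_val, Simp.left_val, Simp.left_val, Simp.map_val]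
        exact (restr_restr_congr _ _ _ _ _ _ _ _ _ fun i hi ↦ rfl))
      (by
        rw [Simp.right_val, Simp.left_val, Simp.left_val, Simp.right_val, Simp.map_val]
        refine (restr_restr _ _ _ _ _).trans (Eq.symm ?_)
        refine (congrArg (restr _ _ _) (restr_restr _ _ _ _ _)).trans ?_
        exact restr_restr_eq _ _ _ _ _ _ _ fun i hi ↦ rfl)
      (by
        rw [Simp.right_val, Simp.right_val, Simp.right_val, Simp.map_val]
        refine Eq.symm ?_
        refine (congrArg (restr _ _ _) (restr_restr _ _ _ _ _)).trans ?_
        exact restr_restr_eq _ _ _ _ _ _ _ fun i hi ↦ (Nat.add_assoc _ _ _).symm)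
    exact (chain₃ h₁ ((mul_whiskerRight _ _ _).trans (congrArg (mul · _) h₂))
      (mul_assoc _ _ _)).trans (h₆.trans (chain₃ h₃ h₄
        ((mul_whiskerLeft _ _ _).trans (congrArg (mul _ ·) h₅))).symm)
  oplax_left_unitality n := free_ext fun a b x ↦ by
    obtain ⟨n⟩ := n
    have h₁ := gen_map V (λ_ n).hom x
    have h₂ := gen_δ V K (𝟙_ FInt) n (Simp.map (λ_ n).hom x)
    have h₃ := gen_η V K (Simp.left 0 n.len (Simp.map (λ_ n).hom x))
    have h₄ := unit_mul_gen_congr (V := V) (Simp.left 0 n.len (Simp.map (λ_ n).hom x)).eq_of_zero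
      (y := Simp.right 0 n.len (Simp.map (λ_ n).hom x)) (x := x) (by
        rw [Simp.right_val, Simp.map_val]
        exact (restr_restr _ _ _ _ _).trans (restr_id _ _ _ fun i _ ↦ Nat.zero_add i))
    exact (leftUnitor_inv_mul _).trans (h₄.symm.trans (chain₃ h₁ h₂
      ((mul_whiskerRight _ _ _).trans (congrArg (mul · _) h₃))).symm)
  oplax_right_unitality n := free_ext fun a b x ↦ by
    obtain ⟨n⟩ := n
    have h₁ := gen_map V (ρ_ n).hom x
    have h₂ := gen_δ V K n (𝟙_ FInt) (Simp.map (ρ_ n).hom x)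
    have h₃ := gen_η V K (Simp.right n.len 0 (Simp.map (ρ_ n).hom x))
    have h₄ := mul_unit_gen_congr (V := V) (Simp.right n.len 0 (Simp.map (ρ_ n).hom x)).eq_of_zero
      (y := Simp.left n.len 0 (Simp.map (ρ_ n).hom x)) (x := x) (by
        rw [Simp.left_val, Simp.map_val]
        exact (restr_restr _ _ _ _ _).trans (restr_id _ _ _ fun i _ ↦ rfl))
    exact (rightUnitor_inv_mul _).trans (h₄.symm.trans (chain₃ h₁ h₂
      ((mul_whiskerLeft _ _ _).trans (congrArg (mul _ ·) h₃))).symm)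

/-- The templicial object of a simplicial set. -/
def freeTemplicial : Templicial V where
  S := simp K 0
  X := freeFunctor V K
  unital := inferInstanceAs (IsIso (freeη V K).hom)

variable {V} in
/-- The natural transformation underlying the morphism of templicial objects induced by a map of
simplicial sets. -/
def freeApp {K L : SSet.{u}}
    (k : K ⟶ L) : freeFunctor V K ⟶ freeFunctor V L ⋙ Quiv.pullback (k.app _) where
  app n := ⟨fun a b ↦ freeDesc (Y := ((freeFunctor V L).obj n).hom (k.app _ a) (k.app _ b))
    fun x ↦ gen (x.image k)⟩
  naturality m n f := free_ext fun a b x ↦ by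
    obtain ⟨m⟩ := m
    obtain ⟨n⟩ := n
    obtain ⟨f⟩ := f
    have h₁ := gen_map V f x
    have h₂ : gen (V := V) (x.map f) ≫ freeDesc (fun x ↦ gen (x.image k)) =
      gen ((x.map f).image k) := gen_desc _ _
    have h₃ : gen (V := V) x ≫ freeDesc (fun x ↦ gen (x.image k)) = gen (x.image k) := gen_desc _ _
    have h₄ := gen_map V f (x.image k)
    refine (chain₂ h₁ h₂).trans (Eq.trans (congrArg gen (Simp.ext ?_)) (chain₂ h₃ h₄).symm)
    exact restr_natural k _ _ _ _

variable {V} in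
lemma gen_app {K L : SSet.{u}}
    (k : K ⟶ L) (n : FInt) {a b : simp K 0} (x : Simp K n.len a b) :
    gen (V := V) x ≫ ((freeApp k).app (op n)).app a b = gen (x.image k) := gen_desc _ _

/-- The functor from simplicial sets to templicial objects induced by the free functor. -/
def freeTemp : SSet.{u} ⥤ Templicial V where
  obj := freeTemplicial V
  map {K L} k :=
    { map := k.app _
      app := freeApp k
      app_comul m n := free_ext fun a b x ↦ by
        have h₁ := gen_app (V := V) k (⟨m⟩ ⊗ ⟨n⟩) x
        have h₂ := gen_δ V L ⟨m⟩ ⟨n⟩ (x.image k)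
        have h₃ := gen_δ V K ⟨m⟩ ⟨n⟩ x
        have h₄ := gen_app (V := V) k ⟨m⟩ (x.left m n)
        have h₅ := gen_app (V := V) k ⟨n⟩ (x.right m n)
        have h₆ := mul_gen_congr (V := V) (x := (x.image k).left m n)
          (y := (x.image k).right m n) (x' := (x.left m n).image k) (y' := (x.right m n).image k)
          (restr_natural k _ _ _ _).symm (restr_natural k _ _ _ _).symm
        have h₇ : mul (P := (Quiv.pullback (k.app _)).obj ((freeFunctor V L).obj (op ⟨m⟩)))
            (R := (Quiv.pullback (k.app _)).obj ((freeFunctor V L).obj (op ⟨n⟩)))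
            (gen ((x.left m n).image k)) (gen ((x.right m n).image k)) ≫ _ = _ :=
          mul_pullbackμ (k.app _) (gen ((x.left m n).image k)) (gen ((x.right m n).image k))
        exact (chain₂ h₁ h₂).trans (h₆.trans
          (chain₃ h₃ ((mul_tensorHom _ _ _ _).trans (congrArg₂ mul h₄ h₅)) h₇).symm)
      app_counit := free_ext fun a b x ↦ by
        have h₁ := gen_η V K x
        have h₂ := unitι_pullbackε (V := V) (k.app (op (SimplexCategory.mk 0))) x.eq_of_zero
        have h₃ := gen_app (V := V) k (𝟙_ _) x
        have h₄ := gen_η V L (x.image k)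
        exact (chain₂ h₁ h₂).trans (chain₂ h₃ h₄).symm }
  map_id K := Templicial.Hom.ext' fun n a b ↦ Sigma.hom_ext _ _ fun x ↦
    (gen_app (𝟙 K) n.unop x).trans (Category.comp_id (gen (V := V) x)).symm
  map_comp k l := Templicial.Hom.ext' fun n a b ↦ Sigma.hom_ext _ _ fun x ↦
    (gen_app (k ≫ l) n.unop x).trans
      (chain₂ (gen_app (V := V) k n.unop x) (gen_app l n.unop (x.image k))).symm

end

/-! ## The classical homotopy coherent nerve -/

section Classical

/-- The category of small simplicial categories. -/
abbrev SmallSimplicialCat : Type (u + 1) := SmallEnrichedCat SSet.{u}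

variable (C : SmallSimplicialCat.{u})

/-- The simplicial category `ℭ[Δ^n]`, whose simplicial sets of morphisms are the nerves of the posets
of subsets of `{i, …, j}` containing the endpoints. -/
abbrev Thick (n : SimplexCategoryᵒᵖ) : Type u :=
  SimplicialThickening (ULift.{u} (Fin (n.unop.len + 1)))

/-- The simplicial functor `ℭ[Δ^m] ⟶ ℭ[Δ^n]` induced by a morphism `[m] ⟶ [n]`. -/
def thickMap {n m : SimplexCategoryᵒᵖ} (f : n ⟶ m) : EnrichedFunctor SSet.{u} (Thick m) (Thick n) :=
  SimplicialThickening.functor f.unop.toOrderHom.uliftMap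

/-- The homotopy coherent nerve of a simplicial category `C`, whose `n`-simplices are the simplicial
functors `ℭ[Δ^n] ⟶ C`. -/
def hcNerveObj : SSet.{u} where
  obj n := EnrichedFunctor SSet.{u} (Thick.{u} n) C.Obj
  map f := TypeCat.ofHom fun F ↦ EnrichedFunctor.comp SSet.{u} (thickMap f) F
  map_id n := by
    ext F
    change EnrichedFunctor.comp SSet (SimplicialThickening.functor OrderHom.id) F = F
    rw [SimplicialThickening.functor_id]
    rfl
  map_comp f g := by
    ext F
    change EnrichedFunctor.comp SSet (SimplicialThickening.functor
      (f.unop.toOrderHom.uliftMap.comp g.unop.toOrderHom.uliftMap)) F = _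
    rw [SimplicialThickening.functor_comp]
    rfl

/-- The classical homotopy coherent nerve functor. -/
def hcNerve : SmallSimplicialCat.{u} ⥤ SSet.{u} where
  obj := hcNerveObj
  map {C D} G :=
    { app n := TypeCat.ofHom fun F ↦ EnrichedFunctor.comp SSet.{u} F G }
  map_id C := by
    ext n F
    rfl
  map_comp G H := by
    ext n F
    rfl

end Classical

/-! ## Quasi-categories in a monoidal category -/

section Quasicategory

/-- The vertex `i` of the standard simplex `Δ^n`. -/
def simplexVertex (n : ℕ) (i : Fin (n + 1)) : simp (SSet.stdSimplex.{u}.obj (SimplexCategory.mk n)) 0 :=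
  SSet.stdSimplex.obj₀Equiv.symm i

/-- The vertex `i` of the horn `Λ^n_j`, for `n ≥ 2`. -/
def hornVertex (n : ℕ) (j i : Fin (n + 3)) : simp (SSet.horn.{u} (n + 2) j : SSet.{u}) 0 :=
  ⟨simplexVertex (n + 2) i, by rw [SSet.horn_obj_zero]; trivial⟩

variable {V : Type v} [Category.{u} V] [MonoidalCategory V] [HasColimits V]
  [SymmetricCategory V] [MonoidalClosed V]

/-- The map `F(Λ^n_j)_•(0, n) ⟶ F(Δ^n)_•(0, n)` of functors on necklaces induced by the inclusion of
the horn, for `n ≥ 2`. -/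
def hornInclusion (V : Type v) [Category.{u} V] [MonoidalCategory V] [HasColimits V]
    [SymmetricCategory V] [MonoidalClosed V] (n : ℕ) (j : Fin (n + 3)) :
    necHom (freeTemplicial V (SSet.horn.{u} (n + 2) j : SSet.{u}))
        (hornVertex n j 0) (hornVertex n j (Fin.last (n + 2))) ⟶
      necHom (freeTemplicial V (SSet.stdSimplex.{u}.obj (SimplexCategory.mk (n + 2))))
        (simplexVertex (n + 2) 0) (simplexVertex (n + 2) (Fin.last (n + 2))) :=
  ((nec (V := V)).map ((freeTemp V).map (SSet.horn.{u} (n + 2) j).ι)).app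
    (hornVertex n j 0) (hornVertex n j (Fin.last (n + 2)))

/-- A functor `Y` on necklaces lifts inner horns if it has the right lifting property with respect to
the maps `F(Λ^n_j)_•(0, n) ⟶ F(Δ^n)_•(0, n)`, for `0 < j < n`. -/
def LiftsInnerHorns (Y : Necᵒᵖ ⥤ V) : Prop :=
  ∀ (n : ℕ) (j : Fin (n + 3)), 0 < j → j < Fin.last (n + 2) → ∀ φ : _ ⟶ Y,
    ∃ ψ : _ ⟶ Y, hornInclusion V n j ≫ ψ = φ

/-- A templicial object `X` is a quasi-category in `V` if the functors `X_•(a, b)` lift inner horns,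
for all vertices `a` and `b`. -/
def Templicial.IsQuasicategory (X : Templicial V) : Prop :=
  ∀ a b : X.S, LiftsInnerHorns (necHom X a b)

end Quasicategory

section Statement

variable {V : Type v} [Category.{u} V] [MonoidalCategory V] [HasLimits V]

/-- The underlying simplicial set `U(Y)_n = V(I, Y_n)` of a simplicial object `Y`. -/
def underlying (Y : SimplicialObject V) : SSet.{u} := Y ⋙ coyoneda.obj (op (𝟙_ V))

/-- A simplicially enriched category `C` is locally Kan if the underlying simplicial sets of its
simplicial objects of morphisms are Kan complexes. -/
def LocallyKan (C : SmallEnrichedCat (SimplicialObject V)) : Prop :=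
  ∀ A B : C.Obj, SSet.KanComplex (underlying (C.sHom A B))

/-- A functor of necklace categories `η : D ⟶ 𝔫(C)` exhibits `C` as `𝔰(D)` if it is bijective on
objects and `η : D(A, B) ⟶ 𝔫(C(η A, η B))` exhibits `C(η A, η B)` as the weighted colimit of the
functors `F(N(P_T))` with weight `D(A, B)`, for all objects `A` and `B`: composition with
`η` is a bijection from the morphisms `C(η A, η B) ⟶ Y` of simplicial objects to the morphisms
`D(A, B) ⟶ 𝔫(Y)` of functors on necklaces, for every `Y`. -/
def IsHomwiseColimit {D : NecCat V} {C : SmallEnrichedCat (SimplicialObject V)}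
    (η : D ⟶ nFunctor.obj C) : Prop :=
  Function.Bijective (NecCat.Hom.obj η) ∧ ∀ (A B : D.Obj) (Y : SimplicialObject V),
    Function.Bijective fun g : C.sHom (NecCat.Hom.obj η A) (NecCat.Hom.obj η B) ⟶ Y ↦
      NecCat.Hom.app η A B ≫ nMap g

end Statement

end HCNerve

end

noncomputable section

namespace HCNerve

/-! ## Maps of necklaces -/

namespace Nec

lemma hom_ext' {T U : Nec} {f g : T ⟶ U} (h : ∀ i ≤ T.len, f.vert i = g.vert i) : f = g :=
  Hom.ext (FInt.Hom.ext_of_le h)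

lemma comp_vert {T U R : Nec} (f : T ⟶ U) (g : U ⟶ R) (i : ℕ) :
    (f ≫ g).vert i = g.vert (f.vert i) := rfl

lemma tensorHom_vert {T T' U U' : Nec} (f : T ⟶ T') (g : U ⟶ U') (i : ℕ) :
    (f ⊗ₘ g).vert i = if i ≤ T.len then f.vert i else T'.len + g.vert (i - T.len) := rfl

lemma whiskerLeft_vert (T : Nec) {U U' : Nec} (g : U ⟶ U') (i : ℕ) :
    (T ◁ g).vert i = if i ≤ T.len then i else T.len + g.vert (i - T.len) := rfl

lemma whiskerRight_vert {T T' : Nec} (f : T ⟶ T') (U : Nec) (i : ℕ) :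
    (f ▷ U).vert i = if i ≤ T.len then f.vert i else T'.len + (i - T.len) := rfl

@[simp] lemma associator_inv_vert (T U R : Nec) (i : ℕ) : (α_ T U R).inv.vert i = i := rfl
/-- The map of necklaces which is the identity on vertices. -/
def inert {T U : Nec} (h : T.len = U.len) (hj : joints U.beads ⊆ joints T.beads) : T ⟶ U :=
  ⟨FInt.Hom.cast h, fun i hi ↦ ⟨i, hj hi, rfl⟩⟩

/-- The list of beads of the simplex `Δ^n`, for `n ≥ 0`. -/
def bdl : ℕ → List ℕ
  | 0 => []
  | n + 1 => [n + 1]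

lemma bdl_pos : ∀ n, ∀ b ∈ bdl n, 0 < b
  | 0, _, h => by simp [bdl] at h
  | n + 1, b, h => by simp [bdl] at h; omega

@[simp] lemma bdl_sum : ∀ n, (bdl n).sum = n
  | 0 => rfl
  | n + 1 => by simp [bdl]

lemma mem_joints_bdl {n i : ℕ} : i ∈ joints (bdl n) ↔ i = 0 ∨ i = n := by
  cases n with
  | zero => simp [bdl, joints]
  | succ n => simp [bdl, joints]

/-- The simplex `Δ^n` as a necklace, for `n ≥ 0`. -/
def bd (n : ℕ) : Nec := ⟨bdl n, bdl_pos n⟩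

@[simp] lemma bd_len (n : ℕ) : (bd n).len = n := bdl_sum n

@[simp] lemma tensor_len (T U : Nec) : (T ⊗ U).len = T.len + U.len := wedge_len T U

/-- A map of simplices as a map of necklaces. -/
def bdMap {m n : ℕ} (f : FInt.Hom m n) : bd m ⟶ bd n :=
  ⟨((FInt.Hom.cast (bdl_sum m)).comp f).comp (FInt.Hom.cast (bdl_sum n).symm), fun i hi ↦ by
    obtain rfl | rfl := mem_joints_bdl.1 hi
    · exact ⟨0, mem_joints_bdl.2 (Or.inl rfl), f.map_zero⟩
    · exact ⟨m, mem_joints_bdl.2 (Or.inr rfl), f.map_last⟩⟩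

@[simp] lemma bdMap_vert {m n : ℕ} (f : FInt.Hom m n) (i : ℕ) : (bdMap f).vert i = f i := rfl

/-- The map `Δ^k ∨ Δ^l ⟶ Δ^n` for `k + l = n`. -/
def cutMap (k l n : ℕ) (h : k + l = n) : bd k ⊗ bd l ⟶ bd n :=
  inert (by simp [h]) (fun i hi ↦ by
    obtain rfl | rfl := mem_joints_bdl.1 hi
    · exact zero_mem_joints _
    · have := sum_mem_joints (bd k ⊗ bd l).beads
      have h' : (bd k ⊗ bd l).beads.sum = i := (tensor_len (bd k) (bd l)).trans (by simp [h])
      rwa [h'] at this)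

@[simp] lemma cutMap_vert (k l n : ℕ) (h : k + l = n) (i : ℕ) : (cutMap k l n h).vert i = i := rfl

end Nec

/-- The cut of a simplex at its last vertex. -/
def Cut.bdl : ∀ n, Cut (Nec.bdl n) n []
  | 0 => .zero rfl rfl
  | n + 1 => .exact (Nat.succ_pos n) rfl

/-- The cut of `Δ^k ∨ T` at the vertex `k`. -/
def Cut.bdlAppend : ∀ (k : ℕ) (T : List ℕ), Cut (Nec.bdl k ++ T) k T
  | 0, _ => .zero rfl rfl
  | k + 1, _ => .exact (Nat.succ_pos k) rfl

/-- The cut of `Δ^n` at the vertex `k`. -/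
def Cut.bdlMid (k l n : ℕ) (h : k + l = n) : Cut (Nec.bdl n) k (Nec.bdl l) := by
  subst h
  match k, l with
  | 0, l => exact .zero rfl (by rw [Nat.zero_add])
  | k + 1, 0 => exact .exact (Nat.succ_pos k) rfl
  | k + 1, l + 1 => exact .mid (l + 1) [] (Nat.succ_pos k) (Nat.succ_pos l) rfl rfl

section BeadHom

variable {W : Type v} [Category.{u} W] [MonoidalCategory W] (X : FIntᵒᵖ ⥤ W)
  [X.OplaxMonoidal] [IsIso (Functor.OplaxMonoidal.η X)] (E : Necᵒᵖ ⥤ W) [E.LaxMonoidal]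

open Functor.LaxMonoidal Nec

/-- Compatible families of morphisms `X_n ⟶ E(Δ^n)`. -/
structure BeadHom where
  /-- the component at `[n]` -/
  app (n : ℕ) : bead X n ⟶ E.obj (op (bd n))
  natural {m n : ℕ} (f : FInt.Hom m n) :
    beadMap X f ≫ app m = app n ≫ E.map (bdMap f).op
  comul (k l : ℕ) : comul X k l ≫ (app k ⊗ₘ app l) ≫ μ E (op (bd k)) (op (bd l)) =
    app (k + l) ≫ E.map (cutMap k l _ rfl).op
  unit : unitInv X ≫ app 0 = ε E

variable {X E}

section

variable {C : Type*} {D : Type*} [Category* C] [Category* D] [MonoidalCategory C]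
  [MonoidalCategory D] (G : D ⥤ C) [G.LaxMonoidal]

lemma lax_unit_aux {T : D} {A : C} (t : A ⟶ G.obj T) {B : C} (k : 𝟙_ C ⟶ B) (b : B ⟶ G.obj (𝟙_ D))
    (h : k ≫ b = ε G) :
    ((λ_ A).inv ≫ k ▷ A) ≫ (b ⊗ₘ t) ≫ μ G (𝟙_ D) T = t ≫ G.map (λ_ T).inv := by
  have h1 : k ▷ A ≫ (b ⊗ₘ t) = 𝟙_ C ◁ t ≫ ε G ▷ _ := by
    rw [← tensorHom_id, tensorHom_comp_tensorHom, h, Category.id_comp,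
      ← id_tensorHom, ← tensorHom_id, tensorHom_comp_tensorHom, Category.id_comp, Category.comp_id]
  rw [Category.assoc, reassoc_of% h1, ← leftUnitor_inv_naturality_assoc, left_unitality_inv]

lemma lax_assoc_aux {P Q R S : D} {A B K N : C} {d : A ⟶ B ⊗ K} {x : B ⟶ G.obj P}
    {y : K ⟶ G.obj Q} {t : N ⟶ G.obj R} {z : A ⟶ G.obj S} {m' : S ⟶ P ⊗ Q}
    (h : d ≫ (x ⊗ₘ y) ≫ μ G P Q = z ≫ G.map m') :
    (d ▷ N ≫ (α_ _ _ _).hom) ≫ (x ⊗ₘ ((y ⊗ₘ t) ≫ μ G Q R)) ≫ μ G P (Q ⊗ R) =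
      (z ⊗ₘ t) ≫ μ G S R ≫ G.map (m' ▷ R ≫ (α_ _ _ _).hom) := by
  simpa using func_aux₂ G (n := t) h.symm

lemma lax_cons_aux {P Q Q' S : D} {A B K : C} {x : B ⟶ G.obj P} {y : K ⟶ G.obj Q} {q : Q ⟶ Q'}
    {s : A ⟶ B ⊗ K} {z : A ⟶ G.obj S} {m : S ⟶ P ⊗ Q} 
    (h : s ≫ (x ⊗ₘ y) ≫ μ G P Q = z ≫ G.map m) :
    s ≫ (x ⊗ₘ (y ≫ G.map q)) ≫ μ G P Q' = z ≫ G.map (m ≫ P ◁ q) := by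
  have h1 : (x ⊗ₘ (y ≫ G.map q)) = (x ⊗ₘ y) ≫ _ ◁ G.map q := by
    rw [← id_tensorHom, tensorHom_comp_tensorHom, Category.comp_id]
  rw [h1, Category.assoc, μ_natural_right, G.map_comp, reassoc_of% h]

end

namespace Nec

/-- The isomorphism between a necklace and the wedge of its first bead and the remaining ones. -/
def consMap (a : ℕ) (T : List ℕ) (h : ∀ b ∈ a :: T, 0 < b) :
    (⟨a :: T, h⟩ : Nec) ⟶ bd a ⊗ ⟨T, fun b hb ↦ h b (List.mem_cons_of_mem _ hb)⟩ :=
  inert (by rw [tensor_len, bd_len]; rfl) (by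
    obtain ⟨a, rfl⟩ := Nat.exists_eq_succ_of_ne_zero (h a (List.mem_cons_self ..)).ne'
    exact subset_rfl)

@[simp] lemma consMap_vert (a : ℕ) (T : List ℕ) (h) (i : ℕ) : (consMap a T h).vert i = i := rfl

lemma joints_subset_of_cut {U R : List ℕ} {c : ℕ} (κ : Cut U c R) :
    joints U ⊆ joints (bdl c ++ R) := by
  intro i hi
  rw [mem_joints_append, mem_joints_bdl, bdl_sum]
  by_cases h : i < c
  · cases κ with
    | zero hc => omega
    | exact hc hU =>
      subst hU
      obtain h' | ⟨j, hj, rfl⟩ := hi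
      · exact Or.inl (Or.inl h')
      · dsimp only at h; omega
    | mid r U' hc hr hU hR =>
      subst hU
      obtain h' | ⟨j, hj, rfl⟩ := hi
      · exact Or.inl (Or.inl h')
      · dsimp only at h; omega
  · obtain ⟨j, rfl⟩ := Nat.exists_eq_add_of_le (not_lt.1 h)
    exact Or.inr ⟨j, κ.mem_joints_right hi, rfl⟩

/-- The map of necklaces associated to a cut. -/
def ofCut {U R : List ℕ} {c : ℕ} (κ : Cut U c R) (hU : ∀ b ∈ U, 0 < b) :
    bd c ⊗ ⟨R, κ.pos hU⟩ ⟶ ⟨U, hU⟩ :=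
  inert (by rw [tensor_len, bd_len]; exact κ.add_sum) (joints_subset_of_cut κ)

@[simp] lemma ofCut_vert {U R : List ℕ} {c : ℕ} (κ : Cut U c R) (hU) (i : ℕ) :
    (ofCut κ hU).vert i = i := rfl

end Nec

variable (E) in
lemma map_comp_of_eq {T U R : Nec} {f : T ⟶ U} {g : U ⟶ R} {h : T ⟶ R} (e : f ≫ g = h) :
    E.map g.op ≫ E.map f.op = E.map h.op := by
  rw [← E.map_comp, ← op_comp, e]

namespace BeadHom

variable (g : BeadHom X E)

/-- The components at all necklaces of a compatible family of morphisms `X_n ⟶ E(Δ^n)`. -/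
def nec : ∀ (T : List ℕ) (h : ∀ b ∈ T, 0 < b), necObj X T ⟶ E.obj (op ⟨T, h⟩)
  | [], _ => ε E
  | a :: T, h => (g.app a ⊗ₘ nec T (fun b hb ↦ h b (List.mem_cons_of_mem _ hb))) ≫
      μ E (op (bd a)) (op ⟨T, _⟩) ≫ E.map (consMap a T h).op

lemma nec_split {U R : List ℕ} {c : ℕ} (κ : Cut U c R) (h : ∀ b ∈ U, 0 < b) :
    split X κ ≫ (g.app c ⊗ₘ g.nec R (κ.pos h)) ≫ μ E (op (bd c)) (op ⟨R, κ.pos h⟩) =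
      g.nec U h ≫ E.map (ofCut κ h).op := by
  cases κ with
  | zero hc hR =>
    cases hc; cases hR
    refine (lax_unit_aux E (g.nec U h) (unitInv X) (g.app 0) g.unit).trans ?_
    exact congrArg (fun k ↦ g.nec U h ≫ E.map k)
      (congrArg Quiver.Hom.op (Nec.hom_ext' fun i hi ↦ rfl))
  | exact hc hU =>
    cases hU
    have h' : E.map (consMap c R h).op ≫ E.map (ofCut (.exact hc rfl) h).op = 𝟙 _ :=
      (map_comp_of_eq E (h := 𝟙 _) (Nec.hom_ext' fun i hi ↦ rfl)).trans (E.map_id _)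
    have e := congrArg (fun k ↦ (g.app c ⊗ₘ g.nec R _) ≫ μ E (op (bd c)) (op ⟨R, _⟩) ≫ k) h'
    refine (Category.id_comp _).trans ?_
    refine Eq.trans ?_ (e.symm.trans ?_)
    · exact congrArg (_ ≫ ·) (Category.comp_id _).symm
    · exact (congrArg (_ ≫ ·) (Category.assoc _ _ _).symm).trans (Category.assoc _ _ _).symm
  | mid r U' hc hr hU hR =>
    cases hU; cases hR
    have h1 := lax_assoc_aux E (t := g.nec U' (fun b hb ↦ h b (List.mem_cons_of_mem _ hb)))
      (g.comul c r)
    rw [← Category.assoc (g.app (c + r) ⊗ₘ _)] at h1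
    have h2 := lax_cons_aux E (q := (consMap r U' (fun b hb ↦
      (Cut.mid r U' hc hr rfl rfl : Cut ((c + r) :: U') c (r :: U')).pos h b hb)).op) h1
    refine Eq.trans ?_ (h2.trans ?_)
    · exact congrArg (fun k ↦ _ ≫ (g.app c ⊗ₘ k) ≫ _) (Category.assoc _ _ _).symm
    · have h3 := map_comp_of_eq E (f := ofCut (Cut.mid r U' hc hr rfl rfl) h)
        (g := consMap (c + r) U' h) (h := bd c ◁ consMap r U' _ ≫ (α_ _ _ _).inv ≫
          cutMap c r (c + r) rfl ▷ _) (Nec.hom_ext' fun i hi ↦ by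
            simp only [comp_vert, whiskerLeft_vert, whiskerRight_vert, associator_inv_vert,
              consMap_vert, cutMap_vert, ofCut_vert, bd_len, tensor_len]
            split_ifs <;> omega)
      refine Eq.trans ?_ ((congrArg (fun k ↦ ((g.app (c + r) ⊗ₘ g.nec U' _) ≫
        μ E (op (bd (c + r))) (op ⟨U', _⟩)) ≫ k) h3).symm.trans ?_)
      · rfl
      · exact (Category.assoc _ _ _).symm.trans (congrArg (· ≫ _) (Category.assoc _ _ _))

lemma nec_natural : ∀ {T U : List ℕ} (f : Nec.Hom T U) (hT : ∀ b ∈ T, 0 < b)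
    (h : ∀ b ∈ U, 0 < b), necMap X f h ≫ g.nec T hT =
      g.nec U h ≫ E.map (Quiver.Hom.op (show (⟨T, hT⟩ : Nec) ⟶ ⟨U, h⟩ from f))
  | [], U, f, hT, h => by
    obtain rfl := f.target_nil h
    have e : (show (⟨[], hT⟩ : Nec) ⟶ ⟨[], h⟩ from f) = 𝟙 _ := Nec.hom_ext' fun i hi ↦ by
      obtain rfl : i = 0 := Nat.le_zero.1 hi
      exact f.vert.map_zero
    rw [necMap_nil, Category.id_comp, e, op_id, E.map_id, Category.comp_id]
  | a :: T, U, f, hT, h => by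
    obtain ⟨R, κ⟩ := f.cut h
    have h₁ := func_aux₃ E (b := beadMap X f.vert.front) (x' := g.app a)
      (b' := (bdMap f.vert.front).op) (m := necMap X (f.back κ) (κ.pos h))
      (y' := g.nec T (fun b hb ↦ hT b (List.mem_cons_of_mem _ hb)))
      (g.nec_split κ h) (g.natural f.vert.front) (nec_natural (f.back κ) _ (κ.pos h))
    have h₂ := congrArg (· ≫ E.map (consMap a T hT).op) h₁
    rw [necMap_cons X f h κ]
    refine Eq.trans ?_ (h₂.trans ?_)
    · simp only [nec, Category.assoc]
      exact Category.assoc _ _ _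
    · refine (Category.assoc _ _ _).trans (congrArg (_ ≫ ·) ?_)
      refine map_comp_of_eq E (f := consMap a T hT) (g := (bdMap f.vert.front ⊗ₘ
        (show (⟨T, _⟩ : Nec) ⟶ ⟨R, κ.pos h⟩ from f.back κ)) ≫ ofCut κ h)
        (Nec.hom_ext' fun i hi ↦ ?_)
      have e₁ : (bd a).len = a := bd_len a
      have e₂ : (bd (f.vert a)).len = f.vert a := bd_len _
      change (if i ≤ (bd a).len then f.vert.front i else (bd (f.vert a)).len +
        (f.vert (a + (i - (bd a).len)) - f.vert a)) = f.vert i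
      rw [e₁, e₂]
      split_ifs with h3
      · exact f.vert.front_apply h3
      · have := f.vert.mono (show a ≤ i by omega)
        have e₃ : a + (i - a) = i := by omega
        rw [e₃]
        omega

lemma nec_wedge : ∀ (T U : List ℕ) (hT : ∀ b ∈ T, 0 < b) (hU : ∀ b ∈ U, 0 < b)
    (h : ∀ b ∈ T ++ U, 0 < b), necWedge X T U ≫ g.nec (T ++ U) h =
      (g.nec T hT ⊗ₘ g.nec U hU) ≫ μ E (op ⟨T, hT⟩) (op ⟨U, hU⟩)
  | [], U, hT, hU, h => by
    refine (func_aux₅ E (n := g.nec U hU)).trans (congrArg (_ ≫ ·) ?_)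
    exact (congrArg (μ E (op (𝟙_ Nec)) (op ⟨U, hU⟩) ≫ ·) (E.map_id _)).trans
      (Category.comp_id _)
  | a :: T, U, hT, hU, h => by
    have hT' : ∀ b ∈ T, 0 < b := fun b hb ↦ hT b (List.mem_cons_of_mem _ hb)
    have hTU : ∀ b ∈ T ++ U, 0 < b := fun b hb ↦ h b (List.mem_cons_of_mem _ hb)
    have h₁ : necWedge X T U ≫ g.nec (T ++ U) hTU =
      (g.nec T hT' ⊗ₘ g.nec U hU) ≫ μ E (op ⟨T, hT'⟩) (op ⟨U, hU⟩) ≫ E.map (𝟙 _) := by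
      rw [nec_wedge T U hT' hU hTU, E.map_id, Category.comp_id]
    have h₂ := congrArg (· ≫ E.map (consMap a (T ++ U) h).op)
      (func_aux₄ E (a := g.app a) (A' := op (bd a)) h₁)
    have h₃ : (g.nec (a :: T) hT ⊗ₘ g.nec U hU) = (((g.app a ⊗ₘ g.nec T hT') ≫
        μ E (op (bd a)) (op ⟨T, hT'⟩)) ⊗ₘ g.nec U hU) ≫ E.map (consMap a T hT).op ▷ _ := by
      rw [← tensorHom_id, tensorHom_comp_tensorHom, Category.comp_id]
      simp only [nec, Category.assoc]
      rfl
    refine Eq.trans ?_ (h₂.trans ?_)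
    · simp only [Category.assoc]
      exact (Category.assoc _ _ _).trans rfl
    · rw [h₃]
      refine Eq.trans ?_ (Category.assoc _ _ _).symm
      refine Eq.trans ?_ (congrArg (_ ≫ ·) (μ_natural_left E (consMap a T hT).op
        (op ⟨U, hU⟩)).symm)
      refine (Category.assoc _ _ _).trans (congrArg (_ ≫ ·) ?_)
      refine (Category.assoc _ _ _).trans (congrArg (_ ≫ ·) ?_)
      refine map_comp_of_eq E (f := consMap a (T ++ U) h) 
        (g := show bd a ⊗ (⟨T, hT'⟩ ⊗ ⟨U, hU⟩ : Nec) ⟶ (bd a ⊗ ⟨T, hT'⟩) ⊗ ⟨U, hU⟩ from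
          (bd a ◁ 𝟙 _) ≫ (α_ _ _ _).inv) (Nec.hom_ext' fun i hi ↦ ?_)
      have e₁ : (bd a).len = a := bd_len a
      have e₂ : (⟨a :: T, hT⟩ : Nec).len = a + (⟨T, hT'⟩ : Nec).len := List.sum_cons
      change (if i ≤ (bd a).len then i else (bd a).len + (i - (bd a).len)) =
        if i ≤ (⟨a :: T, hT⟩ : Nec).len then i else (bd a ⊗ ⟨T, hT'⟩ : Nec).len +
          (i - (⟨a :: T, hT⟩ : Nec).len)
      rw [tensor_len, e₂, e₁]
      split_ifs <;> omega

end BeadHom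

section OfNec

/-- The isomorphism between the value at a simplex as a necklace and the value at the simplex. -/
def necBead (n : ℕ) : necObj X (bdl n) ⟶ bead X n := split X (Cut.bdl n) ≫ (ρ_ _).hom

/-- The inverse of `necBead`. -/
def beadNec : ∀ n, bead X n ⟶ necObj X (bdl n)
  | 0 => Functor.OplaxMonoidal.η X
  | _ + 1 => (ρ_ _).inv

lemma unitInv_counit : unitInv X ≫ Functor.OplaxMonoidal.η X = 𝟙 _ := IsIso.inv_hom_id _

lemma counit_unitInv : Functor.OplaxMonoidal.η X ≫ unitInv X = 𝟙 _ := IsIso.hom_inv_id _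

lemma necBead_zero : necBead (X := X) 0 = unitInv X := by
  change ((λ_ (𝟙_ W)).inv ≫ unitInv X ▷ 𝟙_ W) ≫ (ρ_ _).hom = _
  simp [unitors_inv_equal]

lemma beadNec_necBead (n : ℕ) : beadNec n ≫ necBead (X := X) n = 𝟙 _ := by
  cases n with
  | zero => rw [necBead_zero]; exact counit_unitInv
  | succ n => exact (congrArg (_ ≫ ·) (Category.id_comp _)).trans (Iso.inv_hom_id _)

lemma necBead_beadNec (n : ℕ) : necBead (X := X) n ≫ beadNec n = 𝟙 _ := by
  cases n with
  | zero => rw [necBead_zero]; exact unitInv_counit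
  | succ n => exact (congrArg (· ≫ _) (Category.id_comp _)).trans (Iso.hom_inv_id _)

section

variable {C : Type*} [Category* C] [MonoidalCategory C] {A B K P S T Z Q : C}

lemma conj_aux {f : A ⟶ B} {N : P ⟶ Q} {q : Q ⟶ B} {j : B ⟶ Q} {q' : P ⟶ A} {j' : A ⟶ P}
    (h : N ≫ q = q' ≫ f) (h₁ : q ≫ j = 𝟙 _) (h₂ : j' ≫ q' = 𝟙 _) : f ≫ j = j' ≫ N := by
  have := congrArg (fun k ↦ j' ≫ k ≫ j) h
  simp only [Category.assoc, h₁, reassoc_of% h₂, Category.comp_id] at this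
  exact this.symm

lemma cancel_aux {f : A ⟶ B} {g : B ⟶ A} {h : A ⟶ K} (e : f ≫ g = 𝟙 _) : f ≫ g ≫ h = h := by
  rw [reassoc_of% e]

lemma ofNec_cons_aux {R U Y Q : C} {b : B ⟶ S} {r : S ⟶ R} {u : T ⟶ U} {m : R ⊗ U ⟶ Y} {e : Y ⟶ Q}
    {w : S ⊗ T ⟶ B ⊗ T} {z : B ⊗ T ⟶ Y} {s : B ⊗ T ⟶ Q} (h : w ≫ z = (r ⊗ₘ u) ≫ m)
    (h' : 𝟙 _ ≫ s = z ≫ e) (h'' : b ▷ T ≫ w ≫ 𝟙 _ = 𝟙 _) : ((b ≫ r) ⊗ₘ u) ≫ m ≫ e = s := by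
  have h₁ : ((b ≫ r) ⊗ₘ u) = b ▷ T ≫ (r ⊗ₘ u) := by
    rw [← tensorHom_id, tensorHom_comp_tensorHom, Category.id_comp]
  rw [Category.comp_id] at h''
  rw [h₁, Category.assoc, ← reassoc_of% h, ← h', reassoc_of% h'', Category.id_comp]

lemma unit_aux (f : A ⟶ B) : (f ⊗ₘ 𝟙 (𝟙_ C)) ≫ (ρ_ _).hom = (ρ_ _).hom ≫ f := by simp

lemma cut_aux : (ρ_ A).inv ▷ B ≫ ((α_ A (𝟙_ C) B).hom ≫ A ◁ (λ_ B).hom) ≫ 𝟙 _ = 𝟙 _ := by simp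

lemma cut_aux' {f : A ⟶ 𝟙_ C} {g : 𝟙_ C ⟶ A} (h : f ≫ g = 𝟙 _) :
    f ▷ B ≫ (λ_ B).hom ≫ (λ_ B).inv ≫ g ▷ B = 𝟙 _ := by
  rw [Iso.hom_inv_id_assoc, ← comp_whiskerRight, h, id_whiskerRight]

lemma comul_aux {d : A ⟶ B ⊗ K} {x : B ⟶ S} {y : K ⟶ T} {w : S ⊗ T ⟶ Z} {j : A ⟶ P} {n : P ⟶ Z}
    {s : Z ⟶ B ⊗ T} {s' : P ⟶ B ⊗ T} {q : T ⟶ K} {q' : P ⟶ A} (hs : IsIso s)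
    (h₁ : n ≫ s = s' ≫ (𝟙 _ ⊗ₘ 𝟙 _)) (h₃ : s' ≫ B ◁ q = q' ≫ d) (h₄ : x ▷ T ≫ w ≫ s = 𝟙 _)
    (hy : y ≫ q = 𝟙 _) (hq : q ≫ y = 𝟙 _) (hj : j ≫ q' = 𝟙 _) : d ≫ (x ⊗ₘ y) ≫ w = j ≫ n := by
  have hq' : IsIso q := ⟨y, hq, hy⟩
  rw [id_tensorHom_id, Category.comp_id] at h₁
  rw [← cancel_mono s, ← cancel_mono (B ◁ q), MonoidalCategory.tensorHom_def']
  simp only [Category.assoc, reassoc_of% h₄]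
  rw [reassoc_of% h₁, h₃, ← whiskerLeft_comp, hy, reassoc_of% hj]
  simp

lemma ofNec_aux {R U Y N : C} {d : A ⟶ B ⊗ K} {x : B ⟶ S} {y : K ⟶ T} {w : S ⊗ T ⟶ Z} {j : A ⟶ P}
    {n : P ⟶ Z} {r : S ⟶ R} {u : T ⟶ U} {m : R ⊗ U ⟶ N} {z : Z ⟶ N} {p : P ⟶ Y} {e : Y ⟶ N}
    (h : d ≫ (x ⊗ₘ y) ≫ w = j ≫ n) (h' : w ≫ z = (r ⊗ₘ u) ≫ m) (h'' : n ≫ z = p ≫ e) :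
    d ≫ ((x ≫ r) ⊗ₘ (y ≫ u)) ≫ m = (j ≫ p) ≫ e := by
  rw [← tensorHom_comp_tensorHom, Category.assoc, ← h', Category.assoc, ← h'', ← reassoc_of% h]

lemma split_aux {s : P ⟶ B ⊗ T} {t : T ⟶ K ⊗ 𝟙_ C} {b : A ⟶ A} {u : P ⟶ A ⊗ 𝟙_ C} {d : A ⟶ B ⊗ K}
    (h : u ≫ (b ≫ d) ▷ 𝟙_ C ≫ (α_ _ _ _).hom = s ≫ B ◁ t) (hb : b = 𝟙 _) :
    s ≫ B ◁ (t ≫ (ρ_ _).hom) = (u ≫ (ρ_ _).hom) ≫ d := by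
  rw [whiskerLeft_comp, ← reassoc_of% h, hb]
  simp

end

lemma beadMap_beadNec {m n : ℕ} (f : FInt.Hom m n) :
    beadMap X f ≫ beadNec m = beadNec n ≫ necMap X (bdMap f) (bdl_pos n) := by
  have h := necMap_split X (bdMap f) (bdl_pos n) (Cut.bdl m) (Cut.bdl n) f (fun _ _ ↦ rfl)
    (Nec.Hom.id []) (fun i hi ↦ by
      obtain rfl : i = 0 := by simpa using hi
      exact f.map_last.symm)
  have h' : necMap X (bdMap f) (bdl_pos n) ≫ necBead m = necBead n ≫ beadMap X f := by
    exact (Category.assoc _ _ _).symm.trans ((congrArg (· ≫ (ρ_ _).hom) h).trans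
      ((Category.assoc _ _ _).trans ((congrArg (_ ≫ ·) (unit_aux _)).trans
        (Category.assoc _ _ _).symm)))
  exact conj_aux h' (necBead_beadNec m) (beadNec_necBead n)

lemma beadNec_wedge_split : ∀ (k : ℕ) (T : List ℕ), beadNec (X := X) k ▷ _ ≫
    necWedge X (bdl k) T ≫ split X (Cut.bdlAppend k T) = 𝟙 _
  | 0, T => by
    exact cut_aux' counit_unitInv
  | k + 1, T => by
    exact cut_aux

instance isIso_split_bdlAppend : ∀ (k : ℕ) (T : List ℕ), IsIso (split X (Cut.bdlAppend k T))
  | 0, T => by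
    have : IsIso (unitInv X) := by unfold unitInv; infer_instance
    exact inferInstanceAs (IsIso ((λ_ _).inv ≫ unitInv X ▷ _))
  | k + 1, T => inferInstanceAs (IsIso (𝟙 _))

lemma comul_beadNec (k l : ℕ) : comul X k l ≫ (beadNec k ⊗ₘ beadNec l) ≫
    necWedge X (bdl k) (bdl l) =
      beadNec (k + l) ≫ necMap X (cutMap k l (k + l) rfl) (bdl_pos _) := by
  have h₁ := necMap_split X (cutMap k l (k + l) rfl) (bdl_pos _) (Cut.bdlAppend k (bdl l))
    (Cut.bdlMid k l _ rfl) (FInt.Hom.id k) (fun _ _ ↦ rfl) (Nec.Hom.id _) (fun _ _ ↦ rfl)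
  rw [necMap_id, beadMap_id] at h₁
  exact comul_aux (isIso_split_bdlAppend k _) h₁ (split_aux (split_split X (Cut.bdlMid k l _ rfl) (Cut.bdl l)
    (Cut.bdl (k + l)) rfl) (beadMap_eq_id X _ (fun _ _ ↦ rfl))) (beadNec_wedge_split k (bdl l))
    (beadNec_necBead l) (necBead_beadNec l) (beadNec_necBead (k + l))

variable (σ : ∀ T : Nec, necObj X T.beads ⟶ E.obj (op T))
  (h_nat : ∀ {T U : Nec} (f : T ⟶ U), necMap X f U.pos ≫ σ T = σ U ≫ E.map f.op)
  (h_mul : ∀ T U : Nec, necWedge X T.beads U.beads ≫ σ (T ⊗ U) =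
    (σ T ⊗ₘ σ U) ≫ μ E (op T) (op U))
  (h_unit : σ (𝟙_ Nec) = ε E)

/-- The restriction to simplices of a monoidal natural transformation on necklaces. -/
def BeadHom.ofNec : BeadHom X E where
  app n := beadNec n ≫ σ (bd n)
  natural {m n} f := (Category.assoc _ _ _).symm.trans ((congrArg (· ≫ σ (bd m))
    (beadMap_beadNec f)).trans ((Category.assoc _ _ _).trans ((congrArg (beadNec n ≫ ·)
      (h_nat (bdMap f))).trans (Category.assoc _ _ _).symm)))
  comul k l := ofNec_aux (comul_beadNec k l) (h_mul (bd k) (bd l)) (h_nat (cutMap k l _ rfl))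
  unit := by
    change unitInv X ≫ Functor.OplaxMonoidal.η X ≫ σ (𝟙_ Nec) = _
    exact (cancel_aux unitInv_counit).trans h_unit

lemma BeadHom.ofNec_nec : ∀ (T : List ℕ) (h : ∀ b ∈ T, 0 < b),
    (BeadHom.ofNec σ h_nat h_mul h_unit).nec T h = σ ⟨T, h⟩
  | [], _ => h_unit.symm
  | a :: T, h => by
    have hT : ∀ b ∈ T, 0 < b := fun b hb ↦ h b (List.mem_cons_of_mem _ hb)
    have ih := BeadHom.ofNec_nec T hT
    obtain ⟨a, rfl⟩ := Nat.exists_eq_succ_of_ne_zero (h a (List.mem_cons_self ..)).ne'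
    change ((beadNec (a + 1) ≫ σ (bd (a + 1))) ⊗ₘ nec _ T hT) ≫ _ ≫ _ = _
    rw [ih]
    have h₁ := h_nat (consMap (a + 1) T h)
    refine ofNec_cons_aux (h_mul (bd (a + 1)) ⟨T, hT⟩) ?_ (beadNec_wedge_split (a + 1) T)
    exact (congrArg (· ≫ _) (necMap_id X ((a + 1) :: T) h).symm).trans h₁

lemma BeadHom.nec_app (g : BeadHom X E) (n : ℕ) :
    beadNec n ≫ g.nec (bdl n) (bdl_pos n) = g.app n := by
  cases n with
  | zero =>
    change Functor.OplaxMonoidal.η X ≫ ε E = _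
    rw [← g.unit]
    exact cancel_aux counit_unitInv
  | succ n =>
    have h₁ : E.map (consMap (n + 1) [] (bdl_pos (n + 1))).op =
        E.map (ρ_ (op (bd (n + 1)))).hom :=
      congrArg (fun k ↦ E.map (Quiver.Hom.op k)) (Nec.hom_ext' fun i hi ↦ rfl)
    have h₂ : (ρ_ (bead X (n + 1))).inv ≫ (g.app (n + 1) ⊗ₘ ε E) ≫
        μ E (op (bd (n + 1))) (𝟙_ _) ≫ E.map (ρ_ (op (bd (n + 1)))).hom = g.app (n + 1) := by
      rw [MonoidalCategory.tensorHom_def]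
      simp
    rw [← h₁] at h₂
    exact h₂

end OfNec

end BeadHom

/-! ## Necklace categories as lax monoidal functors -/

section LaxFunctor

variable {V : Type v} [Category.{u} V] [MonoidalCategory V] [HasColimits V]
  [SymmetricCategory V] [MonoidalClosed V]

open Quiv

namespace NecCat

variable (D : NecCat V) {S : Type u} (f : S → D.Obj)

/-- The functor from necklaces to quivers on `S` given by the morphisms of a necklace category. -/
def lax : Necᵒᵖ ⥤ Quiv V S where
  obj T := ⟨fun a b ↦ (D.hom (f a) (f b)).obj T⟩
  map h := ⟨fun a b ↦ (D.hom (f a) (f b)).map h⟩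
  map_id T := by
    ext a b
    exact (D.hom (f a) (f b)).map_id T
  map_comp h k := by
    ext a b
    exact (D.hom (f a) (f b)).map_comp h k

/-- The identities of a necklace category. -/
def laxId (a : S) : 𝟙_ V ⟶ ((D.lax f).obj (𝟙_ Necᵒᵖ)).hom a a := D.id (f a)

/-- The composition of a necklace category. -/
def laxComp (T U : Necᵒᵖ) (a c b : S) : ((D.lax f).obj T).hom a c ⊗ ((D.lax f).obj U).hom c b ⟶
    ((D.lax f).obj (T ⊗ U)).hom a b := D.comp (f a) (f c) (f b) T.unop U.unop

lemma laxComp_assoc (T U R : Necᵒᵖ) (a c d b : S) :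
    D.laxComp f T U a c d ▷ _ ≫ D.laxComp f (T ⊗ U) R a d b ≫
      ((D.lax f).map (α_ T U R).hom).app a b =
    (α_ _ _ _).hom ≫ _ ◁ D.laxComp f U R c d b ≫ D.laxComp f T (U ⊗ R) a c b := by
  have h := D.assoc (f a) (f c) (f d) (f b) T.unop U.unop R.unop
  have h' : (D.hom (f a) (f b)).map (α_ T.unop U.unop R.unop).hom.op ≫
      (D.hom (f a) (f b)).map (α_ T U R).hom = 𝟙 _ := by
    rw [← Functor.map_comp]
    refine Eq.trans (congrArg _ ?_) ((D.hom (f a) (f b)).map_id _)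
    exact (α_ T U R).inv_hom_id
  have h'' := congrArg (· ≫ (D.hom (f a) (f b)).map (α_ T U R).hom) h
  rw [Category.assoc, Category.assoc, Category.assoc, Category.assoc] at h''
  refine h''.trans (congrArg (_ ≫ _ ≫ ·) ?_)
  exact (congrArg (_ ≫ ·) h').trans (Category.comp_id _)

lemma laxId_comp (T : Necᵒᵖ) (a b : S) :
    (λ_ _).hom = D.laxId f a ▷ _ ≫ D.laxComp f (𝟙_ _) T a a b ≫
      ((D.lax f).map (λ_ T).hom).app a b := by
  have h := D.id_comp (f a) (f b) T.unop
  have h' : (D.hom (f a) (f b)).map (λ_ T.unop).hom.op ≫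
      (D.hom (f a) (f b)).map (λ_ T).hom = 𝟙 _ := by
    rw [← Functor.map_comp]
    refine Eq.trans (congrArg _ ?_) ((D.hom (f a) (f b)).map_id _)
    exact (λ_ T).inv_hom_id
  have h'' := congrArg (· ≫ (D.hom (f a) (f b)).map (λ_ T).hom) h
  rw [Category.assoc, Category.assoc, h'] at h''
  exact (Category.comp_id _).symm.trans h''.symm

lemma laxComp_id (T : Necᵒᵖ) (a b : S) :
    (ρ_ _).hom = _ ◁ D.laxId f b ≫ D.laxComp f T (𝟙_ _) a b b ≫
      ((D.lax f).map (ρ_ T).hom).app a b := by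
  have h := D.comp_id (f a) (f b) T.unop
  have h' : (D.hom (f a) (f b)).map (ρ_ T.unop).hom.op ≫
      (D.hom (f a) (f b)).map (ρ_ T).hom = 𝟙 _ := by
    rw [← Functor.map_comp]
    refine Eq.trans (congrArg _ ?_) ((D.hom (f a) (f b)).map_id _)
    exact (ρ_ T).inv_hom_id
  have h'' := congrArg (· ≫ (D.hom (f a) (f b)).map (ρ_ T).hom) h
  rw [Category.assoc, Category.assoc, h'] at h''
  exact (Category.comp_id _).symm.trans h''.symm

/-- The identities of a necklace category as a map of quivers. -/
def laxε : 𝟙_ (Quiv V S) ⟶ (D.lax f).obj (𝟙_ Necᵒᵖ) :=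
  ⟨fun a b ↦ unitDesc fun h ↦ D.laxId f a ≫ eqToHom (by subst h; rfl)⟩

/-- The composition of a necklace category as a map of quivers. -/
def laxμ (T U : Necᵒᵖ) : (D.lax f).obj T ⊗ (D.lax f).obj U ⟶ (D.lax f).obj (T ⊗ U) :=
  ⟨fun a b ↦ desc fun c ↦ D.laxComp f T U a c b⟩

@[simp] lemma unitι_laxε (a : S) : unitι (rfl : a = a) ≫ (D.laxε f).app a a = D.laxId f a :=
  (unitι_desc (fun h : a = a ↦ D.laxId f a ≫ eqToHom (by rfl)) rfl).trans (Category.comp_id _)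

@[simp] lemma ι_laxμ (T U : Necᵒᵖ) (a c b : S) :
    ι ((D.lax f).obj T) ((D.lax f).obj U) a c b ≫ (D.laxμ f T U).app a b =
      D.laxComp f T U a c b :=
  ι_desc _ _

instance : (D.lax f).LaxMonoidal where
  ε := D.laxε f
  μ := D.laxμ f
  μ_natural_left {T T'} g U := by
    ext a b
    refine tensor_ext fun c ↦ ?_
    have h := D.comp_natural (f a) (f c) (f b) g.unop (𝟙 U.unop)
    rw [comp_app, comp_app, ι_whiskerRight_assoc, reassoc_of% ι_laxμ, ι_laxμ]
    rw [op_id, (D.hom (f c) (f b)).map_id, tensorHom_id, tensorHom_id] at h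
    exact h
  μ_natural_right {T T'} U g := by
    ext a b
    refine tensor_ext fun c ↦ ?_
    have h := D.comp_natural (f a) (f c) (f b) (𝟙 U.unop) g.unop
    rw [comp_app, comp_app, ι_whiskerLeft_assoc, reassoc_of% ι_laxμ, ι_laxμ]
    rw [op_id, (D.hom (f a) (f c)).map_id, id_tensorHom, id_tensorHom] at h
    exact h
  associativity T U R := by
    ext a b
    refine tensor_ext fun d ↦ tensorR_ext fun c ↦ ?_
    simp only [comp_app]
    rw [ι_whiskerRight_assoc, ι_associator_hom_assoc, reassoc_of% ι_laxμ,
      ι_whiskerLeft_assoc, ι_laxμ, ← comp_whiskerRight_assoc, ι_laxμ,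
      ← whiskerLeft_comp_assoc, ι_laxμ]
    exact D.laxComp_assoc f T U R a c d b
  left_unitality T := by
    ext a b
    refine tensor_ext fun c ↦ unitR_ext fun h ↦ ?_
    subst h
    simp only [comp_app]
    rw [ι_leftUnitor_hom, ι_whiskerRight_assoc, reassoc_of% ι_laxμ, ← comp_whiskerRight_assoc,
      unitι_laxε]
    exact (Category.comp_id _).trans (D.laxId_comp f T a b)
  right_unitality T := by
    ext a b
    refine tensor_ext fun c ↦ unitL_ext fun h ↦ ?_
    subst h
    simp only [comp_app]
    rw [ι_rightUnitor_hom, ι_whiskerLeft_assoc, reassoc_of% ι_laxμ, ← whiskerLeft_comp_assoc,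
      unitι_laxε]
    exact (Category.comp_id _).trans (D.laxComp_id f T a c)

end NecCat

open Functor.LaxMonoidal

/-- The functor of necklace categories associated to a compatible family of morphisms. -/
def BeadHom.necHom {Y : Templicial V} {D : NecCat V} {f : Y.S → D.Obj}
    (g : BeadHom Y.X (D.lax f)) : HCNerve.nec.obj Y ⟶ D where
  obj := f
  app a b :=
    { app T := (g.nec T.unop.beads T.unop.pos).app a b
      naturality T U h := congrArg (fun k ↦ Quiv.Hom.app k a b)
        (g.nec_natural h.unop U.unop.pos T.unop.pos) }
  map_id a := D.unitι_laxε f a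
  map_comp a b c T U := by
    have h := congrArg (fun k ↦ ι _ _ a b c ≫ Quiv.Hom.app k a c)
      (g.nec_wedge T.beads U.beads T.pos U.pos (T ⊗ U).pos)
    refine (Category.assoc _ _ _).trans (h.trans ?_)
    have h₁ := ι_tensorHom (a := a) (b := c) (c := b) (g.nec T.beads T.pos) (g.nec U.beads U.pos)
    refine (Category.assoc _ _ _).symm.trans ((congrArg (· ≫ _) h₁).trans
      ((Category.assoc _ _ _).trans (congrArg (_ ≫ ·) ?_)))
    exact D.ι_laxμ f (op T) (op U) a b c

variable {Y : Templicial V} {D : NecCat V}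

/-- The map on objects of a functor out of `Y^nec`. -/
abbrev NecCat.Hom.vert (F : HCNerve.nec.obj Y ⟶ D) : Y.S → D.Obj := NecCat.Hom.obj F

/-- The maps of quivers underlying a functor out of `Y^nec`. -/
def NecCat.Hom.quivApp (F : HCNerve.nec.obj Y ⟶ D) (T : Nec) :
    necObj Y.X T.beads ⟶ (D.lax (NecCat.Hom.vert F)).obj (op T) :=
  ⟨fun a b ↦ (NecCat.Hom.app F a b).app (op T)⟩

lemma NecCat.Hom.quivApp_natural (F : HCNerve.nec.obj Y ⟶ D) {T U : Nec} (f : T ⟶ U) :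
    necMap Y.X f U.pos ≫ NecCat.Hom.quivApp F T =
      NecCat.Hom.quivApp F U ≫ (D.lax (NecCat.Hom.vert F)).map f.op := by
  ext a b
  exact (NecCat.Hom.app F a b).naturality f.op

lemma NecCat.Hom.quivApp_wedge (F : HCNerve.nec.obj Y ⟶ D) (T U : Nec) :
    necWedge Y.X T.beads U.beads ≫ NecCat.Hom.quivApp F (T ⊗ U) =
      (NecCat.Hom.quivApp F T ⊗ₘ NecCat.Hom.quivApp F U) ≫ μ _ (op T) (op U) := by
  ext a b
  refine tensor_ext fun c ↦ ?_
  have h := NecCat.Hom.map_comp F a c b T U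
  have h₁ := ι_tensorHom (a := a) (b := b) (c := c)
    (NecCat.Hom.quivApp F T) (NecCat.Hom.quivApp F U)
  refine (Category.assoc _ _ _).symm.trans (h.trans ?_)
  refine Eq.trans ?_ ((Category.assoc _ _ _).symm.trans ((congrArg (· ≫ _) h₁).trans
    (Category.assoc _ _ _))).symm
  exact (congrArg (_ ≫ ·) (D.ι_laxμ _ (op T) (op U) a c b)).symm

lemma NecCat.Hom.quivApp_unit (F : HCNerve.nec.obj Y ⟶ D) :
    NecCat.Hom.quivApp F (𝟙_ Nec) = ε (D.lax (NecCat.Hom.vert F)) := by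
  ext a b
  refine unit_ext fun h ↦ ?_
  subst h
  exact (NecCat.Hom.map_id F a).trans (D.unitι_laxε _ a).symm

/-- The compatible family of morphisms associated to a functor of necklace categories. -/
def NecCat.Hom.beadHom (F : HCNerve.nec.obj Y ⟶ D) : BeadHom Y.X (D.lax (NecCat.Hom.vert F)) :=
  BeadHom.ofNec (E := D.lax (NecCat.Hom.vert F)) (NecCat.Hom.quivApp F)
    (NecCat.Hom.quivApp_natural F) (NecCat.Hom.quivApp_wedge F) (NecCat.Hom.quivApp_unit F)

lemma NecCat.Hom.beadHom_nec (F : HCNerve.nec.obj Y ⟶ D) (a b : Y.S) (T : Nec) :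
    ((NecCat.Hom.beadHom F).nec T.beads T.pos).app a b = (NecCat.Hom.app F a b).app (op T) :=
  congrArg (fun k : necObj Y.X T.beads ⟶ (D.lax (NecCat.Hom.vert F)).obj (op T) ↦ k.app a b)
    (BeadHom.ofNec_nec (E := D.lax (NecCat.Hom.vert F)) (NecCat.Hom.quivApp F)
      (NecCat.Hom.quivApp_natural F) (NecCat.Hom.quivApp_wedge F) (NecCat.Hom.quivApp_unit F)
      T.beads T.pos)

lemma NecCat.Hom.beadHom_necHom (F : HCNerve.nec.obj Y ⟶ D) : (NecCat.Hom.beadHom F).necHom = F :=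
  NecCat.Hom.ext' fun a b T ↦ NecCat.Hom.beadHom_nec F a b T.unop

lemma BeadHom.necHom_beadHom_app {f : Y.S → D.Obj} (g : BeadHom Y.X (D.lax f)) (n : ℕ) :
    (NecCat.Hom.beadHom g.necHom).app n = g.app n := g.nec_app n

/-- Functors of necklace categories out of `Y^nec` are determined by their values at simplices. -/
lemma NecCat.Hom.ext_bead {f : Y.S → D.Obj} {g h : BeadHom Y.X (D.lax f)}
    (w : ∀ n a b, (g.app n).app a b = (h.app n).app a b) : g = h := by
  cases g; cases h
  congr
  ext n a b
  exact w n a b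

end LaxFunctor

/-! ## Cofree coalgebras -/

section ConstrainedProduct

variable {V : Type v} [Category.{u} V] [HasLimits V] {I J : Type} (P : I → V) (R : J → V)
  (s t : J → I) (α : ∀ j, P (s j) ⟶ R j) (β : ∀ j, P (t j) ⟶ R j)

/-- The subobject of the product of the `P i` cut out by the equations `α j (x (s j)) = β j (x (t j))`. -/
abbrev clim : V :=
  equalizer
    (Pi.lift fun j : ULift.{u} J ↦ Pi.π (fun i : ULift.{u} I ↦ P i.down) ⟨s j.down⟩ ≫ α j.down)
    (Pi.lift fun j : ULift.{u} J ↦ Pi.π (fun i : ULift.{u} I ↦ P i.down) ⟨t j.down⟩ ≫ β j.down)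

namespace clim

/-- The projections. -/
def π (i : I) : clim P R s t α β ⟶ P i :=
  equalizer.ι _ _ ≫ Pi.π (fun i : ULift.{u} I ↦ P i.down) ⟨i⟩

lemma condition (j : J) : π P R s t α β (s j) ≫ α j = π P R s t α β (t j) ≫ β j := by
  have h := equalizer.condition
    (Pi.lift fun j : ULift.{u} J ↦ Pi.π (fun i : ULift.{u} I ↦ P i.down) ⟨s j.down⟩ ≫ α j.down)
    (Pi.lift fun j : ULift.{u} J ↦ Pi.π (fun i : ULift.{u} I ↦ P i.down) ⟨t j.down⟩ ≫ β j.down)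
  have h' := congrArg (· ≫ Pi.π (fun j : ULift.{u} J ↦ R j.down) (ULift.up j)) h
  simp only [Category.assoc, Pi.lift_π] at h'
  rw [π, π, Category.assoc, Category.assoc]
  exact h'

variable {P R s t α β}

/-- Morphisms from their components. -/
def lift {A : V} (g : ∀ i, A ⟶ P i) (h : ∀ j, g (s j) ≫ α j = g (t j) ≫ β j) :
    A ⟶ clim P R s t α β :=
  equalizer.lift (Pi.lift fun i ↦ g i.down) (by
    refine Pi.hom_ext _ _ fun j ↦ ?_
    simp only [Category.assoc, Pi.lift_π, Pi.lift_π_assoc]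
    exact h j.down)

@[simp] lemma lift_π {A : V} (g : ∀ i, A ⟶ P i) (h : ∀ j, g (s j) ≫ α j = g (t j) ≫ β j) (i : I) :
    lift g h ≫ π P R s t α β i = g i := by
  rw [lift, π, equalizer.lift_ι_assoc, Pi.lift_π]

lemma hom_ext {A : V} {g h : A ⟶ clim P R s t α β}
    (w : ∀ i, g ≫ π P R s t α β i = h ≫ π P R s t α β i) : g = h := by
  refine equalizer.hom_ext (Pi.hom_ext _ _ fun i ↦ ?_)
  have := w i.down
  rw [π, ← Category.assoc, ← Category.assoc] at this
  exact this

end clim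

end ConstrainedProduct

section Coalgebras

variable {V : Type v} [Category.{u} V] [MonoidalCategory V] [HasColimits V]
  [SymmetricCategory V] [MonoidalClosed V] {S : Type u} (E : Necᵒᵖ ⥤ Quiv V S) [E.LaxMonoidal]

open Nec Functor.LaxMonoidal

/-- The restriction `E(Δ^{n+1}) ⟶ E(Δ^{k+1} ∨ Δ^{l+1})`. -/
abbrev cutE (n k l : ℕ) (h : k + l + 1 = n) :
    E.obj (op (bd (n + 1))) ⟶ E.obj (op (bd (k + 1)) ⊗ op (bd (l + 1))) :=
  E.map (cutMap (k + 1) (l + 1) (n + 1) (by omega)).op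

/-- Coalgebras, concentrated in positive degrees and over `E`. The quiver `X n` has degree
`n + 1`. -/
structure Coalg where
  /-- the underlying quivers -/
  X : ℕ → Quiv V S
  /-- the comultiplication -/
  δ (n k l : ℕ) (h : k + l + 1 = n) : X n ⟶ X k ⊗ X l
  /-- the structure map to `E` -/
  ε (n : ℕ) : X n ⟶ E.obj (op (bd (n + 1)))
  coassoc (n k l m p q : ℕ) (hp : k + l + 1 = p) (hpn : p + m + 1 = n) (hq : l + m + 1 = q)
    (hqn : k + q + 1 = n) :
    δ n p m hpn ≫ δ p k l hp ▷ X m ≫ (α_ _ _ _).hom = δ n k q hqn ≫ X k ◁ δ q l m hq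
  δ_ε (n k l : ℕ) (h : k + l + 1 = n) :
    δ n k l h ≫ (ε k ⊗ₘ ε l) ≫ μ E _ _ = ε n ≫ cutE E n k l h

variable {E}

namespace Coalg

variable (C D : Coalg E)

/-- Maps of coalgebras. -/
structure Hom where
  /-- the components -/
  f (n : ℕ) : C.X n ⟶ D.X n
  δ (n k l : ℕ) (h : k + l + 1 = n) : f n ≫ D.δ n k l h = C.δ n k l h ≫ (f k ⊗ₘ f l)
  ε (n : ℕ) : f n ≫ D.ε n = C.ε n

variable {C} in
/-- The data in degree `n` of a map to the coalgebra `C`. -/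
structure Cone (C : Coalg E) (n : ℕ) (a b : S) (A : V) where
  /-- the structure map -/
  g : A ⟶ (E.obj (op (bd (n + 1)))).hom a b
  /-- the comultiplication -/
  h (k l : ℕ) (e : k + l + 1 = n) : A ⟶ (C.X k ⊗ C.X l).hom a b
  h_g (k l : ℕ) (e : k + l + 1 = n) :
    h k l e ≫ ((C.ε k ⊗ₘ C.ε l) ≫ μ E _ _).app a b = g ≫ (cutE E n k l e).app a b
  h_h (k l m p q : ℕ) (hp : k + l + 1 = p) (hpn : p + m + 1 = n) (hq : l + m + 1 = q)
    (hqn : k + q + 1 = n) : h p m hpn ≫ (C.δ p k l hp ▷ C.X m ≫ (α_ _ _ _).hom).app a b =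
      h k q hqn ≫ (C.X k ◁ C.δ q l m hq).app a b

/-- In degree `n`, the coalgebra `C` is cofree. -/
def IsUniv (n : ℕ) : Prop := ∀ (a b : S) (A : V) (c : C.Cone n a b A),
  ∃! t : A ⟶ (C.X n).hom a b, t ≫ (C.ε n).app a b = c.g ∧
    ∀ k l e, t ≫ (C.δ n k l e).app a b = c.h k l e

variable {C D}

/-- The tautological cone. -/
def cone (C : Coalg E) (n : ℕ) (a b : S) : C.Cone n a b ((C.X n).hom a b) where
  g := (C.ε n).app a b
  h k l e := (C.δ n k l e).app a b
  h_g k l e := congrArg (fun k ↦ Quiv.Hom.app k a b) (C.δ_ε n k l e)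
  h_h k l m p q hp hpn hq hqn := congrArg (fun k ↦ Quiv.Hom.app k a b)
    (C.coassoc n k l m p q hp hpn hq hqn)

/-- Precomposition of cones. -/
def Cone.comp {n : ℕ} {a b : S} {A B : V} (c : C.Cone n a b A) (t : B ⟶ A) : C.Cone n a b B where
  g := t ≫ c.g
  h k l e := t ≫ c.h k l e
  h_g k l e := by rw [Category.assoc, c.h_g, Category.assoc]
  h_h k l m p q hp hpn hq hqn := by
    rw [Category.assoc, c.h_h k l m p q hp hpn hq hqn, Category.assoc]

section

variable {W : Type*} [Category* W] [MonoidalCategory W]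

lemma cone_aux₁ {X Y X' Y' P Q Z : W} {f : X ⟶ X'} {g : Y ⟶ Y'} {e : X' ⟶ P} {e' : Y' ⟶ Q}
    {d : X ⟶ P} {d' : Y ⟶ Q} (h : f ≫ e = d) (h' : g ≫ e' = d') (m : P ⊗ Q ⟶ Z) :
    (f ⊗ₘ g) ≫ (e ⊗ₘ e') ≫ m = (d ⊗ₘ d') ≫ m := by
  rw [tensorHom_comp_tensorHom_assoc, h, h']

lemma cone_aux₂ {X Y X' Y' A B A' B' : W} {f : X ⟶ X'} {g : Y ⟶ Y'} {d : X ⟶ A ⊗ B}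
    {d' : X' ⟶ A' ⊗ B'} {a : A ⟶ A'} {b : B ⟶ B'} (h : f ≫ d' = d ≫ (a ⊗ₘ b)) :
    (f ⊗ₘ g) ≫ d' ▷ Y' ≫ (α_ _ _ _).hom = (d ▷ Y ≫ (α_ _ _ _).hom) ≫ (a ⊗ₘ (b ⊗ₘ g)) := by
  rw [← tensorHom_id, tensorHom_comp_tensorHom_assoc, h, Category.comp_id, Category.assoc,
    ← associator_naturality, ← tensorHom_id, tensorHom_comp_tensorHom_assoc, Category.id_comp]

lemma cone_aux₃ {X Y X' Y' A B A' B' : W} {f : X ⟶ X'} {g : Y ⟶ Y'} {d : X ⟶ A ⊗ B}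
    {d' : X' ⟶ A' ⊗ B'} {a : A ⟶ A'} {b : B ⟶ B'} (h : f ≫ d' = d ≫ (a ⊗ₘ b)) :
    (g ⊗ₘ f) ≫ Y' ◁ d' = Y ◁ d ≫ (g ⊗ₘ (a ⊗ₘ b)) := by
  rw [← id_tensorHom, tensorHom_comp_tensorHom, h, Category.comp_id, ← id_tensorHom,
    tensorHom_comp_tensorHom, Category.id_comp]

end

lemma app_comp_eq {Q P P' R : Quiv V S} {f : Q ⟶ P} {g : P ⟶ R} {f' : Q ⟶ P'} {g' : P' ⟶ R}
    (h : f ≫ g = f' ≫ g') {a b : S} {A : V} (x : A ⟶ Q.hom a b) :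
    (x ≫ f.app a b) ≫ g.app a b = (x ≫ f'.app a b) ≫ g'.app a b := by
  rw [Category.assoc, Category.assoc, ← Quiv.comp_app, h, Quiv.comp_app]

/-- The image of a cone under a map of coalgebras. -/
def Cone.map {n : ℕ} {a b : S} {A : V} (c : C.Cone n a b A) (φ : C.Hom D) : D.Cone n a b A where
  g := c.g
  h k l e := c.h k l e ≫ (φ.f k ⊗ₘ φ.f l).app a b
  h_g k l e := by
    rw [← c.h_g, Category.assoc, ← Quiv.comp_app, cone_aux₁ (φ.ε k) (φ.ε l)]
  h_h k l m p q hp hpn hq hqn := by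
    rw [app_comp_eq (cone_aux₂ (φ.δ p k l hp)), c.h_h k l m p q hp hpn hq hqn]
    exact app_comp_eq (cone_aux₃ (φ.δ q l m hq)).symm _

lemma Cone.ext' {n : ℕ} {a b : S} {A : V} {c c' : C.Cone n a b A} (hg : c.g = c'.g)
    (hh : ∀ k l e, c.h k l e = c'.h k l e) : c = c' := by
  cases c; cases c'
  obtain rfl : _ = _ := hg
  congr
  ext k l e
  exact hh k l e

/-- Cones lift along maps of coalgebras which are isomorphisms in lower degrees. -/
lemma Cone.exists_map {n : ℕ} {a b : S} {A : V} (c : D.Cone n a b A) (φ : C.Hom D)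
    (hφ : ∀ k < n, IsIso (φ.f k)) : ∃ c' : C.Cone n a b A, c'.map φ = c := by
  have hi (k l : ℕ) (e : k + l + 1 = n) : IsIso (φ.f k ⊗ₘ φ.f l) := by
    have := hφ k (by omega)
    have := hφ l (by omega)
    infer_instance
  have hh (k l : ℕ) (e : k + l + 1 = n) : ∃ h : A ⟶ (C.X k ⊗ C.X l).hom a b,
      h ≫ (φ.f k ⊗ₘ φ.f l).app a b = c.h k l e := by
    have := hi k l e
    refine ⟨c.h k l e ≫ (inv (φ.f k ⊗ₘ φ.f l)).app a b, ?_⟩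
    rw [Category.assoc, ← Quiv.comp_app, IsIso.inv_hom_id]
    exact Category.comp_id _
  choose h hh using hh
  refine ⟨⟨c.g, h, fun k l e ↦ ?_, fun k l m p q hp hpn hq hqn ↦ ?_⟩, Cone.ext' rfl hh⟩
  · rw [← c.h_g, ← hh, Category.assoc, ← Quiv.comp_app, cone_aux₁ (φ.ε k) (φ.ε l)]
  · have h₁ := hφ k (by omega)
    have h₂ := hφ l (by omega)
    have h₃ := hφ m (by omega)
    have h₄ : Mono ((φ.f k ⊗ₘ (φ.f l ⊗ₘ φ.f m)).app a b) := by
      refine ⟨fun x y w ↦ ?_⟩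
      have w' := congrArg (· ≫ (inv (φ.f k ⊗ₘ (φ.f l ⊗ₘ φ.f m))).app a b) w
      simp only [Category.assoc] at w'
      rw [← Quiv.comp_app, IsIso.hom_inv_id] at w'
      simpa using w'
    rw [← cancel_mono ((φ.f k ⊗ₘ (φ.f l ⊗ₘ φ.f m)).app a b),
      ← app_comp_eq (cone_aux₂ (φ.δ p k l hp)), ← app_comp_eq (cone_aux₃ (φ.δ q l m hq)), hh, hh]
    exact c.h_h k l m p q hp hpn hq hqn

lemma Cone.map_injective {n : ℕ} {a b : S} {A : V} (φ : C.Hom D) (hφ : ∀ k < n, IsIso (φ.f k))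
    {c c' : C.Cone n a b A} (h : c.map φ = c'.map φ) : c = c' := by
  have hg : c.g = c'.g := congrArg (fun c : D.Cone n a b A ↦ c.g) h
  refine Cone.ext' hg fun k l e ↦ ?_
  have := hφ k (by omega)
  have := hφ l (by omega)
  have w : c.h k l e ≫ (φ.f k ⊗ₘ φ.f l).app a b = c'.h k l e ≫ (φ.f k ⊗ₘ φ.f l).app a b :=
    congrArg (fun c : D.Cone n a b A ↦ c.h k l e) h
  have w' := congrArg (· ≫ (inv (φ.f k ⊗ₘ φ.f l)).app a b) w
  simp only [Category.assoc] at w'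
  rw [← Quiv.comp_app, IsIso.hom_inv_id] at w'
  simpa using w'

lemma isUniv_iff {n : ℕ} : C.IsUniv n ↔ ∀ (a b : S) (A : V) (c : C.Cone n a b A),
    ∃! t : A ⟶ (C.X n).hom a b, (C.cone n a b).comp t = c := by
  refine forall₄_congr fun a b A c ↦ ?_
  refine existsUnique_congr fun t ↦ ⟨fun h ↦ Cone.ext' h.1 h.2, ?_⟩
  rintro rfl
  exact ⟨rfl, fun _ _ _ ↦ rfl⟩

lemma cone_map (φ : C.Hom D) (n : ℕ) (a b : S) :
    (C.cone n a b).map φ = (D.cone n a b).comp ((φ.f n).app a b) :=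
  Cone.ext' (congrArg (fun k ↦ Quiv.Hom.app k a b) (φ.ε n)).symm fun k l e ↦
    (congrArg (fun k ↦ Quiv.Hom.app k a b) (φ.δ n k l e)).symm

lemma Cone.comp_map (φ : C.Hom D) {n : ℕ} {a b : S} {A B : V} (c : C.Cone n a b A) (t : B ⟶ A) :
    (c.comp t).map φ = (c.map φ).comp t := Cone.ext' rfl fun _ _ _ ↦ Category.assoc _ _ _

lemma Cone.comp_comp {n : ℕ} {a b : S} {A B B' : V} (c : C.Cone n a b A) (t : B ⟶ A)
    (s : B' ⟶ B) : (c.comp t).comp s = c.comp (s ≫ t) :=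
  Cone.ext' (Category.assoc _ _ _).symm fun _ _ _ ↦ (Category.assoc _ _ _).symm

lemma Cone.comp_id {n : ℕ} {a b : S} {A : V} (c : C.Cone n a b A) : c.comp (𝟙 A) = c :=
  Cone.ext' (Category.id_comp _) fun _ _ _ ↦ Category.id_comp _

/-- Cofreeness in degree `n` from a universal cone for an isomorphic coalgebra. -/
lemma IsUniv.of_cone (φ : C.Hom D) {n : ℕ} (hφ : ∀ k < n, IsIso (φ.f k))
    (u : ∀ a b, C.Cone n a b ((D.X n).hom a b)) (hu : ∀ a b, (u a b).map φ = D.cone n a b)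
    (h : ∀ a b A (c : C.Cone n a b A), ∃! t, (u a b).comp t = c) : D.IsUniv n := by
  rw [isUniv_iff]
  intro a b A c
  obtain ⟨c', rfl⟩ := c.exists_map φ hφ
  refine (existsUnique_congr fun t ↦ ?_).1 (h a b A c')
  rw [← hu, ← Cone.comp_map]
  exact ⟨fun h ↦ congrArg (fun c ↦ Cone.map c φ) h, fun h ↦ Cone.map_injective φ hφ h⟩

lemma IsUniv.of_isIso (φ : C.Hom D) {n : ℕ} (hφ : ∀ k ≤ n, IsIso (φ.f k)) (h : C.IsUniv n) :
    D.IsUniv n := by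
  have hn := hφ n le_rfl
  have h₁ (a b : S) : (inv (φ.f n)).app a b ≫ (φ.f n).app a b = 𝟙 _ :=
    congrArg (fun k ↦ Quiv.Hom.app k a b) (IsIso.inv_hom_id (φ.f n))
  have h₂ (a b : S) : (φ.f n).app a b ≫ (inv (φ.f n)).app a b = 𝟙 _ :=
    congrArg (fun k ↦ Quiv.Hom.app k a b) (IsIso.hom_inv_id (φ.f n))
  refine IsUniv.of_cone φ (fun k hk ↦ hφ k hk.le)
    (fun a b ↦ (C.cone n a b).comp ((inv (φ.f n)).app a b)) (fun a b ↦ ?_) fun a b A c ↦ ?_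
  · rw [Cone.comp_map, cone_map, Cone.comp_comp, h₁, Cone.comp_id]
  · obtain ⟨t, ht, ht'⟩ := isUniv_iff.1 h a b A c
    refine ⟨t ≫ (φ.f n).app a b, ?_, fun s hs ↦ ?_⟩
    · dsimp only
      rw [Cone.comp_comp, Category.assoc, h₂, Category.comp_id]
      exact ht
    · dsimp only at hs
      rw [Cone.comp_comp] at hs
      rw [← ht' _ hs, Category.assoc, h₁, Category.comp_id]

/-- The indices of the components of a cone. -/
inductive ConeIdx (n : ℕ) : Type
  | base : ConeIdx n
  | cut (k l : ℕ) (h : k + l + 1 = n) : ConeIdx n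

/-- The indices of the equations of a cone. -/
inductive ConeRel (n : ℕ) : Type
  | one (k l : ℕ) (h : k + l + 1 = n) : ConeRel n
  | two (k l m p q : ℕ) (hp : k + l + 1 = p) (hpn : p + m + 1 = n) (hq : l + m + 1 = q)
    (hqn : k + q + 1 = n) : ConeRel n

section

variable [HasLimits V] (C) (n : ℕ) (a b : S)

/-- The targets of the components of a cone. -/
def coneObj : ConeIdx n → V
  | .base => (E.obj (op (bd (n + 1)))).hom a b
  | .cut k l _ => (C.X k ⊗ C.X l).hom a b

/-- The targets of the equations of a cone. -/
def relObj : ConeRel n → V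
  | .one k l _ => (E.obj (op (bd (k + 1)) ⊗ op (bd (l + 1)))).hom a b
  | .two k l m _ _ _ _ _ _ => (C.X k ⊗ (C.X l ⊗ C.X m)).hom a b

/-- The component in the left hand side of an equation. -/
def relLeft : ConeRel n → ConeIdx n
  | .one k l h => .cut k l h
  | .two _ _ m p _ _ hpn _ _ => .cut p m hpn

/-- The component in the right hand side of an equation. -/
def relRight : ConeRel n → ConeIdx n
  | .one _ _ _ => .base
  | .two k _ _ _ q _ _ _ hqn => .cut k q hqn

/-- The left hand side of an equation. -/
def relLeftMap : ∀ j : ConeRel n, C.coneObj n a b (relLeft n j) ⟶ C.relObj n a b j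
  | .one k l _ => ((C.ε k ⊗ₘ C.ε l) ≫ μ E _ _).app a b
  | .two k l m p _ hp _ _ _ => (C.δ p k l hp ▷ C.X m ≫ (α_ _ _ _).hom).app a b

/-- The right hand side of an equation. -/
def relRightMap : ∀ j : ConeRel n, C.coneObj n a b (relRight n j) ⟶ C.relObj n a b j
  | .one k l h => (cutE E n k l h).app a b
  | .two k l m _ q _ _ hq _ => (C.X k ◁ C.δ q l m hq).app a b

/-- The object representing cones. -/
def coneLim : V :=
  clim (C.coneObj n a b) (C.relObj n a b) (relLeft n) (relRight n) (C.relLeftMap n a b)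
    (C.relRightMap n a b)

/-- The universal cone. -/
def univ : C.Cone n a b (C.coneLim n a b) where
  g := clim.π (C.coneObj n a b) (C.relObj n a b) (relLeft n) (relRight n) (C.relLeftMap n a b)
    (C.relRightMap n a b) ConeIdx.base
  h k l e := clim.π (C.coneObj n a b) (C.relObj n a b) (relLeft n) (relRight n)
    (C.relLeftMap n a b) (C.relRightMap n a b) (ConeIdx.cut k l e)
  h_g k l e := clim.condition _ _ _ _ (C.relLeftMap n a b) (C.relRightMap n a b) (.one k l e)
  h_h k l m p q hp hpn hq hqn := clim.condition _ _ _ _ (C.relLeftMap n a b) (C.relRightMap n a b)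
    (.two k l m p q hp hpn hq hqn)

variable {C n a b}

lemma existsUnique_univ_comp {A : V} (c : C.Cone n a b A) : ∃! t, (C.univ n a b).comp t = c := by
  let g : ∀ i, A ⟶ C.coneObj n a b i := fun i ↦ match i with
    | .base => c.g
    | .cut k l e => c.h k l e
  have hg : ∀ j, g (relLeft n j) ≫ C.relLeftMap n a b j =
      g (relRight n j) ≫ C.relRightMap n a b j := fun j ↦ match j with
    | .one k l e => c.h_g k l e
    | .two k l m p q hp hpn hq hqn => c.h_h k l m p q hp hpn hq hqn
  refine ⟨clim.lift g hg, Cone.ext' (clim.lift_π g hg ConeIdx.base) fun k l e ↦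
    clim.lift_π g hg (.cut k l e), fun t ht ↦ clim.hom_ext fun i ↦ ?_⟩
  subst ht
  cases i with
  | base => exact (clim.lift_π g hg ConeIdx.base).symm
  | cut k l e => exact (clim.lift_π g hg (.cut k l e)).symm

/-- The map induced by a cone. -/
def Cone.desc {A : V} (c : C.Cone n a b A) : A ⟶ C.coneLim n a b :=
  (existsUnique_univ_comp c).choose

lemma Cone.comp_desc {A : V} (c : C.Cone n a b A) : (C.univ n a b).comp c.desc = c :=
  (existsUnique_univ_comp c).choose_spec.1

lemma Cone.desc_g {A : V} (c : C.Cone n a b A) : c.desc ≫ (C.univ n a b).g = c.g :=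
  congrArg (fun c ↦ Cone.g c) c.comp_desc

lemma Cone.desc_h {A : V} (c : C.Cone n a b A) (k l : ℕ) (e : k + l + 1 = n) :
    c.desc ≫ (C.univ n a b).h k l e = c.h k l e :=
  congrArg (fun c : C.Cone n a b A ↦ c.h k l e) c.comp_desc

variable (C)

/-- The quivers representing cones. -/
def next₀ (n : ℕ) : Quiv V S := ⟨C.coneLim n⟩

/-- The comultiplication of the universal cone. -/
def next₀h (n k l : ℕ) (h : k + l + 1 = n) : C.next₀ n ⟶ C.X k ⊗ C.X l :=
  ⟨fun a b ↦ (C.univ n a b).h k l h⟩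

/-- The structure map of the universal cone. -/
def next₀g (n : ℕ) : C.next₀ n ⟶ E.obj (op (bd (n + 1))) := ⟨fun a b ↦ (C.univ n a b).g⟩

/-- The comparison map from the coalgebra to the universal cone. -/
def toNext₀ (n : ℕ) : C.X n ⟶ C.next₀ n := ⟨fun a b ↦ (C.cone n a b).desc⟩

lemma toNext₀_h (n k l : ℕ) (h : k + l + 1 = n) : C.toNext₀ n ≫ C.next₀h n k l h = C.δ n k l h := by
  ext a b
  exact Cone.desc_h _ k l h

lemma toNext₀_g (n : ℕ) : C.toNext₀ n ≫ C.next₀g n = C.ε n := by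
  ext a b
  exact Cone.desc_g _

lemma next₀_hg (n k l : ℕ) (e : k + l + 1 = n) :
    C.next₀h n k l e ≫ (C.ε k ⊗ₘ C.ε l) ≫ μ E _ _ = C.next₀g n ≫ cutE E n k l e := by
  ext a b
  exact (C.univ n a b).h_g k l e

lemma next₀_hh (n k l m p q : ℕ) (hp : k + l + 1 = p) (hpn : p + m + 1 = n) (hq : l + m + 1 = q)
    (hqn : k + q + 1 = n) : C.next₀h n p m hpn ≫ C.δ p k l hp ▷ C.X m ≫ (α_ _ _ _).hom =
      C.next₀h n k q hqn ≫ C.X k ◁ C.δ q l m hq := by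
  ext a b
  exact (C.univ n a b).h_h k l m p q hp hpn hq hqn

/-- The coalgebra of universal cones over a coalgebra. -/
def next : Coalg E where
  X := C.next₀
  δ n k l h := C.next₀h n k l h ≫ (C.toNext₀ k ⊗ₘ C.toNext₀ l)
  ε := C.next₀g
  coassoc n k l m p q hp hpn hq hqn := by
    rw [Category.assoc, cone_aux₂ (d := C.δ p k l hp) (a := C.toNext₀ k) (b := C.toNext₀ l)
      (by rw [← toNext₀_h, Category.assoc]), Category.assoc, Category.assoc,
      cone_aux₃ (d := C.δ q l m hq) (a := C.toNext₀ l) (b := C.toNext₀ m)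
      (by rw [← toNext₀_h, Category.assoc])]
    simpa only [Category.assoc] using congrArg
      (· ≫ (C.toNext₀ k ⊗ₘ (C.toNext₀ l ⊗ₘ C.toNext₀ m))) (C.next₀_hh n k l m p q hp hpn hq hqn)
  δ_ε n k l h := by
    rw [Category.assoc, cone_aux₁ (C.toNext₀_g k) (C.toNext₀_g l), next₀_hg]

/-- The comparison map of coalgebras. -/
def toNext : C.Hom C.next where
  f := C.toNext₀
  δ n k l h := by
    rw [← C.toNext₀_h, Category.assoc]
    rfl
  ε := C.toNext₀_g

variable {C}

lemma IsUniv.isIso_toNext {n : ℕ} (h : C.IsUniv n) : IsIso (C.toNext.f n) := by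
  rw [isUniv_iff] at h
  choose t ht ht' using fun a b ↦ h a b _ (C.univ n a b)
  have hc (a b : S) : (C.univ n a b).comp ((C.toNext₀ n).app a b) = C.cone n a b :=
    (C.cone n a b).comp_desc
  refine ⟨⟨fun a b ↦ t a b⟩, ?_, ?_⟩
  · ext a b
    refine (h a b _ (C.cone n a b)).unique ?_ (Cone.comp_id _)
    refine (Cone.comp_comp _ _ _).symm.trans (Eq.trans ?_ (hc a b))
    exact congrArg (fun c ↦ Cone.comp c _) (ht a b)
  · ext a b
    refine (existsUnique_univ_comp (C.univ n a b)).unique ?_ (Cone.comp_id _)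
    refine (Cone.comp_comp _ _ _).symm.trans (Eq.trans ?_ (ht a b))
    exact congrArg (fun c ↦ Cone.comp c _) (hc a b)

lemma isUniv_next {n : ℕ} (h : ∀ k < n, C.IsUniv k) : C.next.IsUniv n := by
  refine IsUniv.of_cone C.toNext (fun k hk ↦ (h k hk).isIso_toNext) (fun a b ↦ C.univ n a b)
    (fun a b ↦ Cone.ext' rfl fun _ _ _ ↦ rfl) fun a b A c ↦ existsUnique_univ_comp c

end

end Coalg

end Coalgebras

section SequentialColimits

variable {V : Type v} [Category.{u} V] [HasColimits V] {S : Type u}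

instance : HasColimitsOfShape ℕ V :=
  hasColimitsOfShape_of_equivalence (ULiftHomULiftCategory.equiv.{u, u} ℕ).symm

namespace Quiv

variable (Q : ℕ → Quiv V S) (t : ∀ N, Q N ⟶ Q (N + 1))

/-- The diagram of the components of a sequence of quivers. -/
abbrev seqFunctor (a b : S) : ℕ ⥤ V := Functor.ofSequence fun N ↦ (t N).app a b

/-- The colimit of a sequence of quivers. -/
def seqColim : Quiv V S := ⟨fun a b ↦ colimit (seqFunctor Q t a b)⟩

/-- The maps to the colimit. -/
def seqι (N : ℕ) : Q N ⟶ seqColim Q t := ⟨fun a b ↦ colimit.ι (seqFunctor Q t a b) N⟩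

lemma seqι_w (N : ℕ) : t N ≫ seqι Q t (N + 1) = seqι Q t N := by
  ext a b
  have h := colimit.w (seqFunctor Q t a b) (homOfLE (Nat.le_add_right N 1))
  rw [Functor.ofSequence_map_homOfLE_succ] at h
  exact h

variable {Q t}

/-- Maps out of a sequential colimit. -/
def seqDesc {P : Quiv V S} (g : ∀ N, Q N ⟶ P) (h : ∀ N, t N ≫ g (N + 1) = g N) :
    seqColim Q t ⟶ P :=
  ⟨fun a b ↦ colimit.desc (seqFunctor Q t a b)
    { pt := P.hom a b
      ι := NatTrans.ofSequence (fun N ↦ (g N).app a b) fun N ↦ by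
        rw [Functor.ofSequence_map_homOfLE_succ]
        exact (congrArg (fun k ↦ Quiv.Hom.app k a b) (h N)).trans (Category.comp_id _).symm }⟩

@[simp] lemma seqι_desc {P : Quiv V S} (g : ∀ N, Q N ⟶ P) (h : ∀ N, t N ≫ g (N + 1) = g N) (N : ℕ) :
    seqι Q t N ≫ seqDesc g h = g N := by
  ext a b
  exact colimit.ι_desc _ _

lemma seq_hom_ext {P : Quiv V S} {f g : seqColim Q t ⟶ P}
    (h : ∀ N, seqι Q t N ≫ f = seqι Q t N ≫ g) : f = g := by
  ext a b
  exact colimit.hom_ext fun N ↦ congrArg (fun k ↦ Quiv.Hom.app k a b) (h N)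

lemma isIso_of_app {P R : Quiv V S} (f : P ⟶ R) (h : ∀ a b, IsIso (f.app a b)) : IsIso f :=
  ⟨⟨fun a b ↦ inv (f.app a b)⟩, by ext a b; simp, by ext a b; simp⟩

lemma isIso_app {P R : Quiv V S} (f : P ⟶ R) [IsIso f] (a b : S) : IsIso (f.app a b) :=
  ⟨(inv f).app a b, congrArg (fun k ↦ Quiv.Hom.app k a b) (IsIso.hom_inv_id f),
    congrArg (fun k ↦ Quiv.Hom.app k a b) (IsIso.inv_hom_id f)⟩

lemma isIso_seqι (N : ℕ) (h : ∀ M, N ≤ M → IsIso (t M)) : IsIso (seqι Q t N) := by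
  refine isIso_of_app _ fun a b ↦ ?_
  have hF : (seqFunctor Q t a b).IsEventuallyConstantFrom N := by
    intro M f
    obtain ⟨k, rfl⟩ := Nat.exists_eq_add_of_le (leOfHom f)
    induction k with
    | zero =>
      rw [Subsingleton.elim f (𝟙 _)]
      infer_instance
    | succ k ih =>
      have h₁ := ih (homOfLE (Nat.le_add_right N k))
      have h₂ := h (N + k) (Nat.le_add_right N k)
      have h₃ : IsIso ((seqFunctor Q t a b).map (homOfLE (Nat.le_add_right (N + k) 1))) := by
        rw [Functor.ofSequence_map_homOfLE_succ]
        exact isIso_app _ a b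
      have h₄ : f = homOfLE (Nat.le_add_right N k) ≫ homOfLE (Nat.le_add_right (N + k) 1) := rfl
      rw [h₄, Functor.map_comp]
      infer_instance
  exact hF.isIso_ι_of_isColimit (colimit.isColimit (seqFunctor Q t a b))

end Quiv

end SequentialColimits

section Cofree

variable {V : Type v} [Category.{u} V] [MonoidalCategory V] [HasColimits V] [HasLimits V]
  [SymmetricCategory V] [MonoidalClosed V] {S : Type u} (E : Necᵒᵖ ⥤ Quiv V S) [E.LaxMonoidal]

open Nec Functor.LaxMonoidal Quiv

namespace Coalg

/-- The initial coalgebra. -/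
def bot : Coalg E where
  X _ := ⟨fun _ _ ↦ ⊥_ V⟩
  δ _ _ _ _ := ⟨fun _ _ ↦ initial.to _⟩
  ε _ := ⟨fun _ _ ↦ initial.to _⟩
  coassoc _ _ _ _ _ _ _ _ _ _ := by
    ext a b
  δ_ε _ _ _ _ := by
    ext a b

/-- The approximations of the cofree coalgebra. -/
def seq : ℕ → Coalg E
  | 0 => bot E
  | N + 1 => (seq N).next

lemma isUniv_seq : ∀ N, ∀ n < N, (seq E N).IsUniv n
  | 0, n, h => absurd h (Nat.not_lt_zero n)
  | N + 1, n, h => isUniv_next fun k hk ↦ isUniv_seq N k (by omega)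

/-- The transition maps of the approximations. -/
abbrev trans (N : ℕ) : (seq E N).Hom (seq E (N + 1)) := (seq E N).toNext

/-- The quivers of the cofree coalgebra. -/
def cofreeX (n : ℕ) : Quiv V S := seqColim (fun N ↦ (seq E N).X n) (fun N ↦ (trans E N).f n)

/-- The maps from the approximations to the cofree coalgebra. -/
def cofreeι (N n : ℕ) : (seq E N).X n ⟶ cofreeX E n :=
  seqι (fun N ↦ (seq E N).X n) (fun N ↦ (trans E N).f n) N

lemma trans_ι (N n : ℕ) : (trans E N).f n ≫ cofreeι E (N + 1) n = cofreeι E N n :=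
  seqι_w (fun N ↦ (seq E N).X n) (fun N ↦ (trans E N).f n) N

variable {E} in
lemma cofree_ext {n : ℕ} {P : Quiv V S} {f g : cofreeX E n ⟶ P}
    (h : ∀ N, cofreeι E N n ≫ f = cofreeι E N n ≫ g) : f = g :=
  seq_hom_ext (Q := fun N ↦ (seq E N).X n) (t := fun N ↦ (trans E N).f n) h

lemma δ_compat (n k l : ℕ) (h : k + l + 1 = n) (N : ℕ) : (trans E N).f n ≫
    (seq E (N + 1)).δ n k l h ≫ (cofreeι E (N + 1) k ⊗ₘ cofreeι E (N + 1) l) =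
      (seq E N).δ n k l h ≫ (cofreeι E N k ⊗ₘ cofreeι E N l) := by
  rw [← Category.assoc, (trans E N).δ, Category.assoc, tensorHom_comp_tensorHom, trans_ι, trans_ι]

/-- The comultiplication of the cofree coalgebra. -/
def cofreeδ (n k l : ℕ) (h : k + l + 1 = n) : cofreeX E n ⟶ cofreeX E k ⊗ cofreeX E l :=
  seqDesc (fun N ↦ (seq E N).δ n k l h ≫ (cofreeι E N k ⊗ₘ cofreeι E N l)) (δ_compat E n k l h)

lemma cofreeι_δ (N n k l : ℕ) (h : k + l + 1 = n) : cofreeι E N n ≫ cofreeδ E n k l h =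
    (seq E N).δ n k l h ≫ (cofreeι E N k ⊗ₘ cofreeι E N l) :=
  seqι_desc (fun N ↦ (seq E N).δ n k l h ≫ (cofreeι E N k ⊗ₘ cofreeι E N l)) (δ_compat E n k l h) N

/-- The structure map of the cofree coalgebra. -/
def cofreeε (n : ℕ) : cofreeX E n ⟶ E.obj (op (bd (n + 1))) :=
  seqDesc (fun N ↦ (seq E N).ε n) fun N ↦ (trans E N).ε n

lemma cofreeι_ε (N n : ℕ) : cofreeι E N n ≫ cofreeε E n = (seq E N).ε n :=
  seqι_desc (fun N ↦ (seq E N).ε n) (fun N ↦ (trans E N).ε n) N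

/-- The cofree coalgebra on `E`. -/
def cofree : Coalg E where
  X := cofreeX E
  δ := cofreeδ E
  ε := cofreeε E
  coassoc n k l m p q hp hpn hq hqn := cofree_ext fun N ↦ by
    rw [← Category.assoc, cofreeι_δ, ← Category.assoc (cofreeι E N n), cofreeι_δ, Category.assoc,
      Category.assoc, cone_aux₂ (cofreeι_δ E N p k l hp), cone_aux₃ (cofreeι_δ E N q l m hq)]
    simpa only [Category.assoc] using congrArg
      (· ≫ (cofreeι E N k ⊗ₘ (cofreeι E N l ⊗ₘ cofreeι E N m)))
        ((seq E N).coassoc n k l m p q hp hpn hq hqn)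
  δ_ε n k l h := cofree_ext fun N ↦ by
    rw [← Category.assoc, cofreeι_δ, ← Category.assoc (cofreeι E N n), cofreeι_ε, Category.assoc,
      cone_aux₁ (cofreeι_ε E N k) (cofreeι_ε E N l), (seq E N).δ_ε]

/-- The maps of coalgebras from the approximations to the cofree coalgebra. -/
def toCofree (N : ℕ) : (seq E N).Hom (cofree E) where
  f := cofreeι E N
  δ := cofreeι_δ E N
  ε := cofreeι_ε E N

lemma isUniv_cofree (n : ℕ) : (cofree E).IsUniv n :=
  IsUniv.of_isIso (toCofree E (n + 1)) (fun k hk ↦ isIso_seqι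
    (Q := fun N ↦ (seq E N).X k) (t := fun N ↦ (trans E N).f k) (n + 1) fun M hM ↦
    (isUniv_seq E M k (by omega)).isIso_toNext) (isUniv_seq E (n + 1) n (Nat.lt_succ_self n))

end Coalg

end Cofree

/-! ## Graded coalgebras -/

section GradedCoalgebras

variable {V : Type v} [Category.{u} V] [MonoidalCategory V] [HasColimits V]
  [SymmetricCategory V] [MonoidalClosed V] {S : Type u}

open Nec Functor.LaxMonoidal

/-- Graded counital coassociative coalgebras in quivers. -/
structure GCoalg (V : Type v) [Category.{u} V] [MonoidalCategory V] [HasColimits V]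
    [SymmetricCategory V] [MonoidalClosed V] (S : Type u) where
  /-- the underlying quivers -/
  X : ℕ → Quiv V S
  /-- the comultiplication -/
  δ (k l n : ℕ) (h : k + l = n) : X n ⟶ X k ⊗ X l
  /-- the counit -/
  η : X 0 ⟶ 𝟙_ _
  coassoc (n k l m p q : ℕ) (hp : k + l = p) (hpn : p + m = n) (hq : l + m = q) (hqn : k + q = n) :
    δ p m n hpn ≫ δ k l p hp ▷ X m ≫ (α_ _ _ _).hom = δ k q n hqn ≫ X k ◁ δ l m q hq
  counit_left (n : ℕ) : δ 0 n n (Nat.zero_add n) ≫ η ▷ X n = (λ_ _).inv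
  counit_right (n : ℕ) : δ n 0 n (Nat.add_zero n) ≫ X n ◁ η = (ρ_ _).inv

section

variable {W : Type*} [Category* W] [MonoidalCategory W] {A B K N : W}

lemma assoc_aux₁ (d : A ⟶ B ⊗ K) :
    d ≫ (λ_ B).inv ▷ K ≫ (α_ (𝟙_ W) B K).hom = (λ_ A).inv ≫ 𝟙_ W ◁ d := by
  rw [← leftUnitor_inv_naturality]
  simp

lemma assoc_aux₂ (d : A ⟶ B ⊗ K) :
    d ≫ (ρ_ B).inv ▷ K ≫ (α_ B (𝟙_ W) K).hom = d ≫ B ◁ (λ_ K).inv := by simp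

lemma assoc_aux₃ (d : A ⟶ B ⊗ K) :
    (ρ_ A).inv ≫ d ▷ 𝟙_ W ≫ (α_ B K (𝟙_ W)).hom = d ≫ B ◁ (ρ_ K).inv := by simp

variable {D : Type*} [Category* D] [MonoidalCategory D] (G : D ⥤ W) [G.LaxMonoidal]

lemma unit_left_aux {P : D} (x : A ⟶ G.obj P) :
    (λ_ A).inv ≫ (ε G ⊗ₘ x) ≫ μ G (𝟙_ D) P = x ≫ G.map (λ_ P).inv := by
  rw [MonoidalCategory.tensorHom_def', Category.assoc, ← leftUnitor_inv_naturality_assoc,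
    left_unitality_inv]

lemma unit_right_aux {P : D} (x : A ⟶ G.obj P) :
    (ρ_ A).inv ≫ (x ⊗ₘ ε G) ≫ μ G P (𝟙_ D) = x ≫ G.map (ρ_ P).inv := by
  rw [MonoidalCategory.tensorHom_def, Category.assoc, ← rightUnitor_inv_naturality_assoc,
    right_unitality_inv]

end

namespace Coalg

variable {E : Necᵒᵖ ⥤ Quiv V S} [E.LaxMonoidal] (C : Coalg E)

/-- The quivers of a coalgebra, with the unit in degree zero. -/
def fX : ℕ → Quiv V S
  | 0 => 𝟙_ _
  | n + 1 => C.X n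

/-- The comultiplication in all degrees. -/
def fδ : ∀ (k l n : ℕ) (_ : k + l = n), C.fX n ⟶ C.fX k ⊗ C.fX l
  | 0, l, n, h => eqToHom (congrArg C.fX (by omega : n = l)) ≫ (λ_ (C.fX l)).inv
  | k + 1, 0, n, h => eqToHom (congrArg C.fX (by omega : n = k + 1)) ≫ (ρ_ (C.fX (k + 1))).inv
  | k + 1, l + 1, 0, h => absurd h (by omega)
  | k + 1, l + 1, n + 1, h => C.δ n k l (by omega)

/-- The structure map in all degrees. -/
def fε : ∀ n, C.fX n ⟶ E.obj (op (bd n))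
  | 0 => Functor.LaxMonoidal.ε E
  | n + 1 => C.ε n

lemma fδ_zero_left (n : ℕ) (h : 0 + n = n) : C.fδ 0 n n h = (λ_ _).inv := Category.id_comp _

lemma fδ_zero_right (n : ℕ) (h : n + 0 = n) : C.fδ n 0 n h = (ρ_ _).inv := by
  cases n with
  | zero => exact (Category.id_comp _).trans unitors_inv_equal
  | succ n => exact Category.id_comp _

lemma fcoassoc (n k l m p q : ℕ) (hp : k + l = p) (hpn : p + m = n) (hq : l + m = q)
    (hqn : k + q = n) :
    C.fδ p m n hpn ≫ C.fδ k l p hp ▷ C.fX m ≫ (α_ _ _ _).hom =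
      C.fδ k q n hqn ≫ C.fX k ◁ C.fδ l m q hq := by
  match k, l, m with
  | 0, l, m =>
    obtain rfl : l = p := by omega
    obtain rfl : q = n := by omega
    rw [fδ_zero_left, fδ_zero_left]
    exact assoc_aux₁ _
  | k + 1, 0, m =>
    obtain rfl : p = k + 1 := by omega
    obtain rfl : q = m := by omega
    rw [fδ_zero_left, fδ_zero_right]
    exact assoc_aux₂ _
  | k + 1, l + 1, 0 =>
    obtain rfl : p = n := by omega
    obtain rfl : q = l + 1 := by omega
    rw [fδ_zero_right, fδ_zero_right]
    exact assoc_aux₃ _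
  | k + 1, l + 1, m + 1 =>
    obtain ⟨p, rfl⟩ := Nat.exists_eq_succ_of_ne_zero (show p ≠ 0 by omega)
    obtain ⟨q, rfl⟩ := Nat.exists_eq_succ_of_ne_zero (show q ≠ 0 by omega)
    obtain ⟨n, rfl⟩ := Nat.exists_eq_succ_of_ne_zero (show n ≠ 0 by omega)
    exact C.coassoc n k l m p q (by omega) (by omega) (by omega) (by omega)

lemma fδ_ε (k l n : ℕ) (h : k + l = n) :
    C.fδ k l n h ≫ (C.fε k ⊗ₘ C.fε l) ≫ μ E _ _ = C.fε n ≫ E.map (cutMap k l n h).op := by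
  match k, l with
  | 0, l =>
    obtain rfl : l = n := by omega
    rw [fδ_zero_left]
    refine (unit_left_aux E (C.fε l)).trans (congrArg (_ ≫ E.map ·) ?_)
    exact congrArg Quiver.Hom.op (Nec.hom_ext' fun i hi ↦ rfl)
  | k + 1, 0 =>
    obtain rfl : n = k + 1 := by omega
    rw [fδ_zero_right]
    refine (unit_right_aux E (C.fε (k + 1))).trans (congrArg (_ ≫ E.map ·) ?_)
    exact congrArg Quiver.Hom.op (Nec.hom_ext' fun i hi ↦ rfl)
  | k + 1, l + 1 =>
    obtain ⟨n, rfl⟩ := Nat.exists_eq_succ_of_ne_zero (show n ≠ 0 by omega)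
    exact C.δ_ε n k l (by omega)

/-- The graded coalgebra associated to a coalgebra in positive degrees. -/
def graded : GCoalg V S where
  X := C.fX
  δ := C.fδ
  η := 𝟙 _
  coassoc := C.fcoassoc
  counit_left n := by
    rw [fδ_zero_left]
    exact (congrArg (_ ≫ ·) (id_whiskerRight _ _)).trans (Category.comp_id _)
  counit_right n := by
    rw [fδ_zero_right]
    exact (congrArg (_ ≫ ·) (whiskerLeft_id _ _)).trans (Category.comp_id _)

end Coalg

section

variable {W : Type*} [Category* W] [MonoidalCategory W] {D : Type*} [Category* D]
  [MonoidalCategory D] (G : D ⥤ W) [G.LaxMonoidal]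

lemma lax_whisker_aux {A B N : W} {P Q R : D} {x : A ⟶ G.obj P} {y : B ⟶ G.obj Q} {d' : Q ⟶ R}
    {d : B ⟶ N} {w : N ⟶ G.obj R} (h : y ≫ G.map d' = d ≫ w) :
    ((x ⊗ₘ y) ≫ μ G P Q) ≫ G.map (P ◁ d') = A ◁ d ≫ (x ⊗ₘ w) ≫ μ G P R := by
  rw [Category.assoc, ← μ_natural_right, ← id_tensorHom, ← id_tensorHom,
    tensorHom_comp_tensorHom_assoc, tensorHom_comp_tensorHom_assoc, h, Category.comp_id,
    Category.id_comp]

lemma lax_tensor_aux {A B : W} {P Q P' Q' : D} {x : A ⟶ G.obj P} {y : B ⟶ G.obj Q} {p : P ⟶ P'}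
    {q : Q ⟶ Q'} {x' : A ⟶ G.obj P'} {y' : B ⟶ G.obj Q'} (h : x ≫ G.map p = x')
    (h' : y ≫ G.map q = y') :
    ((x ⊗ₘ y) ≫ μ G P Q) ≫ G.map (p ⊗ₘ q) = (x' ⊗ₘ y') ≫ μ G P' Q' := by
  rw [Category.assoc, ← μ_natural, tensorHom_comp_tensorHom_assoc, h, h']

lemma counit_left_aux {Y₀ Y : W} {P : D} {x : Y ⟶ G.obj P} {d : Y ⟶ Y₀ ⊗ Y} {e : Y₀ ⟶ 𝟙_ W}
    (h : d ≫ e ▷ Y = (λ_ _).inv) : x ≫ G.map (λ_ P).inv = d ≫ ((e ≫ ε G) ⊗ₘ x) ≫ μ G (𝟙_ D) P := by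
  have h' : ((e ≫ ε G) ⊗ₘ x) = e ▷ Y ≫ (ε G ⊗ₘ x) := by
    rw [← tensorHom_id, tensorHom_comp_tensorHom, Category.id_comp]
  rw [h', Category.assoc, reassoc_of% h]
  exact (unit_left_aux G x).symm

lemma counit_right_aux {Y₀ Y : W} {P : D} {x : Y ⟶ G.obj P} {d : Y ⟶ Y ⊗ Y₀} {e : Y₀ ⟶ 𝟙_ W}
    (h : d ≫ Y ◁ e = (ρ_ _).inv) : x ≫ G.map (ρ_ P).inv = d ≫ (x ⊗ₘ (e ≫ ε G)) ≫ μ G P (𝟙_ D) := by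
  have h' : (x ⊗ₘ (e ≫ ε G)) = Y ◁ e ≫ (x ⊗ₘ ε G) := by
    rw [← id_tensorHom, tensorHom_comp_tensorHom, Category.id_comp]
  rw [h', Category.assoc, reassoc_of% h]
  exact (unit_right_aux G x).symm

end

section Lift

variable {E : Necᵒᵖ ⥤ Quiv V S} [E.LaxMonoidal] (C : Coalg E) {T : Type u} (f : T → S)

/-- A family of maps from quivers on `T` to a coalgebra is compatible with the comultiplications
in positive degrees. -/
lemma Coalg.hom_unique (hC : ∀ n, C.IsUniv n) {Q : ℕ → Type*} {Y : ∀ n, Q n → Quiv V T}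
    {t t' : ∀ n q, Y n q ⟶ (Quiv.pullback f).obj (C.fX n)} (h₀ : ∀ q, t 0 q = t' 0 q)
    (hε : ∀ n q, t n q ≫ (Quiv.pullback f).map (C.fε n) = t' n q ≫ (Quiv.pullback f).map (C.fε n))
    (hδ : ∀ k l n (h : k + l = n) (q : Q n), ∃ (q₁ : Q k) (q₂ : Q l) (d : Y n q ⟶ Y k q₁ ⊗ Y l q₂),
      t n q ≫ (Quiv.pullback f).map (C.fδ k l n h) =
        d ≫ (t k q₁ ⊗ₘ t l q₂) ≫ μ (Quiv.pullback f) _ _ ∧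
      t' n q ≫ (Quiv.pullback f).map (C.fδ k l n h) =
        d ≫ (t' k q₁ ⊗ₘ t' l q₂) ≫ μ (Quiv.pullback f) _ _) (n : ℕ) (q : Q n) :
    t n q = t' n q := by
  induction n using Nat.strong_induction_on with
  | _ n ih =>
    cases n with
    | zero => exact h₀ q
    | succ n =>
      ext a b
      obtain ⟨s, -, hs⟩ := hC n (f a) (f b) _ ((C.cone n (f a) (f b)).comp ((t (n + 1) q).app a b))
      refine (hs _ ⟨rfl, fun _ _ _ ↦ rfl⟩).trans (hs _ ⟨?_, fun k l e ↦ ?_⟩).symm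
      · exact (congrArg (fun k ↦ Quiv.Hom.app k a b) (hε (n + 1) q)).symm
      · obtain ⟨q₁, q₂, d, h₁, h₂⟩ := hδ (k + 1) (l + 1) (n + 1) (by omega) q
        rw [ih (k + 1) (by omega), ih (l + 1) (by omega)] at h₁
        exact congrArg (fun k ↦ Quiv.Hom.app k a b) (h₂.trans h₁.symm)

variable (Y : GCoalg V T)

lemma Coalg.comul_zero_left (n : ℕ) (x : Y.X n ⟶ (Quiv.pullback f).obj (C.fX n)) (h : 0 + n = n) :
    x ≫ (Quiv.pullback f).map (C.fδ 0 n n h) = Y.δ 0 n n h ≫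
      ((Y.η ≫ Functor.LaxMonoidal.ε (Quiv.pullback f)) ⊗ₘ x) ≫ μ (Quiv.pullback f) _ _ := by
  rw [C.fδ_zero_left]
  exact counit_left_aux _ (Y.counit_left n)

lemma Coalg.comul_zero_right (n : ℕ) (x : Y.X n ⟶ (Quiv.pullback f).obj (C.fX n)) (h : n + 0 = n) :
    x ≫ (Quiv.pullback f).map (C.fδ n 0 n h) = Y.δ n 0 n h ≫
      (x ⊗ₘ (Y.η ≫ Functor.LaxMonoidal.ε (Quiv.pullback f))) ≫ μ (Quiv.pullback f) _ _ := by
  rw [C.fδ_zero_right]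
  exact counit_right_aux _ (Y.counit_right n)

variable (g : ∀ n, Y.X n ⟶ (Quiv.pullback f).obj (E.obj (op (bd n))))

/-- The components of the map to a cofree coalgebra determined by `g`. -/
inductive Coalg.IsLift : ∀ n, (Y.X n ⟶ (Quiv.pullback f).obj (C.fX n)) → Prop
  | zero : Coalg.IsLift 0 (Y.η ≫ Functor.LaxMonoidal.ε (Quiv.pullback f))
  | succ (n : ℕ) (x : Y.X (n + 1) ⟶ (Quiv.pullback f).obj (C.fX (n + 1)))
      (t : ∀ k ≤ n, Y.X k ⟶ (Quiv.pullback f).obj (C.fX k))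
      (ht : ∀ k hk, Coalg.IsLift k (t k hk))
      (hε : x ≫ (Quiv.pullback f).map (C.fε (n + 1)) = g (n + 1))
      (hδ : ∀ k l (e : k + l + 1 = n),
        x ≫ (Quiv.pullback f).map (C.fδ (k + 1) (l + 1) (n + 1) (by omega)) =
          Y.δ (k + 1) (l + 1) (n + 1) (by omega) ≫
            (t (k + 1) (by omega) ⊗ₘ t (l + 1) (by omega)) ≫ μ (Quiv.pullback f) _ _) :
      Coalg.IsLift (n + 1) x

variable {C f Y g}

/-- The cone in degree `n + 1` associated to a map in lower degrees. -/
def Coalg.liftCone {n : ℕ} {t : ∀ k ≤ n, Y.X k ⟶ (Quiv.pullback f).obj (C.fX k)}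
    (hg : ∀ k l n (h : k + l = n), Y.δ k l n h ≫ (g k ⊗ₘ g l) ≫ μ (Quiv.pullback f) _ _ ≫
      (Quiv.pullback f).map (μ E _ _) = g n ≫ (Quiv.pullback f).map (E.map (cutMap k l n h).op))
    (hε : ∀ k hk, t k hk ≫ (Quiv.pullback f).map (C.fε k) = g k)
    (hδ : ∀ k l p (hp : p ≤ n) (h : k + l = p), t p hp ≫ (Quiv.pullback f).map (C.fδ k l p h) =
      Y.δ k l p h ≫ (t k (by omega) ⊗ₘ t l (by omega)) ≫ μ (Quiv.pullback f) _ _) (a b : T) :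
    C.Cone n (f a) (f b) ((Y.X (n + 1)).hom a b) where
  g := (g (n + 1)).app a b
  h k l e := (Y.δ (k + 1) (l + 1) (n + 1) (by omega) ≫
    (t (k + 1) (by omega) ⊗ₘ t (l + 1) (by omega)) ≫ μ (Quiv.pullback f) _ _).app a b
  h_g k l e := by
    have h₁ := lax_tensor_aux (Quiv.pullback f) (hε (k + 1) (by omega)) (hε (l + 1) (by omega))
    have h₂ : (Y.δ (k + 1) (l + 1) (n + 1) (by omega) ≫ (t (k + 1) (by omega) ⊗ₘ
        t (l + 1) (by omega)) ≫ μ (Quiv.pullback f) _ _) ≫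
          (Quiv.pullback f).map ((C.fε (k + 1) ⊗ₘ C.fε (l + 1)) ≫ μ E _ _) =
        g (n + 1) ≫ (Quiv.pullback f).map (cutE E n k l e) := by
      rw [Functor.map_comp, Category.assoc, Category.assoc, reassoc_of% h₁]
      exact hg (k + 1) (l + 1) (n + 1) (by omega)
    exact congrArg (fun k ↦ Quiv.Hom.app k a b) h₂
  h_h k l m p q hp hpn hq hqn := by
    have h₁ := hδ (k + 1) (l + 1) (p + 1) (by omega) (by omega)
    have h₂ := hδ (l + 1) (m + 1) (q + 1) (by omega) (by omega)
    have h₃ := func_aux₂ (Quiv.pullback f) (n := t (m + 1) (by omega)) h₁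
    have h₄ := lax_whisker_aux (Quiv.pullback f) (x := t (k + 1) (by omega)) h₂
    have h₅ := Y.coassoc (n + 1) (k + 1) (l + 1) (m + 1) (p + 1) (q + 1) (by omega) (by omega)
      (by omega) (by omega)
    have h₆ : (Y.δ (p + 1) (m + 1) (n + 1) (by omega) ≫ (t (p + 1) (by omega) ⊗ₘ
        t (m + 1) (by omega)) ≫ μ (Quiv.pullback f) _ _) ≫ (Quiv.pullback f).map
          (C.fδ (k + 1) (l + 1) (p + 1) (by omega) ▷ C.fX (m + 1) ≫ (α_ _ _ _).hom) =
        (Y.δ (k + 1) (q + 1) (n + 1) (by omega) ≫ (t (k + 1) (by omega) ⊗ₘ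
          t (q + 1) (by omega)) ≫ μ (Quiv.pullback f) _ _) ≫ (Quiv.pullback f).map
            (C.fX (k + 1) ◁ C.fδ (l + 1) (m + 1) (q + 1) (by omega)) := by
      rw [Category.assoc, ← h₃, Category.assoc (Y.δ (k + 1) (q + 1) (n + 1) _), h₄,
        ← reassoc_of% h₅]
      simp only [Category.assoc]
    exact congrArg (fun k ↦ Quiv.Hom.app k a b) h₆

lemma Coalg.IsLift.ε_eq {n : ℕ} {x : Y.X n ⟶ (Quiv.pullback f).obj (C.fX n)}
    (hg₀ : g 0 = Y.η ≫ Functor.LaxMonoidal.ε (Quiv.pullback f) ≫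
      (Quiv.pullback f).map (Functor.LaxMonoidal.ε E)) (h : C.IsLift f Y g n x) :
    x ≫ (Quiv.pullback f).map (C.fε n) = g n := by
  cases h with
  | zero => exact (Category.assoc _ _ _).trans hg₀.symm
  | succ n x t ht hε hδ => exact hε

lemma Coalg.IsLift.δ_eq {n : ℕ} {x : Y.X n ⟶ (Quiv.pullback f).obj (C.fX n)}
    (hu : ∀ k < n, ∀ y z, C.IsLift f Y g k y → C.IsLift f Y g k z → y = z)
    (h : C.IsLift f Y g n x) {k l : ℕ} (hkl : k + l = n)
    {y : Y.X k ⟶ (Quiv.pullback f).obj (C.fX k)} {z : Y.X l ⟶ (Quiv.pullback f).obj (C.fX l)}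
    (hx : k = n → HEq y x) (hx' : l = n → HEq z x)
    (hy : C.IsLift f Y g k y) (hz : C.IsLift f Y g l z) :
    x ≫ (Quiv.pullback f).map (C.fδ k l n hkl) =
      Y.δ k l n hkl ≫ (y ⊗ₘ z) ≫ μ (Quiv.pullback f) _ _ := by
  match k, l with
  | 0, l =>
    obtain rfl : l = n := by omega
    obtain rfl := eq_of_heq (hx' rfl)
    cases hy
    exact C.comul_zero_left f Y _ z hkl
  | k + 1, 0 =>
    obtain rfl : k + 1 = n := by omega
    obtain rfl := eq_of_heq (hx rfl)
    cases hz
    exact C.comul_zero_right f Y _ y hkl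
  | k + 1, l + 1 =>
    cases h with
    | zero => omega
    | succ n x t ht hε hδ =>
      rw [hδ k l (by omega), hu (k + 1) (by omega) _ _ (ht _ _) hy,
        hu (l + 1) (by omega) _ _ (ht _ _) hz]

lemma Coalg.existsUnique_isLift (hC : ∀ n, C.IsUniv n)
    (hg : ∀ k l n (h : k + l = n), Y.δ k l n h ≫ (g k ⊗ₘ g l) ≫ μ (Quiv.pullback f) _ _ ≫
      (Quiv.pullback f).map (μ E _ _) = g n ≫ (Quiv.pullback f).map (E.map (cutMap k l n h).op))
    (hg₀ : g 0 = Y.η ≫ Functor.LaxMonoidal.ε (Quiv.pullback f) ≫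
      (Quiv.pullback f).map (Functor.LaxMonoidal.ε E)) (n : ℕ) : ∃! x, C.IsLift f Y g n x := by
  induction n using Nat.strong_induction_on with
  | _ n ih =>
    have hu : ∀ k < n, ∀ y z, C.IsLift f Y g k y → C.IsLift f Y g k z → y = z :=
      fun k hk y z hy hz ↦ (ih k hk).unique hy hz
    cases n with
    | zero => exact ⟨_, .zero, fun y hy ↦ by cases hy; rfl⟩
    | succ n =>
      choose t ht _ using fun k (hk : k ≤ n) ↦ ih k (by omega)
      choose s hs hs' using fun a b ↦ hC n (f a) (f b) _ (Coalg.liftCone hg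
        (fun k hk ↦ (ht k hk).ε_eq hg₀)
        (fun k l p hp h ↦ (ht p hp).δ_eq (fun j hj ↦ hu j (by omega)) h
          (by rintro rfl; rfl) (by rintro rfl; rfl) (ht k _) (ht l _)) a b)
      refine ⟨⟨s⟩, .succ n _ t ht ?_ fun k l e ↦ ?_, fun x hx ↦ ?_⟩
      · ext a b
        exact (hs a b).1
      · ext a b
        exact (hs a b).2 k l e
      · ext a b
        refine hs' a b _ ⟨?_, fun k l e ↦ ?_⟩
        · exact congrArg (fun k ↦ Quiv.Hom.app k a b) (hx.ε_eq hg₀)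
        · exact congrArg (fun k ↦ Quiv.Hom.app k a b) (hx.δ_eq hu (show k + 1 + (l + 1) = n + 1 by
            omega) (fun h ↦ absurd h (by omega)) (fun h ↦ absurd h (by omega)) (ht _ _) (ht _ _))

/-- The universal property of a cofree coalgebra. -/
lemma Coalg.exists_lift (hC : ∀ n, C.IsUniv n)
    (hg : ∀ k l n (h : k + l = n), Y.δ k l n h ≫ (g k ⊗ₘ g l) ≫ μ (Quiv.pullback f) _ _ ≫
      (Quiv.pullback f).map (μ E _ _) = g n ≫ (Quiv.pullback f).map (E.map (cutMap k l n h).op))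
    (hg₀ : g 0 = Y.η ≫ Functor.LaxMonoidal.ε (Quiv.pullback f) ≫
      (Quiv.pullback f).map (Functor.LaxMonoidal.ε E)) :
    ∃ t : ∀ n, Y.X n ⟶ (Quiv.pullback f).obj (C.fX n),
      t 0 = Y.η ≫ Functor.LaxMonoidal.ε (Quiv.pullback f) ∧
      (∀ n, t n ≫ (Quiv.pullback f).map (C.fε n) = g n) ∧
      ∀ k l n (h : k + l = n), t n ≫ (Quiv.pullback f).map (C.fδ k l n h) =
        Y.δ k l n h ≫ (t k ⊗ₘ t l) ≫ μ (Quiv.pullback f) _ _ := by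
  choose t ht hu using Coalg.existsUnique_isLift hC hg hg₀
  refine ⟨t, (hu 0 _ .zero).symm, fun n ↦ (ht n).ε_eq hg₀, fun k l n h ↦ ?_⟩
  exact (ht n).δ_eq (fun k _ y z hy hz ↦ (hu k y hy).trans (hu k z hz).symm) h
    (by rintro rfl; rfl) (by rintro rfl; rfl) (ht k) (ht l)

end Lift

end GradedCoalgebras

section Decalage

/-- The restriction of a morphism of finite intervals to a segment of length `l` starting at `i`. -/
def FInt.Hom.seg {m n : ℕ} (φ : FInt.Hom m n) (i l r : ℕ) (h : φ i + r = φ (i + l)) :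
    FInt.Hom l r where
  toFun j := if j ≤ l then φ (i + j) - φ i else r + (j - l)
  mono j k hjk := by
    have h₁ := φ.mono (show i + j ≤ i + k by omega)
    have h₂ := φ.mono (show i ≤ i + j by omega)
    dsimp only
    split_ifs with h₃ h₄ h₄
    · omega
    · have := φ.mono (show i + j ≤ i + l by omega)
      omega
    · omega
    · omega
  map_zero := by simp
  map_add j := by
    split_ifs with h'
    · obtain rfl : j = 0 := by omega
      simp only [Nat.add_zero]
      omega
    · omega

lemma FInt.Hom.seg_apply {m n : ℕ} (φ : FInt.Hom m n) (i l r : ℕ) (h : φ i + r = φ (i + l)) {j : ℕ}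
    (hj : j ≤ l) : φ i + φ.seg i l r h j = φ (i + j) := by
  have h₂ := φ.mono (show i ≤ i + j by omega)
  change φ i + (if j ≤ l then _ else _) = _
  rw [if_pos hj]
  omega

lemma FInt.Hom.seg_zero_apply {m n : ℕ} (φ : FInt.Hom m n) (l r : ℕ) (h : φ 0 + r = φ (0 + l))
    {j : ℕ} (hj : j ≤ l) : φ.seg 0 l r h j = φ j := by
  have h₁ := φ.seg_apply 0 l r h hj
  have h₂ := φ.map_zero
  have h₃ : φ (0 + j) = φ j := by rw [Nat.zero_add]
  omega

lemma FInt.Hom.exists_cut {k l m n : ℕ} (h : k + l = m) (φ : FInt.Hom m n) :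
    ∃ (a c : ℕ) (_ : a + c = n) (φ₁ : FInt.Hom k a) (φ₂ : FInt.Hom l c),
      (∀ i ≤ k, φ₁ i = φ i) ∧ ∀ j ≤ l, a + φ₂ j = φ (k + j) := by
  have h₁ : φ k ≤ n := φ.map_le (by omega)
  have h₂ : φ (k + l) = n := by rw [h, φ.map_last]
  have h₃ : φ 0 = 0 := φ.map_zero
  have h₄ : φ (0 + k) = φ k := by rw [Nat.zero_add]
  exact ⟨φ k, n - φ k, by omega, φ.seg 0 k (φ k) (by omega), φ.seg k l (n - φ k) (by omega),
    fun i hi ↦ φ.seg_zero_apply _ _ _ hi, fun j hj ↦ φ.seg_apply _ _ _ _ hj⟩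

variable {V : Type v} [Category.{u} V] [MonoidalCategory V] [HasColimits V]
  [SymmetricCategory V] [MonoidalClosed V] {S : Type u} (Z : GCoalg V S)

open Nec Functor.LaxMonoidal Quiv

namespace GCoalg

/-- The coproduct of the quivers `Z_n` over all maps `[m] ⟶ [n]`. -/
def sumX (m : ℕ) : Quiv V S :=
  ⟨fun a b ↦ ∐ fun q : ULift.{u} (Σ n, FInt.Hom m n) ↦ (Z.X q.down.1).hom a b⟩

/-- The inclusions of the summands. -/
def incl {m n : ℕ} (φ : FInt.Hom m n) : Z.X n ⟶ Z.sumX m :=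
  ⟨fun a b ↦ Sigma.ι (fun q : ULift.{u} (Σ n, FInt.Hom m n) ↦ (Z.X q.down.1).hom a b) ⟨⟨n, φ⟩⟩⟩

variable {Z}

/-- Maps out of the coproduct. -/
def sumDesc {m : ℕ} {P : Quiv V S} (g : ∀ n, FInt.Hom m n → (Z.X n ⟶ P)) : Z.sumX m ⟶ P :=
  ⟨fun a b ↦ Sigma.desc fun q ↦ (g q.down.1 q.down.2).app a b⟩

@[simp] lemma incl_desc {m n : ℕ} {P : Quiv V S} (g : ∀ n, FInt.Hom m n → (Z.X n ⟶ P))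
    (φ : FInt.Hom m n) : Z.incl φ ≫ sumDesc g = g n φ := by
  ext a b
  exact Sigma.ι_desc (fun q : ULift.{u} (Σ n, FInt.Hom m n) ↦ (g q.down.1 q.down.2).app a b) _

lemma sum_ext {m : ℕ} {P : Quiv V S} {f g : Z.sumX m ⟶ P}
    (h : ∀ n (φ : FInt.Hom m n), Z.incl φ ≫ f = Z.incl φ ≫ g) : f = g := by
  ext a b
  exact Sigma.hom_ext _ _ fun q ↦ congrArg (fun k ↦ Quiv.Hom.app k a b) (h q.down.1 q.down.2)

variable (Z)

/-- The comultiplication of the coproduct. -/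
def sumδ (k l m : ℕ) (h : k + l = m) : Z.sumX m ⟶ Z.sumX k ⊗ Z.sumX l :=
  sumDesc fun n φ ↦ Z.δ (φ k) (n - φ k) n (Nat.add_sub_cancel' (φ.map_le (by omega))) ≫
    (Z.incl (φ.seg 0 k (φ k) (by rw [φ.map_zero, Nat.zero_add, Nat.zero_add])) ⊗ₘ
      Z.incl (φ.seg k l (n - φ k) (by
        rw [h, φ.map_last, Nat.add_sub_cancel' (φ.map_le (by omega))])))

lemma incl_sumδ {k l m : ℕ} (h : k + l = m) {n a c : ℕ} (φ : FInt.Hom m n) (φ₁ : FInt.Hom k a)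
    (φ₂ : FInt.Hom l c) (hac : a + c = n) (h₁ : ∀ i ≤ k, φ₁ i = φ i)
    (h₂ : ∀ j ≤ l, a + φ₂ j = φ (k + j)) :
    Z.incl φ ≫ Z.sumδ k l m h = Z.δ a c n hac ≫ (Z.incl φ₁ ⊗ₘ Z.incl φ₂) := by
  rw [sumδ, incl_desc]
  obtain rfl : a = φ k := φ₁.map_last.symm.trans (h₁ k le_rfl)
  obtain rfl : c = n - φ k := by omega
  congr 3
  · refine FInt.Hom.ext_of_le fun i hi ↦ ?_
    exact (φ.seg_zero_apply _ _ _ hi).trans (h₁ i hi).symm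
  · refine FInt.Hom.ext_of_le fun i hi ↦ ?_
    have := φ.seg_apply k l (n - φ k) (by
        rw [h, φ.map_last, Nat.add_sub_cancel' (φ.map_le (by omega))]) hi
    have := h₂ i hi
    omega

/-- The counit of the coproduct. -/
def sumη : Z.sumX 0 ⟶ 𝟙_ (Quiv V S) :=
  sumDesc fun _ φ ↦ eqToHom (congrArg Z.X (φ.map_last.symm.trans φ.map_zero)) ≫ Z.η

lemma incl_sumη (φ : FInt.Hom 0 0) : Z.incl φ ≫ Z.sumη = Z.η := by
  rw [sumη, incl_desc]
  exact Category.id_comp _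

section

variable {W : Type*} [Category* W] [MonoidalCategory W] {A B K P Q R A' B' K' U : W}

lemma sum_aux₁ {d : A ⟶ P ⊗ K} {e : P ⟶ B ⊗ Q} {i : P ⟶ U} {j : K ⟶ K'} {d' : U ⟶ A' ⊗ B'}
    {x : B ⟶ A'} {y : Q ⟶ B'} (h : i ≫ d' = e ≫ (x ⊗ₘ y)) :
    d ≫ (i ⊗ₘ j) ≫ d' ▷ K' ≫ (α_ _ _ _).hom =
      (d ≫ e ▷ K ≫ (α_ _ _ _).hom) ≫ (x ⊗ₘ (y ⊗ₘ j)) := by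
  have h' : (i ⊗ₘ j) ≫ d' ▷ K' = e ▷ K ≫ ((x ⊗ₘ y) ⊗ₘ j) := by
    rw [← tensorHom_id, ← tensorHom_id, tensorHom_comp_tensorHom, tensorHom_comp_tensorHom, h,
      Category.comp_id, Category.id_comp]
  rw [reassoc_of% h', associator_naturality]
  simp only [Category.assoc]

lemma sum_aux₂ {d : A ⟶ B ⊗ P} {e : P ⟶ Q ⊗ K} {i : B ⟶ A'} {j : P ⟶ U} {d' : U ⟶ B' ⊗ K'}
    {x : Q ⟶ B'} {y : K ⟶ K'} (h : j ≫ d' = e ≫ (x ⊗ₘ y)) :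
    d ≫ (i ⊗ₘ j) ≫ A' ◁ d' = (d ≫ B ◁ e) ≫ (i ⊗ₘ (x ⊗ₘ y)) := by
  have h' : (i ⊗ₘ j) ≫ A' ◁ d' = B ◁ e ≫ (i ⊗ₘ (x ⊗ₘ y)) := by
    rw [← id_tensorHom, ← id_tensorHom, tensorHom_comp_tensorHom, tensorHom_comp_tensorHom, h,
      Category.comp_id, Category.id_comp]
  rw [h', Category.assoc]

lemma sum_aux₃ {d : A ⟶ P ⊗ A} {i : P ⟶ Q} {e : Q ⟶ 𝟙_ W} {e' : P ⟶ 𝟙_ W} {j : A ⟶ B}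
    (h : i ≫ e = e') (h' : d ≫ e' ▷ A = (λ_ A).inv) : d ≫ (i ⊗ₘ j) ≫ e ▷ B = j ≫ (λ_ B).inv := by
  rw [← tensorHom_id, tensorHom_comp_tensorHom, h, Category.comp_id, MonoidalCategory.tensorHom_def,
    reassoc_of% h', leftUnitor_inv_naturality]

lemma sum_aux₄ {d : A ⟶ A ⊗ P} {i : P ⟶ Q} {e : Q ⟶ 𝟙_ W} {e' : P ⟶ 𝟙_ W} {j : A ⟶ B}
    (h : i ≫ e = e') (h' : d ≫ A ◁ e' = (ρ_ A).inv) : d ≫ (j ⊗ₘ i) ≫ B ◁ e = j ≫ (ρ_ B).inv := by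
  rw [← id_tensorHom, tensorHom_comp_tensorHom, h, Category.comp_id,
    MonoidalCategory.tensorHom_def', reassoc_of% h', rightUnitor_inv_naturality]

end

/-- The graded coalgebra of the coproducts of the `Z_n` over all maps `[m] ⟶ [n]`. -/
def sum : GCoalg V S where
  X := Z.sumX
  δ := Z.sumδ
  η := Z.sumη
  coassoc m k l r p q hp hpm hq hqm := sum_ext fun n φ ↦ by
    have m₁ := φ.mono (show k ≤ p by omega)
    have m₂ : φ p ≤ n := φ.map_le (by omega)
    have e₀ := φ.map_zero
    have e₁ : φ (k + l) = φ p := by rw [hp]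
    have e₂ : φ (p + r) = n := by rw [hpm, φ.map_last]
    have e₃ : φ (k + q) = n := by rw [hqm, φ.map_last]
    have e₄ : φ (0 + k) = φ k := by rw [Nat.zero_add]
    have e₅ : φ (0 + p) = φ p := by rw [Nat.zero_add]
    let φ₁ := φ.seg 0 k (φ k) (by omega)
    let φ₂ := φ.seg k l (φ p - φ k) (by omega)
    let φ₃ := φ.seg p r (n - φ p) (by omega)
    let φ₁₂ := φ.seg 0 p (φ p) (by omega)
    let φ₂₃ := φ.seg k q (n - φ k) (by omega)
    have s₁ : ∀ i ≤ k, φ₁ i = φ i := fun i hi ↦ φ.seg_zero_apply _ _ _ hi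
    have s₂ : ∀ i ≤ l, φ k + φ₂ i = φ (k + i) := fun i hi ↦ φ.seg_apply k l _ _ hi
    have s₃ : ∀ i ≤ r, φ p + φ₃ i = φ (p + i) := fun i hi ↦ φ.seg_apply p r _ _ hi
    have s₁₂ : ∀ i ≤ p, φ₁₂ i = φ i := fun i hi ↦ φ.seg_zero_apply _ _ _ hi
    have s₂₃ : ∀ i ≤ q, φ k + φ₂₃ i = φ (k + i) := fun i hi ↦ φ.seg_apply k q _ _ hi
    rw [← Category.assoc, Z.incl_sumδ hpm φ φ₁₂ φ₃ (by omega) s₁₂ s₃, Category.assoc,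
      sum_aux₁ (Z.incl_sumδ hp φ₁₂ φ₁ φ₂ (by omega)
        (fun i hi ↦ (s₁ i hi).trans (s₁₂ i (by omega)).symm)
        (fun i hi ↦ (s₂ i hi).trans (s₁₂ (k + i) (by omega)).symm)),
      Z.coassoc n (φ k) (φ p - φ k) (n - φ p) (φ p) (n - φ k) (by omega) (by omega) (by omega)
        (by omega), ← Category.assoc (Z.incl φ), Z.incl_sumδ hqm φ φ₁ φ₂₃ (by omega) s₁ s₂₃,
      Category.assoc _ (Z.incl φ₁ ⊗ₘ Z.incl φ₂₃), sum_aux₂ (Z.incl_sumδ hq φ₂₃ φ₂ φ₃ (by omega)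
        (fun i hi ↦ by have := s₂ i hi; have := s₂₃ i (by omega); omega)
        (fun i hi ↦ by
          have h₁ := s₃ i hi
          have h₂ := s₂₃ (l + i) (by omega)
          have h₃ : k + (l + i) = p + i := by omega
          rw [h₃] at h₂
          omega))]
  counit_left m := sum_ext fun n φ ↦ by
    rw [← Category.assoc, Z.incl_sumδ (Nat.zero_add m) φ (FInt.Hom.id 0) φ (Nat.zero_add n)
      (fun i hi ↦ by obtain rfl := Nat.le_zero.1 hi; exact φ.map_zero.symm)
      (fun j hj ↦ by rw [Nat.zero_add, Nat.zero_add]), Category.assoc]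
    exact sum_aux₃ (Z.incl_sumη _) (Z.counit_left n)
  counit_right m := sum_ext fun n φ ↦ by
    rw [← Category.assoc, Z.incl_sumδ (Nat.add_zero m) φ φ (FInt.Hom.id 0) (Nat.add_zero n)
      (fun _ _ ↦ rfl) (fun j hj ↦ by obtain rfl := Nat.le_zero.1 hj; exact φ.map_last.symm),
      Category.assoc]
    exact sum_aux₄ (Z.incl_sumη _) (Z.counit_right n)

end GCoalg

end Decalage

section Cofree

variable {V : Type v} [Category.{u} V] [MonoidalCategory V] [HasColimits V]
  [SymmetricCategory V] [MonoidalClosed V] {S : Type u} {E : Necᵒᵖ ⥤ Quiv V S} [E.LaxMonoidal]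
  (C : Coalg E) (hC : ∀ n, C.IsUniv n)

open Nec Functor.LaxMonoidal Quiv

namespace Coalg

lemma hom_unique_id (hC : ∀ n, C.IsUniv n) {Q : ℕ → Type*} {Y : ∀ n, Q n → Quiv V S}
    {t t' : ∀ n q, Y n q ⟶ C.fX n} (h₀ : ∀ q, t 0 q = t' 0 q)
    (hε : ∀ n q, t n q ≫ C.fε n = t' n q ≫ C.fε n)
    (hδ : ∀ k l n (h : k + l = n) (q : Q n), ∃ (q₁ : Q k) (q₂ : Q l) (d : Y n q ⟶ Y k q₁ ⊗ Y l q₂),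
      t n q ≫ C.fδ k l n h = d ≫ (t k q₁ ⊗ₘ t l q₂) ∧
      t' n q ≫ C.fδ k l n h = d ≫ (t' k q₁ ⊗ₘ t' l q₂)) (n : ℕ) (q : Q n) :
    t n q = t' n q := by
  refine hom_unique (f := id) C hC h₀ hε (fun k l n h q ↦ ?_) n q
  obtain ⟨q₁, q₂, d, h₁, h₂⟩ := hδ k l n h q
  refine ⟨q₁, q₂, d, h₁.trans ?_, h₂.trans ?_⟩
  · exact congrArg (d ≫ ·) ((congrArg ((t k q₁ ⊗ₘ t l q₂) ≫ ·) (pullbackμ_id _ _)).trans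
      (Category.comp_id _)).symm
  · exact congrArg (d ≫ ·) ((congrArg ((t' k q₁ ⊗ₘ t' l q₂) ≫ ·) (pullbackμ_id _ _)).trans
      (Category.comp_id _)).symm

variable {C} in
lemma exists_lift_id (hC : ∀ n, C.IsUniv n) {Y : GCoalg V S} {g : ∀ n, Y.X n ⟶ E.obj (op (bd n))}
    (hg : ∀ k l n (h : k + l = n), Y.δ k l n h ≫ (g k ⊗ₘ g l) ≫ μ E _ _ =
      g n ≫ E.map (cutMap k l n h).op)
    (hg₀ : g 0 = Y.η ≫ Functor.LaxMonoidal.ε E) :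
    ∃ t : ∀ n, Y.X n ⟶ C.fX n, t 0 = Y.η ∧ (∀ n, t n ≫ C.fε n = g n) ∧
      ∀ k l n (h : k + l = n), t n ≫ C.fδ k l n h = Y.δ k l n h ≫ (t k ⊗ₘ t l) := by
  obtain ⟨t, h₀, h₁, h₂⟩ := exists_lift (C := C) (f := id) (Y := Y) (g := g) hC
    (fun k l n h ↦ Eq.trans (congrArg (fun m ↦ Y.δ k l n h ≫ (g k ⊗ₘ g l) ≫ m)
      ((congrArg (· ≫ μ E (op (bd k)) (op (bd l))) (pullbackμ_id _ _)).trans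
        (Category.id_comp _))) (hg k l n h))
    (hg₀.trans (congrArg (Y.η ≫ ·) ((congrArg (· ≫ Functor.LaxMonoidal.ε E)
      pullbackε_id).trans (Category.id_comp _)).symm))
  refine ⟨t, h₀.trans ((congrArg (Y.η ≫ ·) pullbackε_id).trans (Category.comp_id _)), h₁,
    fun k l n h ↦ (h₂ k l n h).trans (congrArg (Y.δ k l n h ≫ ·) ?_)⟩
  exact (congrArg ((t k ⊗ₘ t l) ≫ ·) (pullbackμ_id _ _)).trans (Category.comp_id _)

section

variable {W : Type*} [Category* W] [MonoidalCategory W] {A B K P Q R U N M : W}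

lemma tensor_chain_aux {i : A ⟶ B} {s : B ⟶ P ⊗ Q} {d : A ⟶ K ⊗ N} {x : K ⟶ P} {y : N ⟶ Q}
    (h : i ≫ s = d ≫ (x ⊗ₘ y)) {x' : P ⟶ U} {y' : Q ⟶ M} {z : K ⟶ U} {w : N ⟶ M} (hx : x ≫ x' = z)
    (hy : y ≫ y' = w) {m : U ⊗ M ⟶ R} : i ≫ s ≫ (x' ⊗ₘ y') ≫ m = d ≫ (z ⊗ₘ w) ≫ m := by
  rw [reassoc_of% h, tensorHom_comp_tensorHom_assoc, hx, hy]

end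

lemma exists_map (hC : ∀ n, C.IsUniv n) : ∃ t : ∀ {m n : ℕ}, FInt.Hom m n → (C.fX n ⟶ C.fX m),
    (∀ φ : FInt.Hom 0 0, t φ = 𝟙 _) ∧
    (∀ {m n : ℕ} (φ : FInt.Hom m n), t φ ≫ C.fε m = C.fε n ≫ E.map (bdMap φ).op) ∧
    ∀ {k l m n a c : ℕ} (h : k + l = m) (hac : a + c = n) (φ : FInt.Hom m n)
      (φ₁ : FInt.Hom k a) (φ₂ : FInt.Hom l c), (∀ i ≤ k, φ₁ i = φ i) →
      (∀ j ≤ l, a + φ₂ j = φ (k + j)) →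
      t φ ≫ C.fδ k l m h = C.fδ a c n hac ≫ (t φ₁ ⊗ₘ t φ₂) := by
  let g : ∀ m, C.graded.sum.X m ⟶ E.obj (op (bd m)) := fun m ↦
    GCoalg.sumDesc fun n φ ↦ C.fε n ≫ E.map (bdMap φ).op
  have hg (m n : ℕ) (φ : FInt.Hom m n) : C.graded.incl φ ≫ g m = C.fε n ≫ E.map (bdMap φ).op :=
    GCoalg.incl_desc _ φ
  obtain ⟨t, ht₀, htε, htδ⟩ := exists_lift_id (C := C) (Y := C.graded.sum) (g := g) hC
    (fun k l m h ↦ by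
      refine GCoalg.sum_ext fun n φ ↦ ?_
      obtain ⟨a, c, hac, φ₁, φ₂, h₁, h₂⟩ := φ.exists_cut h
      refine (tensor_chain_aux (C.graded.incl_sumδ h φ φ₁ φ₂ hac h₁ h₂) (hg k a φ₁)
        (hg l c φ₂)).trans ?_
      have e₁ := congrArg (C.fδ a c n hac ≫ ·) (lax_tensor_aux E (x := C.fε a) (y := C.fε c)
        (p := (bdMap φ₁).op) (q := (bdMap φ₂).op) rfl rfl)
      have e₂ := congrArg (· ≫ E.map ((bdMap φ₁).op ⊗ₘ (bdMap φ₂).op)) (C.fδ_ε a c n hac)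
      have e₃ := map_comp_of_eq E (f := bdMap φ₁ ⊗ₘ bdMap φ₂) (g := cutMap a c n hac)
        (h := cutMap k l m h ≫ bdMap φ) (Nec.hom_ext' fun i hi ↦ by
          simp only [comp_vert, tensorHom_vert, cutMap_vert, bdMap_vert, bd_len]
          split_ifs with h'
          · exact h₁ i h'
          · rw [tensor_len, bd_len, bd_len] at hi
            rw [h₂ (i - k) (by omega)]
            congr 1
            omega)
      refine e₁.symm.trans (((congrArg (_ ≫ ·) (Category.assoc _ _ _)).trans ?_).trans
        (e₂.trans ((Category.assoc _ _ _).trans ((congrArg (_ ≫ ·) e₃).trans ?_))))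
      · simp only [Category.assoc]
      · refine Eq.trans ?_ ((Category.assoc _ _ _).symm.trans
          ((congrArg (· ≫ E.map (cutMap k l m h).op) (hg m n φ)))).symm
        rw [op_comp, E.map_comp]
        exact (Category.assoc _ _ _).symm) (by
      refine GCoalg.sum_ext fun n φ ↦ ?_
      obtain rfl : n = 0 := φ.map_last.symm.trans φ.map_zero
      refine (hg 0 0 φ).trans (Eq.trans ?_ ((Category.assoc _ _ _).symm.trans
        (congrArg (· ≫ Functor.LaxMonoidal.ε E) (C.graded.incl_sumη φ))).symm)
      have e : E.map (bdMap φ).op = 𝟙 _ := (congrArg (fun k ↦ E.map (Quiver.Hom.op k))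
        (Nec.hom_ext' (g := 𝟙 _) fun i hi ↦ by
          obtain rfl : i = 0 := Nat.le_zero.1 (hi.trans (bd_len 0).le)
          exact φ.map_zero)).trans (E.map_id _)
      rw [e, Category.comp_id]
      exact (Category.id_comp _).symm)
  refine ⟨fun {m n} φ ↦ C.graded.incl φ ≫ t m, fun φ ↦ ?_, fun {m n} φ ↦ ?_,
    fun {k l m n a c} h hac φ φ₁ φ₂ h₁ h₂ ↦ ?_⟩
  · exact (congrArg (_ ≫ ·) ht₀).trans (C.graded.incl_sumη φ)
  · exact (Category.assoc _ _ _).trans ((congrArg (_ ≫ ·) (htε m)).trans (hg m n φ))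
  · have e₁ := C.graded.incl_sumδ h φ φ₁ φ₂ hac h₁ h₂
    have e₂ := tensor_chain_aux e₁ (x' := t k) (y' := t l) rfl rfl (m := 𝟙 _)
    rw [Category.comp_id, Category.comp_id] at e₂
    exact (Category.assoc _ _ _).trans ((congrArg (_ ≫ ·) (htδ k l m h)).trans e₂)

end Coalg

end Cofree

section Cofree

variable {V : Type v} [Category.{u} V] [MonoidalCategory V] [HasColimits V]
  [SymmetricCategory V] [MonoidalClosed V] {S : Type u} {E : Necᵒᵖ ⥤ Quiv V S} [E.LaxMonoidal]
  {C : Coalg E} (hC : ∀ n, C.IsUniv n)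

open Nec Functor.LaxMonoidal Quiv

namespace Coalg

/-- The action of the maps of finite intervals on a cofree coalgebra. -/
def mapHom {m n : ℕ} (φ : FInt.Hom m n) : C.fX n ⟶ C.fX m :=
  (exists_map C hC).choose φ

lemma mapHom_zero (φ : FInt.Hom 0 0) : mapHom hC φ = 𝟙 _ :=
  (exists_map C hC).choose_spec.1 φ

lemma mapHom_ε {m n : ℕ} (φ : FInt.Hom m n) :
    mapHom hC φ ≫ C.fε m = C.fε n ≫ E.map (bdMap φ).op :=
  (exists_map C hC).choose_spec.2.1 φ

lemma mapHom_δ {k l m n a c : ℕ} (h : k + l = m) (hac : a + c = n) (φ : FInt.Hom m n)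
    (φ₁ : FInt.Hom k a) (φ₂ : FInt.Hom l c) (h₁ : ∀ i ≤ k, φ₁ i = φ i)
    (h₂ : ∀ j ≤ l, a + φ₂ j = φ (k + j)) :
    mapHom hC φ ≫ C.fδ k l m h = C.fδ a c n hac ≫ (mapHom hC φ₁ ⊗ₘ mapHom hC φ₂) :=
  (exists_map C hC).choose_spec.2.2 h hac φ φ₁ φ₂ h₁ h₂

lemma mapHom_id (m : ℕ) : mapHom hC (FInt.Hom.id m) = 𝟙 _ := by
  refine hom_unique_id C hC (Q := fun _ ↦ Unit) (Y := fun n _ ↦ C.fX n)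
    (t := fun n _ ↦ mapHom hC (FInt.Hom.id n)) (t' := fun n _ ↦ 𝟙 _) (fun _ ↦ mapHom_zero hC _)
    (fun n _ ↦ ?_) (fun k l n h _ ↦ ⟨(), (), C.fδ k l n h, ?_, ?_⟩) m ()
  · rw [mapHom_ε, Category.id_comp]
    exact (congrArg (_ ≫ ·) (E.map_id _)).trans (Category.comp_id _)
  · exact mapHom_δ hC h h _ _ _ (fun _ _ ↦ rfl) (fun _ _ ↦ rfl)
  · rw [id_tensorHom_id, Category.comp_id, Category.id_comp]

lemma mapHom_comp {m n p : ℕ} (φ : FInt.Hom m n) (ψ : FInt.Hom n p) :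
    mapHom hC (φ.comp ψ) = mapHom hC ψ ≫ mapHom hC φ := by
  refine hom_unique_id C hC (Q := fun m ↦ Σ (n p : ℕ), FInt.Hom m n × FInt.Hom n p)
    (Y := fun _ q ↦ C.fX q.2.1) (t := fun _ q ↦ mapHom hC (q.2.2.1.comp q.2.2.2))
    (t' := fun _ q ↦ mapHom hC q.2.2.2 ≫ mapHom hC q.2.2.1) ?_ ?_ ?_ m ⟨n, p, φ, ψ⟩
  · rintro ⟨n, p, φ, ψ⟩
    obtain rfl : n = 0 := φ.map_last.symm.trans φ.map_zero
    obtain rfl : p = 0 := ψ.map_last.symm.trans ψ.map_zero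
    dsimp only
    rw [mapHom_zero, mapHom_zero, mapHom_zero, Category.comp_id]
  · rintro m ⟨n, p, φ, ψ⟩
    dsimp only
    rw [Category.assoc, mapHom_ε, mapHom_ε, ← Category.assoc, mapHom_ε, Category.assoc]
    exact congrArg (_ ≫ ·) (map_comp_of_eq E (f := bdMap φ) (g := bdMap ψ)
      (h := bdMap (φ.comp ψ)) (Nec.hom_ext' fun i hi ↦ rfl)).symm
  · rintro k l m h ⟨n, p, φ, ψ⟩
    obtain ⟨a, c, hac, φ₁, φ₂, h₁, h₂⟩ := φ.exists_cut h
    obtain ⟨a', c', hac', ψ₁, ψ₂, h₁', h₂'⟩ := ψ.exists_cut hac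
    refine ⟨⟨a, a', φ₁, ψ₁⟩, ⟨c, c', φ₂, ψ₂⟩, C.fδ a' c' p hac', ?_, ?_⟩
    · refine mapHom_δ hC h hac' _ _ _ (fun i hi ↦ ?_) (fun j hj ↦ ?_)
      · exact (h₁' _ (φ₁.map_le hi)).trans (congrArg ψ (h₁ i hi))
      · exact (h₂' _ (φ₂.map_le hj)).trans (congrArg ψ (h₂ j hj))
    · dsimp only
      rw [Category.assoc, mapHom_δ hC h hac φ φ₁ φ₂ h₁ h₂, ← Category.assoc,
        mapHom_δ hC hac hac' ψ ψ₁ ψ₂ h₁' h₂', Category.assoc, tensorHom_comp_tensorHom]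

/-- The functor on finite intervals given by a cofree coalgebra. -/
def functor : FIntᵒᵖ ⥤ Quiv V S where
  obj m := C.fX m.unop.len
  map φ := mapHom hC φ.unop
  map_id m := mapHom_id hC m.unop.len
  map_comp φ ψ := mapHom_comp hC ψ.unop φ.unop

lemma functor_assoc_aux {W : Type*} [Category* W] [MonoidalCategory W] {A B K P Q R P' : W}
    {a : A ⟶ B} {d : A ⟶ P ⊗ Q} {d' : B ⟶ P ⊗ Q} {i : P ⟶ P} {j : Q ⟶ Q} (hi : i = 𝟙 _)
    (hj : j = 𝟙 _) (h : a ≫ d' = d ≫ (i ⊗ₘ j)) {e : Q ⟶ R ⊗ K} {s : A ⟶ P' ⊗ K}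
    {s' : P' ⟶ P ⊗ R} (h' : s ≫ s' ▷ K ≫ (α_ _ _ _).hom = d ≫ P ◁ e) :
    s ≫ s' ▷ K ≫ (α_ _ _ _).hom = a ≫ d' ≫ P ◁ e := by
  rw [h', reassoc_of% h, hi, hj]
  simp

lemma functor_left_aux {W : Type*} [Category* W] [MonoidalCategory W] {A B : W} {a : A ⟶ B}
    {d : A ⟶ 𝟙_ W ⊗ A} {d' : B ⟶ 𝟙_ W ⊗ A} {i : 𝟙_ W ⟶ 𝟙_ W} {j : A ⟶ A} (hi : i = 𝟙 _)
    (hj : j = 𝟙 _) (h : a ≫ d' = d ≫ (i ⊗ₘ j)) (hd : d = (λ_ _).inv) :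
    (λ_ _).inv = a ≫ d' ≫ 𝟙 (𝟙_ W) ▷ A := by
  rw [← Category.assoc, h, hi, hj, hd]
  simp

lemma functor_right_aux {W : Type*} [Category* W] [MonoidalCategory W] {A B : W} {a : A ⟶ B}
    {d : A ⟶ A ⊗ 𝟙_ W} {d' : B ⟶ A ⊗ 𝟙_ W} {i : 𝟙_ W ⟶ 𝟙_ W} {j : A ⟶ A} (hi : i = 𝟙 _)
    (hj : j = 𝟙 _) (h : a ≫ d' = d ≫ (j ⊗ₘ i)) (hd : d = (ρ_ _).inv) :
    (ρ_ _).inv = a ≫ d' ≫ A ◁ 𝟙 (𝟙_ W) := by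
  rw [← Category.assoc, h, hi, hj, hd]
  simp

instance : (functor hC).OplaxMonoidal where
  η := 𝟙 (𝟙_ (Quiv V S))
  δ m n := C.fδ m.unop.len n.unop.len _ rfl
  δ_natural_left {m m'} f n := by
    have h := mapHom_δ hC (k := m'.unop.len) (l := n.unop.len) rfl rfl
      (FInt.Hom.add f.unop (FInt.Hom.id n.unop.len)) f.unop (FInt.Hom.id n.unop.len)
      (fun i hi ↦ (if_pos hi).symm) (fun j hj ↦ by
        change _ = if _ then _ else _
        split_ifs with h
        · obtain rfl : j = 0 := by omega
          exact f.unop.map_last.symm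
        · rw [Nat.add_sub_cancel_left])
    rw [mapHom_id, tensorHom_id] at h
    exact h.symm
  δ_natural_right {m m'} n f := by
    have h := mapHom_δ hC (k := n.unop.len) (l := m'.unop.len) rfl rfl
      (FInt.Hom.add (FInt.Hom.id n.unop.len) f.unop) (FInt.Hom.id n.unop.len) f.unop
      (fun i hi ↦ (if_pos hi).symm) (fun j hj ↦ by
        change _ = if _ then _ else _
        split_ifs with h
        · obtain rfl : j = 0 := by omega
          have := f.unop.map_zero
          change n.unop.len + f.unop.toFun 0 = n.unop.len + 0
          omega
        · rw [Nat.add_sub_cancel_left])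
    rw [mapHom_id, id_tensorHom] at h
    exact h.symm
  oplax_associativity m n p := functor_assoc_aux (mapHom_id hC m.unop.len)
    (mapHom_id hC (n.unop.len + p.unop.len))
    (mapHom_δ hC (k := m.unop.len) (l := n.unop.len + p.unop.len) rfl (Nat.add_assoc _ _ _).symm
      (α_ m.unop n.unop p.unop).inv (FInt.Hom.id _) (FInt.Hom.id _) (fun _ _ ↦ rfl)
      (fun _ _ ↦ rfl))
    (C.fcoassoc _ _ _ _ _ _ rfl rfl rfl (Nat.add_assoc _ _ _).symm)
  oplax_left_unitality n := functor_left_aux (mapHom_zero hC (FInt.Hom.id 0))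
    (mapHom_id hC n.unop.len) (mapHom_δ hC (k := 0) (l := n.unop.len) rfl (Nat.zero_add _)
      (λ_ n.unop).hom (FInt.Hom.id _) (FInt.Hom.id _) (fun _ _ ↦ rfl)
      (fun _ _ ↦ rfl)) (C.fδ_zero_left _ _)
  oplax_right_unitality n := functor_right_aux (mapHom_zero hC (FInt.Hom.id 0))
    (mapHom_id hC n.unop.len) (mapHom_δ hC (k := n.unop.len) (l := 0) rfl (Nat.add_zero _)
      (ρ_ n.unop).hom (FInt.Hom.id _) (FInt.Hom.id _) (fun _ _ ↦ rfl)
      (fun _ _ ↦ rfl)) (C.fδ_zero_right _ _)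

instance : IsIso (Functor.OplaxMonoidal.η (functor hC)) := inferInstanceAs (IsIso (𝟙 _))

/-- The compatible family of structure maps of a cofree coalgebra. -/
def beadHom : BeadHom (functor hC) E where
  app := C.fε
  natural f := mapHom_ε hC f
  comul k l := C.fδ_ε k l _ rfl
  unit := by
    have h : unitInv (functor hC) = 𝟙 (𝟙_ (Quiv V S)) := IsIso.inv_id
    exact (congrArg (· ≫ Functor.LaxMonoidal.ε E) h).trans (Category.id_comp _)

end Coalg

end Cofree

/-! ## The right adjoint of `(-)^nec` -/

section Comul

variable {W : Type v} [Category.{u} W] [MonoidalCategory W] (X : FIntᵒᵖ ⥤ W) [X.OplaxMonoidal]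
  [IsIso (Functor.OplaxMonoidal.η X)]

/-- The comultiplication `X_n ⟶ X_k ⊗ X_l` for `k + l = n`. -/
def comulOf (k l n : ℕ) (h : k + l = n) : bead X n ⟶ bead X k ⊗ bead X l :=
  beadMap X (FInt.Hom.cast h) ≫ comul X k l

lemma comulOf_rfl (k l : ℕ) : comulOf X k l _ rfl = comul X k l :=
  (congrArg (· ≫ comul X k l) (beadMap_id X _)).trans (Category.id_comp _)

lemma comulOf_natural {k l m n a c : ℕ} (h : k + l = m) (hac : a + c = n) (φ : FInt.Hom m n)
    (φ₁ : FInt.Hom k a) (φ₂ : FInt.Hom l c) (h₁ : ∀ i ≤ k, φ₁ i = φ i)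
    (h₂ : ∀ j ≤ l, a + φ₂ j = φ (k + j)) :
    beadMap X φ ≫ comulOf X k l m h = comulOf X a c n hac ≫ (beadMap X φ₁ ⊗ₘ beadMap X φ₂) := by
  subst h hac
  rw [comulOf_rfl, comulOf_rfl, ← comul_natural]
  congr 2
  refine FInt.Hom.ext_of_le fun i hi ↦ ?_
  change _ = if _ then _ else _
  split_ifs with h
  · exact (h₁ i h).symm
  · rw [h₂ (i - k) (by omega)]
    congr 1
    omega

lemma comulOf_zero_left (n : ℕ) :
    comulOf X 0 n n (Nat.zero_add n) ≫ Functor.OplaxMonoidal.η X ▷ bead X n = (λ_ _).inv := by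
  have h : (λ_ (bead X n)).inv = beadMap X (FInt.Hom.cast (Nat.zero_add n)) ≫ comul X 0 n ≫
      Functor.OplaxMonoidal.η X ▷ _ := Functor.OplaxMonoidal.left_unitality (F := X) (op ⟨n⟩)
  exact (Category.assoc _ _ _).trans h.symm

lemma comulOf_zero_right (n : ℕ) :
    comulOf X n 0 n (Nat.add_zero n) ≫ bead X n ◁ Functor.OplaxMonoidal.η X = (ρ_ _).inv := by
  have h : (ρ_ (bead X n)).inv = beadMap X (FInt.Hom.cast (Nat.add_zero n)) ≫ comul X n 0 ≫
      _ ◁ Functor.OplaxMonoidal.η X := Functor.OplaxMonoidal.right_unitality (F := X) (op ⟨n⟩)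
  exact (Category.assoc _ _ _).trans h.symm

lemma comulOf_assoc (n k l m p q : ℕ) (hp : k + l = p) (hpn : p + m = n) (hq : l + m = q)
    (hqn : k + q = n) :
    comulOf X p m n hpn ≫ comulOf X k l p hp ▷ bead X m ≫ (α_ _ _ _).hom =
      comulOf X k q n hqn ≫ bead X k ◁ comulOf X l m q hq := by
  subst hp hpn hq
  rw [comulOf_rfl, comulOf_rfl, comulOf_rfl, comul_assoc, comulOf, Category.assoc]

end Comul

section Temp

variable {V : Type v} [Category.{u} V] [MonoidalCategory V] [HasColimits V]
  [SymmetricCategory V] [MonoidalClosed V]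

open Nec Functor.LaxMonoidal Quiv

/-- A templicial object as a graded coalgebra. -/
def Templicial.gcoalg (Y : Templicial V) : GCoalg V Y.S where
  X := bead Y.X
  δ := comulOf Y.X
  η := Functor.OplaxMonoidal.η Y.X
  coassoc := comulOf_assoc Y.X
  counit_left := comulOf_zero_left Y.X
  counit_right := comulOf_zero_right Y.X

lemma beadNec_necApp {Y X : Templicial V} (G : Templicial.Hom Y X) : ∀ n,
    beadNec (X := Y.X) n ≫ necApp G.app (bdl n) = beadApp G.app n ≫ (Quiv.pullback G.map).map (beadNec (X := X.X) n)
  | 0 => G.app_counit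
  | n + 1 => unit_right_aux (Quiv.pullback G.map) (beadApp G.app (n + 1))

lemma BeadHom.comp_necHom_app {Y X : Templicial V} (G : Templicial.Hom Y X) {D : NecCat V}
    {f : X.S → D.Obj} (g : BeadHom X.X (D.lax f)) (n : ℕ) :
    (NecCat.Hom.beadHom (HCNerve.nec.map (X := Y) (Y := X) G ≫ g.necHom)).app n =
      beadApp G.app n ≫ (Quiv.pullback G.map).map (g.app n) := by
  have h₁ := congrArg (· ≫ (Quiv.pullback G.map).map (g.nec (bdl n) (bdl_pos n)))
    (beadNec_necApp G n)
  have h₂ := congrArg (beadApp G.app n ≫ (Quiv.pullback G.map).map ·) (g.nec_app n)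
  refine Eq.trans ?_ (h₁.trans (Eq.trans ?_ h₂))
  · exact Quiv.hom_ext fun a b ↦ (Category.assoc ((beadNec (X := Y.X) n).app a b)
      ((necApp G.app (bdl n)).app a b) ((g.nec (bdl n) (bdl_pos n)).app _ _)).symm
  · exact (Category.assoc (beadApp G.app n) _ _).trans
      (congrArg (_ ≫ ·) ((Quiv.pullback G.map).map_comp _ _).symm)

variable {D : NecCat V}

lemma NecCat.pullback_laxμ {S T : Type u} (f : S → T) (g : T → D.Obj) (P Q : Necᵒᵖ) :
    μ (Quiv.pullback f) _ _ ≫ (Quiv.pullback f).map (D.laxμ g P Q) = D.laxμ (g ∘ f) P Q := by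
  ext a b
  refine tensor_ext fun c ↦ ?_
  refine (Category.assoc _ _ _).symm.trans ((congrArg (· ≫ _) (ι_pullbackμ f _ _ a c b)).trans ?_)
  exact (D.ι_laxμ g P Q (f a) (f c) (f b)).trans (D.ι_laxμ (g ∘ f) P Q a c b).symm

lemma NecCat.pullback_laxε {S T : Type u} (f : S → T) (g : T → D.Obj) :
    Functor.LaxMonoidal.ε (Quiv.pullback f) ≫ (Quiv.pullback f).map (D.laxε g) =
      D.laxε (g ∘ f) := by
  ext a b
  refine unit_ext fun h ↦ ?_
  subst h
  refine (Category.assoc _ _ _).symm.trans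
    ((congrArg (· ≫ _) (unitι_pullbackε f (rfl : a = a))).trans ?_)
  exact (D.unitι_laxε g (f a)).trans (D.unitι_laxε (g ∘ f) a).symm

variable [HasLimits V]

/-- The cofree coalgebra on a necklace category. -/
abbrev NecCat.cofree (D : NecCat V) : Coalg (D.lax (_root_.id : D.Obj → D.Obj)) := Coalg.cofree _

/-- The functor underlying the templicial object cofreely generated by a necklace category. -/
abbrev NecCat.tempX (D : NecCat V) : FIntᵒᵖ ⥤ Quiv V D.Obj :=
  Coalg.functor (C := D.cofree) (Coalg.isUniv_cofree _)

/-- The templicial object cofreely generated by a necklace category. -/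
def NecCat.temp (D : NecCat V) : Templicial V where
  S := D.Obj
  X := D.tempX

/-- The structure maps of the templicial object cofreely generated by a necklace category. -/
def NecCat.counitHom (D : NecCat V) : BeadHom D.tempX (D.lax (_root_.id : D.Obj → D.Obj)) :=
  Coalg.beadHom (Coalg.isUniv_cofree _)

/-- The counit. -/
def NecCat.counit (D : NecCat V) : HCNerve.nec.obj D.temp ⟶ D :=
  BeadHom.necHom (Y := D.temp) D.counitHom

lemma NecCat.Hom.app_injective {C D : NecCat V} {obj : C.Obj → D.Obj}
    {app app' : ∀ A B : C.Obj, C.hom A B ⟶ D.hom (obj A) (obj B)} {h₁ h₂ h₁' h₂'}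
    (h : (⟨obj, app, h₁, h₂⟩ : NecCat.Hom C D) = ⟨obj, app', h₁', h₂'⟩) : app = app' := by
  injection h

lemma NecCat.temp_hom_ext {Y : Templicial V} {G H : Y ⟶ D.temp}
    (h : HCNerve.nec.map G ≫ D.counit = HCNerve.nec.map H ≫ D.counit) : G = H := by
  obtain ⟨f, t, h₁, h₂⟩ := G
  obtain ⟨f', t', h₁', h₂'⟩ := H
  obtain rfl : f = f' := congrArg (fun k : HCNerve.nec.obj Y ⟶ D ↦ NecCat.Hom.obj k) h
  have h' := NecCat.Hom.app_injective h
  have hε (n : ℕ) : beadApp t n ≫ (Quiv.pullback f).map (D.cofree.fε n) =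
      beadApp t' n ≫ (Quiv.pullback f).map (D.cofree.fε n) := by
    refine (BeadHom.comp_necHom_app ⟨f, t, h₁, h₂⟩ D.counitHom n).symm.trans
      (Eq.trans ?_ (BeadHom.comp_necHom_app ⟨f, t', h₁', h₂'⟩ D.counitHom n))
    ext a b
    exact congrArg (fun k ↦ (beadNec (X := Y.X) n).app a b ≫ (k a b).app (op (bd n))) h'
  refine Templicial.Hom.ext' fun n a b ↦ ?_
  have h₀ := D.cofree.hom_unique f (Coalg.isUniv_cofree _) (Q := fun _ ↦ Unit)
    (Y := fun n _ ↦ bead Y.X n) (t := fun n _ ↦ beadApp t n) (t' := fun n _ ↦ beadApp t' n)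
    (fun _ ↦ ?_) (fun n _ ↦ hε n) (fun k l n h _ ↦ ?_) n.unop.len ()
  · exact congrArg (fun k ↦ Quiv.Hom.app k a b) h₀
  · have e₁ := h₂.symm.trans h₂'
    refine Eq.trans ?_ (e₁.trans ?_)
    · exact (Category.comp_id _).symm
    · exact (Category.comp_id _)
  · subst h
    exact ⟨(), (), comul Y.X k l, h₁ k l, h₁' k l⟩

lemma NecCat.exists_temp_hom {Y : Templicial V} {f : Y.S → D.Obj} (g : BeadHom Y.X (D.lax f)) :
    ∃ G : Y ⟶ D.temp, HCNerve.nec.map G ≫ D.counit = g.necHom := by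
  have hC := Coalg.isUniv_cofree (D.lax (_root_.id : D.Obj → D.Obj))
  obtain ⟨t, ht₀, htε, htδ⟩ := Coalg.exists_lift (C := D.cofree) (f := f) (Y := Y.gcoalg)
    (g := g.app) hC (fun k l n h ↦ by
      subst h
      have h₁ := congrArg (fun m ↦ comul Y.X k l ≫ (g.app k ⊗ₘ g.app l) ≫ m)
        (NecCat.pullback_laxμ f (_root_.id : D.Obj → D.Obj) (op (bd k)) (op (bd l)))
      refine Eq.trans ?_ (h₁.trans (g.comul k l))
      exact congrArg (· ≫ _) (comulOf_rfl Y.X k l)) (by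
      have h₁ := congrArg (Functor.OplaxMonoidal.η Y.X ≫ ·)
        (NecCat.pullback_laxε f (_root_.id : D.Obj → D.Obj))
      refine Eq.trans ?_ h₁.symm
      refine Eq.trans ?_ (congrArg (Functor.OplaxMonoidal.η Y.X ≫ ·) g.unit)
      exact (cancel_aux counit_unitInv).symm)
  have hnat {m n : ℕ} (φ : FInt.Hom m n) : beadMap Y.X φ ≫ t m =
      t n ≫ (Quiv.pullback f).map (Coalg.mapHom hC φ) := by
    refine D.cofree.hom_unique f hC (Q := fun m ↦ Σ n, FInt.Hom m n) (Y := fun _ q ↦ bead Y.X q.1)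
      (t := fun m q ↦ beadMap Y.X q.2 ≫ t m)
      (t' := fun m q ↦ t q.1 ≫ (Quiv.pullback f).map (Coalg.mapHom hC q.2)) ?_ ?_ ?_ m ⟨n, φ⟩
    · rintro ⟨n, φ⟩
      obtain rfl : n = 0 := φ.map_last.symm.trans φ.map_zero
      dsimp only
      rw [Coalg.mapHom_zero, beadMap_eq_id _ _ fun i hi ↦ by
        obtain rfl := Nat.le_zero.1 hi
        exact φ.map_zero]
      exact (Category.id_comp _).trans (Category.comp_id _).symm
    · rintro m ⟨n, φ⟩
      dsimp only
      have h₁ := congrArg (fun k ↦ t n ≫ (Quiv.pullback f).map k) (Coalg.mapHom_ε hC φ)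
      rw [Functor.map_comp, Functor.map_comp] at h₁
      have h₂ := congrArg (· ≫ (Quiv.pullback f).map ((D.lax _root_.id).map (bdMap φ).op)) (htε n)
      refine (Category.assoc _ _ _).trans ((congrArg (_ ≫ ·) (htε m)).trans
        ((g.natural φ).trans ?_))
      exact h₂.symm.trans ((Category.assoc _ _ _).trans (h₁.symm.trans (Category.assoc _ _ _).symm))
    · rintro k l m h ⟨n, φ⟩
      obtain ⟨a, c, hac, φ₁, φ₂, h₁, h₂⟩ := φ.exists_cut h
      refine ⟨⟨a, φ₁⟩, ⟨c, φ₂⟩, comulOf Y.X a c n hac, ?_, ?_⟩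
      · have e₁ := congrArg (· ≫ (t k ⊗ₘ t l) ≫ μ (Quiv.pullback f) _ _)
          (comulOf_natural Y.X h hac φ φ₁ φ₂ h₁ h₂)
        have e₂ := congrArg (beadMap Y.X φ ≫ ·) (htδ k l m h)
        refine (Category.assoc _ _ _).trans (e₂.trans ((Category.assoc _ _ _).symm.trans
          (e₁.trans ((Category.assoc _ _ _).trans (congrArg (_ ≫ ·) ?_)))))
        exact tensorHom_comp_tensorHom_assoc _ _ _ _ _
      · have e₁ := congrArg (fun k ↦ t n ≫ (Quiv.pullback f).map k)
          (Coalg.mapHom_δ hC h hac φ φ₁ φ₂ h₁ h₂)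
        rw [Functor.map_comp, Functor.map_comp] at e₁
        have e₂ := congrArg (· ≫ (Quiv.pullback f).map
          (Coalg.mapHom hC φ₁ ⊗ₘ Coalg.mapHom hC φ₂)) (htδ a c n hac)
        refine (Category.assoc _ _ _).trans (e₁.trans ((Category.assoc _ _ _).symm.trans
          (e₂.trans ((Category.assoc _ _ _).trans (congrArg (_ ≫ ·) ?_)))))
        exact lax_tensor_aux (Quiv.pullback f) rfl rfl
  let G : Templicial.Hom Y D.temp := ⟨f, ⟨fun n ↦ t n.unop.len, fun m n φ ↦ hnat φ.unop⟩,
    fun m n ↦ (htδ m n _ rfl).trans (congrArg (· ≫ _) (comulOf_rfl Y.X m n)),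
    ht₀.symm.trans (Category.comp_id _).symm⟩
  let F : HCNerve.nec.obj Y ⟶ D := HCNerve.nec.map (X := Y) (Y := D.temp) G ≫ D.counit
  have h : NecCat.Hom.beadHom F = g := NecCat.Hom.ext_bead (f := f) (h := g) fun n a b ↦
    congrArg (fun k ↦ Quiv.Hom.app k a b)
      ((BeadHom.comp_necHom_app (X := D.temp) G D.counitHom n).trans (htε n))
  exact ⟨G, (NecCat.Hom.beadHom_necHom F).symm.trans (congrArg BeadHom.necHom h)⟩

/-- The counit is terminal. -/
def NecCat.isTerminalCounit (D : NecCat V) :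
    IsTerminal (CostructuredArrow.mk (S := HCNerve.nec) D.counit) :=
  IsTerminal.ofUniqueHom
    (fun Y ↦ CostructuredArrow.homMk
      (NecCat.exists_temp_hom (NecCat.Hom.beadHom (D := D) Y.hom)).choose
      ((NecCat.exists_temp_hom (NecCat.Hom.beadHom (D := D) Y.hom)).choose_spec.trans
        (NecCat.Hom.beadHom_necHom (D := D) Y.hom)))
    fun Y m ↦ CostructuredArrow.hom_ext _ _ (NecCat.temp_hom_ext
      ((CostructuredArrow.w m).trans (CostructuredArrow.w (CostructuredArrow.homMk
        (NecCat.exists_temp_hom (NecCat.Hom.beadHom (D := D) Y.hom)).choose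
        ((NecCat.exists_temp_hom (NecCat.Hom.beadHom (D := D) Y.hom)).choose_spec.trans
          (NecCat.Hom.beadHom_necHom (D := D) Y.hom)) : Y ⟶ CostructuredArrow.mk D.counit)).symm))

lemma nec_isLeftAdjoint : (HCNerve.nec (V := V)).IsLeftAdjoint :=
  isLeftAdjoint_iff_hasTerminal_costructuredArrow.2 fun D ↦ D.isTerminalCounit.hasTerminal

/-- Any right adjoint of `(-)^nec` is computed by cofree templicial objects. -/
def tempIso {temp : NecCat V ⥤ Templicial V} (adj : HCNerve.nec ⊣ temp) (D : NecCat V) :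
    temp.obj D ≅ D.temp :=
  (CostructuredArrow.proj _ _).mapIso
    ((mkTerminalOfRightAdjoint _ adj D).uniqueUpToIso D.isTerminalCounit)

end Temp

/-! ## The left adjoint of `𝔫` -/

section Weights

/-- The functor sending a necklace `T` to the set of `n`-simplices of `N(P_T)`. -/
def necWeight (n : SimplexCategoryᵒᵖ) : Nec ⥤ Type where
  obj T := (weight T).obj n
  map f := TypeCat.ofHom (push (NecPoset.map f))
  map_id T := by
    refine ConcreteCategory.hom_ext _ _ fun x ↦ ?_
    exact push_id (F := NecPoset.map (𝟙 T)) (fun a ↦ Subtype.ext (Set.image_id _)) x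
  map_comp f g := by
    refine ConcreteCategory.hom_ext _ _ fun x ↦ ?_
    exact (push_eq' (F := NecPoset.map f) (G := NecPoset.map g) (F' := NecPoset.map (f ≫ g))
      (fun a ↦ Subtype.ext (Set.image_image _ _ _)) x).symm

namespace NecPoset

/-- The simplex of `N(P_{T ∨ U})` with components `x` and `y`. -/
def join {T U : Nec} {n : SimplexCategoryᵒᵖ} (x : (weight T).obj n) (y : (weight U).obj n) :
    (weight (T ⊗ U)).obj n where
  obj i := (splitIso T U).symm (x.obj i, y.obj i)
  map f := homOfLE ((splitIso T U).symm.monotone ⟨leOfHom (x.map f), leOfHom (y.map f)⟩)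

variable {T U : Nec} {n : SimplexCategoryᵒᵖ}

lemma simplex_ext {P : Type} [PartialOrder P] {x y : (nerve P).obj n} (h : ∀ i, x.obj i = y.obj i) :
    x = y :=
  CategoryTheory.Functor.ext h fun _ _ _ ↦ Subsingleton.elim _ _

@[simp] lemma push_fst_join (x : (weight T).obj n) (y : (weight U).obj n) :
    push (fst T U) (join x y) = x :=
  simplex_ext fun i ↦ congrArg Prod.fst ((splitIso T U).apply_symm_apply (x.obj i, y.obj i))

@[simp] lemma push_snd_join (x : (weight T).obj n) (y : (weight U).obj n) :
    push (snd T U) (join x y) = y :=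
  simplex_ext fun i ↦ congrArg Prod.snd ((splitIso T U).apply_symm_apply (x.obj i, y.obj i))

@[simp] lemma join_push (z : (weight (T ⊗ U)).obj n) :
    join (push (fst T U) z) (push (snd T U) z) = z :=
  simplex_ext fun i ↦ (splitIso T U).symm_apply_apply (z.obj i)

lemma tensor_simplex_ext {z z' : (weight (T ⊗ U)).obj n}
    (h₁ : push (fst T U) z = push (fst T U) z') (h₂ : push (snd T U) z = push (snd T U) z') :
    z = z' := by
  rw [← join_push z, h₁, h₂, join_push]

lemma push_map_join {T' U' : Nec} (f : T ⟶ T') (g : U ⟶ U') (x : (weight T).obj n)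
    (y : (weight U).obj n) :
    push (map (f ⊗ₘ g)) (join x y) = join (push (map f) x) (push (map g) y) := by
  refine tensor_simplex_ext ?_ ?_
  · rw [push_fst_join, push_eq (fst_map f g), push_fst_join]
  · rw [push_snd_join, push_eq (snd_map f g), push_snd_join]

lemma push_associator_join {R : Nec} (x : (weight T).obj n) (y : (weight U).obj n)
    (z : (weight R).obj n) :
    push (map (α_ T U R).hom) (join (join x y) z) = join x (join y z) := by
  refine tensor_simplex_ext ?_ (tensor_simplex_ext ?_ ?_)
  · rw [← push_eq (fst_fst T U R) (join (join x y) z)]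
    simp only [push_fst_join]
  · refine (push_eq (F := fst (T ⊗ U) R) (G := snd T U) (F' := map (α_ T U R).hom ⋙ snd T (U ⊗ R))
      (snd_fst T U R) (join (join x y) z)).symm.trans ?_
    simp only [push_fst_join, push_snd_join]
  · refine (push_eq' (F := map (α_ T U R).hom ⋙ snd T (U ⊗ R))
      (fun a ↦ (snd_snd T U R a).symm) (join (join x y) z)).trans ?_
    simp only [push_snd_join]

instance : Unique (NecPoset (𝟙_ Nec)) where
  default := ⟨{0}, subset_rfl, fun _ hi ↦ le_of_eq hi⟩
  uniq S := Subtype.ext (Set.Subset.antisymm (fun _ hi ↦ Nat.le_zero.1 (S.2.2 hi)) S.2.1)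

/-- The simplex of `N(P_T)` for the trivial necklace `T`. -/
def unitSimplex (n : SimplexCategoryᵒᵖ) : (weight (𝟙_ Nec)).obj n where
  obj _ := default
  map _ := 𝟙 _

lemma push_leftUnitor_join (e : (weight (𝟙_ Nec)).obj n) (x : (weight T).obj n) :
    push (map (λ_ T).hom) (join e x) = x :=
  (congrArg (fun F ↦ push F (join e x)) (functor_eq (snd_unit T))).symm.trans (push_snd_join e x)

lemma push_rightUnitor_join (e : (weight (𝟙_ Nec)).obj n) (x : (weight T).obj n) :
    push (map (ρ_ T).hom) (join x e) = x :=
  (congrArg (fun F ↦ push F (join x e)) (functor_eq (fst_unit T))).symm.trans (push_fst_join x e)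

end NecPoset

end Weights

section WeightedColimit

variable {V : Type v} [Category.{u} V] [HasColimits V] (P : Necᵒᵖ ⥤ V)

open NecPoset

/-- The weighted colimit of `T ↦ N(P_T)_n` with weight `P`. -/
def sLev (n : SimplexCategoryᵒᵖ) : V :=
  colimit ((CategoryOfElements.π (necWeight n)).op ⋙ P)

/-- The inclusions of the weighted colimit. -/
def sι (n : SimplexCategoryᵒᵖ) (T : Nec) (x : (weight T).obj n) : P.obj (op T) ⟶ sLev P n :=
  colimit.ι ((CategoryOfElements.π (necWeight n)).op ⋙ P) (op ⟨T, x⟩)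

lemma map_sι (n : SimplexCategoryᵒᵖ) {T U : Nec} (f : T ⟶ U) (x : (weight T).obj n) :
    P.map f.op ≫ sι P n T x = sι P n U (push (NecPoset.map f) x) :=
  colimit.w ((CategoryOfElements.π (necWeight n)).op ⋙ P)
    (Quiver.Hom.op (show (necWeight n).elementsMk T x ⟶
      (necWeight n).elementsMk U (push (NecPoset.map f) x) from ⟨f, rfl⟩))

/-- The cocone associated to a compatible family of morphisms. -/
abbrev sCocone {n : SimplexCategoryᵒᵖ} {A : V}
    (g : ∀ T, (weight T).obj n → (P.obj (op T) ⟶ A))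
    (h : ∀ T U (f : T ⟶ U) (x : (weight T).obj n),
      P.map f.op ≫ g T x = g U (push (NecPoset.map f) x)) :
    Cocone ((CategoryOfElements.π (necWeight n)).op ⋙ P) where
  pt := A
  ι :=
    { app := fun x ↦ g x.unop.1 x.unop.2
      naturality := fun x y f ↦ by
        have := h _ _ f.unop.1 y.unop.2
        have e := f.unop.2
        rw [show push (NecPoset.map f.unop.1) y.unop.2 = x.unop.2 from e] at this
        exact this.trans (Category.comp_id _).symm }

variable {P}

/-- Morphisms out of the weighted colimit from their components. -/
def sDesc {n : SimplexCategoryᵒᵖ} {A : V} (g : ∀ T, (weight T).obj n → (P.obj (op T) ⟶ A))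
    (h : ∀ T U (f : T ⟶ U) (x : (weight T).obj n),
      P.map f.op ≫ g T x = g U (push (NecPoset.map f) x)) : sLev P n ⟶ A :=
  colimit.desc _ (sCocone P g h)

@[simp] lemma sι_desc {n : SimplexCategoryᵒᵖ} {A : V}
    (g : ∀ T, (weight T).obj n → (P.obj (op T) ⟶ A)) (h) (T : Nec) (x : (weight T).obj n) :
    sι P n T x ≫ sDesc g h = g T x :=
  colimit.ι_desc (sCocone P g h) _

lemma sι_desc_assoc {n : SimplexCategoryᵒᵖ} {A B : V}
    (g : ∀ T, (weight T).obj n → (P.obj (op T) ⟶ A)) (h) (T : Nec) (x : (weight T).obj n)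
    (k : A ⟶ B) : sι P n T x ≫ sDesc g h ≫ k = g T x ≫ k := by
  rw [← Category.assoc, sι_desc]

lemma sLev_ext {n : SimplexCategoryᵒᵖ} {A : V} {g h : sLev P n ⟶ A}
    (w : ∀ T x, sι P n T x ≫ g = sι P n T x ≫ h) : g = h :=
  colimit.hom_ext fun x ↦ w x.unop.1 x.unop.2

variable (P)

/-- The colimit of `T ↦ F N(P_T)` with weight `P`. -/
def sObj : SimplicialObject V where
  obj := sLev P
  map {n m} f := sDesc (fun T x ↦ sι P m T ((weight T).map f x)) fun T U g x ↦ by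
    rw [map_sι, push_map]
  map_id n := sLev_ext fun T x ↦ by
    rw [sι_desc, Category.comp_id, CategoryTheory.Functor.map_id]
    rfl
  map_comp f g := sLev_ext fun T x ↦ by
    rw [sι_desc, ← Category.assoc, sι_desc, sι_desc, CategoryTheory.Functor.map_comp]
    rfl

lemma sι_map {n m : SimplexCategoryᵒᵖ} (f : n ⟶ m) (T : Nec) (x : (weight T).obj n) :
    sι P n T x ≫ (sObj P).map f = sι P m T ((weight T).map f x) := sι_desc _ _ _ _

variable [MonoidalCategory V] [HasLimits V]

/-- The unit of the weighted colimit. -/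
def sUnit : P ⟶ nObj (sObj P) where
  app T := wlift (fun n x ↦ sι P n T.unop x) fun _ _ f x ↦ sι_map P f T.unop x
  naturality T U f := by
    refine nObj_ext fun n x ↦ ?_
    have h₁ := wlift_π (K := weight U.unop) (Y := sObj P) (fun n x ↦ sι P n U.unop x)
      (fun n m f x ↦ sι_map P f U.unop x) n x
    have h₂ := wlift_π (K := weight T.unop) (Y := sObj P) (fun n x ↦ sι P n T.unop x)
      (fun n m f x ↦ sι_map P f T.unop x) n (push (NecPoset.map f.unop) x)
    refine (Category.assoc _ _ _).trans ((congrArg (P.map f ≫ ·) h₁).trans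
      ((map_sι P n f.unop x).trans (h₂.symm.trans ?_)))
    exact (congrArg (_ ≫ ·) (nObj_map_π (sObj P) f.unop n x).symm).trans (Category.assoc _ _ _).symm

lemma sUnit_π (T : Nec) (n : SimplexCategoryᵒᵖ) (x : (weight T).obj n) :
    (sUnit P).app (op T) ≫ nπ (sObj P) T n x = sι P n T x :=
  wlift_π (K := weight T) (Y := sObj P) (fun n x ↦ sι P n T x) (fun _ _ f x ↦ sι_map P f T x) n x

variable {P}

/-- The morphism out of the weighted colimit corresponding to a morphism `P ⟶ 𝔫(Y)`. -/
def sHomDesc {Y : SimplicialObject V} (φ : P ⟶ nObj Y) : sObj P ⟶ Y where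
  app n := sDesc (fun T x ↦ φ.app (op T) ≫ nπ Y T n x) fun T U f x ↦ by
    rw [NatTrans.naturality_assoc, nObj_map_π]
  naturality n m f := sLev_ext fun T x ↦ by
    have h := sι_map P f T x
    refine (Category.assoc _ _ _).symm.trans ((congrArg (· ≫ _) h).trans ((sι_desc _ _ _ _).trans
      (Eq.trans ?_ (sι_desc_assoc _ _ T x (Y.map f)).symm)))
    rw [Category.assoc, nπ_natural]

lemma sι_homDesc {Y : SimplicialObject V} (φ : P ⟶ nObj Y) (T : Nec) (n : SimplexCategoryᵒᵖ)
    (x : (weight T).obj n) : sι P n T x ≫ (sHomDesc φ).app n = φ.app (op T) ≫ nπ Y T n x :=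
  sι_desc _ _ _ _

lemma sUnit_nMap_π {Y : SimplicialObject V} (g : sObj P ⟶ Y) (T : Nec) (n : SimplexCategoryᵒᵖ)
    (x : (weight T).obj n) :
    (sUnit P ≫ nMap g).app (op T) ≫ nπ Y T n x = sι P n T x ≫ g.app n := by
  rw [NatTrans.comp_app, Category.assoc, nMap_π, ← Category.assoc, sUnit_π]
  rfl

lemma sUnit_homDesc {Y : SimplicialObject V} (φ : P ⟶ nObj Y) : sUnit P ≫ nMap (sHomDesc φ) = φ := by
  ext T
  exact nObj_ext fun n x ↦ (sUnit_nMap_π _ _ _ _).trans (sι_homDesc _ _ _ _)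

lemma sHom_ext {Y : SimplicialObject V} {g h : sObj P ⟶ Y}
    (w : sUnit P ≫ nMap g = sUnit P ≫ nMap h) : g = h := by
  ext n
  refine sLev_ext fun T x ↦ ?_
  rw [← sUnit_nMap_π, w, sUnit_nMap_π]

lemma bijective_sUnit (Y : SimplicialObject V) :
    Function.Bijective fun g : sObj P ⟶ Y ↦ sUnit P ≫ nMap g :=
  ⟨fun _ _ h ↦ sHom_ext h, fun φ ↦ ⟨sHomDesc φ, sUnit_homDesc φ⟩⟩

end WeightedColimit

section Tensor

variable {V : Type v} [Category.{u} V] [MonoidalCategory V] [HasColimits V]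
  [SymmetricCategory V] [MonoidalClosed V] {P Q R : Necᵒᵖ ⥤ V} {n : SimplexCategoryᵒᵖ} {A Z : V}

/-- The tensor product with `Z` of a weighted colimit is a weighted colimit. -/
def isColimitSRight (P : Necᵒᵖ ⥤ V) (n : SimplexCategoryᵒᵖ) (Z : V) :
    IsColimit ((tensorRight Z).mapCocone
      (colimit.cocone ((CategoryOfElements.π (necWeight n)).op ⋙ P))) :=
  isColimitOfPreserves _ (colimit.isColimit _)

/-- The tensor product with `Z` of a weighted colimit is a weighted colimit. -/
def isColimitSLeft (P : Necᵒᵖ ⥤ V) (n : SimplexCategoryᵒᵖ) (Z : V) :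
    IsColimit ((tensorLeft Z).mapCocone
      (colimit.cocone ((CategoryOfElements.π (necWeight n)).op ⋙ P))) :=
  isColimitOfPreserves _ (colimit.isColimit _)

/-- Morphisms out of the tensor product of a weighted colimit and an object. -/
def sDescR (g : ∀ T, (weight T).obj n → (P.obj (op T) ⊗ Z ⟶ A))
    (h : ∀ T U (f : T ⟶ U) (x : (weight T).obj n),
      P.map f.op ▷ Z ≫ g T x = g U (push (NecPoset.map f) x)) : sLev P n ⊗ Z ⟶ A :=
  (isColimitSRight P n Z).desc ⟨A, (sCocone (P ⋙ tensorRight Z) g h).ι⟩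

@[simp] lemma sι_descR (g : ∀ T, (weight T).obj n → (P.obj (op T) ⊗ Z ⟶ A)) (h) (T : Nec)
    (x : (weight T).obj n) : sι P n T x ▷ Z ≫ sDescR g h = g T x :=
  (isColimitSRight P n Z).fac ⟨A, (sCocone (P ⋙ tensorRight Z) g h).ι⟩ (op ⟨T, x⟩)

/-- Morphisms out of the tensor product of an object and a weighted colimit. -/
def sDescL (g : ∀ T, (weight T).obj n → (Z ⊗ P.obj (op T) ⟶ A))
    (h : ∀ T U (f : T ⟶ U) (x : (weight T).obj n),
      Z ◁ P.map f.op ≫ g T x = g U (push (NecPoset.map f) x)) : Z ⊗ sLev P n ⟶ A :=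
  (isColimitSLeft P n Z).desc ⟨A, (sCocone (P ⋙ tensorLeft Z) g h).ι⟩

@[simp] lemma sι_descL (g : ∀ T, (weight T).obj n → (Z ⊗ P.obj (op T) ⟶ A)) (h) (T : Nec)
    (x : (weight T).obj n) : Z ◁ sι P n T x ≫ sDescL g h = g T x :=
  (isColimitSLeft P n Z).fac ⟨A, (sCocone (P ⋙ tensorLeft Z) g h).ι⟩ (op ⟨T, x⟩)

lemma sR_ext {g h : sLev P n ⊗ Z ⟶ A} (w : ∀ T x, sι P n T x ▷ Z ≫ g = sι P n T x ▷ Z ≫ h) :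
    g = h :=
  (isColimitSRight P n Z).hom_ext fun x ↦ w x.unop.1 x.unop.2

lemma sL_ext {g h : Z ⊗ sLev P n ⟶ A} (w : ∀ T x, Z ◁ sι P n T x ≫ g = Z ◁ sι P n T x ≫ h) :
    g = h :=
  (isColimitSLeft P n Z).hom_ext fun x ↦ w x.unop.1 x.unop.2

lemma sTensor_ext {g h : sLev P n ⊗ sLev Q n ⟶ A}
    (w : ∀ T x U y, (sι P n T x ⊗ₘ sι Q n U y) ≫ g = (sι P n T x ⊗ₘ sι Q n U y) ≫ h) : g = h :=
  sR_ext fun T x ↦ sL_ext fun U y ↦ by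
    have := w T x U y
    rwa [MonoidalCategory.tensorHom_def', Category.assoc, Category.assoc] at this

lemma sFst_ext {B : V} {g h : (sLev P n ⊗ B) ⊗ Z ⟶ A}
    (w : ∀ T x, sι P n T x ▷ B ▷ Z ≫ g = sι P n T x ▷ B ▷ Z ≫ h) : g = h := by
  rw [← cancel_epi (α_ _ _ _).inv]
  refine sR_ext fun T x ↦ ?_
  have := congrArg (fun t ↦ (α_ _ _ _).inv ≫ t) (w T x)
  simpa using this

lemma sMid_ext {B : V} {g h : (B ⊗ sLev Q n) ⊗ Z ⟶ A}
    (w : ∀ U y, (B ◁ sι Q n U y) ▷ Z ≫ g = (B ◁ sι Q n U y) ▷ Z ≫ h) : g = h := by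
  rw [← cancel_epi ((β_ _ _).hom ▷ Z)]
  refine sFst_ext fun U y ↦ ?_
  have := congrArg (fun t ↦ (β_ _ _).hom ▷ Z ≫ t) (w U y)
  simpa [← comp_whiskerRight_assoc] using this

lemma sTensor₃_ext {g h : (sLev P n ⊗ sLev Q n) ⊗ sLev R n ⟶ A}
    (w : ∀ T x U y S z, ((sι P n T x ⊗ₘ sι Q n U y) ⊗ₘ sι R n S z) ≫ g =
      ((sι P n T x ⊗ₘ sι Q n U y) ⊗ₘ sι R n S z) ≫ h) : g = h :=
  sL_ext fun S z ↦ sFst_ext fun T x ↦ sMid_ext fun U y ↦ by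
    have := w T x U y S z
    rwa [MonoidalCategory.tensorHom_def (sι P n T x ⊗ₘ sι Q n U y),
      MonoidalCategory.tensorHom_def', comp_whiskerRight, Category.assoc, Category.assoc,
      Category.assoc, Category.assoc] at this

/-- Morphisms out of the tensor product of two weighted colimits. -/
def sDesc₂ (g : ∀ T, (weight T).obj n → ∀ U, (weight U).obj n → (P.obj (op T) ⊗ Q.obj (op U) ⟶ A))
    (h : ∀ T T' (f : T ⟶ T') (x : (weight T).obj n) U U' (k : U ⟶ U') (y : (weight U).obj n),
      (P.map f.op ⊗ₘ Q.map k.op) ≫ g T x U y =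
        g T' (push (NecPoset.map f) x) U' (push (NecPoset.map k) y)) : sLev P n ⊗ sLev Q n ⟶ A :=
  sDescR (fun T x ↦ sDescL (fun U y ↦ g T x U y) fun U U' k y ↦ by
      have := h T T (𝟙 T) x U U' k y
      rwa [op_id, P.map_id, id_tensorHom, push_id (F := NecPoset.map (𝟙 T))
        (fun a ↦ Subtype.ext (Set.image_id _))] at this)
    fun T T' f x ↦ sL_ext fun U y ↦ by
      have := h T T' f x U U (𝟙 U) y
      rw [op_id, Q.map_id, tensorHom_id, push_id (F := NecPoset.map (𝟙 U))
        (fun a ↦ Subtype.ext (Set.image_id _))] at this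
      rw [sι_descL, whisker_exchange_assoc, sι_descL, this]

@[simp] lemma sι_desc₂ (g : ∀ T, (weight T).obj n → ∀ U, (weight U).obj n →
    (P.obj (op T) ⊗ Q.obj (op U) ⟶ A)) (h) (T : Nec) (x : (weight T).obj n) (U : Nec)
    (y : (weight U).obj n) : (sι P n T x ⊗ₘ sι Q n U y) ≫ sDesc₂ g h = g T x U y := by
  rw [MonoidalCategory.tensorHom_def', Category.assoc, sDesc₂, sι_descR, sι_descL]

end Tensor

section Category

variable {V : Type v} [Category.{u} V] [MonoidalCategory V] [HasColimits V]
  [SymmetricCategory V] [MonoidalClosed V] (D : NecCat V)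

open NecPoset

/-- The identities of `𝔰(D)`. -/
def sId (A : D.Obj) : 𝟙_ (SimplicialObject V) ⟶ sObj (D.hom A A) where
  app n := D.id A ≫ sι _ n (𝟙_ Nec) (unitSimplex n)
  naturality n _ f := (Category.id_comp _).trans (Eq.trans (congrArg (D.id A ≫ ·)
    (sι_map _ f (𝟙_ Nec) (unitSimplex n)).symm) (Category.assoc _ _ _).symm)

/-- The composition of `𝔰(D)` at simplicial level `n`. -/
def sCompAt (A B C : D.Obj) (n : SimplexCategoryᵒᵖ) :
    sLev (D.hom A B) n ⊗ sLev (D.hom B C) n ⟶ sLev (D.hom A C) n :=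
  sDesc₂ (fun T x U y ↦ D.comp A B C T U ≫ sι _ n (T ⊗ U) (join x y))
    fun T T' f x U U' k y ↦ by
      rw [← Category.assoc, D.comp_natural, Category.assoc, map_sι, push_map_join]

lemma sι_compAt (A B C : D.Obj) (n : SimplexCategoryᵒᵖ) (T : Nec) (x : (weight T).obj n) (U : Nec)
    (y : (weight U).obj n) : (sι (D.hom A B) n T x ⊗ₘ sι (D.hom B C) n U y) ≫ sCompAt D A B C n =
      D.comp A B C T U ≫ sι _ n (T ⊗ U) (join x y) := sι_desc₂ _ _ _ _ _ _

/-- The composition of `𝔰(D)`. -/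
def sComp (A B C : D.Obj) : sObj (D.hom A B) ⊗ sObj (D.hom B C) ⟶ sObj (D.hom A C) where
  app n := sCompAt D A B C n
  naturality n m f := sTensor_ext fun T x U y ↦ by
    have h₁ := sι_compAt D A B C n T x U y
    have h₂ := sι_compAt D A B C m T ((weight T).map f x) U ((weight U).map f y)
    have h₃ : (sι (D.hom A B) n T x ⊗ₘ sι (D.hom B C) n U y) ≫
        ((sObj (D.hom A B)).map f ⊗ₘ (sObj (D.hom B C)).map f) =
        (sι (D.hom A B) m T ((weight T).map f x) ⊗ₘ sι (D.hom B C) m U ((weight U).map f y)) :=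
      (tensorHom_comp_tensorHom _ _ _ _).trans (congrArg₂ (· ⊗ₘ ·) (sι_map _ f T x) (sι_map _ f U y))
    have h₄ := sι_map (D.hom A C) f (T ⊗ U) (join x y)
    refine ((Category.assoc _ _ _).symm.trans ((congrArg (· ≫ _) h₃).trans h₂)).trans (Eq.symm ?_)
    refine (Category.assoc _ _ _).symm.trans ((congrArg (· ≫ _) h₁).trans
      ((Category.assoc _ _ _).trans (congrArg (_ ≫ ·) h₄)))

lemma sId_compAt (A B : D.Obj) (n : SimplexCategoryᵒᵖ) :
    (λ_ (sLev (D.hom A B) n)).inv ≫ (D.id A ≫ sι _ n (𝟙_ Nec) (unitSimplex n)) ▷ _ ≫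
      sCompAt D A A B n = 𝟙 _ := sLev_ext fun T x ↦ by
  have h := D.id_comp A B T
  have e : (D.id A ≫ sι (D.hom A A) n (𝟙_ Nec) (unitSimplex n) ⊗ₘ sι (D.hom A B) n T x) =
      D.id A ▷ _ ≫ (sι (D.hom A A) n (𝟙_ Nec) (unitSimplex n) ⊗ₘ sι (D.hom A B) n T x) := by
    rw [← tensorHom_id, tensorHom_comp_tensorHom, Category.id_comp]
  rw [leftUnitor_inv_naturality_assoc, ← MonoidalCategory.tensorHom_def'_assoc, e, Category.assoc,
    sι_compAt, reassoc_of% h, map_sι, Iso.inv_hom_id_assoc, push_leftUnitor_join, Category.comp_id]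

lemma sCompAt_id (A B : D.Obj) (n : SimplexCategoryᵒᵖ) :
    (ρ_ (sLev (D.hom A B) n)).inv ≫ _ ◁ (D.id B ≫ sι _ n (𝟙_ Nec) (unitSimplex n)) ≫
      sCompAt D A B B n = 𝟙 _ := sLev_ext fun T x ↦ by
  have h := D.comp_id A B T
  have e : (sι (D.hom A B) n T x ⊗ₘ D.id B ≫ sι (D.hom B B) n (𝟙_ Nec) (unitSimplex n)) =
      _ ◁ D.id B ≫ (sι (D.hom A B) n T x ⊗ₘ sι (D.hom B B) n (𝟙_ Nec) (unitSimplex n)) := by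
    rw [← id_tensorHom, tensorHom_comp_tensorHom, Category.id_comp]
  rw [rightUnitor_inv_naturality_assoc, ← MonoidalCategory.tensorHom_def_assoc, e, Category.assoc,
    sι_compAt, reassoc_of% h, map_sι, Iso.inv_hom_id_assoc, push_rightUnitor_join, Category.comp_id]

lemma sCompAt_assoc (A B C E : D.Obj) (n : SimplexCategoryᵒᵖ) :
    (α_ (sLev (D.hom A B) n) (sLev (D.hom B C) n) (sLev (D.hom C E) n)).inv ≫
      sCompAt D A B C n ▷ _ ≫ sCompAt D A C E n = _ ◁ sCompAt D B C E n ≫ sCompAt D A B E n := by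
  rw [← cancel_epi (α_ _ _ _).hom, Iso.hom_inv_id_assoc]
  refine sTensor₃_ext fun T x U y S z ↦ ?_
  have h := D.assoc A B C E T U S
  have e₁ : ((sι (D.hom A B) n T x ⊗ₘ sι (D.hom B C) n U y) ⊗ₘ sι (D.hom C E) n S z) ≫
      sCompAt D A B C n ▷ _ = D.comp A B C T U ▷ _ ≫
        (sι (D.hom A C) n (T ⊗ U) (join x y) ⊗ₘ sι (D.hom C E) n S z) := by
    rw [← tensorHom_id, ← tensorHom_id, tensorHom_comp_tensorHom, tensorHom_comp_tensorHom,
      sι_compAt, Category.id_comp, Category.comp_id]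
  have e₂ : (sι (D.hom A B) n T x ⊗ₘ (sι (D.hom B C) n U y ⊗ₘ sι (D.hom C E) n S z)) ≫
      _ ◁ sCompAt D B C E n = _ ◁ D.comp B C E U S ≫
        (sι (D.hom A B) n T x ⊗ₘ sι (D.hom B E) n (U ⊗ S) (join y z)) := by
    rw [← id_tensorHom, ← id_tensorHom, tensorHom_comp_tensorHom, tensorHom_comp_tensorHom,
      sι_compAt, Category.id_comp, Category.comp_id]
  rw [reassoc_of% e₁, sι_compAt, reassoc_of% h, map_sι, associator_naturality_assoc,
    reassoc_of% e₂, sι_compAt, push_associator_join]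

/-- The simplicially enriched category `𝔰(D)`. -/
def sCat : SmallEnrichedCat (SimplicialObject V) where
  Obj := D.Obj
  enriched :=
    { Hom A B := sObj (D.hom A B)
      id := sId D
      comp := sComp D
      id_comp A B := NatTrans.ext (funext fun n ↦ sId_compAt D A B n)
      comp_id A B := NatTrans.ext (funext fun n ↦ sCompAt_id D A B n)
      assoc A B C E := NatTrans.ext (funext fun n ↦ sCompAt_assoc D A B C E n) }

variable [HasLimits V]

/-- The unit of the adjunction between `𝔰` and `𝔫`. -/
def sCatUnit : D ⟶ nFunctor.obj (sCat D) where
  obj A := A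
  app A B := sUnit (D.hom A B)
  map_id A := nObj_ext fun n x ↦ by
    obtain rfl : x = unitSimplex n := simplex_ext fun i ↦ Subsingleton.elim _ _
    have h₁ := sUnit_π (D.hom A A) (𝟙_ Nec) n (unitSimplex n)
    have h₂ := nId_π (sCat D) A n (unitSimplex n)
    exact (Category.assoc _ _ _).trans ((congrArg (_ ≫ ·) h₁).trans h₂.symm)
  map_comp A B E T U := nObj_ext fun n x ↦ by
    have h₁ := sUnit_π (D.hom A E) (T ⊗ U) n x
    have h₂ := nComp_π (sCat D) A B E T U n x
    have h₃ := sι_compAt D A B E n T (push (NecPoset.fst T U) x) U (push (NecPoset.snd T U) x)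
    rw [join_push] at h₃
    refine (Category.assoc _ _ _).trans ((congrArg (_ ≫ ·) h₁).trans (h₃.symm.trans (Eq.symm ?_)))
    refine (Category.assoc _ _ _).trans ((congrArg (_ ≫ ·) h₂).trans
      ((Category.assoc _ _ _).symm.trans (congrArg (· ≫ _) ?_)))
    exact (tensorHom_comp_tensorHom _ _ _ _).trans
      (congrArg₂ (· ⊗ₘ ·) (sUnit_π _ T n _) (sUnit_π _ U n _))

variable {D}

/-- The functor out of `𝔰(D)` corresponding to a functor `D ⟶ 𝔫(C)`. -/
def sCatDesc {C : SmallEnrichedCat (SimplicialObject V)} (F : D ⟶ nFunctor.obj C) : sCat D ⟶ C where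
  obj := NecCat.Hom.obj F
  map A B := sHomDesc (NecCat.Hom.app F A B)
  map_id A := NatTrans.ext (funext fun n ↦ by
    have h₁ := sι_homDesc (NecCat.Hom.app F A A) (𝟙_ Nec) n (unitSimplex n)
    have h₂ := congrArg (· ≫ nπ _ (𝟙_ Nec) n (unitSimplex n)) (NecCat.Hom.map_id F A)
    have h₃ := nId_π C (NecCat.Hom.obj F A) n (unitSimplex n)
    exact (Category.assoc _ _ _).trans ((congrArg (_ ≫ ·) h₁).trans
      ((Category.assoc _ _ _).symm.trans (h₂.trans h₃))))
  map_comp A B E := NatTrans.ext (funext fun n ↦ sTensor_ext fun T x U y ↦ by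
    have h₁ := sι_homDesc (NecCat.Hom.app F A E) (T ⊗ U) n (join x y)
    have h₂ := congrArg (· ≫ nπ _ (T ⊗ U) n (join x y)) (NecCat.Hom.map_comp F A B E T U)
    have h₃ := nComp_π C (NecCat.Hom.obj F A) (NecCat.Hom.obj F B) (NecCat.Hom.obj F E) T U n
      (join x y)
    have h₄ := sι_compAt D A B E n T x U y
    rw [push_fst_join, push_snd_join] at h₃
    refine (Category.assoc _ _ _).symm.trans ((congrArg (· ≫ _) h₄).trans
      ((Category.assoc _ _ _).trans ((congrArg (_ ≫ ·) h₁).trans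
        ((Category.assoc _ _ _).symm.trans (h₂.trans ((Category.assoc _ _ _).trans
          ((congrArg (_ ≫ ·) h₃).trans (Eq.symm ?_))))))))
    refine (Category.assoc _ _ _).symm.trans (Eq.trans (congrArg (· ≫ compAt C _ _ _ n) ?_)
      (Category.assoc _ _ _))
    refine (tensorHom_comp_tensorHom _ _ _ _).trans (Eq.trans ?_
      (tensorHom_comp_tensorHom _ _ _ _).symm)
    exact congrArg₂ (· ⊗ₘ ·) (sι_homDesc _ T n x) (sι_homDesc _ U n y))

lemma sCatUnit_desc {C : SmallEnrichedCat (SimplicialObject V)} (F : D ⟶ nFunctor.obj C) :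
    sCatUnit D ≫ nFunctor.map (sCatDesc F) = F :=
  NecCat.Hom.ext' fun A B T ↦ congrArg (fun k ↦ NatTrans.app k T)
    (sUnit_homDesc (NecCat.Hom.app F A B))

lemma sCat_hom_ext {C : SmallEnrichedCat (SimplicialObject V)} {G H : sCat D ⟶ C}
    (h : sCatUnit D ≫ nFunctor.map G = sCatUnit D ≫ nFunctor.map H) : G = H := by
  obtain ⟨f, m, h₁, h₂⟩ := G
  obtain ⟨f', m', h₁', h₂'⟩ := H
  obtain rfl : f = f' := congrArg (fun k : D ⟶ nFunctor.obj C ↦ NecCat.Hom.obj k) h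
  have h' := NecCat.Hom.app_injective h
  obtain rfl : m = m' := by
    ext A B : 2
    exact sHom_ext (congrFun (congrFun h' A) B)
  rfl

variable (D) in
/-- The unit is initial. -/
def isInitialSCatUnit : IsInitial (StructuredArrow.mk (T := nFunctor) (sCatUnit D)) :=
  IsInitial.ofUniqueHom
    (fun Y ↦ StructuredArrow.homMk (sCatDesc (D := D) Y.hom) (sCatUnit_desc (D := D) Y.hom))
    fun Y m ↦ StructuredArrow.hom_ext _ _ (sCat_hom_ext
      ((StructuredArrow.w m).trans (sCatUnit_desc (D := D) Y.hom).symm))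

lemma nFunctor_isRightAdjoint : (nFunctor (V := V)).IsRightAdjoint :=
  isRightAdjoint_iff_hasInitial_structuredArrow.2 fun D ↦ (isInitialSCatUnit D).hasInitial

lemma isHomwiseColimit_sCatUnit : IsHomwiseColimit (sCatUnit D) :=
  ⟨Function.bijective_id, fun A B Y ↦ bijective_sUnit (P := D.hom A B) Y⟩

end Category

section Uniqueness

variable {V : Type v} [Category.{u} V] [MonoidalCategory V]

lemma SmallEnrichedCat.isIso_map {W : Type v} [Category.{u} W] [MonoidalCategory W]
    {C C' : SmallEnrichedCat W} (e : C ≅ C') (A B : C.Obj) :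
    IsIso (EnrichedFunctor.map (V := W) e.hom A B) := by
  have key : ∀ {K : SmallEnrichedCat W} (H : K ⟶ K), H = 𝟙 K → ∀ A B : K.Obj,
      IsIso (EnrichedFunctor.map (V := W) H A B) := by
    rintro K _ rfl A B
    exact inferInstanceAs (IsIso (𝟙 _))
  have h₁ : IsIso (EnrichedFunctor.map (V := W) e.hom A B ≫
    EnrichedFunctor.map (V := W) e.inv _ _) := key _ e.hom_inv_id A B
  have h₂ : IsIso (EnrichedFunctor.map (V := W) e.inv (EnrichedFunctor.obj (V := W) e.hom A)
      (EnrichedFunctor.obj (V := W) e.hom B) ≫ EnrichedFunctor.map (V := W) e.hom _ _) :=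
    key _ e.inv_hom_id _ _
  have h₃ : Mono (EnrichedFunctor.map (V := W) e.inv (EnrichedFunctor.obj (V := W) e.hom A)
      (EnrichedFunctor.obj (V := W) e.hom B)) := mono_of_mono _ (EnrichedFunctor.map (V := W) e.hom _ _)
  have h₄ : IsSplitEpi (EnrichedFunctor.map (V := W) e.inv (EnrichedFunctor.obj (V := W) e.hom A)
      (EnrichedFunctor.obj (V := W) e.hom B)) := ⟨⟨⟨inv (EnrichedFunctor.map (V := W) e.hom A B ≫
    EnrichedFunctor.map (V := W) e.inv _ _) ≫ EnrichedFunctor.map (V := W) e.hom A B,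
      (Category.assoc _ _ _).trans (IsIso.inv_hom_id _)⟩⟩⟩
  have h₅ := isIso_of_mono_of_isSplitEpi (EnrichedFunctor.map (V := W) e.inv
    (EnrichedFunctor.obj (V := W) e.hom A) (EnrichedFunctor.obj (V := W) e.hom B))
  exact IsIso.of_isIso_comp_right _ (EnrichedFunctor.map (V := W) e.inv _ _)

lemma SmallEnrichedCat.bijective_obj {W : Type v} [Category.{u} W] [MonoidalCategory W]
    {C C' : SmallEnrichedCat W} (e : C ≅ C') :
    Function.Bijective (EnrichedFunctor.obj (V := W) e.hom) :=
  Function.bijective_iff_has_inverse.2 ⟨EnrichedFunctor.obj (V := W) e.inv,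
    fun A ↦ congrArg (fun k : C ⟶ C ↦ EnrichedFunctor.obj (V := W) k A) e.hom_inv_id,
    fun A ↦ congrArg (fun k : C' ⟶ C' ↦ EnrichedFunctor.obj (V := W) k A) e.inv_hom_id⟩

variable [HasLimits V]

lemma nMap_comp {X Y Z : SimplicialObject V} (f : X ⟶ Y) (g : Y ⟶ Z) :
    nMap f ≫ nMap g = nMap (f ≫ g) := by
  ext T
  refine nObj_ext fun n x ↦ ?_
  rw [NatTrans.comp_app, Category.assoc, nMap_π, nMap_π, NatTrans.comp_app, ← Category.assoc,
    nMap_π, Category.assoc]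

lemma IsHomwiseColimit.comp_iso {D : NecCat V} {C C' : SmallEnrichedCat (SimplicialObject V)}
    {η : D ⟶ nFunctor.obj C} (h : IsHomwiseColimit η) (e : C ≅ C') :
    IsHomwiseColimit (η ≫ nFunctor.map e.hom) := by
  refine ⟨(SmallEnrichedCat.bijective_obj e).comp h.1, fun A B Y ↦ ?_⟩
  have := SmallEnrichedCat.isIso_map e (NecCat.Hom.obj η A) (NecCat.Hom.obj η B)
  have h₁ : Function.Bijective fun g : C'.sHom _ _ ⟶ Y ↦
      EnrichedFunctor.map (V := SimplicialObject V) e.hom (NecCat.Hom.obj η A)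
        (NecCat.Hom.obj η B) ≫ g :=
    ⟨fun g g' w ↦ (cancel_epi _).1 w, fun g ↦ ⟨inv _ ≫ g, IsIso.hom_inv_id_assoc _ _⟩⟩
  have h₂ := (h.2 A B Y).comp h₁
  refine Eq.mp (congrArg Function.Bijective (funext fun g ↦ ?_)) h₂
  exact ((Category.assoc _ _ _).trans (congrArg (_ ≫ ·) (nMap_comp _ _))).symm

variable [HasColimits V] [SymmetricCategory V] [MonoidalClosed V]

lemma isHomwiseColimit_unit {s : NecCat V ⥤ SmallEnrichedCat (SimplicialObject V)}
    (adj : s ⊣ nFunctor) (D : NecCat V) : IsHomwiseColimit (adj.unit.app D) := by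
  let e := (isInitialSCatUnit D).uniqueUpToIso (mkInitialOfLeftAdjoint _ adj D)
  have h : sCatUnit D ≫ nFunctor.map e.hom.right = adj.unit.app D := StructuredArrow.w e.hom
  rw [← h]
  exact isHomwiseColimit_sCatUnit.comp_iso ((StructuredArrow.proj _ _).mapIso e)

end Uniqueness

/-! ## Elements of the necklaces of a simplicial set -/

section Path

open Quiv

variable (K : SSet.{u})

/-- The set of maps from the necklace with beads `T` to a simplicial set `K`, that is the set of
sequences of simplices with dimensions `T` in which the last vertex of each simplex is the first
vertex of the next. -/
def Path : List ℕ → simp K 0 → simp K 0 → Type u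
  | [], a, b => ULift.{u} (PLift (a = b))
  | n :: T, a, b => Σ c, Simp K n a c × Path T c b

variable {K} {V : Type v} [Category.{u} V] [MonoidalCategory V] [HasColimits V]
  [SymmetricCategory V] [MonoidalClosed V]

namespace Path

variable (V) in
/-- The element of `F̃(K)_T(a, b)` given by a path. -/
def gen : ∀ {T : List ℕ} {a b : simp K 0}, Path K T a b →
    (𝟙_ V ⟶ (necObj (freeFunctor V K) T).hom a b)
  | [], _, _, t => unitι t.down.down
  | _ :: _, _, _, t => mul (Quiv.gen t.2.1) (gen t.2.2)

lemma mul_desc_aux {S : Type u} {Q : S → S → Type u} {P : Quiv V S} {a c b : S} (x : Q a c)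
    (q : 𝟙_ V ⟶ P.hom c b) {Z : V} (g : ((free V Q) ⊗ P).hom a b ⟶ Z) :
    mul (Quiv.gen x) q ≫ g = q ≫ (λ_ _).inv ≫ (Quiv.gen x ▷ _ ≫ ι (free V Q) P a c b ≫ g) := by
  rw [mul, MonoidalCategory.tensorHom_def', Category.assoc, Category.assoc, Category.assoc,
    leftUnitor_inv_naturality_assoc]

lemma gen_ext : ∀ {T : List ℕ} {a b : simp K 0} {Z : V}
    {f g : (necObj (freeFunctor V K) T).hom a b ⟶ Z},
    (∀ t : Path K T a b, t.gen V ≫ f = t.gen V ≫ g) → f = g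
  | [], _, _, _, _, _, h => unit_ext fun e ↦ h ⟨⟨e⟩⟩
  | n :: T, a, b, Z, f, g, h => by
    refine tensor_ext fun c ↦ sigmaR_ext fun x ↦ ?_
    rw [← cancel_epi (λ_ _).inv]
    refine gen_ext (T := T) fun t ↦ ?_
    exact (mul_desc_aux _ _ f).symm.trans ((h ⟨c, x, t⟩).trans (mul_desc_aux _ _ g))

/-- Morphisms out of `F̃(K)_T(a, b)`. -/
def desc : ∀ {T : List ℕ} {a b : simp K 0} {Z : V} (_ : Path K T a b → (𝟙_ V ⟶ Z)),
    (necObj (freeFunctor V K) T).hom a b ⟶ Z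
  | [], _, _, _, g => unitDesc fun e ↦ g ⟨⟨e⟩⟩
  | n :: _, _, _, _, g => Quiv.desc fun c ↦ descR (J := Simp K n _ c) (f := fun _ ↦ 𝟙_ V)
      fun x ↦ (λ_ _).hom ≫ desc fun t ↦ g ⟨c, x, t⟩

lemma gen_desc : ∀ {T : List ℕ} {a b : simp K 0} {Z : V} (g : Path K T a b → (𝟙_ V ⟶ Z))
    (t : Path K T a b), t.gen V ≫ desc g = g t
  | [], _, _, _, g, t => unitι_desc _ _
  | n :: T, a, b, Z, g, ⟨c, x, t⟩ => by
    refine (mul_desc_aux _ _ _).trans (Eq.trans ?_ (gen_desc (fun t ↦ g ⟨c, x, t⟩) t))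
    refine congrArg (t.gen V ≫ ·) ?_
    have h₁ : ι (free V (Simp K n)) (necObj (freeFunctor V K) T) a c b ≫ desc (T := n :: T) g =
      descR (J := Simp K n a c) (f := fun _ ↦ 𝟙_ V)
        fun x ↦ (λ_ _).hom ≫ desc fun t ↦ g ⟨c, x, t⟩ := ι_desc _ _
    refine (congrArg (fun k ↦ (λ_ _).inv ≫ Quiv.gen x ▷ _ ≫ k) h₁).trans ?_
    refine (congrArg ((λ_ _).inv ≫ ·) (ι_descR (f := fun _ : Simp K n a c ↦ 𝟙_ V) _ x)).trans ?_
    exact Iso.inv_hom_id_assoc _ _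

/-- The image of a path under a map of simplicial sets. -/
def image {L : SSet.{u}} (k : K ⟶ L) : ∀ {T : List ℕ} {a b : simp K 0}, Path K T a b →
    Path L T (k.app _ a) (k.app _ b)
  | [], _, _, t => ⟨⟨congrArg _ t.down.down⟩⟩
  | _ :: _, _, _, ⟨_, x, t⟩ => ⟨_, x.image k, image k t⟩

end Path

variable (K) in
/-- A simplicial set whose simplices are determined by their vertices, which are natural numbers
in increasing order. -/
structure Chart where
  /-- the number of a vertex -/
  num : simp K 0 → ℕ
  mono : ∀ {n : ℕ} (x : simp K n) {i j : ℕ} (hij : i ≤ j) (hj : j ≤ n),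
    num (vertex x i (hij.trans hj)) ≤ num (vertex x j hj)
  inj : ∀ {n : ℕ} (x y : simp K n),
    (∀ i (hi : i ≤ n), num (vertex x i hi) = num (vertex y i hi)) → x = y

lemma vertex_self (a : simp K 0) (h : 0 ≤ 0) : vertex a 0 h = a :=
  restr_id _ _ _ fun _ hi ↦ (Nat.le_zero.1 hi).symm

namespace Path

instance : IsIso (Functor.OplaxMonoidal.η (freeFunctor V K)) := (freeTemplicial V K).unital

variable (C : Chart K)

lemma _root_.HCNerve.Chart.num_inj {a b : simp K 0} (h : C.num a = C.num b) : a = b :=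
  C.inj a b fun i hi ↦ by
    obtain rfl := Nat.le_zero.1 hi
    rwa [vertex_self, vertex_self]

/-- The numbers of the vertices of a path. -/
def vtx : ∀ {T : List ℕ} {a b : simp K 0}, Path K T a b → ℕ → ℕ
  | [], _, b, _, i => C.num b + i
  | n :: _, _, _, ⟨_, x, t⟩, i => if h : i ≤ n then C.num (vertex x.val i h) else vtx t (i - n)

lemma vtx_zero : ∀ {T : List ℕ} {a b : simp K 0} (t : Path K T a b), t.vtx C 0 = C.num a
  | [], _, _, t => (congrArg C.num t.down.down).symm
  | n :: _, _, _, ⟨_, x, _⟩ => (dif_pos (Nat.zero_le n)).trans (congrArg C.num x.first)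

lemma vtx_of_le {n : ℕ} {T : List ℕ} {a b c : simp K 0} (x : Simp K n a c) (t : Path K T c b)
    {i : ℕ} (h : i ≤ n) : vtx C (T := n :: T) ⟨c, x, t⟩ i = C.num (vertex x.val i h) := dif_pos h

lemma vtx_cons_add {n : ℕ} {T : List ℕ} {a b c : simp K 0} (x : Simp K n a c) (t : Path K T c b)
    (i : ℕ) : vtx C (T := n :: T) ⟨c, x, t⟩ (n + i) = t.vtx C i := by
  obtain rfl | h := Nat.eq_zero_or_pos i
  · exact (vtx_of_le C x t le_rfl).trans ((congrArg C.num x.last).trans (vtx_zero C t).symm)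
  · refine (dif_neg (by omega)).trans ?_
    rw [Nat.add_sub_cancel_left]

lemma vtx_sum_add : ∀ {T : List ℕ} {a b : simp K 0} (t : Path K T a b) (i : ℕ),
    t.vtx C (T.sum + i) = C.num b + i
  | [], _, _, _, i => by rw [List.sum_nil, Nat.zero_add]; rfl
  | n :: T, _, _, ⟨c, x, t⟩, i => by
    rw [List.sum_cons, Nat.add_assoc, vtx_cons_add, vtx_sum_add]

lemma vtx_mono : ∀ {T : List ℕ} {a b : simp K 0} (t : Path K T a b), Monotone (t.vtx C)
  | [], _, _, _, _, _, h => Nat.add_le_add_left h _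
  | n :: T, _, _, ⟨c, x, t⟩, i, j, h => by
    by_cases hj : j ≤ n
    · rw [vtx_of_le C x t hj, vtx_of_le C x t (h.trans hj)]
      exact C.mono _ h hj
    · obtain ⟨k, rfl⟩ := Nat.exists_eq_add_of_le (Nat.le_of_not_le hj)
      rw [vtx_cons_add]
      by_cases hi : i ≤ n
      · rw [vtx_of_le C x t hi]
        refine (C.mono _ hi le_rfl).trans ?_
        rw [x.last, ← vtx_zero C t]
        exact vtx_mono t (Nat.zero_le k)
      · obtain ⟨l, rfl⟩ := Nat.exists_eq_add_of_le (Nat.le_of_not_le hi)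
        rw [vtx_cons_add]
        exact vtx_mono t (by omega)

lemma vtx_injective : ∀ {T : List ℕ} {a b : simp K 0} {t t' : Path K T a b}
    (_ : ∀ i ≤ T.sum, t.vtx C i = t'.vtx C i), t = t'
  | [], _, _, _, _, _ => Subsingleton.elim (α := ULift (PLift _)) _ _
  | n :: T, a, b, ⟨c, x, t⟩, ⟨c', x', t'⟩, h => by
    have h₁ : ∀ i (hi : i ≤ n), C.num (vertex x.val i hi) = C.num (vertex x'.val i hi) :=
      fun i hi ↦ by
        have := h i (hi.trans (Nat.le_add_right n T.sum))
        rwa [vtx_of_le C x t hi, vtx_of_le C x' t' hi] at this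
    have hx : x.val = x'.val := C.inj _ _ h₁
    obtain rfl : c = c' := by rw [← x.last, ← x'.last, hx]
    obtain rfl : x = x' := Simp.ext hx
    obtain rfl : t = t' := vtx_injective fun i hi ↦ by
      have := h (n + i) (Nat.add_le_add_left hi n)
      rwa [vtx_cons_add, vtx_cons_add] at this
    rfl

variable (V) in
lemma exists_split {a b : simp K 0} : ∀ {U : List ℕ} {c : ℕ} {R : List ℕ} (t : Path K U a b)
    (κ : Cut U c R), ∃ (d : simp K 0) (x : Simp K c a d) (r : Path K R d b),
      t.gen V ≫ (split (freeFunctor V K) κ).app a b = mul (Quiv.gen x) (r.gen V) ∧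
      (∀ i (h : i ≤ c), C.num (vertex x.val i h) = t.vtx C i) ∧
      ∀ i, r.vtx C i = t.vtx C (c + i) := by
  rintro U c R t (⟨rfl, rfl⟩ | ⟨hc, rfl⟩ | ⟨s, U', hc, hs, rfl, rfl⟩)
  · refine ⟨a, Simp.point a, t, ?_, fun i h ↦ ?_, fun i ↦ by rw [Nat.zero_add]⟩
    · have h₁ := leftUnitor_inv_mul (t.gen V)
      have h₂ : unitι (V := V) (rfl : a = a) ≫ (unitInv (freeFunctor V K)).app a a = Quiv.gen (Simp.point a) := by
        have e : unitInv (freeFunctor V K) = (freeη V K).inv :=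
          IsIso.inv_eq_of_hom_inv_id (freeη V K).hom_inv_id
        rw [e]
        exact unitι_desc (V := V) (fun h : a = a ↦ Quiv.gen (h ▸ Simp.point a)) rfl
      have h₃ := mul_whiskerRight (unitι (V := V) (rfl : a = a)) (t.gen V)
        (unitInv (freeFunctor V K))
      exact chain₂ h₁ (h₃.trans (congrArg (mul · _) h₂))
    · obtain rfl := Nat.le_zero.1 h
      rw [vtx_zero]
      exact congrArg C.num (vertex_self _ _)
  · obtain ⟨d, x, r⟩ := t
    exact ⟨d, x, r, Category.comp_id _, fun i h ↦ (vtx_of_le C x r h).symm,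
      fun i ↦ (vtx_cons_add C x r i).symm⟩
  · obtain ⟨d, x, r⟩ := t
    refine ⟨x.middle c s, x.left c s, ⟨d, x.right c s, r⟩, ?_, fun i h ↦ ?_, fun i ↦ ?_⟩
    · have h₁ := gen_δ V K ⟨c⟩ ⟨s⟩ x
      exact chain₂ ((mul_whiskerRight _ _ _).trans (congrArg (mul · _) h₁)) (mul_assoc _ _ _)
    · rw [vtx_of_le C x r (h.trans (Nat.le_add_right c s))]
      exact congrArg C.num (vertex_restr _ _ _ _ _)
    · by_cases hi : i ≤ s
      · rw [vtx_of_le C _ r hi, vtx_of_le C x r (Nat.add_le_add_left hi c)]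
        exact congrArg C.num (vertex_restr _ _ _ _ _)
      · obtain ⟨j, rfl⟩ := Nat.exists_eq_add_of_le (Nat.le_of_not_le hi)
        rw [vtx_cons_add, ← Nat.add_assoc, vtx_cons_add]

variable (V) in
lemma exists_map : ∀ {T U : List ℕ} (f : Nec.Hom T U) (hU : ∀ b ∈ U, 0 < b) {a b : simp K 0}
    (t : Path K U a b), ∃ t' : Path K T a b,
      t.gen V ≫ (necMap (freeFunctor V K) f hU).app a b = t'.gen V ∧
      ∀ i, t'.vtx C i = t.vtx C (f.vert i)
  | [], U, f, hU, a, b, t => by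
    obtain rfl := f.target_nil hU
    refine ⟨t, Category.comp_id _, fun i ↦ ?_⟩
    have := f.vert.map_add i
    simp only [List.sum_nil, Nat.zero_add] at this
    rw [this]
  | n :: T, U, f, hU, a, b, t => by
    obtain ⟨R, κ⟩ := f.cut hU
    obtain ⟨d, x, r, h₁, h₂, h₃⟩ := exists_split V C t κ
    obtain ⟨r', h₄, h₅⟩ := exists_map (f.back κ) (κ.pos hU) r
    refine ⟨⟨d, x.map f.vert.front, r'⟩, ?_, fun i ↦ ?_⟩
    · rw [necMap_cons _ f hU κ]
      exact chain₂ h₁ ((mul_tensorHom _ _ _ _).trans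
        (congrArg₂ mul (gen_map V (m := ⟨n⟩) (n := ⟨f.vert n⟩) f.vert.front x) h₄))
    · by_cases hi : i ≤ n
      · rw [vtx_of_le C _ r' hi, ← h₂ (f.vert i) (f.vert.mono hi)]
        refine (congrArg C.num (vertex_restr _ _ _ _ _)).trans ?_
        congr 2
        exact f.vert.front_apply hi
      · obtain ⟨j, rfl⟩ := Nat.exists_eq_add_of_le (Nat.le_of_not_le hi)
        rw [vtx_cons_add, h₅, h₃]
        refine congrArg (t.vtx C) ?_
        change f.vert n + (f.vert (n + j) - f.vert n) = _
        have := f.vert.mono (Nat.le_add_right n j)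
        omega

lemma gen_image {L : SSet.{u}} (k : K ⟶ L) : ∀ {T : List ℕ} {a b : simp K 0} (t : Path K T a b),
    t.gen V ≫ (necApp (freeApp k) T).app a b = (t.image k).gen V
  | [], _, _, ⟨⟨h⟩⟩ => unitι_pullbackε (V := V) (k.app (op (SimplexCategory.mk 0))) h
  | n :: T, _, _, ⟨c, x, t⟩ => by
    have h₁ := gen_app (V := V) k ⟨n⟩ x
    have h₂ := gen_image k t
    have h₃ : mul (P := (Quiv.pullback (k.app _)).obj ((freeFunctor V L).obj (op ⟨n⟩)))
        (R := (Quiv.pullback (k.app _)).obj (necObj (freeFunctor V L) T))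
        (Quiv.gen (x.image k)) ((t.image k).gen V) ≫ _ = _ :=
      mul_pullbackμ (k.app _) (Quiv.gen (x.image k)) ((t.image k).gen V)
    exact chain₂ ((mul_tensorHom _ _ _ _).trans (congrArg₂ mul h₁ h₂)) h₃

end Path

end Path

/-! ## Lifting inner horns in terms of compatible elements -/

section Amalgamation

/-- The vertices of a standard simplex are naturally numbered. -/
def simplexChart (n : ℕ) : Chart (SSet.stdSimplex.{u}.obj (SimplexCategory.mk n)) where
  num a := ((SSet.stdSimplex.objEquiv a).toOrderHom (0 : Fin 1) : Fin (n + 1))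
  mono x i j hij hj := SSet.stdSimplex.monotone_apply x
    (show (⟨i, Nat.lt_succ_of_le (hij.trans hj)⟩ : Fin _) ≤ ⟨j, Nat.lt_succ_of_le hj⟩ from hij)
  inj x y h := SSet.stdSimplex.ext x y fun i ↦ Fin.ext (h i (Nat.le_of_lt_succ i.2))

/-- The numbering of the vertices of a subcomplex. -/
def Chart.comap {K L : SSet.{u}} (C : Chart L) (k : K ⟶ L)
    (hk : ∀ n (x y : simp K n), k.app _ x = k.app _ y → x = y) : Chart K where
  num a := C.num (k.app _ a)
  mono x i j hij hj := by
    rw [vertex_natural, vertex_natural]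
    exact C.mono _ hij hj
  inj x y h := hk _ _ _ (C.inj _ _ fun i hi ↦ by
    rw [← vertex_natural, ← vertex_natural]
    exact h i hi)

lemma Path.vtx_image {K L : SSet.{u}} (C : Chart L) (k : K ⟶ L)
    (hk : ∀ n (x y : simp K n), k.app _ x = k.app _ y → x = y) : ∀ {T : List ℕ} {a b : simp K 0}
    (t : Path K T a b) (i : ℕ), (t.image k).vtx C i = t.vtx (C.comap k hk) i
  | [], _, _, _, _ => rfl
  | n :: T, _, _, ⟨c, x, t⟩, i => by
    by_cases hi : i ≤ n
    · rw [vtx_of_le (C.comap k hk) x t hi]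
      refine (vtx_of_le C (x.image k) (t.image k) hi).trans ?_
      exact congrArg C.num (vertex_natural k _ _ _).symm
    · obtain ⟨j, rfl⟩ := Nat.exists_eq_add_of_le (Nat.le_of_not_le hi)
      rw [vtx_cons_add]
      exact (vtx_cons_add C (x.image k) (t.image k) j).trans (vtx_image C k hk t j)

/-- The numbering of the vertices of a horn. -/
def hornChart (n : ℕ) (j : Fin (n + 1)) : Chart (SSet.horn.{u} n j : SSet.{u}) :=
  (simplexChart n).comap (SSet.horn n j).ι fun _ _ _ h ↦ Subtype.ext h

/-- The simplex of a standard simplex with given vertices. -/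
def simplexOf {n m : ℕ} (v : ℕ → ℕ) (hv : Monotone v) (h : v m ≤ n) :
    simp (SSet.stdSimplex.{u}.obj (SimplexCategory.mk n)) m :=
  SSet.stdSimplex.objEquiv.symm (simplexHom v hv h)

/-- The maps to the simplex `Δ^n` from necklaces that factor through the horn `Λ^n_j`. -/
def IsInner (n j : ℕ) {T : Nec} (f : T ⟶ Nec.bd n) : Prop :=
  (∃ k ∈ joints T.beads, 0 < f.vert k ∧ f.vert k < n) ∨
    ∃ i ≤ n, i ≠ j ∧ ∀ l ≤ T.len, f.vert l ≠ i

lemma IsInner.comp {n j : ℕ} {T U : Nec} {f : U ⟶ Nec.bd n} (hf : IsInner n j f) (g : T ⟶ U) :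
    IsInner n j (g ≫ f) := by
  obtain ⟨k, hk, h⟩ | ⟨i, hi, hij, h⟩ := hf
  · obtain ⟨l, hl, rfl⟩ := g.joints_subset hk
    exact Or.inl ⟨l, hl, h⟩
  · exact Or.inr ⟨i, hi, hij, fun l hl ↦ h _ (g.vert.map_le hl)⟩

/-- Every compatible family of elements of `Y` at the maps that factor through the horn `Λ^n_j`
is induced by an element of `Y` at `Δ^n`. -/
def AmalgamatesInner {V : Type v} [Category.{u} V] [MonoidalCategory V] (Y : Necᵒᵖ ⥤ V) : Prop :=
  ∀ n j : ℕ, 0 < j → j < n →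
    ∀ h : ∀ (T : Nec) (f : T ⟶ Nec.bd n), IsInner n j f → (𝟙_ V ⟶ Y.obj (op T)),
      (∀ (T U : Nec) (g : T ⟶ U) (f : U ⟶ Nec.bd n) (hf : IsInner n j f),
        h U f hf ≫ Y.map g.op = h T (g ≫ f) (hf.comp g)) →
      ∃ y : 𝟙_ V ⟶ Y.obj (op (Nec.bd n)), ∀ T f hf, y ≫ Y.map f.op = h T f hf

lemma exists_horn_path (n : ℕ) (j : Fin (n + 1)) (hj : 0 < (j : ℕ)) (hj' : (j : ℕ) < n) :
    ∀ (T : List ℕ) (v : ℕ → ℕ) (_ : Monotone v) (_ : v T.sum ≤ n)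
      (_ : (∃ k ∈ joints T, 0 < v k ∧ v k < n) ∨ ∃ i ≤ n, i ≠ j ∧ ∀ l ≤ T.sum, v l ≠ i)
      (a b : simp (SSet.horn.{u} n j : SSet.{u}) 0) (_ : (hornChart n j).num a = v 0)
      (_ : (hornChart n j).num b = v T.sum),
      ∃ t : Path _ T a b, ∀ i ≤ T.sum, t.vtx (hornChart n j) i = v i
  | [], v, hv, hn, h, a, b, ha, hb => by
    refine ⟨⟨⟨Chart.num_inj (hornChart n j) (ha.trans hb.symm)⟩⟩, fun i hi ↦ ?_⟩
    obtain rfl := Nat.le_zero.1 hi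
    exact hb
  | m :: T, v, hv, hn, h, a, b, ha, hb => by
    have hm : v m ≤ n := (hv (Nat.le_add_right _ _)).trans hn
    have hx : ∃ i ≤ n, i ≠ j ∧ ∀ l ≤ m, v l ≠ i := by
      obtain ⟨k, rfl | ⟨k, hk, rfl⟩, h₀, h₁⟩ | ⟨i, hi, hij, h⟩ := h
      · exact ⟨0, Nat.zero_le _, hj.ne, fun l _ ↦ (h₀.trans_le (hv (Nat.zero_le l))).ne'⟩
      · exact ⟨n, le_rfl, hj'.ne', fun l hl ↦
          ((hv (hl.trans (Nat.le_add_right m k))).trans_lt h₁).ne⟩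
      · exact ⟨i, hi, hij, fun l hl ↦ h l (hl.trans (Nat.le_add_right _ _))⟩
    have hmem : simplexOf.{u} v hv hm ∈ (SSet.horn.{u} n j).obj _ := by
      rw [SSet.mem_horn_iff_notMem_range]
      obtain ⟨i, hi, hij, h⟩ := hx
      refine ⟨⟨i, Nat.lt_succ_of_le hi⟩, fun e ↦ hij (congrArg Fin.val e), ?_⟩
      rintro ⟨l, hl⟩
      exact h l (Nat.le_of_lt_succ l.2) (congrArg Fin.val hl)
    let x : simp (SSet.horn.{u} n j : SSet.{u}) m := ⟨simplexOf v hv hm, hmem⟩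
    have hxv : ∀ i (hi : i ≤ m), (hornChart n j).num (vertex x i hi) = v i := fun i hi ↦ rfl
    have hT : (∃ k ∈ joints T, 0 < v (m + k) ∧ v (m + k) < n) ∨
        (∃ i ≤ n, i ≠ j ∧ ∀ l ≤ T.sum, v (m + l) ≠ i) := by
      obtain ⟨k, rfl | ⟨k, hk, rfl⟩, h₀, h₁⟩ | ⟨i, hi, hij, h⟩ := h
      · exact Or.inr ⟨0, Nat.zero_le _, hj.ne, fun l _ ↦ (h₀.trans_le (hv (Nat.zero_le _))).ne'⟩
      · exact Or.inl ⟨k, hk, h₀, h₁⟩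
      · exact Or.inr ⟨i, hi, hij, fun l hl ↦ h _ (Nat.add_le_add_left hl m)⟩
    obtain ⟨t, ht⟩ := exists_horn_path n j hj hj' T (fun i ↦ v (m + i))
      (fun _ _ h ↦ hv (Nat.add_le_add_left h m)) hn hT (vertex x m le_rfl) b (hxv m le_rfl) hb
    refine ⟨⟨vertex x m le_rfl, ⟨x, ?_, rfl⟩, t⟩, fun i hi ↦ ?_⟩
    · exact Chart.num_inj (hornChart n j) ((hxv 0 (Nat.zero_le m)).trans ha.symm)
    · by_cases him : i ≤ m
      · exact (Path.vtx_of_le _ _ _ him).trans (hxv i him)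
      · obtain ⟨l, rfl⟩ := Nat.exists_eq_add_of_le (Nat.le_of_not_le him)
        exact (Path.vtx_cons_add _ _ _ _).trans (ht l (Nat.le_of_add_le_add_left hi))

lemma hornChart_num_le {n : ℕ} {j : Fin (n + 1)} (a : simp (SSet.horn.{u} n j : SSet.{u}) 0) :
    (hornChart n j).num a ≤ n :=
  Nat.le_of_lt_succ (Fin.is_lt _)

lemma horn_path_inner (n : ℕ) (j : Fin (n + 1)) (hj' : 0 < n) :
    ∀ (T : List ℕ) (a b : simp (SSet.horn.{u} n j : SSet.{u}) 0) (_ : (hornChart n j).num a = 0)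
      (_ : (hornChart n j).num b = n) (t : Path _ T a b),
      (∃ k ∈ joints T, 0 < t.vtx (hornChart n j) k ∧ t.vtx (hornChart n j) k < n) ∨
        ∃ i ≤ n, i ≠ j ∧ ∀ l ≤ T.sum, t.vtx (hornChart n j) l ≠ i
  | [], a, b, ha, hb, t => by
    have := congrArg (hornChart n j).num t.down.down
    omega
  | m :: T, a, b, ha, hb, ⟨c, x, t⟩ => by
    have hc := hornChart_num_le c
    have hx : Path.vtx (T := m :: T) (hornChart n j) ⟨c, x, t⟩ m = (hornChart n j).num c :=
      (Path.vtx_of_le _ _ _ le_rfl).trans (congrArg _ x.last)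
    have hmono := Path.vtx_mono (T := m :: T) (hornChart n j) ⟨c, x, t⟩
    obtain h₀ | h₀ := Nat.eq_zero_or_pos ((hornChart n j).num c)
    · obtain ⟨k, hk, h⟩ | ⟨i, hi, hij, h⟩ := horn_path_inner n j hj' T c b h₀ hb t
      · exact Or.inl ⟨m + k, Or.inr ⟨k, hk, rfl⟩, by rwa [Path.vtx_cons_add]⟩
      · refine Or.inr ⟨i, hi, hij, fun l hl ↦ ?_⟩
        by_cases hlm : l ≤ m
        · have h₁ := h 0 (Nat.zero_le _)
          rw [Path.vtx_zero, h₀] at h₁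
          have := hmono hlm
          omega
        · obtain ⟨k, rfl⟩ := Nat.exists_eq_add_of_le (Nat.le_of_not_le hlm)
          rw [Path.vtx_cons_add]
          exact h k (Nat.le_of_add_le_add_left hl)
    obtain h₁ | h₁ := hc.lt_or_eq
    · exact Or.inl ⟨m, Or.inr ⟨0, zero_mem_joints _, rfl⟩, by rw [hx]; exact ⟨h₀, h₁⟩⟩
    · have hmem := (SSet.mem_horn_iff_notMem_range _ _).1 x.val.2
      obtain ⟨i, hij, h⟩ := hmem
      have hl : ∀ l ≤ m, Path.vtx (T := m :: T) (hornChart n j) ⟨c, x, t⟩ l ≠ i := fun l hl e ↦ by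
        rw [Path.vtx_of_le _ _ _ hl] at e
        exact h ⟨⟨l, Nat.lt_succ_of_le hl⟩, Fin.ext e⟩
      refine Or.inr ⟨i, Nat.le_of_lt_succ i.2, fun e ↦ hij (Fin.ext e), fun l hl' ↦ ?_⟩
      by_cases hlm : l ≤ m
      · exact hl l hlm
      · have h₂ := hl m le_rfl
        have h₃ := hmono (Nat.le_of_not_le hlm)
        have h₄ := hmono hl'
        have h₅ : Path.vtx (T := m :: T) (hornChart n j) ⟨c, x, t⟩ (m :: T).sum = n :=
          (Path.vtx_sum_add (hornChart n j) _ 0).trans hb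
        omega

/-- The map of necklaces `T ⟶ Δ^n` given by the vertices of a path. -/
def Path.toSimplex {K : SSet.{u}} (C : Chart K) {T : Nec} {a b : simp K 0}
    (t : Path K T.beads a b) (n : ℕ) (ha : C.num a = 0) (hb : C.num b = n) : T ⟶ Nec.bd n where
  vert :=
    { toFun := t.vtx C
      mono := t.vtx_mono C
      map_zero := (t.vtx_zero C).trans ha
      map_add i := (t.vtx_sum_add C i).trans (by rw [hb]; exact congrArg (· + i) (Nec.bdl_sum n).symm) }
  joints_subset i hi := by
    obtain rfl | rfl := Nec.mem_joints_bdl.1 hi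
    · exact ⟨0, zero_mem_joints _, (t.vtx_zero C).trans ha⟩
    · exact ⟨_, sum_mem_joints _, (t.vtx_sum_add C 0).trans hb⟩

variable {V : Type v} [Category.{u} V] [MonoidalCategory V] [HasColimits V]
  [SymmetricCategory V] [MonoidalClosed V]

lemma AmalgamatesInner.liftsInnerHorns {Y : Necᵒᵖ ⥤ V} (hY : AmalgamatesInner Y) :
    LiftsInnerHorns Y := by
  intro n j hj hj' φ
  have hj₁ : 0 < (j : ℕ) := hj
  have hj₂ : (j : ℕ) < n + 2 := hj'
  let C := hornChart.{u} (n + 2) j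
  let C' := simplexChart.{u} (n + 2)
  have hp : ∀ (T : Nec) (f : T ⟶ Nec.bd (n + 2)) (_ : IsInner (n + 2) j f),
      ∃ t : Path (SSet.horn.{u} (n + 2) j : SSet.{u}) T.beads (hornVertex n j 0)
        (hornVertex n j (Fin.last (n + 2))), ∀ i ≤ T.len, t.vtx C i = f.vert i := fun T f hf ↦
    exists_horn_path (n + 2) j hj₁ hj₂ T.beads f.vert f.vert.mono f.vert.map_last.le hf _ _
      f.vert.map_zero.symm f.vert.map_last.symm
  choose p hp using hp
  obtain ⟨y, hy⟩ := hY (n + 2) j hj₁ hj₂ (fun T f hf ↦ (p T f hf).gen V ≫ φ.app (op T))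
    fun T U g f hf ↦ by
      obtain ⟨t, ht, ht'⟩ := Path.exists_map V C g U.pos (p U f hf)
      have e : t = p T (g ≫ f) (hf.comp g) := Path.vtx_injective C fun i hi ↦ by
        rw [ht', hp U f hf _ (g.vert.map_le hi), hp T (g ≫ f) _ _ hi]
        rfl
      subst e
      have h := φ.naturality g.op
      refine (Category.assoc _ _ _).trans ((congrArg (_ ≫ ·) h).symm.trans ?_)
      exact (Category.assoc _ _ _).symm.trans (congrArg (· ≫ φ.app (op T)) ht)
  have hmap : ∀ {T U : Nec} (g : T ⟶ U) (f : U ⟶ Nec.bd (n + 2)) (k : T ⟶ Nec.bd (n + 2))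
      (_ : ∀ i, k.vert i = f.vert (g.vert i)), (y ≫ Y.map f.op) ≫ Y.map g.op = y ≫ Y.map k.op := by
    intro T U g f k h
    have e : k = g ≫ f := Nec.hom_ext' fun i _ ↦ h i
    rw [e, op_comp, Y.map_comp, Category.assoc]
  let ψ : necHom (freeTemplicial V (SSet.stdSimplex.{u}.obj (SimplexCategory.mk (n + 2))))
      (simplexVertex (n + 2) 0) (simplexVertex (n + 2) (Fin.last (n + 2))) ⟶ Y :=
    { app T := Path.desc fun t ↦ y ≫ Y.map (t.toSimplex (T := T.unop) C' (n + 2) rfl rfl).op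
      naturality U T g := Path.gen_ext fun t ↦ by
        obtain ⟨t', ht, ht'⟩ := Path.exists_map V C' g.unop U.unop.pos t
        refine (Quiv.chain₂ ht (Path.gen_desc _ t')).trans (Eq.symm ?_)
        refine Quiv.chain₂ (Path.gen_desc _ t) ?_
        exact hmap g.unop _ _ ht' }
  refine ⟨ψ, ?_⟩
  ext T
  refine Path.gen_ext fun t ↦ ?_
  have hk : ∀ m (x y : simp (SSet.horn.{u} (n + 2) j : SSet.{u}) m),
    (SSet.horn.{u} (n + 2) j).ι.app _ x = (SSet.horn.{u} (n + 2) j).ι.app _ y → x = y :=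
    fun _ _ _ h ↦ Subtype.ext h
  have h₀ : ∀ i, (t.image (SSet.horn.{u} (n + 2) j).ι).vtx C' i = t.vtx C i :=
    Path.vtx_image C' _ hk t
  refine (Quiv.chain₂ (Path.gen_image (V := V) (SSet.horn.{u} (n + 2) j).ι t) (Path.gen_desc _ _)).trans ?_
  let f := Path.toSimplex (T := T.unop) C' (t.image (SSet.horn.{u} (n + 2) j).ι) (n + 2) rfl rfl
  have hf : IsInner (n + 2) j f := by
    obtain ⟨k, hk, h⟩ | ⟨i, hi, hij, h⟩ := horn_path_inner (n + 2) j (Nat.succ_pos _) T.unop.beads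
      _ _ rfl rfl t
    · exact Or.inl ⟨k, hk, by rw [← h₀] at h; exact h⟩
    · exact Or.inr ⟨i, hi, hij, fun l hl ↦ (h₀ l).trans_ne (h l hl)⟩
  refine (hy T.unop f hf).trans (congrArg (· ≫ φ.app T) (congrArg (Path.gen V) ?_))
  exact Path.vtx_injective C fun i hi ↦ (hp T.unop f hf i hi).trans (h₀ i)

end Amalgamation

/-! ## Amalgamation in cofree templicial objects -/

section Pair

variable {W : Type v} [Category.{u} W] [MonoidalCategory W] (X : FIntᵒᵖ ⥤ W)

open Nec

instance isIso_necWedge : ∀ T U : List ℕ, IsIso (necWedge X T U)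
  | [], _ => inferInstanceAs (IsIso (λ_ _).hom)
  | a :: T, U => by
    have := isIso_necWedge T U
    exact inferInstanceAs (IsIso ((α_ _ _ _).hom ≫ bead X a ◁ necWedge X T U))

variable [X.OplaxMonoidal] [IsIso (Functor.OplaxMonoidal.η X)]

instance isIso_beadNec (n : ℕ) : IsIso (beadNec (X := X) n) :=
  ⟨necBead n, beadNec_necBead n, necBead_beadNec n⟩

/-- The isomorphism between `X_k ⊗ X_l` and the value of `X` at the necklace `Δ^k ∨ Δ^l`. -/
def pairNec (k l : ℕ) : bead X k ⊗ bead X l ⟶ necObj X (bdl k ++ bdl l) :=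
  (beadNec k ⊗ₘ beadNec l) ≫ necWedge X (bdl k) (bdl l)

instance (k l : ℕ) : IsIso (pairNec X k l) :=
  inferInstanceAs (IsIso ((beadNec k ⊗ₘ beadNec l) ≫ necWedge X (bdl k) (bdl l)))

/-- The isomorphism between `X_k ⊗ (X_l ⊗ X_m)` and the value of `X` at the necklace
`Δ^k ∨ (Δ^l ∨ Δ^m)`. -/
def tripleNec (k l m : ℕ) : bead X k ⊗ (bead X l ⊗ bead X m) ⟶
    necObj X (bdl k ++ (bdl l ++ bdl m)) :=
  (beadNec k ⊗ₘ pairNec X l m) ≫ necWedge X (bdl k) (bdl l ++ bdl m)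

instance (k l m : ℕ) : IsIso (tripleNec X k l m) :=
  inferInstanceAs (IsIso ((beadNec k ⊗ₘ pairNec X l m) ≫ necWedge X (bdl k) (bdl l ++ bdl m)))

lemma comulOf_pairNec (k l n : ℕ) (h : k + l = n) : comulOf X k l n h ≫ pairNec X k l =
    beadNec n ≫ necMap X (cutMap k l n h) (bdl_pos n) := by
  subst h
  rw [comulOf_rfl]
  exact comul_beadNec k l

section

variable {C : Type*} [Category* C] [MonoidalCategory C] {P M P' M' Q Z K L K' L' Y R T : C}

lemma pair_map_aux {b : P ⟶ P'} {b' : M ⟶ M'} {w : P' ⊗ M' ⟶ Z} {n : Z ⟶ Y} {u : P' ⟶ K'}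
    {u' : M' ⟶ L'} {w' : K' ⊗ L' ⟶ Y} {v : P ⟶ K} {v' : M ⟶ L} {c : K ⟶ K'} {c' : L ⟶ L'}
    (h : w ≫ n = (u ⊗ₘ u') ≫ w') (h₁ : v ≫ c = b ≫ u) (h₂ : v' ≫ c' = b' ≫ u') :
    ((b ⊗ₘ b') ≫ w) ≫ n = (v ⊗ₘ v') ≫ (c ⊗ₘ c') ≫ w' := by
  rw [Category.assoc, h, tensorHom_comp_tensorHom_assoc, tensorHom_comp_tensorHom_assoc, h₁, h₂]

lemma pair_left_aux {bp : P ⟶ P'} {bm : M ⟶ M'} {w : P' ⊗ M' ⟶ Z} {n : Z ⟶ Y} {u : P' ⟶ Q}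
    {i : M' ⟶ M'} {w₁ : Q ⊗ M' ⟶ Y} {c : P ⟶ K ⊗ L} {bk : K ⟶ K'} {bl : L ⟶ L'}
    {w₂ : K' ⊗ L' ⟶ Q} {w₃ : L' ⊗ M' ⟶ R} {w₄ : K' ⊗ R ⟶ T} {s : T ⟶ Y} {s' : Y ⟶ T}
    (h₁ : w ≫ n = (u ⊗ₘ i) ≫ w₁) (hi : i = 𝟙 _) (h₂ : c ≫ (bk ⊗ₘ bl) ≫ w₂ = bp ≫ u)
    (h₃ : w₂ ▷ M' ≫ w₁ = (α_ _ _ _).hom ≫ K' ◁ w₃ ≫ w₄ ≫ s) (h₄ : s ≫ s' = 𝟙 _) :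
    ((bp ⊗ₘ bm) ≫ w) ≫ n ≫ s' = c ▷ M ≫ (α_ _ _ _).hom ≫ (bk ⊗ₘ ((bl ⊗ₘ bm) ≫ w₃)) ≫ w₄ := by
  subst hi
  have e : ((bp ≫ u) ⊗ₘ bm) = c ▷ M ≫ ((bk ⊗ₘ bl) ⊗ₘ bm) ≫ w₂ ▷ M' := by
    rw [← h₂, ← tensorHom_id, ← tensorHom_id, tensorHom_comp_tensorHom, tensorHom_comp_tensorHom,
      Category.id_comp, Category.comp_id]
  have e' : (bk ⊗ₘ ((bl ⊗ₘ bm) ≫ w₃)) = (bk ⊗ₘ (bl ⊗ₘ bm)) ≫ K' ◁ w₃ := by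
    rw [← id_tensorHom, tensorHom_comp_tensorHom, Category.comp_id]
  rw [Category.assoc, reassoc_of% h₁, tensorHom_comp_tensorHom_assoc, Category.comp_id, e, e']
  simp only [Category.assoc]
  rw [reassoc_of% h₃, h₄, associator_naturality_assoc, Category.comp_id]

lemma pair_right_aux {bp : P ⟶ P'} {bm : M ⟶ M'} {w : P' ⊗ M' ⟶ Z} {n : Z ⟶ Y} {u : M' ⟶ Q}
    {i : P' ⟶ P'} {w₁ : P' ⊗ Q ⟶ Y} {c : M ⟶ K} {x : K ⟶ Q}
    (h₁ : w ≫ n = (i ⊗ₘ u) ≫ w₁) (hi : i = 𝟙 _) (h₂ : c ≫ x = bm ≫ u) :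
    ((bp ⊗ₘ bm) ≫ w) ≫ n = P ◁ c ≫ (bp ⊗ₘ x) ≫ w₁ := by
  subst hi
  rw [Category.assoc, h₁, tensorHom_comp_tensorHom_assoc, Category.comp_id, ← h₂,
    ← id_tensorHom, tensorHom_comp_tensorHom_assoc, Category.id_comp]

end

lemma pairNec_map {k l a c : ℕ} (φ₁ : FInt.Hom k a) (φ₂ : FInt.Hom l c) :
    pairNec X a c ≫ necMap X (bdMap φ₁ ⊗ₘ bdMap φ₂) (bd a ⊗ bd c).pos =
      (beadMap X φ₁ ⊗ₘ beadMap X φ₂) ≫ pairNec X k l :=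
  pair_map_aux (necWedge_natural X (bdMap φ₁) (bdMap φ₂) (bd a).pos (bd c).pos (bd a ⊗ bd c).pos)
    (beadMap_beadNec φ₁) (beadMap_beadNec φ₂)

lemma pairNec_left (k l m p : ℕ) (hp : k + l = p) :
    pairNec X p m ≫ necMap X ((α_ _ _ _).inv ≫ cutMap k l p hp ▷ bd m) (bd p ⊗ bd m).pos =
      comulOf X k l p hp ▷ bead X m ≫ (α_ _ _ _).hom ≫ tripleNec X k l m := by
  have h₀ := necMap_comp X (α_ (bd k) (bd l) (bd m)).inv (cutMap k l p hp ▷ bd m)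
    ((bd k ⊗ bd l) ⊗ bd m).pos (bd p ⊗ bd m).pos
  have h₁ := necWedge_natural X (cutMap k l p hp) (𝟙 (bd m)) (bd p).pos (bd m).pos
    (bd p ⊗ bd m).pos
  have h₂ := comulOf_pairNec X k l p hp
  have h₃ := necWedge_assoc X (bdl k) (bdl l) (bdl m) (bd k ⊗ (bd l ⊗ bd m)).pos
  have h₄ := (necMap_comp X (α_ (bd k) (bd l) (bd m)).inv (α_ (bd k) (bd l) (bd m)).hom
    ((bd k ⊗ bd l) ⊗ bd m).pos (bd k ⊗ (bd l ⊗ bd m)).pos).symm.trans (necMap_id X _ _)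
  exact (congrArg (pairNec X p m ≫ ·) h₀).trans
    (pair_left_aux h₁ (necMap_id X _ _) h₂ h₃ h₄)

lemma pairNec_right (k l m q : ℕ) (hq : l + m = q) :
    pairNec X k q ≫ necMap X (bd k ◁ cutMap l m q hq) (bd k ⊗ bd q).pos =
      bead X k ◁ comulOf X l m q hq ≫ tripleNec X k l m :=
  pair_right_aux (necWedge_natural X (𝟙 (bd k)) (cutMap l m q hq) (bd k).pos (bd q).pos
    (bd k ⊗ bd q).pos) (necMap_id X _ _) (comulOf_pairNec X l m q hq)

lemma BeadHom.pairNec_nec {E : Necᵒᵖ ⥤ W} [E.LaxMonoidal] (g : BeadHom X E) (k l : ℕ) :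
    pairNec X k l ≫ g.nec (bdl k ++ bdl l) (bd k ⊗ bd l).pos =
      (g.app k ⊗ₘ g.app l) ≫ Functor.LaxMonoidal.μ E (op (bd k)) (op (bd l)) := by
  refine (Category.assoc _ _ _).trans ((congrArg (_ ≫ ·) (g.nec_wedge (bdl k) (bdl l) (bdl_pos k)
    (bdl_pos l) (bd k ⊗ bd l).pos)).trans ?_)
  exact (Category.assoc _ _ _).symm.trans (congrArg (· ≫ _) ((tensorHom_comp_tensorHom _ _ _ _).trans
    (congrArg₂ (· ⊗ₘ ·) (g.nec_app k) (g.nec_app l))))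

end Pair

/-- The map `[n] ⟶ [n + 1]` that omits `i`. -/
def FInt.Hom.face {n i : ℕ} (h₀ : 0 < i) (h : i ≤ n) : FInt.Hom n (n + 1) where
  toFun l := if l < i then l else l + 1
  mono a b h := by
    dsimp only
    split_ifs <;> omega
  map_zero := if_pos h₀
  map_add l := (if_neg (by omega)).trans (by omega)

lemma FInt.Hom.face_pos {n i k : ℕ} (h₀ : 0 < i) (h : i ≤ n) (hk : 0 < k) :
    0 < FInt.Hom.face h₀ h k := by
  change 0 < if k < i then k else k + 1
  split_ifs <;> omega

lemma FInt.Hom.face_lt {n i k : ℕ} (h₀ : 0 < i) (h : i ≤ n) (hk : k < n) :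
    FInt.Hom.face h₀ h k < n + 1 := by
  change (if k < i then k else k + 1) < n + 1
  split_ifs <;> omega

namespace Nec

/-- Maps to a simplex that miss an inner vertex factor through a face. -/
lemma exists_face {n i : ℕ} (h₀ : 0 < i) (h : i ≤ n) {T : Nec} (f : T ⟶ bd (n + 1))
    (hf : ∀ l ≤ T.len, f.vert l ≠ i) :
    ∃ g : T ⟶ bd n, g ≫ bdMap (FInt.Hom.face h₀ h) = f := by
  have hT : f.vert T.len = n + 1 := f.vert.map_last
  have hn : ∀ l, T.len < l → n + 1 ≤ f.vert l := fun l hl ↦ hT.ge.trans (f.vert.mono hl.le)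
  have hf' : ∀ l, f.vert l ≠ i := fun l ↦ by
    obtain hl | hl := le_or_gt l T.len
    · exact hf l hl
    · have := hn l hl
      omega
  have hm : ∀ a b, a ≤ b → f.vert a ≤ f.vert b := fun a b h ↦ f.vert.mono h
  have h0 : f.vert 0 = 0 := f.vert.map_zero
  have ha : ∀ l, f.vert (T.beads.sum + l) = n + 1 + l := f.vert.map_add
  have hs : (bd n).beads.sum = n := bdl_sum n
  refine ⟨⟨⟨fun l ↦ if f.vert l < i then f.vert l else f.vert l - 1, fun a b hab ↦ ?_, ?_,
    fun l ↦ ?_⟩, fun k hk ↦ ?_⟩, hom_ext' fun l hl ↦ ?_⟩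
  · have := hm a b hab
    dsimp only
    split_ifs <;> omega
  · rw [h0]
    simp
  · rw [ha, hs]
    split_ifs <;> omega
  · obtain rfl | rfl := mem_joints_bdl.1 hk
    · exact ⟨0, zero_mem_joints _, by change (if _ then _ else _) = _; rw [h0]; simp⟩
    · refine ⟨_, sum_mem_joints _, ?_⟩
      have := ha 0
      change (if f.vert (T.beads.sum + 0) < i then f.vert (T.beads.sum + 0) else
        f.vert (T.beads.sum + 0) - 1) = _
      split_ifs <;> omega
  · have := hf' l
    change (if (if f.vert l < i then f.vert l else f.vert l - 1) < i then
      (if f.vert l < i then f.vert l else f.vert l - 1) else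
        (if f.vert l < i then f.vert l else f.vert l - 1) + 1) = f.vert l
    split_ifs <;> omega

/-- Maps to a simplex with a joint at an inner vertex `k` factor through the cut at `k`. -/
lemma exists_cutMap {k l n : ℕ} (h : k + l = n) {T : Nec} (f : T ⟶ bd n) {j : ℕ}
    (hj : j ∈ joints T.beads) (hk : f.vert j = k) :
    ∃ g : T ⟶ bd k ⊗ bd l, g ≫ cutMap k l n h = f := by
  have hs : (bd k ⊗ bd l).beads.sum = (bd n).beads.sum :=
    (tensor_len (bd k) (bd l)).trans (by rw [bd_len, bd_len, h]; exact (bdl_sum n).symm)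
  refine ⟨⟨f.vert.comp (FInt.Hom.cast hs.symm), fun i hi ↦ ?_⟩, hom_ext' fun _ _ ↦ rfl⟩
  obtain hi | ⟨i, hi', rfl⟩ := mem_joints_append.1 hi
  · obtain rfl | rfl := mem_joints_bdl.1 hi
    · exact ⟨0, zero_mem_joints _, f.vert.map_zero⟩
    · exact ⟨j, hj, hk⟩
  · have e : (bd k).beads.sum = k := bdl_sum k
    have e' : (bd n).beads.sum = n := bdl_sum n
    rw [e]
    obtain rfl | rfl := mem_joints_bdl.1 hi'
    · exact ⟨j, hj, hk⟩
    · exact ⟨_, sum_mem_joints _, f.vert.map_last.trans (e'.trans h.symm)⟩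

lemma isInner_cutMap {k l n j : ℕ} (h : k + l = n) (hk : 0 < k) (hl : 0 < l) :
    IsInner n j (cutMap k l n h) :=
  Or.inl ⟨k, mem_joints_append.2 (Or.inl (mem_joints_bdl.2 (Or.inr rfl))), hk,
    by rw [cutMap_vert]; omega⟩

lemma isInner_face {n i j : ℕ} (h₀ : 0 < i) (h : i ≤ n) (hij : i ≠ j) :
    IsInner (n + 1) j (bdMap (FInt.Hom.face h₀ h)) :=
  Or.inr ⟨i, by omega, hij, fun l hl ↦ by
    change (if l < i then l else l + 1) ≠ i
    split_ifs <;> omega⟩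

end Nec

section TempAmalgamation

variable {V : Type v} [Category.{u} V] [MonoidalCategory V] [HasColimits V]
  [SymmetricCategory V] [MonoidalClosed V] [HasLimits V]

open Nec Quiv

lemma comulOf_tempX (D : NecCat V) (k l n : ℕ) (h : k + 1 + (l + 1) = n + 1) (h' : k + l + 1 = n) :
    comulOf D.tempX (k + 1) (l + 1) (n + 1) h = D.cofree.δ n k l h' := by
  obtain rfl : n = k + 1 + l := by omega
  exact comulOf_rfl D.tempX (k + 1) (l + 1)

lemma app_chain {S : Type u} {A : V} {Q R P Z : Quiv V S} {a b : S} {x : A ⟶ Q.hom a b} {f : Q ⟶ R}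
    {k : R ⟶ Z} {f' : Q ⟶ P} {k' : P ⟶ Z} (h : f ≫ k = f' ≫ k') {y : A ⟶ P.hom a b}
    (hy : x ≫ f'.app a b = y) : (x ≫ f.app a b) ≫ k.app a b = y ≫ k'.app a b := by
  subst hy
  exact (Category.assoc _ _ _).trans ((congrArg (fun k ↦ x ≫ Quiv.Hom.app k a b) h).trans
    (Category.assoc _ _ _).symm)

lemma NecCat.amalgamatesInner_temp (D : NecCat V) {a b : D.Obj}
    (hD : AmalgamatesInner (D.hom a b)) :
    AmalgamatesInner (HCNerve.necHom D.temp a b) := by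
  intro n j hj hjn h hh
  obtain ⟨N, rfl⟩ : ∃ N, n = N + 1 := ⟨n - 1, by omega⟩
  let t : ∀ (T : Nec) (f : T ⟶ bd (N + 1)), IsInner (N + 1) j f →
    (𝟙_ V ⟶ (necObj D.tempX T.beads).hom a b) := h
  have ht : ∀ {T U : Nec} (g : T ⟶ U) (f : U ⟶ bd (N + 1)) (hf) (f' : T ⟶ bd (N + 1)) (hf'),
      g ≫ f = f' → t U f hf ≫ (necMap D.tempX g U.pos).app a b = t T f' hf' := by
    rintro T U g f hf _ hf' rfl
    exact hh T U g f hf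
  let g := D.counitHom
  obtain ⟨γ, hγ⟩ := hD (N + 1) j hj hjn
    (fun T f hf ↦ t T f hf ≫ (g.nec T.beads T.pos).app a b) fun T U k f hf ↦ by
      have e := congrArg (fun k ↦ t U f hf ≫ Quiv.Hom.app k a b) (g.nec_natural k T.pos U.pos)
      refine (Category.assoc _ _ _).trans (e.symm.trans ?_)
      exact (Category.assoc _ _ _).symm.trans (congrArg (· ≫ _) (ht k f hf _ (hf.comp k) rfl))
  let γ' : 𝟙_ V ⟶ ((D.lax (_root_.id : D.Obj → D.Obj)).obj (op (bd (N + 1)))).hom a b := γ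
  have hγ' : ∀ {T : Nec} (f : T ⟶ bd (N + 1)) hf,
      γ' ≫ ((D.lax (_root_.id : D.Obj → D.Obj)).map f.op).app a b =
        t T f hf ≫ (g.nec T.beads T.pos).app a b := fun f hf ↦ hγ _ f hf
  have hcut (k l : ℕ) (e : k + l + 1 = N) : k + 1 + (l + 1) = N + 1 := by omega
  have hinner (k l : ℕ) (e : k + l + 1 = N) :
      IsInner (N + 1) j (cutMap (k + 1) (l + 1) (N + 1) (hcut k l e)) :=
    isInner_cutMap _ (Nat.succ_pos k) (Nat.succ_pos l)
  let τ (k l : ℕ) (e : k + l + 1 = N) : 𝟙_ V ⟶ (D.cofree.X k ⊗ D.cofree.X l).hom a b :=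
    t _ (cutMap (k + 1) (l + 1) (N + 1) (hcut k l e)) (hinner k l e) ≫
      (inv (pairNec D.tempX (k + 1) (l + 1))).app a b
  have hτ (k l : ℕ) (e : k + l + 1 = N) : τ k l e ≫ (pairNec D.tempX (k + 1) (l + 1)).app a b =
      t _ (cutMap (k + 1) (l + 1) (N + 1) (hcut k l e)) (hinner k l e) := by
    have e₁ := congrArg (fun k ↦ Quiv.Hom.app k a b)
      (IsIso.inv_hom_id (pairNec D.tempX (k + 1) (l + 1)))
    exact (Category.assoc _ _ _).trans ((congrArg (_ ≫ ·) e₁).trans (Category.comp_id _))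
  let c : D.cofree.Cone N a b (𝟙_ V) :=
    { g := γ'
      h := τ
      h_g k l e := by
        have e₁ := congrArg (fun q ↦ τ k l e ≫ Quiv.Hom.app q a b) (BeadHom.pairNec_nec D.tempX g (k + 1) (l + 1))
        refine e₁.symm.trans ((Category.assoc _ _ _).symm.trans ?_)
        exact (congrArg (· ≫ _) (hτ k l e)).trans (hγ' _ (hinner k l e)).symm
      h_h k l m p q hp hpn hq hqn := by
        have : IsIso ((tripleNec D.tempX (k + 1) (l + 1) (m + 1)).app a b) := isIso_app _ a b
        have e₁ := pairNec_left D.tempX (k + 1) (l + 1) (m + 1) (p + 1) (by omega)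
        have e₂ := pairNec_right D.tempX (k + 1) (l + 1) (m + 1) (q + 1) (by omega)
        rw [comulOf_tempX D k l p _ hp] at e₁
        rw [comulOf_tempX D l m q _ hq] at e₂
        refine (cancel_mono ((tripleNec D.tempX (k + 1) (l + 1) (m + 1)).app a b)).1 ?_
        refine (app_chain (e₁.trans (Category.assoc _ _ _).symm).symm (hτ p m hpn)).trans
          (Eq.trans ?_ (app_chain e₂.symm (hτ k q hqn)).symm)
        have hf := (hinner k q hqn).comp (bd (k + 1) ◁ cutMap (l + 1) (m + 1) (q + 1) (by omega))
        refine (ht _ _ (hinner p m hpn) _ hf (hom_ext' fun i _ ↦ ?_)).trans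
          (ht _ _ (hinner k q hqn) _ hf rfl).symm
        simp only [comp_vert, cutMap_vert, whiskerRight_vert, whiskerLeft_vert,
          associator_inv_vert, bd_len, tensor_len]
        split_ifs <;> omega }
  obtain ⟨y, ⟨hyε, hyδ⟩, -⟩ := Coalg.isUniv_cofree (D.lax (_root_.id : D.Obj → D.Obj)) N a b _ c
  let y' : 𝟙_ V ⟶ (necObj D.tempX (bdl (N + 1))).hom a b :=
    y ≫ (beadNec (X := D.tempX) (N + 1)).app a b
  have hA (k l : ℕ) (e : k + l + 1 = N) :
      y' ≫ (necMap D.tempX (cutMap (k + 1) (l + 1) (N + 1) (hcut k l e)) (bdl_pos (N + 1))).app a b =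
        t _ (cutMap (k + 1) (l + 1) (N + 1) (hcut k l e)) (hinner k l e) := by
    have e₁ := comulOf_pairNec D.tempX (k + 1) (l + 1) (N + 1) (hcut k l e)
    rw [comulOf_tempX D k l N _ e] at e₁
    exact (app_chain e₁.symm (hyδ k l e)).trans (hτ k l e)
  have hB {i : ℕ} (h₀ : 0 < i) (hi : i ≤ N) (hij : i ≠ j) :
      y' ≫ (necMap D.tempX (bdMap (FInt.Hom.face h₀ hi)) (bdl_pos (N + 1))).app a b =
        t _ (bdMap (FInt.Hom.face h₀ hi)) (isInner_face h₀ hi hij) := by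
    obtain ⟨M, rfl⟩ : ∃ M, N = M + 1 := ⟨N - 1, by omega⟩
    have hf := isInner_face h₀ hi hij
    let φ := FInt.Hom.face h₀ hi
    let z : 𝟙_ V ⟶ (D.cofree.X M).hom a b :=
      t _ (bdMap φ) hf ≫ (necBead (X := D.tempX) (M + 1)).app a b
    have hz : z ≫ (beadNec (X := D.tempX) (M + 1)).app a b = t _ (bdMap φ) hf := by
      have e₁ := congrArg (fun k ↦ Quiv.Hom.app k a b) (necBead_beadNec (X := D.tempX) (M + 1))
      exact (Category.assoc _ _ _).trans ((congrArg (_ ≫ ·) e₁).trans (Category.comp_id _))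
    let w : 𝟙_ V ⟶ (D.cofree.X M).hom a b := y ≫ (beadMap D.tempX φ).app a b
    have hw : w = z := by
      refine (Coalg.isUniv_cofree (D.lax (_root_.id : D.Obj → D.Obj)) M a b _
        ((D.cofree.cone M a b).comp z)).unique ⟨?_, fun k l e ↦ ?_⟩ ⟨rfl, fun _ _ _ ↦ rfl⟩
      · have e₁ := app_chain (x := y) (g.natural φ) hyε
        refine e₁.trans ((hγ' (bdMap φ) hf).trans ?_)
        refine (congrArg (· ≫ _) hz).symm.trans ((Category.assoc _ _ _).trans (congrArg (_ ≫ ·) ?_))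
        exact congrArg (fun k ↦ Quiv.Hom.app k a b) (g.nec_app (M + 1))
      · have hkl : k + 1 + (l + 1) = M + 1 := by omega
        have : IsIso ((pairNec D.tempX (k + 1) (l + 1)).app a b) := isIso_app _ a b
        refine (cancel_mono ((pairNec D.tempX (k + 1) (l + 1)).app a b)).1 ?_
        obtain ⟨a', c', hac, φ₁, φ₂, h₁, h₂⟩ := φ.exists_cut hkl
        have ha : 0 < a' := by
          have := h₁ (k + 1) le_rfl
          rw [φ₁.map_last] at this
          rw [this]
          exact FInt.Hom.face_pos h₀ hi (Nat.succ_pos k)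
        have hc : 0 < c' := by
          have := h₂ 0 (Nat.zero_le _)
          rw [φ₂.map_zero] at this
          have h₃ := FInt.Hom.face_lt (k := k + 1) h₀ hi (by omega)
          change φ (k + 1) < _ at h₃
          change a' + 0 = φ (k + 1) at this
          omega
        obtain ⟨a', rfl⟩ : ∃ d, a' = d + 1 := ⟨a' - 1, by omega⟩
        obtain ⟨c', rfl⟩ : ∃ d, c' = d + 1 := ⟨c' - 1, by omega⟩
        have hac' : a' + c' + 1 = M + 1 := by omega
        have e₁ := comulOf_natural D.tempX hkl hac φ φ₁ φ₂ h₁ h₂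
        rw [comulOf_tempX D k l M hkl e, comulOf_tempX D a' c' (M + 1) hac hac'] at e₁
        have e₂ := app_chain (x := y) e₁ (hyδ a' c' hac')
        have e₃ := pairNec_map D.tempX φ₁ φ₂
        have e₄ := app_chain e₃.symm (hτ a' c' hac')
        have e₅ := comulOf_pairNec D.tempX (k + 1) (l + 1) (M + 1) hkl
        rw [comulOf_tempX D k l M hkl e] at e₅
        have e₆ := app_chain e₅ hz
        refine (congrArg (· ≫ _) e₂).trans (e₄.trans (Eq.trans ?_ e₆.symm))
        have hf' := hf.comp (cutMap (k + 1) (l + 1) (M + 1) hkl)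
        refine (ht _ _ (hinner a' c' hac') _ hf' (hom_ext' fun i hi' ↦ ?_)).trans
          (ht _ _ hf _ hf' rfl).symm
        simp only [comp_vert, cutMap_vert, tensorHom_vert, bdMap_vert, bd_len]
        split_ifs with h'
        · exact h₁ i h'
        · rw [tensor_len, bd_len, bd_len] at hi'
          refine (h₂ (i - (k + 1)) (by omega)).trans (congrArg φ ?_)
          omega
    have e₁ := app_chain (x := y) (beadMap_beadNec (X := D.tempX) φ) rfl
    exact e₁.symm.trans ((congrArg (· ≫ _) hw).trans hz)
  have hcomp : ∀ {T U : Nec} (g : T ⟶ U) (f : U ⟶ bd (N + 1)) (f' : T ⟶ bd (N + 1)) (hf) (hf'),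
      g ≫ f = f' → y' ≫ (necMap D.tempX f (bdl_pos (N + 1))).app a b = t U f hf →
        y' ≫ (necMap D.tempX f' (bdl_pos (N + 1))).app a b = t T f' hf' := by
    rintro T U g f _ hf hf' rfl e
    have e₁ := necMap_comp D.tempX g f U.pos (bdl_pos (N + 1))
    refine (congrArg (fun k ↦ y' ≫ Quiv.Hom.app k a b) e₁).trans ?_
    refine (Category.assoc _ _ _).symm.trans ((congrArg (· ≫ _) e).trans ?_)
    exact ht g f hf _ hf' rfl
  refine ⟨y', fun T f hf ↦ ?_⟩
  obtain ⟨k, hk, hk₀, hk₁⟩ | ⟨i, hi, hij, hf'⟩ := _root_.id hf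
  · obtain ⟨p, hp⟩ : ∃ p, f.vert k = p + 1 := ⟨f.vert k - 1, by omega⟩
    obtain ⟨q, hq⟩ : ∃ q, p + q + 1 = N := ⟨N - 1 - p, by omega⟩
    obtain ⟨g, hg⟩ := exists_cutMap (hcut p q hq) f hk hp
    exact hcomp g _ f _ hf hg (hA p q hq)
  · have h₀ : 0 < i := by
      have := hf' 0 (Nat.zero_le _)
      rw [f.vert.map_zero] at this
      omega
    have h₁ : i ≤ N := by
      have := hf' T.len le_rfl
      have e : f.vert T.len = N + 1 := f.vert.map_last
      omega
    obtain ⟨g, hg⟩ := exists_face h₀ h₁ f hf'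
    exact hcomp g _ f _ hf hg (hB h₀ h₁ hij)

end TempAmalgamation

/-! ## Subnecklaces and chains -/

lemma exists_subnecklace (p : ℕ) : ∀ (J M : Set ℕ), J ⊆ M → M ⊆ Set.Iic p → 0 ∈ J → p ∈ J →
    ∃ (l : List ℕ) (_ : ∀ b ∈ l, 0 < b) (f : FInt.Hom l.sum p), StrictMono f ∧
      f '' joints l = J ∧ f '' Set.Iic l.sum = M := by
  induction p using Nat.strong_induction_on with
  | _ p ih =>
    intro J M hJM hM h₀ hp
    obtain rfl | hp₀ := Nat.eq_zero_or_pos p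
    · refine ⟨[], by simp, FInt.Hom.id 0, strictMono_id, ?_, ?_⟩
      · refine subset_antisymm ?_ fun i hi ↦ ⟨i, Nat.le_zero.1 (hM (hJM hi)), rfl⟩
        rintro _ ⟨i, rfl, rfl⟩
        exact h₀
      · refine subset_antisymm ?_ fun i hi ↦ ⟨i, hM hi, rfl⟩
        rintro _ ⟨i, hi, rfl⟩
        obtain rfl := Nat.le_zero.1 hi
        exact hJM h₀
    classical
    have hex : ∃ c, 0 < c ∧ c ∈ M := ⟨p, hp₀, hJM hp⟩
    obtain ⟨c, ⟨hc₀, hcM⟩, hmin⟩ : ∃ c, (0 < c ∧ c ∈ M) ∧ ∀ i ∈ M, i ≠ 0 → c ≤ i :=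
      ⟨Nat.find hex, Nat.find_spec hex,
        fun i hi hi₀ ↦ Nat.find_min' hex ⟨Nat.pos_of_ne_zero hi₀, hi⟩⟩
    have hcp : c ≤ p := hM hcM
    obtain ⟨l, hl, f, hf, hfJ, hfM⟩ := ih (p - c) (by omega) {i | i = 0 ∨ c + i ∈ J}
      {i | c + i ∈ M} (by rintro i (rfl | h); exacts [hcM, hJM h])
      (fun i hi ↦ by have := hM hi; simp only [Set.mem_Iic] at this ⊢; omega) (Or.inl rfl)
      (Or.inr (by rwa [Nat.add_sub_cancel' hcp]))
    let F : FInt.Hom (1 + l.sum) p :=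
      { toFun i := if i = 0 then 0 else c + f (i - 1)
        mono i j h := by
          dsimp only
          split_ifs
          · exact le_rfl
          · exact Nat.zero_le _
          · omega
          · exact Nat.add_le_add_left (f.mono (by omega)) _
        map_zero := rfl
        map_add i := by
          rw [if_neg (by omega), show 1 + l.sum + i - 1 = l.sum + i by omega, f.map_add]
          omega }
    have hF : StrictMono F := fun i j h ↦ by
      change (if i = 0 then 0 else c + f (i - 1)) < if j = 0 then 0 else c + f (j - 1)
      split_ifs
      · omega
      · omega
      · omega
      · exact Nat.add_lt_add_left (hf (by omega)) _
    have hF₁ : ∀ i, F (1 + i) = c + f i := fun i ↦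
      (if_neg (by omega)).trans (by rw [Nat.add_sub_cancel_left])
    have hFM : F '' Set.Iic (1 + l.sum) = M := by
      apply subset_antisymm
      · rintro _ ⟨i, hi, rfl⟩
        obtain _ | i := i
        · exact hJM h₀
        · rw [Nat.add_comm i, hF₁]
          exact hfM.subset ⟨i, by simp only [Set.mem_Iic] at hi ⊢; omega, rfl⟩
      · intro i hi
        obtain rfl | hi₀ := eq_or_ne i 0
        · exact ⟨0, Nat.zero_le _, rfl⟩
        · obtain ⟨k, rfl⟩ := Nat.exists_eq_add_of_le (hmin i hi hi₀)
          obtain ⟨k, hk, rfl⟩ := hfM.superset hi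
          exact ⟨1 + k, Nat.add_le_add_left hk 1, hF₁ k⟩
    by_cases hcJ : c ∈ J
    · refine ⟨1 :: l, by simpa using hl, F, hF, ?_, hFM⟩
      apply subset_antisymm
      · rintro _ ⟨_, rfl | ⟨i, hi, rfl⟩, rfl⟩
        · exact h₀
        · rw [hF₁]
          obtain h | h := hfJ.subset ⟨i, hi, rfl⟩
          · rwa [h]
          · exact h
      · intro i hi
        obtain rfl | hi₀ := eq_or_ne i 0
        · exact ⟨0, Or.inl rfl, rfl⟩
        · obtain ⟨k, rfl⟩ := Nat.exists_eq_add_of_le (hmin i (hJM hi) hi₀)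
          obtain ⟨k, hk, rfl⟩ := hfJ.superset (Or.inr hi)
          exact ⟨1 + k, Or.inr ⟨k, hk, rfl⟩, hF₁ k⟩
    · obtain _ | ⟨b, l⟩ := l
      · have h := f.map_last
        have h' : f 0 = 0 := f.map_zero
        change f 0 = _ at h
        obtain rfl : c = p := by omega
        exact absurd hp hcJ
      have hs : ((1 + b) :: l).sum = 1 + (b :: l).sum := by
        simp only [List.sum_cons, Nat.add_assoc]
      refine ⟨(1 + b) :: l, by
        rintro _ (_ | ⟨_, h⟩); exacts [by omega, hl _ (List.mem_cons_of_mem _ h)],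
        (FInt.Hom.cast hs).comp F, hF, ?_, (congrArg (fun k ↦ F '' Set.Iic k) hs).trans hFM⟩
      change F '' joints ((1 + b) :: l) = J
      apply subset_antisymm
      · rintro _ ⟨_, rfl | ⟨i, hi, rfl⟩, rfl⟩
        · exact h₀
        · change F (1 + b + i) ∈ J
          rw [Nat.add_assoc, hF₁]
          obtain h | h := hfJ.subset ⟨b + i, Or.inr ⟨i, hi, rfl⟩, rfl⟩
          · have h₁ := hf.le_apply (x := b + i)
            have h₂ := hl b List.mem_cons_self
            omega
          · exact h
      · intro i hi
        obtain rfl | hi₀ := eq_or_ne i 0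
        · exact ⟨0, Or.inl rfl, rfl⟩
        · obtain ⟨k, rfl⟩ := Nat.exists_eq_add_of_le (hmin i (hJM hi) hi₀)
          obtain ⟨_, rfl | ⟨k, hk, rfl⟩, rfl⟩ := hfJ.superset (Or.inr hi)
          · rw [f.map_zero] at hi
            exact absurd hi hcJ
          · exact ⟨1 + b + k, Or.inr ⟨k, hk, rfl⟩, by rw [Nat.add_assoc]; exact hF₁ _⟩

namespace Nec

lemma exists_factor {R T Q : Nec} (ι : R ⟶ T) (hι : StrictMono ι.vert) (g : Q ⟶ T)
    (hM : ∀ l ≤ Q.len, ∃ k, ι.vert k = g.vert l)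
    (hJ : ∀ k ∈ joints R.beads, ∃ l ∈ joints Q.beads, g.vert l = ι.vert k) :
    ∃ k : Q ⟶ R, k ≫ ι = g := by
  have h : ∀ l, ∃ k, ι.vert k = g.vert l := fun l ↦ by
    by_cases hl : l ≤ Q.len
    · exact hM l hl
    · obtain ⟨i, rfl⟩ := Nat.exists_eq_add_of_le (Nat.le_of_not_le hl)
      exact ⟨_, (ι.vert.map_add i).trans (g.vert.map_add i).symm⟩
  choose k hk using h
  refine ⟨⟨⟨k, fun i j hij ↦ hι.le_iff_le.1 ?_, hι.injective ?_, fun i ↦ hι.injective ?_⟩,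
    fun i hi ↦ ?_⟩, Nec.hom_ext' fun i _ ↦ hk i⟩
  · rw [hk, hk]
    exact g.vert.mono hij
  · rw [hk, g.vert.map_zero, ι.vert.map_zero]
  · exact (hk _).trans ((g.vert.map_add i).trans (ι.vert.map_add i).symm)
  · obtain ⟨l, hl, hl'⟩ := hJ i hi
    exact ⟨l, hl, hι.injective ((hk l).trans hl')⟩

end Nec

namespace NecPoset

variable {T U : Nec} {m : SimplexCategoryᵒᵖ}

lemma obj_mono (x : (weight T).obj m) {i j : Fin (m.unop.len + 1)} (h : i ≤ j) :
    (x.obj i).1 ⊆ (x.obj j).1 :=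
  leOfHom (x.map (homOfLE h))

lemma push_map_injective (f : T ⟶ U) (hf : StrictMono f.vert) {z z' : (weight T).obj m}
    (h : push (map f) z = push (map f) z') : z = z' :=
  simplex_ext fun i ↦ Subtype.ext (hf.injective.image_injective
    (congrArg (fun y : (weight U).obj m ↦ (y.obj i).1) h))

/-- Every chain comes from a chain from the minimal to the maximal element of a subnecklace. -/
lemma exists_push_eq (x : (weight T).obj m) :
    ∃ (R : Nec) (ι : R ⟶ T) (z : (weight R).obj m), StrictMono ι.vert ∧
      ι.vert '' joints R.beads = (x.obj 0).1 ∧ ι.vert '' Set.Iic R.len = (x.obj (Fin.last _)).1 ∧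
      push (map ι) z = x := by
  obtain ⟨l, hl, f, hf, hJ, hM⟩ := exists_subnecklace T.len (x.obj 0).1 (x.obj (Fin.last _)).1
    (obj_mono x (Fin.zero_le _)) (x.obj _).2.2 ((x.obj _).2.1 (zero_mem_joints _))
    ((x.obj _).2.1 (sum_mem_joints _))
  let R : Nec := ⟨l, hl⟩
  let ι : R ⟶ T := ⟨f, (x.obj 0).2.1.trans hJ.superset⟩
  let z : (weight R).obj m := Monotone.functor
    (f := fun i : Fin (m.unop.len + 1) ↦ (⟨f ⁻¹' (x.obj i).1, fun k hk ↦
        obj_mono x (Fin.zero_le i) (hJ.subset ⟨k, hk, rfl⟩), fun k hk ↦ by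
          have h : f k ≤ T.len := (x.obj i).2.2 hk
          exact hf.le_iff_le.1 (h.trans_eq f.map_last.symm)⟩ : NecPoset R))
    fun i j h ↦ Set.preimage_mono (obj_mono x h)
  refine ⟨R, ι, z, hf, hJ, hM, simplex_ext fun i ↦ Subtype.ext ?_⟩
  refine Set.image_preimage_eq_of_subset ((obj_mono x (Fin.le_last i)).trans ?_)
  rw [← hM]
  exact Set.image_subset_range _ _

end NecPoset

/-! ## Horns in nerves of posets of vertices -/

namespace InnerChain

variable (n j : ℕ)

/-- The chains that come from a necklace over the inner horn. -/
def Mem {m : SimplexCategoryᵒᵖ} (x : (weight (Nec.bd n)).obj m) : Prop :=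
  (∃ k ∈ (x.obj 0).1, 0 < k ∧ k < n) ∨ ∃ i ≤ n, i ≠ j ∧ i ∉ (x.obj (Fin.last _)).1

/-- The chains that come from a necklace over the inner horn, not using the joint `j`. -/
def Mem' {m : SimplexCategoryᵒᵖ} (x : (weight (Nec.bd n)).obj m) : Prop :=
  (∃ k ∈ (x.obj 0).1, k ≠ j ∧ 0 < k ∧ k < n) ∨ ∃ i ≤ n, i ≠ j ∧ i ∉ (x.obj (Fin.last _)).1

variable {n j}

lemma obj_zero_subset {T : Nec} {m m' : SimplexCategoryᵒᵖ} (θ : m ⟶ m') (x : (weight T).obj m) :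
    (x.obj 0).1 ⊆ (((weight T).map θ x).obj 0).1 :=
  NecPoset.obj_mono x (Fin.zero_le _)

lemma obj_last_subset {T : Nec} {m m' : SimplexCategoryᵒᵖ} (θ : m ⟶ m') (x : (weight T).obj m) :
    (((weight T).map θ x).obj (Fin.last _)).1 ⊆ (x.obj (Fin.last _)).1 :=
  NecPoset.obj_mono x (Fin.le_last _)

lemma Mem.map {m m' : SimplexCategoryᵒᵖ} (θ : m ⟶ m') {x : (weight (Nec.bd n)).obj m}
    (h : Mem n j x) : Mem n j ((weight (Nec.bd n)).map θ x) := by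
  obtain ⟨k, hk, h⟩ | ⟨i, hi, hij, h⟩ := h
  · exact Or.inl ⟨k, obj_zero_subset θ x hk, h⟩
  · exact Or.inr ⟨i, hi, hij, fun hi ↦ h (obj_last_subset θ x hi)⟩

lemma Mem'.map {m m' : SimplexCategoryᵒᵖ} (θ : m ⟶ m') {x : (weight (Nec.bd n)).obj m}
    (h : Mem' n j x) : Mem' n j ((weight (Nec.bd n)).map θ x) := by
  obtain ⟨k, hk, h⟩ | ⟨i, hi, hij, h⟩ := h
  · exact Or.inl ⟨k, obj_zero_subset θ x hk, h⟩
  · exact Or.inr ⟨i, hi, hij, fun hi ↦ h (obj_last_subset θ x hi)⟩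

lemma mem_push {T : Nec} {f : T ⟶ Nec.bd n} (hf : IsInner n j f) {m : SimplexCategoryᵒᵖ}
    (z : (weight T).obj m) : Mem n j (push (NecPoset.map f) z) := by
  obtain ⟨k, hk, h⟩ | ⟨i, hi, hij, h⟩ := hf
  · exact Or.inl ⟨_, ⟨k, (z.obj 0).2.1 hk, rfl⟩, h⟩
  · refine Or.inr ⟨i, hi, hij, ?_⟩
    rintro ⟨l, hl, e⟩
    exact h l ((z.obj _).2.2 hl) e

lemma Mem.isInner {m : SimplexCategoryᵒᵖ} {x : (weight (Nec.bd n)).obj m} (h : Mem n j x) {T : Nec}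
    {f : T ⟶ Nec.bd n} (h₀ : f.vert '' joints T.beads = (x.obj 0).1)
    (h₁ : f.vert '' Set.Iic T.len = (x.obj (Fin.last _)).1) : IsInner n j f := by
  obtain ⟨k, hk, h⟩ | ⟨i, hi, hij, h⟩ := h
  · obtain ⟨l, hl, rfl⟩ := h₀.superset hk
    exact Or.inl ⟨l, hl, h⟩
  · exact Or.inr ⟨i, hi, hij, fun l hl e ↦ h (h₁.subset ⟨l, hl, e⟩)⟩

/-- The nerve of the poset of sets of vertices of a simplex. -/
abbrev chains (n : ℕ) : SSet.{u} := SSet.uliftFunctor.{u, 0}.obj (weight (Nec.bd n))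

/-- The subcomplex of chains that come from a necklace over the inner horn. -/
def inner (n j : ℕ) : (chains.{u} n).Subcomplex where
  obj _ := {x | Mem n j x.down}
  map θ _ hx := Mem.map θ hx

/-- The subcomplex of chains that come from a necklace over the inner horn, not using the joint
`j`. -/
def inner' (n j : ℕ) : (chains.{u} n).Subcomplex where
  obj _ := {x | Mem' n j x.down}
  map θ _ hx := Mem'.map θ hx


/-- The union of a set of vertices with `{j}` if a condition holds, and its difference with `{j}`
otherwise. -/
def modify (hj : 0 < j) (hj' : j < n) (S : NecPoset (Nec.bd n)) (p : Prop) : NecPoset (Nec.bd n) :=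
  ⟨{i | (i ∈ S.1 ∧ i ≠ j) ∨ (i = j ∧ p)}, fun i hi ↦ Or.inl ⟨S.2.1 hi, by
    obtain rfl | rfl := Nec.mem_joints_bdl.1 hi <;> omega⟩, fun i hi ↦ by
      obtain h | h := hi
      · exact S.2.2 h.1
      · exact (h.1.trans_le hj'.le).trans_eq (Nec.bdl_sum n).symm⟩

lemma modify_mono (hj : 0 < j) (hj' : j < n) {S S' : NecPoset (Nec.bd n)} (h : S.1 ⊆ S'.1) {p p' : Prop} (hp : p → p') :
    (modify hj hj' S p).1 ⊆ (modify hj hj' S' p').1 := fun _ hi ↦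
  hi.imp (And.imp_left fun hi ↦ h hi) (And.imp_right hp)

/-- The retraction of `Δ^1 × N(P)` onto `N(P)`. -/
def retraction (hj : 0 < j) (hj' : j < n) :
    SSet.stdSimplex.{u}.obj (SimplexCategory.mk 1) ⊗ chains.{u} n ⟶ chains.{u} n where
  app m := TypeCat.ofHom fun (y : (SSet.stdSimplex.{u}.obj (SimplexCategory.mk 1) ⊗ chains.{u} n : SSet.{u}).obj m) ↦ ⟨Monotone.functor
    (f := fun i : Fin (m.unop.len + 1) ↦ modify hj hj' (y.2.down.obj i)
      ((SSet.stdSimplex.objEquiv y.1).toOrderHom i = 1)) fun i i' h ↦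
        modify_mono hj hj' (NecPoset.obj_mono y.2.down h) fun e ↦ by
          have := (SSet.stdSimplex.objEquiv y.1).toOrderHom.monotone h
          rw [e] at this
          exact le_antisymm (Fin.le_last _) this⟩
  naturality m m' θ := by
    ext y
    exact ULift.ext _ _ (NecPoset.simplex_ext fun i ↦ rfl)

open Classical in
/-- The section of the retraction of `Δ^1 × N(P)` onto `N(P)`. -/
def retractionSection (n j : ℕ) : chains.{u} n ⟶
    SSet.stdSimplex.{u}.obj (SimplexCategory.mk 1) ⊗ chains.{u} n where
  app m := TypeCat.ofHom fun (y : (chains.{u} n).obj m) ↦ (SSet.stdSimplex.objEquiv.symm (SimplexCategory.Hom.mk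
    ⟨fun i : Fin (m.unop.len + 1) ↦ (if j ∈ (y.down.obj i).1 then 1 else 0 : Fin 2), fun i i' h ↦ by
      dsimp only
      split_ifs with h₁ h₂
      · exact le_rfl
      · exact absurd (NecPoset.obj_mono y.down h h₁) h₂
      · exact Fin.zero_le _
      · exact le_rfl⟩), y)
  naturality m m' θ := ConcreteCategory.hom_ext _ _ fun y ↦ rfl

open Classical in
lemma section_retraction (hj : 0 < j) (hj' : j < n) : retractionSection.{u} n j ≫ retraction.{u} hj hj' = 𝟙 _ := by
  ext m y
  refine ULift.ext _ _ (NecPoset.simplex_ext fun i ↦ Subtype.ext (Set.ext fun k ↦ ?_))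
  change (k ∈ (y.down.obj i).1 ∧ k ≠ j) ∨ (k = j ∧ (if j ∈ (y.down.obj i).1 then (1 : Fin 2) else 0) = 1) ↔
    k ∈ (y.down.obj i).1
  by_cases hk : k = j
  · subst hk
    simp
  · simp [hk]

/-- The union of `{1} × N(P)` and `Δ^1 × B'`. -/
abbrev cyl (n j : ℕ) : (SSet.stdSimplex.{u}.obj (SimplexCategory.mk 1) ⊗ chains.{u} n).Subcomplex :=
  SSet.Subcomplex.unionProd (SSet.horn.{u} 1 1) (inner'.{u} n j)

lemma mem_horn_one_iff {m : SimplexCategoryᵒᵖ}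
    (x : (SSet.stdSimplex.{u}.obj (SimplexCategory.mk 1)).obj m) :
    x ∈ (SSet.horn.{u} 1 1).obj m ↔ (SSet.stdSimplex.objEquiv x).toOrderHom (0 : Fin (m.unop.len + 1)) = (1 : Fin 2) := by
  refine (SSet.mem_horn_iff_notMem_range (d := m.unop.len) x 1).trans ?_
  constructor
  · rintro ⟨i, hi, h⟩
    by_contra h₀
    refine h ⟨0, ?_⟩
    change (SSet.stdSimplex.objEquiv x).toOrderHom (0 : Fin (m.unop.len + 1)) = i
    have key : ∀ k i : Fin 2, k ≠ 1 → i ≠ 1 → k = i := by decide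
    exact key _ _ h₀ hi
  · intro h
    refine ⟨0, by simp, ?_⟩
    rintro ⟨k, hk⟩
    have h₁ : (1 : Fin 2) ≤ (0 : Fin 2) :=
      h.symm.trans_le (((SSet.stdSimplex.objEquiv x).toOrderHom.monotone (Fin.zero_le k)).trans_eq hk)
    omega

lemma retraction_mem (hj : 0 < j) (hj' : j < n) {m : SimplexCategoryᵒᵖ}
    (y : (SSet.stdSimplex.{u}.obj (SimplexCategory.mk 1) ⊗ chains.{u} n : SSet.{u}).obj m)
    (hy : y ∈ (cyl.{u} n j).obj m) : (retraction hj hj').app m y ∈ (inner n j).obj m := by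
  obtain hy | hy := (SSet.Subcomplex.mem_unionProd_iff _ _ _).1 hy
  · obtain ⟨k, hk, hkj, h⟩ | ⟨i, hi, hij, h⟩ := hy
    · exact Or.inl ⟨k, Or.inl ⟨hk, hkj⟩, h⟩
    · refine Or.inr ⟨i, hi, hij, ?_⟩
      rintro (⟨h', _⟩ | ⟨h', _⟩)
      · exact h h'
      · exact hij h'
  · exact Or.inl ⟨j, Or.inr ⟨rfl, (mem_horn_one_iff _).1 hy⟩, hj, hj'⟩

lemma section_mem {m : SimplexCategoryᵒᵖ} (x : (chains.{u} n).obj m)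
    (hx : x ∈ (inner.{u} n j).obj m) : (retractionSection n j).app m x ∈ (cyl n j).obj m := by
  refine (SSet.Subcomplex.mem_unionProd_iff _ _ _).2 ?_
  obtain ⟨k, hk, h⟩ | ⟨i, hi, hij, h⟩ := hx
  · by_cases hkj : k = j
    · subst hkj
      exact Or.inr ((mem_horn_one_iff _).2 (if_pos hk))
    · exact Or.inl (Or.inl ⟨k, hk, hkj, h⟩)
  · exact Or.inl (Or.inr ⟨i, hi, hij, h⟩)

open SSet.modelCategoryQuillen in
lemma exists_extension (hj : 0 < j) (hj' : j < n) {Z : SSet.{u}} (hZ : SSet.KanComplex Z)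
    (b : (inner.{u} n j : SSet.{u}) ⟶ Z) : ∃ g : chains.{u} n ⟶ Z, (inner n j).ι ≫ g = b := by
  have hA := SSet.anodyneExtensions_unionProd_ι' (SSet.horn.{u} 1 1) (inner'.{u} n j)
    (SSet.anodyneExtensions.horn_ι 1)
  let r' : (cyl.{u} n j : SSet.{u}) ⟶ (inner.{u} n j : SSet.{u}) :=
    SSet.Subcomplex.lift ((cyl n j).ι ≫ retraction hj hj') (by
      rintro m _ ⟨y, rfl⟩
      exact retraction_mem hj hj' y.1 y.2)
  let s' : (inner.{u} n j : SSet.{u}) ⟶ (cyl.{u} n j : SSet.{u}) :=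
    SSet.Subcomplex.lift ((inner n j).ι ≫ retractionSection n j) (by
      rintro m _ ⟨y, rfl⟩
      exact section_mem y.1 y.2)
  have sq : CommSq (r' ≫ b) (cyl.{u} n j).ι (terminal.from Z) (terminal.from _) := ⟨by simp⟩
  have : SSet.KanComplex Z := hZ
  have := hA (terminal.from Z) ((HomotopicalAlgebra.fibration_iff _).1 inferInstance)
  refine ⟨retractionSection n j ≫ sq.lift, ?_⟩
  have h₁ : (inner.{u} n j).ι ≫ retractionSection n j = s' ≫ (cyl n j).ι := rfl
  have h₂ : s' ≫ r' = 𝟙 _ := by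
    rw [← cancel_mono (inner.{u} n j).ι, Category.assoc, Category.id_comp]
    exact (Category.assoc _ _ _).symm.trans ((congrArg ((inner n j).ι ≫ ·)
      (section_retraction hj hj')).trans (Category.comp_id _))
  rw [reassoc_of% h₁, sq.fac_left, reassoc_of% h₂]

end InnerChain

section

variable {V : Type v} [Category.{u} V] [MonoidalCategory V] [HasLimits V] [HasColimits V]
  [SymmetricCategory V] [MonoidalClosed V]

section

variable {Y : SimplicialObject V} {n j : ℕ}
  (h : ∀ (T : Nec) (f : T ⟶ Nec.bd n) (_ : IsInner n j f), 𝟙_ V ⟶ (nObj Y).obj (op T))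

lemma inner_value_push (hh : ∀ (T U : Nec) (g : T ⟶ U) (f : U ⟶ Nec.bd n) (hf : IsInner n j f),
    h U f hf ≫ (nObj Y).map g.op = h T (g ≫ f) (hf.comp g)) {T U : Nec} (g : T ⟶ U)
    (f : U ⟶ Nec.bd n) (hf : IsInner n j f) (f' : T ⟶ Nec.bd n) (hf' : IsInner n j f')
    (e : g ≫ f = f') {m : SimplexCategoryᵒᵖ}
    (z : (weight T).obj m) :
    h U f hf ≫ nπ Y U m (push (NecPoset.map g) z) = h T f' hf' ≫ nπ Y T m z := by
  subst e
  rw [← nObj_map_π, ← Category.assoc, hh]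

lemma inner_value_eq (hh : ∀ (T U : Nec) (g : T ⟶ U) (f : U ⟶ Nec.bd n) (hf : IsInner n j f),
    h U f hf ≫ (nObj Y).map g.op = h T (g ≫ f) (hf.comp g)) {T R : Nec} (f : T ⟶ Nec.bd n)
    (hf : IsInner n j f) (ι : R ⟶ Nec.bd n) (hι : IsInner n j ι) {m : SimplexCategoryᵒᵖ}
    {x : (weight (Nec.bd n)).obj m} (w : (weight R).obj m)
    (h₁ : StrictMono ι.vert) (h₂ : ι.vert '' joints R.beads = (x.obj 0).1)
    (h₃ : ι.vert '' Set.Iic R.len = (x.obj (Fin.last _)).1) (hw : push (NecPoset.map ι) w = x)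
    (z : (weight T).obj m) (hz : push (NecPoset.map f) z = x) :
    h T f hf ≫ nπ Y T m z = h R ι hι ≫ nπ Y R m w := by
  obtain ⟨Q, κ, y, hκ, hκ₁, hκ₂, rfl⟩ := NecPoset.exists_push_eq z
  subst hz
  obtain ⟨k, hk⟩ := Nec.exists_factor ι h₁ (κ ≫ f) (fun l hl ↦ by
      obtain ⟨i, -, hi⟩ := h₃.superset ⟨κ.vert l, hκ₂.subset ⟨l, hl, rfl⟩, rfl⟩
      exact ⟨i, hi⟩) fun i hi ↦ by
      obtain ⟨l, hl, e⟩ := h₂.subset ⟨i, hi, rfl⟩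
      obtain ⟨l', hl', rfl⟩ := hκ₁.superset hl
      exact ⟨l', hl', e⟩
  have e : push (NecPoset.map k) y = w := NecPoset.push_map_injective ι h₁ (by
    rw [hw]
    exact (push_eq (F := NecPoset.map k) (G := NecPoset.map ι) (F' := NecPoset.map κ)
      (G' := NecPoset.map f) (fun S ↦ Subtype.ext (by
        change ι.vert '' (k.vert '' S.1) = f.vert '' (κ.vert '' S.1)
        rw [Set.image_image, Set.image_image]
        exact Set.image_congr fun i _ ↦ congrArg (fun g : Q ⟶ Nec.bd n ↦ g.vert i) hk)) y))
  rw [inner_value_push h hh κ f hf _ (hf.comp κ) rfl, ← e,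
    inner_value_push h hh k ι hι _ (hf.comp κ) hk]

end

lemma amalgamatesInner_nObj {Y : SimplicialObject V} (hY : SSet.KanComplex (underlying Y)) :
    AmalgamatesInner (nObj Y) := by
  intro n j hj hj' h hh
  choose R ι w h₁ h₂ h₃ hw using fun {m : SimplexCategoryᵒᵖ} (x : (weight (Nec.bd n)).obj m) ↦
    NecPoset.exists_push_eq x
  have hι : ∀ {m : SimplexCategoryᵒᵖ} {x : (weight (Nec.bd n)).obj m}, InnerChain.Mem n j x →
    IsInner n j (ι x) := fun {m x} hx ↦ hx.isInner (h₂ x) (h₃ x)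
  have key : ∀ {T : Nec} (f : T ⟶ Nec.bd n) (hf : IsInner n j f) {m : SimplexCategoryᵒᵖ}
      (x : (weight (Nec.bd n)).obj m) (hx : InnerChain.Mem n j x) (z : (weight T).obj m)
      (_ : push (NecPoset.map f) z = x),
      h T f hf ≫ nπ Y T m z = h (R x) (ι x) (hι hx) ≫ nπ Y (R x) m (w x) :=
    fun f hf m x hx z hz ↦ inner_value_eq h hh f hf (ι x) (hι hx) (w x) (h₁ x) (h₂ x) (h₃ x) (hw x)
      z hz
  let b : (InnerChain.inner.{u} n j : SSet.{u}) ⟶ underlying Y :=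
    { app m := TypeCat.ofHom fun x ↦ h _ (ι x.1.down) (hι x.2) ≫ nπ Y _ m (w x.1.down)
      naturality m m' θ := by
        ext x
        refine (key (ι x.1.down) (hι x.2) _ (InnerChain.Mem.map θ x.2)
          ((weight _).map θ (w x.1.down)) ?_).symm.trans ?_
        · rw [push_map, hw]
        · rw [← nπ_natural]
          exact (Category.assoc _ _ _).symm }
  obtain ⟨g, hg⟩ := InnerChain.exists_extension hj hj' hY b
  refine ⟨wlift (K := weight (Nec.bd n)) (Y := Y) (fun m x ↦ (g.app m (ULift.up x : (InnerChain.chains.{u} n).obj m) : (underlying Y).obj m)) fun m m' θ x ↦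
    (NatTrans.naturality_apply g θ (ULift.up x : (InnerChain.chains.{u} n).obj m)).symm, fun T f hf ↦ nObj_ext fun m z ↦ ?_⟩
  refine (Category.assoc _ _ _).trans ((congrArg (_ ≫ ·) (nObj_map_π Y f m z)).trans
    ((wlift_π (K := weight (Nec.bd n)) (Y := Y) _ _ _ _).trans ?_))
  have hx := InnerChain.mem_push hf z
  let x : (InnerChain.inner.{u} n j : SSet.{u}).obj m := ⟨⟨push (NecPoset.map f) z⟩, hx⟩
  have e := congrArg (fun k : (InnerChain.inner.{u} n j : SSet.{u}) ⟶ underlying Y ↦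
    k.app m x) hg
  exact e.trans (key f hf _ hx z rfl).symm

lemma LiftsInnerHorns.of_retract {Y Z : Necᵒᵖ ⥤ V} (hZ : LiftsInnerHorns Z) (i : Y ⟶ Z) (r : Z ⟶ Y)
    (hir : i ≫ r = 𝟙 Y) : LiftsInnerHorns Y := fun n j hj hj' φ ↦ by
  obtain ⟨ψ, hψ⟩ := hZ n j hj hj' (φ ≫ i)
  exact ⟨ψ ≫ r, by rw [← Category.assoc, hψ, Category.assoc, hir, Category.comp_id]⟩

lemma NecCat.exists_retract_of_comp_eq_id {C D : NecCat V} (G : C ⟶ D) (H : D ⟶ C)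
    (h : G ≫ H = 𝟙 C) (a b : C.Obj) : ∃ (a' b' : D.Obj) (i : C.hom a b ⟶ D.hom a' b')
      (r : D.hom a' b' ⟶ C.hom a b), i ≫ r = 𝟙 _ := by
  obtain ⟨g, ga, g₁, g₂⟩ := G
  obtain ⟨k, ka, k₁, k₂⟩ := H
  have ho : (fun A ↦ k (g A)) = _root_.id := congrArg NecCat.Hom.obj h
  have hk : ∀ (l : C.Obj → C.Obj) (la : ∀ A B, C.hom A B ⟶ C.hom (l A) (l B)) (l₁ l₂),
      (⟨l, la, l₁, l₂⟩ : NecCat.Hom C C) = (𝟙 C : C ⟶ C) →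
      ∃ r : C.hom (l a) (l b) ⟶ C.hom a b, la a b ≫ r = 𝟙 _ := by
    intro l la l₁ l₂ e
    obtain rfl : l = _root_.id := congrArg NecCat.Hom.obj e
    have e' := NecCat.Hom.app_injective e
    subst e'
    exact ⟨𝟙 _, Category.comp_id _⟩
  obtain ⟨r, hr⟩ := hk _ _ _ _ h
  exact ⟨g a, g b, ga a b, ka _ _ ≫ r, (Category.assoc _ _ _).symm.trans hr⟩

lemma exists_retract_of_iso {X Z : Templicial V} (e : X ≅ Z) (a b : X.S) :
    ∃ (a' b' : Z.S) (i : HCNerve.necHom X a b ⟶ HCNerve.necHom Z a' b')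
      (r : HCNerve.necHom Z a' b' ⟶ HCNerve.necHom X a b), i ≫ r = 𝟙 _ := by
  let G : HCNerve.nec.obj X ⟶ HCNerve.nec.obj Z := HCNerve.nec.map e.hom
  let H : HCNerve.nec.obj Z ⟶ HCNerve.nec.obj X := HCNerve.nec.map e.inv
  have h : G ≫ H = 𝟙 _ := by
    rw [← Functor.map_comp, e.hom_inv_id, CategoryTheory.Functor.map_id]
  exact NecCat.exists_retract_of_comp_eq_id G H h a b

lemma isQuasicategory_of_iso {X Z : Templicial V} (e : X ≅ Z)
    (hZ : Z.IsQuasicategory) : X.IsQuasicategory := fun a b ↦ by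
  obtain ⟨a', b', i, r, h⟩ := exists_retract_of_iso e a b
  exact (hZ a' b').of_retract i r h

theorem isQuasicategory_temp {temp : NecCat V ⥤ Templicial V} (adj : HCNerve.nec ⊣ temp)
    (C : SmallEnrichedCat (SimplicialObject V)) (hC : LocallyKan C) :
    ((nFunctor ⋙ temp).obj C).IsQuasicategory :=
  isQuasicategory_of_iso (tempIso adj (nFunctor.obj C)) fun a b ↦
    (NecCat.amalgamatesInner_temp (nFunctor.obj C) (a := a) (b := b)
      (amalgamatesInner_nObj (hC a b))).liftsInnerHorns

end

/-! ## Elements of quivers of sets -/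

namespace Quiv

variable {S : Type u} {Q P R Q' P' : Quiv (Type u) S}

/-- The elements of a quiver of sets. -/
structure El (Q : Quiv (Type u) S) : Type u where
  /-- the source -/
  src : S
  /-- the target -/
  tgt : S
  /-- the element -/
  hom : 𝟙_ (Type u) ⟶ Q.hom src tgt

lemma El.mk_injective {a b : S} {p q : 𝟙_ (Type u) ⟶ Q.hom a b}
    (h : (⟨a, b, p⟩ : El Q) = ⟨a, b, q⟩) : p = q := by
  injection h

/-- The image of an element. -/
def El.map (f : Q ⟶ Q') (x : El Q) : El Q' := ⟨x.src, x.tgt, x.hom ≫ f.app _ _⟩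

lemma El.map_id (x : El Q) : x.map (𝟙 Q) = x := rfl

lemma hom_ext_el {f g : Q ⟶ Q'} (h : ∀ x : El Q, x.map f = x.map g) : f = g := by
  ext a b y
  exact congrArg (fun k : 𝟙_ (Type u) ⟶ Q'.hom a b ↦ k PUnit.unit)
    (El.mk_injective (h ⟨a, b, TypeCat.ofHom fun _ ↦ y⟩))

lemma mul_eq_lift {a c b : S} (p : 𝟙_ (Type u) ⟶ P.hom a c) (q : 𝟙_ (Type u) ⟶ R.hom c b) :
    mul p q = (CartesianMonoidalCategory.lift p q : _ ⟶ P.hom a c ⊗ R.hom c b) ≫ ι P R a c b := by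
  have h : (λ_ (𝟙_ (Type u))).inv ≫ (p ⊗ₘ q) = CartesianMonoidalCategory.lift p q := by
    ext x <;> rfl
  rw [mul, ← Category.assoc, h]

lemma sigma_el_exists {J : Type u} {f : J → Type u} (e : 𝟙_ (Type u) ⟶ ∐ f) :
    ∃ (j : J) (y : 𝟙_ (Type u) ⟶ f j), y ≫ Sigma.ι f j = e := by
  let z := (Types.coproductIso.{u, u} f).hom (e PUnit.unit)
  refine ⟨z.1, TypeCat.ofHom fun _ ↦ z.2, ?_⟩
  rw [← cancel_mono (Types.coproductIso.{u, u} f).hom, Category.assoc,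
    Types.coproductIso_ι_comp_hom]
  exact ConcreteCategory.hom_ext _ _ fun _ ↦ rfl

lemma sigma_el_injective {J : Type u} {f : J → Type u} {i j : J} {x : 𝟙_ (Type u) ⟶ f i}
    {y : 𝟙_ (Type u) ⟶ f j} (h : x ≫ Sigma.ι f i = y ≫ Sigma.ι f j) :
    (⟨i, x⟩ : Σ j, 𝟙_ (Type u) ⟶ f j) = ⟨j, y⟩ := by
  have h' := congrArg (· ≫ (Types.coproductIso.{u, u} f).hom) h
  simp only [Category.assoc, Types.coproductIso_ι_comp_hom] at h'
  have h'' := congrArg (fun k : 𝟙_ (Type u) ⟶ (Σ j, f j) ↦ k PUnit.unit) h'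
  have e : ∀ (i : J) (x : 𝟙_ (Type u) ⟶ f i), (⟨i, x⟩ : Σ j, 𝟙_ (Type u) ⟶ f j) =
      (fun w : Σ j, f j ↦ ⟨w.1, TypeCat.ofHom fun _ ↦ w.2⟩) ⟨i, x PUnit.unit⟩ := fun i x ↦ rfl
  rw [e, e]
  exact congrArg (fun w : Σ j, f j ↦
    (⟨w.1, TypeCat.ofHom fun _ ↦ w.2⟩ : Σ j, 𝟙_ (Type u) ⟶ f j)) h''

lemma exists_mul {a b : S} (e : 𝟙_ (Type u) ⟶ (P ⊗ R).hom a b) :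
    ∃ (c : S) (p : 𝟙_ (Type u) ⟶ P.hom a c) (q : 𝟙_ (Type u) ⟶ R.hom c b), mul p q = e := by
  obtain ⟨c, y, rfl⟩ := sigma_el_exists (f := fun c : S ↦ P.hom a c ⊗ R.hom c b) e
  refine ⟨c, y ≫ CartesianMonoidalCategory.fst _ _, y ≫ CartesianMonoidalCategory.snd _ _, ?_⟩
  rw [mul_eq_lift]
  exact congrArg (· ≫ ι P R a c b) (CartesianMonoidalCategory.lift_comp_fst_snd y)

lemma mul_injective {a b c c' : S} {p : 𝟙_ (Type u) ⟶ P.hom a c} {q : 𝟙_ (Type u) ⟶ R.hom c b}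
    {p' : 𝟙_ (Type u) ⟶ P.hom a c'} {q' : 𝟙_ (Type u) ⟶ R.hom c' b} (h : mul p q = mul p' q') :
    (⟨a, c, p⟩ : El P) = ⟨a, c', p'⟩ ∧ (⟨c, b, q⟩ : El R) = ⟨c', b, q'⟩ := by
  rw [mul_eq_lift, mul_eq_lift] at h
  have h' := sigma_el_injective (f := fun c : S ↦ P.hom a c ⊗ R.hom c b) h
  injection h' with h₁ h₂
  subst h₁
  have h₃ := eq_of_heq h₂
  have h₄ := congrArg (· ≫ CartesianMonoidalCategory.fst _ _) h₃
  have h₅ := congrArg (· ≫ CartesianMonoidalCategory.snd _ _) h₃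
  simp only [CartesianMonoidalCategory.lift_fst, CartesianMonoidalCategory.lift_snd] at h₄ h₅
  rw [h₄, h₅]
  exact ⟨rfl, rfl⟩

lemma gen_surjective {Q : S → S → Type u} {a b : S}
    (e : 𝟙_ (Type u) ⟶ (free (Type u) Q).hom a b) : ∃ x : Q a b, gen x = e := by
  obtain ⟨x, y, rfl⟩ := sigma_el_exists (f := fun _ : Q a b ↦ 𝟙_ (Type u)) e
  refine ⟨x, ?_⟩
  obtain rfl : y = 𝟙 _ := by ext
  exact (Category.id_comp _).symm

lemma gen_injective {Q : S → S → Type u} {a b : S} {x y : Q a b}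
    (h : gen (V := Type u) x = gen y) : x = y := by
  have h' := sigma_el_injective (f := fun _ : Q a b ↦ 𝟙_ (Type u)) (x := 𝟙 _) (y := 𝟙 _)
    (i := x) (j := y) ((Category.id_comp _).trans (h.trans (Category.id_comp _).symm))
  exact congrArg Sigma.fst h'

lemma unit_el_eq {a b : S} (e : 𝟙_ (Type u) ⟶ (𝟙_ (Quiv (Type u) S)).hom a b) :
    ∃ h : a = b, e = unitι h := by
  obtain ⟨x, y, rfl⟩ := sigma_el_exists
    (f := fun _ : ULift.{u} (PLift (a = b)) ↦ 𝟙_ (Type u)) e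
  refine ⟨x.down.down, ?_⟩
  obtain rfl : y = 𝟙 _ := by ext
  exact Category.id_comp _

/-- The point of the middle of an element of a tensor product. -/
def mid (x : El (P ⊗ R)) : S := (exists_mul x.hom).choose

/-- The left factor of an element of a tensor product. -/
def El.left (x : El (P ⊗ R)) : El P := ⟨x.src, mid x, (exists_mul x.hom).choose_spec.choose⟩

/-- The right factor of an element of a tensor product. -/
def El.right (x : El (P ⊗ R)) : El R :=
  ⟨mid x, x.tgt, (exists_mul x.hom).choose_spec.choose_spec.choose⟩

lemma El.mul_left_right (x : El (P ⊗ R)) : mul x.left.hom x.right.hom = x.hom :=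
  (exists_mul x.hom).choose_spec.choose_spec.choose_spec

lemma El.left_eq (x : El (P ⊗ R)) {c : S} {p : 𝟙_ (Type u) ⟶ P.hom x.src c}
    {q : 𝟙_ (Type u) ⟶ R.hom c x.tgt} (h : mul p q = x.hom) : x.left = ⟨_, _, p⟩ :=
  (mul_injective (x.mul_left_right.trans h.symm)).1

lemma El.right_eq (x : El (P ⊗ R)) {c : S} {p : 𝟙_ (Type u) ⟶ P.hom x.src c}
    {q : 𝟙_ (Type u) ⟶ R.hom c x.tgt} (h : mul p q = x.hom) : x.right = ⟨_, _, q⟩ :=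
  (mul_injective (x.mul_left_right.trans h.symm)).2

lemma El.left_mul {a c b : S} (p : 𝟙_ (Type u) ⟶ P.hom a c) (q : 𝟙_ (Type u) ⟶ R.hom c b) :
    (⟨a, b, mul p q⟩ : El (P ⊗ R)).left = ⟨a, c, p⟩ :=
  El.left_eq _ rfl

lemma El.right_mul {a c b : S} (p : 𝟙_ (Type u) ⟶ P.hom a c) (q : 𝟙_ (Type u) ⟶ R.hom c b) :
    (⟨a, b, mul p q⟩ : El (P ⊗ R)).right = ⟨c, b, q⟩ :=
  El.right_eq _ rfl

lemma El.ext_tensor {x y : El (P ⊗ R)} (hl : x.left = y.left) (hr : x.right = y.right) :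
    x = y := by
  have h₁ := x.mul_left_right
  have h₂ := y.mul_left_right
  obtain ⟨a, b, e⟩ := x
  obtain ⟨a', b', e'⟩ := y
  have key : ∀ (p p' : El P) (q q' : El R) (_ : p = p') (_ : q = q') (h : p.tgt = q.src)
      (h' : p'.tgt = q'.src), (⟨p.src, q.tgt, mul p.hom (h ▸ q.hom)⟩ : El (P ⊗ R)) =
        ⟨p'.src, q'.tgt, mul p'.hom (h' ▸ q'.hom)⟩ := by
    rintro p _ q _ rfl rfl h h'
    rfl
  have h := key _ _ _ _ hl hr rfl rfl
  change (⟨a, b, e⟩ : El (P ⊗ R)) = ⟨a', b', e'⟩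
  exact (congrArg (fun k ↦ (⟨a, b, k⟩ : El (P ⊗ R))) h₁).symm.trans
    (h.trans (congrArg (fun k ↦ (⟨a', b', k⟩ : El (P ⊗ R))) h₂))

lemma El.left_map (f : P ⟶ P') (g : R ⟶ Q') (x : El (P ⊗ R)) :
    (x.map (f ⊗ₘ g)).left = x.left.map f := by
  refine El.left_eq _ ((mul_tensorHom x.left.hom x.right.hom f g).symm.trans ?_)
  exact congrArg (· ≫ _) x.mul_left_right

lemma El.right_map (f : P ⟶ P') (g : R ⟶ Q') (x : El (P ⊗ R)) :
    (x.map (f ⊗ₘ g)).right = x.right.map g := by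
  refine El.right_eq _ ((mul_tensorHom x.left.hom x.right.hom f g).symm.trans ?_)
  exact congrArg (· ≫ _) x.mul_left_right

lemma El.left_whiskerRight (f : P ⟶ P') (x : El (P ⊗ R)) :
    (x.map (f ▷ R)).left = x.left.map f := by
  rw [← tensorHom_id, left_map]

lemma El.right_whiskerRight (f : P ⟶ P') (x : El (P ⊗ R)) :
    (x.map (f ▷ R)).right = x.right := by
  rw [← tensorHom_id, right_map, map_id]

lemma El.left_whiskerLeft (f : R ⟶ Q') (x : El (P ⊗ R)) :
    (x.map (P ◁ f)).left = x.left := by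
  rw [← id_tensorHom, left_map, map_id]

lemma El.right_whiskerLeft (f : R ⟶ Q') (x : El (P ⊗ R)) :
    (x.map (P ◁ f)).right = x.right.map f := by
  rw [← id_tensorHom, right_map]

lemma El.map_associator_aux (x : El ((P ⊗ Q) ⊗ R)) :
    mul x.left.left.hom (mul (P := Q) x.left.right.hom x.right.hom) =
      (x.map (α_ P Q R).hom).hom := by
  refine (mul_assoc (P := P) (R := Q) (T := R) x.left.left.hom x.left.right.hom
    x.right.hom).symm.trans ?_
  have h₁ := x.left.mul_left_right
  have h₂ := x.mul_left_right
  refine congrArg (· ≫ _) (Eq.trans ?_ h₂)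
  exact congrArg (fun k ↦ mul k x.right.hom) h₁

lemma El.left_associator (x : El ((P ⊗ Q) ⊗ R)) : (x.map (α_ P Q R).hom).left = x.left.left :=
  El.left_eq _ x.map_associator_aux

lemma El.right_associator (x : El ((P ⊗ Q) ⊗ R)) :
    (x.map (α_ P Q R).hom).right = ⟨_, _, mul (P := Q) x.left.right.hom x.right.hom⟩ :=
  El.right_eq _ x.map_associator_aux

lemma El.left_right_associator (x : El ((P ⊗ Q) ⊗ R)) :
    (x.map (α_ P Q R).hom).right.left = x.left.right := by
  rw [El.right_associator]
  exact El.left_eq _ rfl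

lemma El.right_right_associator (x : El ((P ⊗ Q) ⊗ R)) :
    (x.map (α_ P Q R).hom).right.right = x.right := by
  rw [El.right_associator]
  exact El.right_eq _ rfl

lemma El.right_leftUnitor_inv (x : El P) : (x.map (λ_ P).inv).right = x :=
  El.right_eq _ (leftUnitor_inv_mul x.hom).symm

lemma El.left_rightUnitor_inv (x : El P) : (x.map (ρ_ P).inv).left = x :=
  El.left_eq _ (rightUnitor_inv_mul x.hom).symm

end Quiv

/-! ## The simplicial set of a templicial set -/

namespace FInt.Hom

/-- The map `[1] ⟶ [a]`. -/
def init (a : ℕ) : FInt.Hom 1 a where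
  toFun i := if i = 0 then 0 else a + (i - 1)
  mono i j h := by dsimp only; split_ifs <;> omega
  map_zero := rfl
  map_add i := by rw [if_neg (by omega)]; omega

/-- The extension of an order preserving map by new endpoints. -/
def extend {m n : ℕ} (φ : Fin (m + 1) →o Fin (n + 1)) : FInt.Hom (1 + m + 1) n where
  toFun i := if i = 0 then 0 else if h : i < m + 2 then φ ⟨i - 1, by omega⟩ else n + (i - (m + 2))
  mono i j h := by
    dsimp only
    split_ifs
    · exact le_rfl
    · exact Nat.zero_le _
    · exact Nat.zero_le _
    · omega
    · exact φ.monotone (Fin.mk_le_mk.2 (by omega))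
    · have := (φ ⟨i - 1, by omega⟩).2
      omega
    · omega
    · omega
    · omega
  map_zero := rfl
  map_add i := by
    rw [if_neg (by omega), dif_neg (by omega)]
    omega

lemma extend_one_add {m n : ℕ} (φ : Fin (m + 1) →o Fin (n + 1)) (i : Fin (m + 1)) :
    extend φ (1 + i) = φ i := by
  have h : extend φ (1 + i) = if h : 1 + (i : ℕ) < m + 2 then (φ ⟨1 + i - 1, by omega⟩ : ℕ) else
    n + (1 + i - (m + 2)) := if_neg (by omega)
  rw [h, dif_pos (by omega)]
  congr 2
  exact Fin.ext (Nat.add_sub_cancel_left _ _)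

lemma add_apply_of_le {m m' n n' : ℕ} (f : FInt.Hom m m') (g : FInt.Hom n n') {i : ℕ} (h : i ≤ m) :
    f.add g i = f i := if_pos h

lemma add_apply_add {m m' n n' : ℕ} (f : FInt.Hom m m') (g : FInt.Hom n n') (i : ℕ) :
    f.add g (m + i) = m' + g i := by
  change (if m + i ≤ m then f (m + i) else m' + g (m + i - m)) = _
  rw [Nat.add_sub_cancel_left]
  split_ifs with h
  · obtain rfl : i = 0 := by omega
    rw [g.map_zero]
    exact f.map_last
  · rfl

lemma init_comp_eq_extend {m n a b : ℕ} (φ : Fin (m + 1) →o Fin (n + 1)) (f : FInt.Hom (a + m + b) n)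
    (hf : ∀ i : Fin (m + 1), f (a + i) = φ i) :
    (((init a).add (id m)).add (init b)).comp f = extend φ := by
  refine ext_of_le fun i hi ↦ ?_
  change f ((((init a).add (id m)).add (init b)) i) = _
  by_cases h : i ≤ 1 + m
  · rw [add_apply_of_le _ _ h]
    obtain rfl | h₀ := Nat.eq_zero_or_pos i
    · rw [((init a).add (id m)).map_zero, f.map_zero, (extend φ).map_zero]
    · obtain ⟨k, rfl⟩ := Nat.exists_eq_add_of_le (show 1 ≤ i from h₀)
      rw [add_apply_add]
      exact (hf ⟨k, by omega⟩).trans (extend_one_add φ ⟨k, by omega⟩).symm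
  · obtain rfl : i = 1 + m + 1 := by omega
    exact (congrArg f (map_last _)).trans (f.map_last.trans (map_last _).symm)

end FInt.Hom

namespace Templicial

open Quiv

variable (X : Templicial.{u} (Type u))

/-- The `n`-simplices of a templicial set. -/
abbrev Elt (n : ℕ) : Type u := El (bead X.X n)

variable {X}

/-- The action of a map of intervals on the simplices of a templicial set. -/
def act {m n : ℕ} (f : FInt.Hom m n) (x : X.Elt n) : X.Elt m := x.map (beadMap X.X f)

/-- The initial part of a simplex of a templicial set. -/
def left (k l : ℕ) (x : X.Elt (k + l)) : X.Elt k := (x.map (comul X.X k l)).left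

/-- The final part of a simplex of a templicial set. -/
def right (k l : ℕ) (x : X.Elt (k + l)) : X.Elt l := (x.map (comul X.X k l)).right

lemma act_id {n : ℕ} (f : FInt.Hom n n) (h : ∀ i ≤ n, f i = i) (x : X.Elt n) : act f x = x :=
  congrArg x.map (beadMap_eq_id X.X f h)

lemma act_act {m n p : ℕ} (f : FInt.Hom m n) (g : FInt.Hom n p) (x : X.Elt p) :
    act f (act g x) = act (f.comp g) x :=
  (congrArg x.map (beadMap_comp X.X f g)).symm

lemma act_congr {m n : ℕ} {f g : FInt.Hom m n} (h : ∀ i ≤ m, f i = g i) (x : X.Elt n) :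
    act f x = act g x :=
  congrArg (fun f ↦ act f x) (FInt.Hom.ext_of_le h)

lemma act_left {m m' n n' : ℕ} (f : FInt.Hom m m') (g : FInt.Hom n n') (x : X.Elt (m' + n')) :
    act f (left m' n' x) = left m n (act (f.add g) x) :=
  ((congrArg (fun k ↦ (x.map k).left) (comul_natural X.X f g)).trans
    (El.left_map (beadMap X.X f) (beadMap X.X g) (x.map (comul X.X m' n')))).symm

lemma act_right {m m' n n' : ℕ} (f : FInt.Hom m m') (g : FInt.Hom n n') (x : X.Elt (m' + n')) :
    act g (right m' n' x) = right m n (act (f.add g) x) :=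
  ((congrArg (fun k ↦ (x.map k).right) (comul_natural X.X f g)).trans
    (El.right_map (beadMap X.X f) (beadMap X.X g) (x.map (comul X.X m' n')))).symm

lemma map_comul_assoc (m n p : ℕ) (x : X.Elt (m + n + p)) :
    (((x.map (comul X.X (m + n) p)).map (comul X.X m n ▷ _)).map (α_ _ _ _).hom) =
      ((act (FInt.Hom.cast (Nat.add_assoc m n p).symm) x).map (comul X.X m (n + p))).map
        (_ ◁ comul X.X n p) :=
  congrArg x.map (comul_assoc X.X m n p)

lemma left_left (m n p : ℕ) (x : X.Elt (m + n + p)) :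
    left m n (left (m + n) p x) =
      left m (n + p) (act (FInt.Hom.cast (Nat.add_assoc m n p).symm) x) := by
  have h := congrArg El.left (map_comul_assoc m n p x)
  rw [El.left_associator, El.left_whiskerRight, El.left_whiskerLeft] at h
  exact h

lemma right_left (m n p : ℕ) (x : X.Elt (m + n + p)) :
    right m n (left (m + n) p x) =
      left n p (right m (n + p) (act (FInt.Hom.cast (Nat.add_assoc m n p).symm) x)) := by
  have h := congrArg (fun y ↦ El.left (El.right y)) (map_comul_assoc m n p x)
  rw [El.left_right_associator, El.left_whiskerRight, El.right_whiskerLeft] at h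
  exact h

lemma right_right (m n p : ℕ) (x : X.Elt (m + n + p)) :
    right n p (right m (n + p) (act (FInt.Hom.cast (Nat.add_assoc m n p).symm) x)) =
      right (m + n) p x := by
  have h := congrArg (fun y ↦ El.right (El.right y)) (map_comul_assoc m n p x)
  rw [El.right_right_associator, El.right_whiskerRight, El.right_whiskerLeft] at h
  exact h.symm

lemma left_zero (n : ℕ) (x : X.Elt n) : left n 0 x = x :=
  (congrArg (fun k ↦ (El.map k x).left) (comul_zero_right X.X n)).trans
    ((El.left_whiskerLeft (unitInv X.X) (x.map (ρ_ _).inv)).trans (El.left_rightUnitor_inv _))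

lemma right_zero (n : ℕ) (x : X.Elt (0 + n)) :
    right 0 n x = act (FInt.Hom.cast (Nat.zero_add n).symm) x :=
  (congrArg (fun k ↦ (El.map k x).right) (comul_zero_left X.X n)).trans
    ((El.right_whiskerRight (unitInv X.X) ((act (FInt.Hom.cast (Nat.zero_add n).symm) x).map
      (λ_ _).inv)).trans (El.right_leftUnitor_inv _))

/-- The middle part of a simplex of a templicial set. -/
def middle (a m b : ℕ) (x : X.Elt (a + m + b)) : X.Elt m := right a m (left (a + m) b x)

lemma act_middle {a a' m m' b b' : ℕ} (f : FInt.Hom a a') (g : FInt.Hom m m') (h : FInt.Hom b b')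
    (x : X.Elt (a' + m' + b')) :
    act g (middle a' m' b' x) = middle a m b (act ((f.add g).add h) x) := by
  rw [middle, act_right f g, act_left _ h, middle]

lemma middle_middle (a a' m b' b : ℕ) (x : X.Elt (a + (a' + m + b') + b)) :
    middle a' m b' (middle a (a' + m + b') b x) = middle (a + a') m (b' + b)
      (act (FInt.Hom.cast (by omega)) x) := by
  have h₁ := right_left (X := X) a (a' + m) b' (act (FInt.Hom.cast (by omega))
    (left (a + (a' + m + b')) b x))
  rw [act_act, act_id _ fun _ _ ↦ rfl, act_left _ (FInt.Hom.id b), left_left, act_act] at h₁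
  have h₂ := right_right a a' m (act (FInt.Hom.cast (Nat.add_assoc a a' m))
    (left (a + (a' + m)) (b' + b) (act (FInt.Hom.cast (by omega)) x)))
  rw [act_act, act_id _ fun _ _ ↦ rfl, act_left _ (FInt.Hom.id (b' + b)), act_act] at h₂
  have e : (act ((FInt.Hom.cast (Nat.add_assoc (a + (a' + m)) b' b).symm).comp
      ((FInt.Hom.cast (by omega)).add (FInt.Hom.id b))) x : X.Elt (a + (a' + m) + (b' + b))) =
      act (FInt.Hom.cast (by omega)) x := act_congr (fun i hi ↦ by
        change (if i ≤ _ then i else _ + (i - _)) = i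
        split_ifs <;> omega) x
  rw [e] at h₁
  rw [middle, middle, middle, ← h₁]
  refine h₂.trans ?_
  refine congrArg (fun y ↦ right (a + a') m (left (a + a' + m) (b' + b) y)) (act_congr (fun i hi ↦ ?_) x)
  change (if i ≤ _ then i else _ + (i - _)) = i
  split_ifs <;> omega

lemma middle_zero (n : ℕ) (f : FInt.Hom (0 + n + 0) n) (hf : ∀ i ≤ n, f i = i) (x : X.Elt n) :
    middle 0 n 0 (act f x) = x := by
  rw [middle, left_zero, right_zero, act_act]
  exact act_id _ (fun i hi ↦ hf i hi) x

/-- The restriction of a simplex of a templicial set along an order preserving map. -/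
def restrict {m n : ℕ} (φ : Fin (m + 1) →o Fin (n + 1)) (x : X.Elt n) : X.Elt m :=
  middle 1 m 1 (act (FInt.Hom.extend φ) x)

lemma restrict_eq {m n a b : ℕ} (φ : Fin (m + 1) →o Fin (n + 1)) (f : FInt.Hom (a + m + b) n)
    (hf : ∀ i : Fin (m + 1), f (a + i) = φ i) (x : X.Elt n) : restrict φ x = middle a m b (act f x) := by
  rw [restrict, ← FInt.Hom.init_comp_eq_extend φ f hf, ← act_act, ← act_middle]
  exact act_id _ (fun _ _ ↦ rfl) _

lemma restrict_restrict {m n p : ℕ} (φ : Fin (m + 1) →o Fin (n + 1)) (ψ : Fin (n + 1) →o Fin (p + 1))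
    (x : X.Elt p) : restrict φ (restrict ψ x) = restrict (ψ.comp φ) x := by
  rw [restrict, restrict, act_middle (FInt.Hom.id 1) (FInt.Hom.extend φ) (FInt.Hom.id 1), middle_middle,
    act_act, act_act]
  refine (restrict_eq _ _ (fun i ↦ ?_) x).symm
  change FInt.Hom.extend ψ (((FInt.Hom.id 1).add (FInt.Hom.extend φ)).add (FInt.Hom.id 1)
    (1 + 1 + i)) = _
  rw [FInt.Hom.add_apply_of_le _ _ (by omega), Nat.add_assoc 1 1, FInt.Hom.add_apply_add,
    FInt.Hom.extend_one_add, FInt.Hom.extend_one_add]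
  rfl

variable (X) in
/-- The simplicial set of simplices of a templicial set. -/
def under : SSet.{u} where
  obj n := X.Elt n.unop.len
  map f := TypeCat.ofHom fun x : X.Elt _ ↦ restrict f.unop.toOrderHom x
  map_id n := by
    ext x
    exact (restrict_eq _ (FInt.Hom.cast (by omega)) (fun i ↦ Nat.zero_add _) x).trans
      (middle_zero _ _ (fun _ _ ↦ rfl) x)
  map_comp f g := by
    ext x
    exact (restrict_restrict g.unop.toOrderHom f.unop.toOrderHom x).symm

lemma restr_eq_act {m n : ℕ} (f : FInt.Hom m n) (x : X.Elt n) :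
    restr (K := X.under) f f.mono f.map_last.le x = act f x := by
  refine (restrict_eq _ ((FInt.Hom.cast (by omega)).comp f : FInt.Hom (0 + m + 0) n) (fun i ↦ ?_) x).trans ?_
  · exact congrArg f (Nat.zero_add _)
  · rw [← act_act]
    exact middle_zero _ _ (fun _ _ ↦ rfl) _

lemma restr_eq_left (k l : ℕ) (x : X.Elt (k + l)) :
    restr (K := X.under) (fun i ↦ i) monotone_id (Nat.le_add_right k l) x = left k l x := by
  refine (restrict_eq _ (FInt.Hom.cast (by omega) : FInt.Hom (0 + k + l) (k + l)) (fun i ↦ ?_) x).trans ?_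
  · exact Nat.zero_add _
  · rw [middle, right_zero, act_left _ (FInt.Hom.id l), act_act]
    refine congrArg (left k l) (act_id _ (fun i hi ↦ ?_) x)
    change (if i ≤ _ then i else _ + (i - _)) = i
    split_ifs <;> omega

lemma restr_eq_right (k l : ℕ) (x : X.Elt (k + l)) :
    restr (K := X.under) (fun i ↦ k + i) (fun _ _ h ↦ Nat.add_le_add_left h k) le_rfl x =
      right k l x := by
  refine (restrict_eq _ (FInt.Hom.id _ : FInt.Hom (k + l + 0) (k + l)) (fun i ↦ rfl) x).trans ?_
  rw [middle, left_zero]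
  exact congrArg (right k l) (act_id _ (fun _ _ ↦ rfl) x)

end Templicial

namespace Templicial

open Quiv

variable {X Y Z : Templicial.{u} (Type u)}

namespace Hom

/-- The map on simplices of a morphism of templicial sets. -/
def el (G : X ⟶ Y) {n : ℕ} (x : X.Elt n) : Y.Elt n :=
  ⟨Templicial.Hom.map G x.src, Templicial.Hom.map G x.tgt,
    x.hom ≫ ((Templicial.Hom.app G).app (Opposite.op ⟨n⟩)).app _ _⟩

lemma el_act (G : X ⟶ Y) {m n : ℕ} (f : FInt.Hom m n) (x : X.Elt n) :
    el G (act f x) = act f (el G x) := by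
  have h := congrArg (fun k ↦ Quiv.Hom.app k x.src x.tgt) ((Templicial.Hom.app G).naturality
    (Quiver.Hom.op (show FInt.mk m ⟶ FInt.mk n from f)))
  have h' : (x.hom ≫ (beadMap X.X f).app _ _) ≫ ((Templicial.Hom.app G).app (Opposite.op ⟨m⟩)).app _ _ =
      (x.hom ≫ ((Templicial.Hom.app G).app (Opposite.op ⟨n⟩)).app _ _) ≫ (beadMap Y.X f).app _ _ :=
    (Category.assoc _ _ _).trans ((congrArg (x.hom ≫ ·) h).trans (Category.assoc _ _ _).symm)
  exact congrArg (fun k ↦ (⟨_, _, k⟩ : Y.Elt m)) h'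

lemma el_comul (G : X ⟶ Y) (k l : ℕ) (x : X.Elt (k + l)) :
    mul (el G (left k l x)).hom (el G (right k l x)).hom = ((el G x).map (comul Y.X k l)).hom := by
  have h := congrArg (fun k ↦ Quiv.Hom.app k x.src x.tgt) (Templicial.Hom.app_comul G k l)
  have h₁ : ((el G x).map (comul Y.X k l)).hom = x.hom ≫ (beadApp (Templicial.Hom.app G) (k + l)).app _ _ ≫
    (comul Y.X k l).app _ _ := Category.assoc _ _ _
  refine Eq.trans ?_ (h₁.trans (congrArg (x.hom ≫ ·) h)).symm
  exact (chain₃ (El.mul_left_right (x.map (comul X.X k l))).symm (mul_tensorHom _ _ _ _)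
    (mul_pullbackμ (Templicial.Hom.map G) _ _)).symm

lemma left_el (G : X ⟶ Y) (k l : ℕ) (x : X.Elt (k + l)) :
    left k l (el G x) = el G (left k l x) :=
  El.left_eq _ (el_comul G k l x)

lemma right_el (G : X ⟶ Y) (k l : ℕ) (x : X.Elt (k + l)) :
    right k l (el G x) = el G (right k l x) :=
  El.right_eq _ (el_comul G k l x)

lemma el_restrict (G : X ⟶ Y) {m n : ℕ} (φ : Fin (m + 1) →o Fin (n + 1)) (x : X.Elt n) :
    el G (restrict φ x) = restrict φ (el G x) := by
  rw [restrict, restrict, middle, middle, ← el_act, left_el, right_el]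

end Hom

/-- The functor from templicial sets to simplicial sets. -/
def underFunctor : Templicial.{u} (Type u) ⥤ SSet.{u} where
  obj := under
  map G :=
    { app n := TypeCat.ofHom fun x ↦ Hom.el G x
      naturality n m f := by
        ext x
        exact Hom.el_restrict G _ x }
  map_id X := by
    ext n x
    exact congrArg (fun k ↦ (⟨_, _, k⟩ : X.Elt _)) (Category.comp_id x.hom)
  map_comp {X Y Z} G H := by
    ext n x
    exact congrArg (fun k ↦ (⟨_, _, k⟩ : Z.Elt _)) (Category.assoc x.hom _ _).symm

/-- The degenerate simplex at a vertex. -/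
def point (a : X.S) : X.Elt 0 := ⟨a, a, unitι rfl ≫ (unitInv X.X).app a a⟩

lemma eq_point (x : X.Elt 0) : x = point x.src := by
  obtain ⟨a, b, p⟩ := x
  obtain ⟨h, hp⟩ := unit_el_eq (p ≫ (Functor.OplaxMonoidal.η X.X).app a b)
  subst h
  refine congrArg (fun k ↦ (⟨a, a, k⟩ : X.Elt 0)) ?_
  have h : (Functor.OplaxMonoidal.η X.X ≫ unitInv X.X).app a a = 𝟙 _ :=
    congrArg (fun k ↦ Quiv.Hom.app k a a) (counit_unitInv (X := X.X))
  exact (Category.comp_id p).symm.trans ((congrArg (p ≫ ·) h).symm.trans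
    ((Category.assoc _ _ _).symm.trans (congrArg (· ≫ _) hp)))

lemma left_zero_eq_point {n : ℕ} (x : X.Elt (0 + n)) : left 0 n x = point x.src := eq_point _

lemma right_eq_point {n : ℕ} (x : X.Elt (n + 0)) : right n 0 x = point x.tgt := by
  have h := eq_point (right n 0 x)
  obtain ⟨e, -⟩ := unit_el_eq ((right n 0 x).hom ≫ (Functor.OplaxMonoidal.η X.X).app _ _)
  rw [e] at h
  exact h

section Extend

variable (k : X.under ⟶ Y.under)

/-- The map on `n`-simplices. -/
def simpMap {n : ℕ} (x : X.Elt n) : Y.Elt n := k.app (Opposite.op (SimplexCategory.mk n)) x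

lemma simpMap_act {m n : ℕ} (f : FInt.Hom m n) (x : X.Elt n) :
    simpMap k (act f x) = act f (simpMap k x) := by
  rw [← restr_eq_act, ← restr_eq_act]
  exact restr_natural k _ _ _ _

lemma simpMap_left (m n : ℕ) (x : X.Elt (m + n)) :
    left m n (simpMap k x) = simpMap k (left m n x) := by
  rw [← restr_eq_left, ← restr_eq_left]
  exact (restr_natural k _ _ _ _).symm

lemma simpMap_right (m n : ℕ) (x : X.Elt (m + n)) :
    right m n (simpMap k x) = simpMap k (right m n x) := by
  rw [← restr_eq_right, ← restr_eq_right]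
  exact (restr_natural k _ _ _ _).symm

/-- The map on vertices. -/
def vertMap (a : X.S) : Y.S := (simpMap k (point a)).src

lemma simpMap_src {n : ℕ} (x : X.Elt n) : (simpMap k x).src = vertMap k x.src := by
  have h := congrArg El.src (simpMap_left k 0 n (act (FInt.Hom.cast (Nat.zero_add n)) x))
  rw [simpMap_act, left_zero_eq_point, left_zero_eq_point] at h
  exact h

lemma simpMap_tgt {n : ℕ} (x : X.Elt n) : (simpMap k x).tgt = vertMap k x.tgt := by
  have h := congrArg El.src (simpMap_right k n 0 x)
  rw [right_eq_point, right_eq_point] at h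
  exact h

/-- An element between given vertices. -/
def cast {S : Type u} {Q : Quiv (Type u) S} (x : El Q) {a b : S} (h : x.src = a) (h' : x.tgt = b) :
    𝟙_ (Type u) ⟶ Q.hom a b := h ▸ h' ▸ x.hom

lemma mk_cast {S : Type u} {Q : Quiv (Type u) S} (x : El Q) {a b : S} (h : x.src = a)
    (h' : x.tgt = b) : (⟨a, b, cast x h h'⟩ : El Q) = x := by
  subst h h'
  rfl

/-- The component of the transformation of quivers. -/
def extendApp (n : ℕ) : bead X.X n ⟶ (Quiv.pullback (vertMap k)).obj (bead Y.X n) :=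
  ⟨fun a b ↦ TypeCat.ofHom fun y ↦ cast (simpMap k ⟨a, b, TypeCat.ofHom fun _ ↦ y⟩)
    (simpMap_src k _) (simpMap_tgt k _) PUnit.unit⟩

lemma mk_extendApp {n : ℕ} (x : X.Elt n) :
    (⟨_, _, x.hom ≫ (extendApp k n).app _ _⟩ : Y.Elt n) = simpMap k x := by
  refine Eq.trans ?_ (mk_cast (simpMap k x) (simpMap_src k _) (simpMap_tgt k _))
  refine congrArg (fun k ↦ (⟨_, _, k⟩ : Y.Elt n)) ?_
  ext
  rfl

/-- A morphism of templicial sets is the same thing as a map of their simplicial sets. -/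
def homOfUnder : X ⟶ Y where
  map := vertMap k
  app :=
    { app n := extendApp k n.unop.len
      naturality := by
        rintro ⟨n⟩ ⟨m⟩ ⟨f⟩
        refine hom_ext_el fun x ↦ congrArg (fun k ↦ (⟨_, _, k⟩ : El _)) ?_
        refine El.mk_injective (Q := bead Y.X m.len) ?_
        refine Eq.trans (mk_extendApp k (act f x)) ?_
        exact (simpMap_act k f x).trans (congrArg (act f) (mk_extendApp k x)).symm }
  app_comul m n := by
    refine hom_ext_el fun x ↦ congrArg (fun k ↦ (⟨_, _, k⟩ : El _)) ?_
    have h := chain₃ (El.mul_left_right (x.map (comul X.X m n))).symm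
      (mul_tensorHom _ _ (extendApp k m) (extendApp k n)) (mul_pullbackμ (vertMap k) _ _)
    refine Eq.trans ?_ h.symm
    refine El.mk_injective (Q := bead Y.X m ⊗ bead Y.X n) ?_
    refine Eq.trans (congrArg (El.map (comul Y.X m n)) (mk_extendApp k x)) (El.ext_tensor ?_ ?_)
    · exact (simpMap_left k m n x).trans ((mk_extendApp k (left m n x)).symm.trans
        (El.left_mul (P := bead Y.X m) (R := bead Y.X n) _ _).symm)
    · exact (simpMap_right k m n x).trans ((mk_extendApp k (right m n x)).symm.trans
        (El.right_mul (P := bead Y.X m) (R := bead Y.X n) _ _).symm)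
  app_counit := by
    refine hom_ext_el fun x ↦ congrArg (fun k ↦ (⟨_, _, k⟩ : El _)) ?_
    obtain ⟨h, hx⟩ := unit_el_eq (x.hom ≫ (Functor.OplaxMonoidal.η X.X).app _ _)
    refine (chain₂ hx (unitι_pullbackε (vertMap k) h)).trans ?_
    obtain ⟨h', hy⟩ := unit_el_eq (a := vertMap k x.src) (b := vertMap k x.tgt)
      ((x.hom ≫ (extendApp k 0).app _ _) ≫ (Functor.OplaxMonoidal.η Y.X).app _ _)
    exact hy.symm.trans (Category.assoc _ _ _)

lemma el_homOfUnder {n : ℕ} (x : X.Elt n) : Hom.el (homOfUnder k) x = simpMap k x :=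
  mk_extendApp k x

end Extend

lemma Hom.ext_el {G H : X ⟶ Y} (h : ∀ n (x : X.Elt n), Hom.el G x = Hom.el H x) : G = H := by
  obtain ⟨g, ga, g₁, g₂⟩ := G
  obtain ⟨f, fa, f₁, f₂⟩ := H
  obtain rfl : g = f := funext fun a ↦ congrArg El.src (h 0 (point a))
  refine Templicial.Hom.ext' fun n a b ↦ ConcreteCategory.hom_ext _ _ fun y ↦ ?_
  exact congrArg (fun k : 𝟙_ (Type u) ⟶ (Y.X.obj n).hom (g a) (g b) ↦ k PUnit.unit)
    (El.mk_injective (h n.unop.len ⟨a, b, TypeCat.ofHom fun _ ↦ y⟩))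

instance : (underFunctor.{u}).Faithful where
  map_injective {X Y} _ _ h := Hom.ext_el fun _ x ↦
    congrArg (fun k : X.under ⟶ Y.under ↦ simpMap k x) h

instance : (underFunctor.{u}).Full where
  map_surjective {X Y} k := ⟨homOfUnder k, by
    ext n x
    exact el_homOfUnder k x⟩

/-- The simplex of the templicial set of a simplicial set `K` given by a simplex of `K`. -/
def ofSimp {K : SSet.{u}} {n : ℕ} (x : simp K n) : (freeTemplicial (Type u) K).Elt n :=
  ⟨vertex x 0 (Nat.zero_le n), vertex x n le_rfl, gen ⟨x, rfl, rfl⟩⟩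

lemma ofSimp_val {K : SSet.{u}} {n : ℕ} {a b : simp K 0} (x : Simp K n a b) :
    (⟨a, b, gen x⟩ : (freeTemplicial (Type u) K).Elt n) = ofSimp x.val := by
  obtain ⟨x, rfl, rfl⟩ := x
  rfl

lemma ofSimp_bijective {K : SSet.{u}} {n : ℕ} :
    Function.Bijective (ofSimp : simp K n → (freeTemplicial (Type u) K).Elt n) := by
  constructor
  · intro x y h
    have key : ∀ (a b a' b' : simp K 0) (x : Simp K n a b) (y : Simp K n a' b'),
        (⟨a, b, gen x⟩ : (freeTemplicial (Type u) K).Elt n) = ⟨a', b', gen y⟩ → x.val = y.val := by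
      intro a b a' b' x y h
      obtain rfl : a = a' := congrArg El.src h
      obtain rfl : b = b' := congrArg El.tgt h
      exact congrArg Simp.val (gen_injective (El.mk_injective h))
    exact key _ _ _ _ _ _ h
  · rintro ⟨a, b, e⟩
    obtain ⟨x, rfl⟩ := gen_surjective e
    exact ⟨x.val, (ofSimp_val x).symm⟩

lemma act_ofSimp {K : SSet.{u}} {m n : ℕ} (f : FInt.Hom m n) (x : simp K n) :
    act f (ofSimp x) = ofSimp (restr f f.mono f.map_last.le x) := by
  refine Eq.trans ?_ (ofSimp_val (Simp.map f (⟨x, rfl, rfl⟩ : Simp K n _ _)))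
  exact congrArg (fun k ↦ (⟨_, _, k⟩ : (freeTemplicial (Type u) K).Elt m))
    (gen_map (Type u) (show FInt.mk m ⟶ FInt.mk n from f) _)

lemma left_ofSimp {K : SSet.{u}} (m n : ℕ) (x : simp K (m + n)) :
    left m n (ofSimp x) = ofSimp (restr (fun i ↦ i) monotone_id (Nat.le_add_right m n) x) := by
  refine Eq.trans ?_ (ofSimp_val (Simp.left m n ⟨x, rfl, rfl⟩))
  exact El.left_eq _ (gen_δ (Type u) K ⟨m⟩ ⟨n⟩ _).symm

lemma right_ofSimp {K : SSet.{u}} (m n : ℕ) (x : simp K (m + n)) :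
    right m n (ofSimp x) =
      ofSimp (restr (fun i ↦ m + i) (fun _ _ h ↦ Nat.add_le_add_left h m) le_rfl x) := by
  refine Eq.trans ?_ (ofSimp_val (Simp.right m n ⟨x, rfl, rfl⟩))
  exact El.right_eq _ (gen_δ (Type u) K ⟨m⟩ ⟨n⟩ _).symm

lemma restrict_ofSimp {K : SSet.{u}} {m n : ℕ} (φ : SimplexCategory.mk m ⟶ SimplexCategory.mk n)
    (x : simp K n) : restrict φ.toOrderHom (ofSimp x) = ofSimp (K.map φ.op x) := by
  rw [restrict, middle, act_ofSimp, left_ofSimp, right_ofSimp, restr_restr]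
  refine (congrArg ofSimp (restr_restr _ _ _ _ _)).trans ?_
  refine congrArg (fun ψ ↦ ofSimp (K.map (Quiver.Hom.op ψ) x)) ?_
  ext i
  exact FInt.Hom.extend_one_add φ.toOrderHom i

/-- The simplicial set of the templicial set of a simplicial set `K` is `K`. -/
def freeTempUnderIso : freeTemp (Type u) ⋙ underFunctor.{u} ≅ 𝟭 SSet.{u} :=
  (NatIso.ofComponents (fun K ↦ NatIso.ofComponents
    (fun n ↦ (Equiv.ofBijective (ofSimp : simp K n.unop.len → _) ofSimp_bijective).toIso)
    fun {n m} f ↦ by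
      ext x
      exact (restrict_ofSimp f.unop x).symm)
    fun {K L} k ↦ by
      ext n x
      refine Eq.symm ?_
      refine Eq.trans (congrArg (fun k ↦ (⟨_, _, k⟩ : (freeTemplicial (Type u) L).Elt _))
        (gen_app (V := Type u) k ⟨n.unop.len⟩ ⟨x, rfl, rfl⟩)) ?_
      exact ofSimp_val _).symm

instance : (underFunctor.{u}).EssSurj where
  mem_essImage K := ⟨_, ⟨freeTempUnderIso.app K⟩⟩

instance : (underFunctor.{u}).IsEquivalence where

end Templicial

theorem isEquivalence_freeTemp : (freeTemp (Type u)).IsEquivalence :=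
  have := Functor.isEquivalence_of_iso Templicial.freeTempUnderIso.{u}.symm
  Functor.isEquivalence_of_comp_right (freeTemp (Type u)) Templicial.underFunctor.{u}

/-! ## Homotopy coherent families of simplices -/

section CoherentFamily

variable {V : Type v} [Category.{u} V] [MonoidalCategory V] [HasLimits V]

/-- A coherent family of simplices of a simplicially enriched category `C` indexed by a simplicial
set `K` assigns points of the simplicial objects of morphisms of `C` to the simplices of `K` and the
chains of sets of vertices of these simplices. It describes a functor `F(K)^nec ⟶ 𝔫(C)`. -/
structure CoherentFamily (K : SSet.{u}) (C : SmallEnrichedCat (SimplicialObject V)) where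
  /-- the map on vertices -/
  obj : simp K 0 → C.Obj
  /-- the point associated to a simplex of `K` and a chain of sets of its vertices -/
  val {k : ℕ} {a b : simp K 0} (s : Simp K k a b) (m : SimplexCategoryᵒᵖ)
    (x : (weight (Nec.bd k)).obj m) : 𝟙_ V ⟶ (C.sHom (obj a) (obj b)).obj m
  val_naturality {k : ℕ} {a b : simp K 0} (s : Simp K k a b) (m m' : SimplexCategoryᵒᵖ) (θ : m ⟶ m')
    (x : (weight (Nec.bd k)).obj m) :
    val s m x ≫ (C.sHom (obj a) (obj b)).map θ = val s m' ((weight (Nec.bd k)).map θ x)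
  val_map {k l : ℕ} (φ : FInt.Hom k l) {a b : simp K 0} (s : Simp K l a b) (m : SimplexCategoryᵒᵖ)
    (x : (weight (Nec.bd k)).obj m) :
    val (s.map φ) m x = val s m (push (NecPoset.map (Nec.bdMap φ)) x)
  val_comp (k l : ℕ) {a b : simp K 0} (s : Simp K (k + l) a b) (m : SimplexCategoryᵒᵖ)
    (x : (weight (Nec.bd k ⊗ Nec.bd l)).obj m) :
    (λ_ _).inv ≫ (val (s.left k l) m (push (NecPoset.fst _ _) x) ⊗ₘ
        val (s.right k l) m (push (NecPoset.snd _ _) x)) ≫ compAt C _ _ _ m =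
      val s m (push (NecPoset.map (Nec.cutMap k l _ rfl)) x)
  val_point (a : simp K 0) (m : SimplexCategoryᵒᵖ) (x : (weight (Nec.bd 0)).obj m) :
    val (Simp.point a) m x = idAt C (obj a) m

namespace CoherentFamily

variable {K : SSet.{u}} {C : SmallEnrichedCat (SimplicialObject V)}

lemma ext' {obj : simp K 0 → C.Obj}
    {val val' : ∀ {k : ℕ} {a b : simp K 0} (_ : Simp K k a b) (m : SimplexCategoryᵒᵖ)
      (_ : (weight (Nec.bd k)).obj m), 𝟙_ V ⟶ (C.sHom (obj a) (obj b)).obj m}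
    {h₁ h₂ h₃ h₄ h₁' h₂' h₃' h₄'}
    (h : ∀ {k : ℕ} {a b : simp K 0} (s : Simp K k a b) (m : SimplexCategoryᵒᵖ)
      (x : (weight (Nec.bd k)).obj m), val s m x = val' s m x) :
    (⟨obj, val, h₁, h₂, h₃, h₄⟩ : CoherentFamily K C) = ⟨obj, val', h₁', h₂', h₃', h₄'⟩ := by
  congr
  funext k a b s m x
  exact h s m x

/-- The point of `𝔫(C)` at a simplex given by a coherent family. -/
def pt (φ : CoherentFamily K C) {k : ℕ} {a b : simp K 0} (s : Simp K k a b) :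
    𝟙_ V ⟶ (nObj (C.sHom (φ.obj a) (φ.obj b))).obj (op (Nec.bd k)) :=
  wlift (φ.val s) (φ.val_naturality s)

lemma pt_π (φ : CoherentFamily K C) {k : ℕ} {a b : simp K 0} (s : Simp K k a b)
    (m : SimplexCategoryᵒᵖ) (x : (weight (Nec.bd k)).obj m) :
    φ.pt s ≫ nπ _ _ m x = φ.val s m x :=
  wlift_π _ _ _ _

lemma pt_map (φ : CoherentFamily K C) {k l : ℕ} (f : FInt.Hom k l) {a b : simp K 0}
    (s : Simp K l a b) :
    φ.pt (s.map f) = φ.pt s ≫ (nObj _).map (Nec.bdMap f).op := nObj_ext fun m x ↦ by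
  rw [Category.assoc, nObj_map_π, pt_π, pt_π, val_map]

lemma pt_comp (φ : CoherentFamily K C) (k l : ℕ) {a b : simp K 0} (s : Simp K (k + l) a b) :
    (λ_ _).inv ≫ (φ.pt (s.left k l) ⊗ₘ φ.pt (s.right k l)) ≫ nComp C _ _ _ _ _ =
      φ.pt s ≫ (nObj _).map (Nec.cutMap k l _ rfl).op := nObj_ext fun m x ↦ by
  rw [Category.assoc, Category.assoc, Category.assoc, nObj_map_π, nComp_π, pt_π,
    tensorHom_comp_tensorHom_assoc, pt_π, pt_π, val_comp]

lemma pt_point (φ : CoherentFamily K C) (a : simp K 0) : φ.pt (Simp.point a) = nId C (φ.obj a) :=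
  nObj_ext fun m x ↦ (φ.pt_π _ m x).trans ((φ.val_point a m x).trans (nId_π C _ m x).symm)

lemma nComp_point {A B D : C.Obj} {T U W : Nec} {f : T ⊗ U ⟶ W}
    {p : 𝟙_ V ⟶ (nObj (C.sHom A B)).obj (op T)} {q : 𝟙_ V ⟶ (nObj (C.sHom B D)).obj (op U)}
    {r : 𝟙_ V ⟶ (nObj (C.sHom A D)).obj (op W)}
    (h : (λ_ _).inv ≫ (p ⊗ₘ q) ≫ nComp C A B D T U = r ≫ (nObj _).map f.op)
    (m : SimplexCategoryᵒᵖ) (x : (weight (T ⊗ U)).obj m) :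
    (λ_ _).inv ≫ (p ≫ nπ _ _ m (push (NecPoset.fst _ _) x) ⊗ₘ
        q ≫ nπ _ _ m (push (NecPoset.snd _ _) x)) ≫ compAt C _ _ _ m =
      r ≫ nπ _ _ m (push (NecPoset.map f) x) := by
  rw [← tensorHom_comp_tensorHom_assoc, ← nComp_π, reassoc_of% h, nObj_map_π]

variable [HasColimits V] [SymmetricCategory V] [MonoidalClosed V]

open Quiv

lemma gen_point (a : simp K 0) :
    unitι (V := V) rfl ≫ (unitInv (freeFunctor V K)).app a a = gen (Simp.point a) := by
  have h : unitInv (freeFunctor V K) = (freeη V K).inv :=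
    IsIso.inv_eq_of_hom_inv_id (freeη V K).hom_inv_id
  rw [h]
  exact unitι_desc (fun h : a = a ↦ gen (V := V) (h ▸ Simp.point a)) rfl

/-- The map on vertices of a coherent family, with values in the objects of `𝔫(C)`. -/
abbrev vert (φ : CoherentFamily K C) : simp K 0 → (nFunctor.obj C).Obj := φ.obj

/-- The compatible family of morphisms associated to a coherent family. -/
def beadHom (φ : CoherentFamily K C) :
    BeadHom (freeFunctor V K) ((nFunctor.obj C).lax φ.vert) where
  app n := ⟨fun _ _ ↦ freeDesc φ.pt⟩
  natural {m n} f := free_ext fun a b s ↦ by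
    have h₁ : gen s ≫ (beadMap (freeFunctor V K) f).app a b = gen (s.map f) := gen_desc _ s
    have h₂ : gen (s.map f) ≫ freeDesc φ.pt = φ.pt (s.map f) := gen_desc _ _
    have h₃ : gen s ≫ freeDesc φ.pt = φ.pt s := gen_desc _ _
    exact (chain₂ h₁ h₂).trans (chain₂ h₃ (φ.pt_map f s).symm).symm
  comul k l := free_ext fun a b s ↦ by
    have h₁ : gen s ≫ (comul (freeFunctor V K) k l).app a b =
      mul (gen (s.left k l)) (gen (s.right k l)) := gen_δ V K ⟨k⟩ ⟨l⟩ s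
    have h₂ : gen (s.left k l) ≫ freeDesc φ.pt = φ.pt (s.left k l) := gen_desc _ _
    have h₃ : gen (s.right k l) ≫ freeDesc φ.pt = φ.pt (s.right k l) := gen_desc _ _
    have h₄ : gen s ≫ freeDesc φ.pt = φ.pt s := gen_desc _ _
    refine (chain₃ h₁ ((mul_tensorHom _ _ _ _).trans (congrArg₂ mul h₂ h₃)) ?_).trans
      (chain₂ h₄ (φ.pt_comp k l s).symm).symm
    refine (Category.assoc _ _ _).trans (congrArg (_ ≫ ·) ((Category.assoc _ _ _).trans
      (congrArg (_ ≫ ·) ?_)))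
    exact (nFunctor.obj C).ι_laxμ _ (op (Nec.bd k)) (op (Nec.bd l)) a _ b
  unit := by
    ext a b
    refine unit_ext fun h ↦ ?_
    subst h
    have h₁ : gen (Simp.point a) ≫ freeDesc φ.pt = φ.pt (Simp.point a) := gen_desc _ _
    exact (chain₂ (gen_point a) (h₁.trans (φ.pt_point a))).trans
      ((nFunctor.obj C).unitι_laxε _ a).symm

/-- The functor `F(K)^nec ⟶ 𝔫(C)` associated to a coherent family. -/
def toHom (φ : CoherentFamily K C) : HCNerve.nec.obj ((freeTemp V).obj K) ⟶ nFunctor.obj C :=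
  BeadHom.necHom (Y := freeTemplicial V K) φ.beadHom

/-- The value at a generator of a functor out of `F(K)^nec`. -/
def genValue (F : HCNerve.nec.obj ((freeTemp V).obj K) ⟶ nFunctor.obj C) {k : ℕ} {a b : simp K 0}
    (s : Simp K k a b) :
    𝟙_ V ⟶ (nObj (C.sHom (NecCat.Hom.obj F a) (NecCat.Hom.obj F b))).obj (op (Nec.bd k)) :=
  gen s ≫ ((NecCat.Hom.beadHom (Y := freeTemplicial V K) (D := nFunctor.obj C) F).app k).app a b

lemma genValue_map (F : HCNerve.nec.obj ((freeTemp V).obj K) ⟶ nFunctor.obj C) {k l : ℕ}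
    (f : FInt.Hom k l) {a b : simp K 0} (s : Simp K l a b) :
    genValue F (s.map f) = genValue F s ≫ (nObj _).map (Nec.bdMap f).op := by
  have h₁ : gen s ≫ (beadMap (freeFunctor V K) f).app a b = gen (s.map f) := gen_desc _ s
  have h := congrArg (fun t ↦ gen s ≫ Quiv.Hom.app t a b)
    ((NecCat.Hom.beadHom (Y := freeTemplicial V K) (D := nFunctor.obj C) F).natural f)
  exact (chain₂ h₁ rfl).symm.trans (h.trans (chain₂ rfl rfl))

lemma genValue_comp (F : HCNerve.nec.obj ((freeTemp V).obj K) ⟶ nFunctor.obj C) (k l : ℕ)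
    {a b : simp K 0} (s : Simp K (k + l) a b) :
    (λ_ _).inv ≫ (genValue F (s.left k l) ⊗ₘ genValue F (s.right k l)) ≫ nComp C _ _ _ _ _ =
      genValue F s ≫ (nObj _).map (Nec.cutMap k l _ rfl).op := by
  have h₁ : gen s ≫ (comul (freeFunctor V K) k l).app a b =
      mul (gen (s.left k l)) (gen (s.right k l)) := gen_δ V K ⟨k⟩ ⟨l⟩ s
  have h := congrArg (fun t ↦ gen s ≫ Quiv.Hom.app t a b)
    ((NecCat.Hom.beadHom (Y := freeTemplicial V K) (D := nFunctor.obj C) F).comul k l)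
  refine Eq.trans ?_ (h.trans (chain₂ rfl rfl))
  refine ((chain₃ h₁ (mul_tensorHom _ _ _ _) ?_)).symm
  refine (Category.assoc _ _ _).trans (congrArg (_ ≫ ·) ((Category.assoc _ _ _).trans
    (congrArg (_ ≫ ·) ?_)))
  exact (nFunctor.obj C).ι_laxμ _ (op (Nec.bd k)) (op (Nec.bd l)) a _ b

lemma genValue_point (F : HCNerve.nec.obj ((freeTemp V).obj K) ⟶ nFunctor.obj C) (a : simp K 0) :
    genValue F (Simp.point a) = nId C (NecCat.Hom.obj F a) := by
  have h := congrArg (fun t ↦ unitι (rfl : a = a) ≫ Quiv.Hom.app t a a)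
    (NecCat.Hom.beadHom (Y := freeTemplicial V K) (D := nFunctor.obj C) F).unit
  exact (chain₂ (gen_point a) rfl).symm.trans (h.trans ((nFunctor.obj C).unitι_laxε _ a))

/-- The coherent family associated to a functor `F(K)^nec ⟶ 𝔫(C)`. -/
def ofHom (F : HCNerve.nec.obj ((freeTemp V).obj K) ⟶ nFunctor.obj C) : CoherentFamily K C where
  obj := NecCat.Hom.obj F
  val s m x := genValue F s ≫ nπ _ _ m x
  val_naturality s m m' θ x := (Category.assoc _ _ _).trans (congrArg (_ ≫ ·) (nπ_natural _ _ θ x))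
  val_map f a b s m x := by
    rw [genValue_map, Category.assoc, nObj_map_π]
  val_comp k l a b s m x := nComp_point (genValue_comp F k l s) m x
  val_point a m x := (congrArg (· ≫ nπ _ _ m x) (genValue_point F a)).trans (nId_π _ _ _ _)

lemma genValue_toHom (φ : CoherentFamily K C) {k : ℕ} {a b : simp K 0} (s : Simp K k a b) :
    genValue φ.toHom s = (φ.pt s : 𝟙_ V ⟶ _) :=
  (congrArg (fun t ↦ gen s ≫ Quiv.Hom.app t a b)
    (BeadHom.necHom_beadHom_app (Y := freeTemplicial V K) φ.beadHom k)).trans (gen_desc _ _)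

lemma ofHom_toHom (φ : CoherentFamily K C) : ofHom φ.toHom = φ :=
  ext' fun s m x ↦ (congrArg (· ≫ nπ _ _ m x) (genValue_toHom φ s)).trans (φ.pt_π s m x)

lemma toHom_ofHom (F : HCNerve.nec.obj ((freeTemp V).obj K) ⟶ nFunctor.obj C) :
    toHom (ofHom F) = F := by
  refine Eq.trans (congrArg (fun g ↦ BeadHom.necHom (Y := freeTemplicial V K)
    (D := nFunctor.obj C) (f := (NecCat.Hom.obj F : simp K 0 → (nFunctor.obj C).Obj)) g) ?_)
    (NecCat.Hom.beadHom_necHom (Y := freeTemplicial V K) F)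
  refine NecCat.Hom.ext_bead (Y := freeTemplicial V K) (D := nFunctor.obj C)
    (g := (ofHom F).beadHom) fun n a b ↦ Sigma.hom_ext _ _ fun s ↦ ?_
  refine (gen_desc _ _).trans (nObj_ext fun m x ↦ ?_)
  exact pt_π (ofHom F) s m x

/-- Coherent families are the same thing as functors `F(K)^nec ⟶ 𝔫(C)`. -/
def equivHom : CoherentFamily K C ≃ (HCNerve.nec.obj ((freeTemp V).obj K) ⟶ nFunctor.obj C) where
  toFun := toHom
  invFun := ofHom
  left_inv := ofHom_toHom
  right_inv := toHom_ofHom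

/-- The image of a coherent family under a functor. -/
def comp (φ : CoherentFamily K C) {D : SmallEnrichedCat (SimplicialObject V)} (G : C ⟶ D) :
    CoherentFamily K D :=
  ofHom (φ.toHom ≫ nFunctor.map G)

lemma comp_val (φ : CoherentFamily K C) {D : SmallEnrichedCat (SimplicialObject V)} (G : C ⟶ D)
    {k : ℕ} {a b : simp K 0} (s : Simp K k a b) (m : SimplexCategoryᵒᵖ)
    (x : (weight (Nec.bd k)).obj m) :
    (φ.comp G).val s m x =
      φ.val s m x ≫ (EnrichedFunctor.map (V := SimplicialObject V) G (φ.obj a) (φ.obj b)).app m := by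
  have h : genValue (φ.toHom ≫ nFunctor.map G) s = φ.pt s ≫
      (nMap (EnrichedFunctor.map (V := SimplicialObject V) G (φ.obj a) (φ.obj b))).app _ := by
    refine Eq.trans ?_ (congrArg (· ≫ (nMap (EnrichedFunctor.map (V := SimplicialObject V) G
      (φ.obj a) (φ.obj b))).app _) (φ.genValue_toHom s))
    exact (congrArg (gen s ≫ ·) (Category.assoc _ _ _).symm).trans (Category.assoc _ _ _).symm
  refine (congrArg (· ≫ nπ _ _ m x) h).trans ((Category.assoc _ _ _).trans ?_)
  refine (congrArg (φ.pt s ≫ ·) (nMap_π _ _ _ _)).trans ((Category.assoc _ _ _).symm.trans ?_)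
  exact congrArg (· ≫ (EnrichedFunctor.map (V := SimplicialObject V) G (φ.obj a) (φ.obj b)).app m)
    (φ.pt_π s m x)

/-- The restriction of a coherent family along a map of simplicial sets. -/
def restrict {L : SSet.{u}} (φ : CoherentFamily L C) (k : K ⟶ L) : CoherentFamily K C :=
  ofHom (HCNerve.nec.map ((freeTemp V).map k) ≫ φ.toHom)

lemma restrict_val {L : SSet.{u}} (φ : CoherentFamily L C) (f : K ⟶ L) {k : ℕ} {a b : simp K 0}
    (s : Simp K k a b) (m : SimplexCategoryᵒᵖ) (x : (weight (Nec.bd k)).obj m) :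
    (φ.restrict f).val s m x = φ.val (s.image f) m x := by
  have h : genValue (HCNerve.nec.map ((freeTemp V).map f) ≫ φ.toHom) s = φ.pt (s.image f) := by
    refine (congrArg (fun t ↦ gen s ≫ Quiv.Hom.app t a b) (BeadHom.comp_necHom_app
      (Y := freeTemplicial V K) (X := freeTemplicial V L) ((freeTemp V).map f) φ.beadHom k)).trans ?_
    exact chain₂ (gen_app f ⟨k⟩ s) (gen_desc _ _)
  exact (congrArg (· ≫ nπ _ _ m x) h).trans (φ.pt_π _ m x)

end CoherentFamily

end CoherentFamily

/-! ## Comparison with the classical homotopy coherent nerve -/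

section Comparison

/-- The vertex `t` of a simplex of a standard simplex. -/
def stdVertex {N : SimplexCategory} {k : ℕ} (x : simp (SSet.stdSimplex.{u}.obj N) k) (t : ℕ)
    (ht : t ≤ k) : ULift.{u} (Fin (N.len + 1)) :=
  ⟨(SSet.stdSimplex.objEquiv x).toOrderHom ⟨t, Nat.lt_succ_of_le ht⟩⟩

lemma stdVertex_mono {N : SimplexCategory} {k : ℕ} (x : simp (SSet.stdSimplex.{u}.obj N) k) {t t' : ℕ}
    (h : t ≤ t') (ht' : t' ≤ k) : stdVertex x t (h.trans ht') ≤ stdVertex x t' ht' :=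
  (SSet.stdSimplex.objEquiv x).toOrderHom.monotone h

lemma stdVertex_restr {N : SimplexCategory} {k l : ℕ} (x : simp (SSet.stdSimplex.{u}.obj N) l)
    (φ : ℕ → ℕ) (hφ : Monotone φ) (h : φ k ≤ l) (t : ℕ) (ht : t ≤ k) :
    stdVertex (restr φ hφ h x) t ht = stdVertex x (φ t) ((hφ ht).trans h) := rfl

lemma stdSimplex_ext {N : SimplexCategory} {k : ℕ} {x y : simp (SSet.stdSimplex.{u}.obj N) k}
    (h : ∀ t ht, stdVertex x t ht = stdVertex y t ht) : x = y := by
  refine SSet.stdSimplex.objEquiv.injective (SimplexCategory.Hom.ext _ _ (OrderHom.ext _ _ ?_))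
  funext t
  exact congrArg ULift.down (h t (Nat.le_of_lt_succ t.2))

/-- The object of `ℭ[Δ^n]` given by a vertex of a standard simplex. -/
abbrev stdVert {N : SimplexCategory} (a : simp (SSet.stdSimplex.{u}.obj N) 0) :
    SimplicialThickening (ULift.{u} (Fin (N.len + 1))) := ⟨stdVertex a 0 le_rfl⟩

variable {N : SimplexCategory} {K : SSet.{u}}

lemma stdVert_first {k : ℕ} {a b : simp (SSet.stdSimplex.{u}.obj N) 0}
    (s : Simp (SSet.stdSimplex.{u}.obj N) k a b) : stdVertex s.val 0 (Nat.zero_le k) = (stdVert a).as :=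
  congrArg (fun a ↦ stdVertex a 0 le_rfl) s.first

lemma stdVert_last {k : ℕ} {a b : simp (SSet.stdSimplex.{u}.obj N) 0}
    (s : Simp (SSet.stdSimplex.{u}.obj N) k a b) : stdVertex s.val k le_rfl = (stdVert b).as :=
  congrArg (fun a ↦ stdVertex a 0 le_rfl) s.last

/-- The map from sets of vertices of `Δ^k` to paths in `Δ^n` induced by a `k`-simplex of `Δ^n`. -/
def path {k : ℕ} {a b : simp (SSet.stdSimplex.{u}.obj N) 0}
    (s : Simp (SSet.stdSimplex.{u}.obj N) k a b) : NecPoset (Nec.bd k) ⥤ (stdVert a ⟶ stdVert b) where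
  obj S :=
    { I := {j | ∃ t ht, t ∈ S.1 ∧ stdVertex s.val t ht = j}
      left := ⟨0, Nat.zero_le k, S.2.1 (zero_mem_joints _), stdVert_first s⟩
      right := ⟨k, le_rfl, S.2.1 (Nec.mem_joints_bdl.2 (Or.inr rfl)), stdVert_last s⟩
      left_le := by
        rintro _ ⟨t, ht, -, rfl⟩
        exact (stdVert_first s).symm.trans_le (stdVertex_mono s.val (Nat.zero_le t) ht)
      le_right := by
        rintro _ ⟨t, ht, -, rfl⟩
        exact (stdVertex_mono s.val ht le_rfl).trans_eq (stdVert_last s) }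
  map f := ⟨⟨⟨fun _ ⟨t, ht, h, e⟩ ↦ ⟨t, ht, leOfHom f h, e⟩⟩⟩⟩

instance {J : Type u} [LinearOrder J] {i j : SimplicialThickening J} (f g : i ⟶ j) :
    Subsingleton (f ⟶ g) :=
  ⟨fun _ _ ↦ InducedCategory.hom_ext (Subsingleton.elim _ _)⟩

lemma path_simplex_ext {J : Type u} [LinearOrder J] {i j : SimplicialThickening J}
    {m : SimplexCategoryᵒᵖ} {x y : (nerve (i ⟶ j)).obj m} (h : ∀ t l, l ∈ (x.obj t).I ↔ l ∈ (y.obj t).I) :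
    x = y :=
  CategoryTheory.Functor.ext (fun t ↦ SimplicialThickening.hom_ext _ _ _ _ (h t))
    fun _ _ _ ↦ Subsingleton.elim _ _

/-- The chain of paths in `Δ^n` given by a `k`-simplex of `Δ^n` and a chain of sets of vertices of
`Δ^k`. -/
def pathChain {k : ℕ} {a b : simp (SSet.stdSimplex.{u}.obj N) 0}
    (s : Simp (SSet.stdSimplex.{u}.obj N) k a b) {m : SimplexCategoryᵒᵖ}
    (x : (weight (Nec.bd k)).obj m) : (nerve (stdVert a ⟶ stdVert b)).obj m :=
  Functor.comp (C := Fin (m.unop.len + 1)) x (path s)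

lemma mem_pathChain {k : ℕ} {a b : simp (SSet.stdSimplex.{u}.obj N) 0}
    (s : Simp (SSet.stdSimplex.{u}.obj N) k a b) {m : SimplexCategoryᵒᵖ}
    (x : (weight (Nec.bd k)).obj m) (t) (j : ULift (Fin (N.len + 1))) :
    j ∈ ((pathChain s x).obj t).I ↔ ∃ l hl, l ∈ (x.obj t).1 ∧ stdVertex s.val l hl = j := Iff.rfl

/-- A point of a set. -/
abbrev elt {A : Type u} (x : A) : 𝟙_ (Type u) ⟶ A := TypeCat.ofHom fun _ : PUnit ↦ x

lemma pathChain_map {k l : ℕ} (φ : FInt.Hom k l) {a b : simp (SSet.stdSimplex.{u}.obj N) 0}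
    (s : Simp (SSet.stdSimplex.{u}.obj N) l a b) {m : SimplexCategoryᵒᵖ}
    (x : (weight (Nec.bd k)).obj m) :
    pathChain (s.map φ) x = pathChain s (push (NecPoset.map (Nec.bdMap φ)) x) := by
  refine path_simplex_ext fun t j ↦ ?_
  rw [mem_pathChain, mem_pathChain]
  constructor
  · rintro ⟨i, hi, h, rfl⟩
    exact ⟨φ i, φ.map_le hi, ⟨i, h, rfl⟩, rfl⟩
  · rintro ⟨_, hi, ⟨i, h, rfl⟩, rfl⟩
    exact ⟨i, ((x.obj t).2.2 h).trans_eq (Nec.bd_len k), h, rfl⟩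

/-- The composition of chains of paths. -/
def chainComp {J : Type u} [LinearOrder J] {i j l : SimplicialThickening J} {m : SimplexCategoryᵒᵖ}
    (x : (nerve (i ⟶ j)).obj m) (y : (nerve (j ⟶ l)).obj m) : (nerve (i ⟶ l)).obj m :=
  Functor.prod' (A := Fin (m.unop.len + 1)) x y ⋙ SimplicialThickening.compFunctor i j l

lemma pathChain_comp (k l : ℕ) {a b : simp (SSet.stdSimplex.{u}.obj N) 0}
    (s : Simp (SSet.stdSimplex.{u}.obj N) (k + l) a b) (m : SimplexCategoryᵒᵖ)
    (x : (weight (Nec.bd k ⊗ Nec.bd l)).obj m) :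
    chainComp (pathChain (s.left k l) (push (NecPoset.fst _ _) x))
        (pathChain (s.right k l) (push (NecPoset.snd _ _) x)) =
      pathChain s (push (NecPoset.map (Nec.cutMap k l _ rfl)) x) := by
  have hk := Nec.bd_len k
  have hl := Nec.bd_len l
  refine path_simplex_ext fun t j ↦ ?_
  rw [mem_pathChain]
  constructor
  · rintro (⟨i, hi, h, rfl⟩ | ⟨i, hi, h, rfl⟩)
    · exact ⟨i, by omega, ⟨i, h.1, rfl⟩, rfl⟩
    · refine ⟨k + i, by omega, ⟨k + i, ?_, rfl⟩, rfl⟩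
      have h' : (Nec.bd k).len + i ∈ (x.obj t).1 := h
      rwa [hk] at h'
  · rintro ⟨_, hi, ⟨i, h, rfl⟩, rfl⟩
    change i ≤ k + l at hi
    by_cases hik : i ≤ k
    · exact Or.inl ⟨i, hik, ⟨h, hik.trans_eq hk.symm⟩, rfl⟩
    · refine Or.inr ⟨i - k, by omega, ?_, ?_⟩
      · change (Nec.bd k).len + (i - k) ∈ (x.obj t).1
        rwa [hk, Nat.add_sub_cancel' (by omega)]
      · exact (stdVertex_restr _ _ _ _ _ _).trans (by congr 1; exact Nat.add_sub_cancel' (by omega))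

variable {C : SmallSimplicialCat.{u}}

/-- The coherent family indexed by `Δ^n` associated to a simplicial functor `ℭ[Δ^n] ⟶ C`. -/
def CoherentFamily.ofFunctor (G : EnrichedFunctor SSet.{u} (Thick.{u} (op N)) C.Obj) :
    CoherentFamily (V := Type u) (SSet.stdSimplex.{u}.obj N) C where
  obj a := G.obj (stdVert a)
  val s m x := elt (pathChain s x) ≫ (G.map _ _).app m
  val_naturality s m m' θ x := by
    rw [Category.assoc]
    exact congrArg (elt (pathChain s x) ≫ ·) ((G.map _ _).naturality θ).symm
  val_map φ a b s m x := by rw [pathChain_map]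
  val_comp k l a b s m x := by
    rw [← pathChain_comp]
    have h := NatTrans.congr_app (G.map_comp (stdVert a) (stdVert (s.middle k l)) (stdVert b)) m
    exact (congrArg (fun f ↦ (λ_ _).inv ≫ (elt (pathChain (s.left k l) (push (NecPoset.fst _ _) x)) ⊗ₘ
      elt (pathChain (s.right k l) (push (NecPoset.snd _ _) x))) ≫ f) h).symm
  val_point a m x := by
    have h := NatTrans.congr_app (G.map_id (stdVert a)) m
    refine Eq.trans ?_ h
    refine congrArg (fun y ↦ elt y ≫ (G.map (stdVert a) (stdVert a)).app m) ?_
    refine path_simplex_ext fun t j ↦ ?_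
    rw [mem_pathChain]
    constructor
    · rintro ⟨i, hi, h, rfl⟩
      obtain rfl : i = 0 := by omega
      rfl
    · intro h
      exact ⟨0, le_rfl, (x.obj t).2.1 (zero_mem_joints _), Eq.symm h⟩

end Comparison

section Comparison

variable {N : SimplexCategory} {K : SSet.{u}}

/-- The vertex of a standard simplex given by an object of `ℭ[Δ^n]`. -/
def stdPoint (i : Thick.{u} (op N)) : simp (SSet.stdSimplex.{u}.obj N) 0 :=
  SSet.stdSimplex.objEquiv.symm (SimplexCategory.Hom.mk ⟨fun _ ↦ i.as.down, monotone_const⟩)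

lemma stdPoint_stdVert (a : simp (SSet.stdSimplex.{u}.obj N) 0) : stdPoint (stdVert a) = a :=
  stdSimplex_ext fun t ht ↦ by
    obtain rfl : t = 0 := by omega
    rfl

variable {i j l : Thick.{u} (op N)} {k k' : ℕ}

/-- The simplex of a standard simplex spanned by the vertices of an interval. -/
def interval (h : (i.as.down : ℕ) + k = j.as.down) :
    Simp (SSet.stdSimplex.{u}.obj N) k (stdPoint i) (stdPoint j) where
  val := SSet.stdSimplex.objEquiv.symm (SimplexCategory.Hom.mk
    ⟨fun t ↦ ⟨i.as.down + t, by
      have h₁ : (t : ℕ) ≤ k := Nat.le_of_lt_succ t.2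
      have h₂ : (j.as.down : ℕ) < N.len + 1 := j.as.down.2
      omega⟩, fun t t' ht ↦ Nat.add_le_add_left ht _⟩)
  first := stdSimplex_ext fun t ht ↦ rfl
  last := stdSimplex_ext fun t ht ↦ ULift.ext _ _ (Fin.ext h)

lemma exists_eq_map_interval (h : (i.as.down : ℕ) + k = j.as.down)
    (s : Simp (SSet.stdSimplex.{u}.obj N) k' (stdPoint i) (stdPoint j)) :
    ∃ f : FInt.Hom k' k, s = (interval h).map f := by
  have hi : (stdVertex s.val 0 (Nat.zero_le k')).down.val = i.as.down :=
    congrArg (fun a : ULift.{u} (Fin (N.len + 1)) ↦ a.down.val) (stdVert_first s)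
  have hj : (stdVertex s.val k' le_rfl).down.val = j.as.down :=
    congrArg (fun a : ULift.{u} (Fin (N.len + 1)) ↦ a.down.val) (stdVert_last s)
  have h₀ : ∀ t ht, i.as.down.val ≤ (stdVertex s.val t ht).down.val := fun t ht ↦
    hi.ge.trans (stdVertex_mono s.val (Nat.zero_le t) ht)
  have h₁ : ∀ t ht, (stdVertex s.val t ht).down.val ≤ j.as.down.val := fun t ht ↦
    (stdVertex_mono s.val ht le_rfl : (stdVertex s.val t ht).down.val ≤ _).trans hj.le
  let f : FInt.Hom k' k := (FInt.Hom.equivOrderHom k' k).symm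
    ⟨⟨fun t ↦ ⟨(stdVertex s.val t (Nat.le_of_lt_succ t.2)).down - i.as.down, by
        have := h₁ t (Nat.le_of_lt_succ t.2)
        omega⟩, fun t t' ht ↦ Nat.sub_le_sub_right (stdVertex_mono s.val ht _) _⟩,
      Fin.ext (Nat.sub_eq_zero_of_le hi.le), Fin.ext (by
        change (stdVertex s.val k' le_rfl).down.val - _ = k
        omega)⟩
  refine ⟨f, Simp.ext (stdSimplex_ext fun t ht ↦ ULift.ext _ _ (Fin.ext ?_))⟩
  have hf : f t = (stdVertex s.val t ht).down - i.as.down := dif_pos ht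
  change _ = i.as.down.val + f t
  have := h₀ t ht
  omega

/-- The map from paths in an interval `[i, j]` to sets of vertices of `Δ^{j-i}`. -/
def shift (h : (i.as.down : ℕ) + k = j.as.down) : (i ⟶ j) ⥤ NecPoset (Nec.bd k) where
  obj I := ⟨{t | ∃ l ∈ I.I, i.as.down + t = (l.down : ℕ)}, fun t ht ↦ by
      obtain rfl | rfl := Nec.mem_joints_bdl.1 ht
      · exact ⟨_, I.left, rfl⟩
      · exact ⟨_, I.right, h⟩, by
      rintro t ⟨l, hl, ht⟩
      have h' : (l.down : ℕ) ≤ j.as.down := I.le_right l hl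
      refine Set.mem_Iic.2 (le_trans ?_ (Nec.bd_len k).ge)
      omega⟩
  map f := homOfLE fun _ ⟨l, hl, ht⟩ ↦ ⟨l, f.1.1.1 hl, ht⟩

/-- The chain of sets of vertices of `Δ^{j-i}` associated to a chain of paths in `[i, j]`. -/
def shiftChain (h : (i.as.down : ℕ) + k = j.as.down) {m : SimplexCategoryᵒᵖ}
    (y : (nerve (i ⟶ j)).obj m) : (weight (Nec.bd k)).obj m :=
  Functor.comp (C := Fin (m.unop.len + 1)) y (shift h)

lemma pathChain_shiftChain (h : (i.as.down : ℕ) + k = j.as.down) {m : SimplexCategoryᵒᵖ}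
    (y : (nerve (i ⟶ j)).obj m) : pathChain (interval h) (shiftChain h y) = y := by
  refine path_simplex_ext (i := i) (j := j) fun t l ↦ ?_
  constructor
  · rintro ⟨s, hs, ⟨l, hl, hls⟩, rfl⟩
    have e : stdVertex (interval h).val s hs = l := ULift.ext _ _ (Fin.ext hls)
    exact e ▸ hl
  · intro hl
    have h₁ : (i.as.down : ℕ) ≤ l.down := (y.obj t).left_le l hl
    have h₂ : (l.down : ℕ) ≤ j.as.down := (y.obj t).le_right l hl
    have h₃ := Nat.add_sub_cancel' h₁
    exact ⟨l.down - i.as.down, by omega, ⟨l, hl, h₃⟩, ULift.ext _ _ (Fin.ext h₃)⟩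

lemma push_cutMap_join (h : (i.as.down : ℕ) + k = j.as.down) (h' : (j.as.down : ℕ) + k' = l.as.down)
    (h'' : (i.as.down : ℕ) + (k + k') = l.as.down) {m : SimplexCategoryᵒᵖ}
    (y : (nerve (i ⟶ j)).obj m) (z : (nerve (j ⟶ l)).obj m) :
    push (NecPoset.map (Nec.cutMap k k' _ rfl)) (NecPoset.join (shiftChain h y) (shiftChain h' z)) =
      shiftChain h'' (chainComp y z) := by
  have hk := Nec.bd_len k
  refine NecPoset.simplex_ext fun t ↦ Subtype.ext (Set.ext fun s ↦ ?_)
  constructor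
  · rintro ⟨_, ⟨p, hp, e⟩ | ⟨s, ⟨p, hp, e⟩, rfl⟩, rfl⟩
    · exact ⟨p, Or.inl hp, e⟩
    · refine ⟨p, Or.inr hp, ?_⟩
      change i.as.down + ((Nec.bd k).len + s) = _
      omega
  · rintro ⟨p, hp | hp, e⟩
    · exact ⟨s, Or.inl ⟨p, hp, e⟩, rfl⟩
    · have h₁ : (j.as.down : ℕ) ≤ p.down := (z.obj t).left_le p hp
      refine ⟨s, Or.inr ⟨s - k, ⟨p, hp, by omega⟩, ?_⟩, rfl⟩
      change (Nec.bd k).len + (s - k) = s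
      omega

section

variable {V : Type v} [Category.{u} V] [MonoidalCategory V] [HasLimits V]
  {C : SmallEnrichedCat (SimplicialObject V)}

lemma CoherentFamily.val_comp_eq (φ : CoherentFamily K C) (k l : ℕ) {a b c : simp K 0}
    {s : Simp K (k + l) a b} {p : Simp K k a c} {q : Simp K l c b} (hp : (s.left k l).val = p.val)
    (hq : (s.right k l).val = q.val) {m : SimplexCategoryᵒᵖ} (x : (weight (Nec.bd k)).obj m)
    (y : (weight (Nec.bd l)).obj m) :
    (λ_ _).inv ≫ (φ.val p m x ⊗ₘ φ.val q m y) ≫ compAt C _ _ _ m =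
      φ.val s m (push (NecPoset.map (Nec.cutMap k l _ rfl)) (NecPoset.join x y)) := by
  have hc : s.middle k l = c := by rw [← p.last, ← (s.left k l).last, hp]
  subst hc
  obtain rfl : s.left k l = p := Simp.ext hp
  obtain rfl : s.right k l = q := Simp.ext hq
  rw [← φ.val_comp, NecPoset.push_fst_join, NecPoset.push_snd_join]

end

namespace CoherentFamily

variable {C : SmallSimplicialCat.{u}}

/-- The point given by a coherent family at a chain of paths in an interval of length `k`. -/
def chainVal (φ : CoherentFamily (V := Type u) (SSet.stdSimplex.{u}.obj N) C)
    (h : (i.as.down : ℕ) + k = j.as.down) {m : SimplexCategoryᵒᵖ} (y : (nerve (i ⟶ j)).obj m) :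
    𝟙_ (Type u) ⟶ (C.sHom (φ.obj (stdPoint i)) (φ.obj (stdPoint j))).obj m :=
  φ.val (interval h) m (shiftChain h y)

lemma add_sub_of_chain {m : SimplexCategoryᵒᵖ} (y : (nerve (i ⟶ j)).obj m) :
    (i.as.down : ℕ) + (j.as.down - i.as.down) = j.as.down :=
  Nat.add_sub_cancel' ((y.obj 0).left_le _ (y.obj 0).right)

/-- The value of a coherent family at a chain of paths. -/
def chainApp (φ : CoherentFamily (V := Type u) (SSet.stdSimplex.{u}.obj N) C)
    {m : SimplexCategoryᵒᵖ} (y : (nerve (i ⟶ j)).obj m) :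
    (C.sHom (φ.obj (stdPoint i)) (φ.obj (stdPoint j))).obj m :=
  φ.chainVal (add_sub_of_chain y) y PUnit.unit

lemma elt_chainApp (φ : CoherentFamily (V := Type u) (SSet.stdSimplex.{u}.obj N) C)
    (h : (i.as.down : ℕ) + k = j.as.down) {m : SimplexCategoryᵒᵖ} (y : (nerve (i ⟶ j)).obj m) :
    elt (φ.chainApp y) = φ.chainVal h y := by
  obtain rfl : k = j.as.down - i.as.down := by omega
  rfl

lemma chainApp_comp (φ : CoherentFamily (V := Type u) (SSet.stdSimplex.{u}.obj N) C)
    {m : SimplexCategoryᵒᵖ} (y : (nerve (i ⟶ j)).obj m) (z : (nerve (j ⟶ l)).obj m) :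
    φ.chainApp (chainComp y z) = compAt (V := Type u) C _ _ _ m (φ.chainApp y, φ.chainApp z) := by
  have h := add_sub_of_chain y
  have h' := add_sub_of_chain z
  have h'' : (i.as.down : ℕ) + ((j.as.down - i.as.down) + (l.as.down - j.as.down)) = l.as.down := by
    omega
  have e := φ.val_comp_eq _ _ (s := interval h'') (p := interval h) (q := interval h')
    (stdSimplex_ext fun t ht ↦ rfl)
    (stdSimplex_ext fun t ht ↦ ULift.ext _ _ (Fin.ext
      ((Nat.add_assoc _ _ _).symm.trans (congrArg (· + t) h)))) (shiftChain h y) (shiftChain h' z)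
  rw [push_cutMap_join h h' h''] at e
  exact (ConcreteCategory.congr_hom ((φ.elt_chainApp h'' (chainComp y z)).trans e.symm) PUnit.unit)

lemma chainApp_id (φ : CoherentFamily (V := Type u) (SSet.stdSimplex.{u}.obj N) C)
    {m : SimplexCategoryᵒᵖ} (y : (nerve (i ⟶ i)).obj m) :
    elt (φ.chainApp y) = idAt (V := Type u) C (φ.obj (stdPoint i)) m := by
  rw [← φ.val_point (stdPoint i) m (shiftChain (k := 0) rfl y), φ.elt_chainApp (k := 0) rfl]
  refine congrArg (fun s ↦ φ.val s m _) (Simp.ext (stdSimplex_ext fun t ht ↦ ?_))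
  obtain rfl : t = 0 := by omega
  rfl

lemma chainApp_map (φ : CoherentFamily (V := Type u) (SSet.stdSimplex.{u}.obj N) C)
    {m m' : SimplexCategoryᵒᵖ} (θ : m ⟶ m') (y : (nerve (i ⟶ j)).obj m) :
    φ.chainApp ((nerve (i ⟶ j)).map θ y) = (C.sHom _ _).map θ (φ.chainApp y) :=
  (ConcreteCategory.congr_hom (φ.val_naturality (interval (add_sub_of_chain y)) m m' θ
    (shiftChain (add_sub_of_chain y) y)) PUnit.unit).symm

/-- The simplicial functor `ℭ[Δ^n] ⟶ C` associated to a coherent family. -/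
def toFunctor (φ : CoherentFamily (V := Type u) (SSet.stdSimplex.{u}.obj N) C) :
    EnrichedFunctor SSet.{u} (Thick.{u} (op N)) C.Obj where
  obj i := φ.obj (stdPoint i)
  map i j :=
    { app m := TypeCat.ofHom fun y : (nerve (i ⟶ j)).obj m ↦ φ.chainApp y
      naturality m m' θ := ConcreteCategory.hom_ext _ _ fun y ↦ φ.chainApp_map θ y }
  map_id i := by
    ext m x
    exact ConcreteCategory.congr_hom (φ.chainApp_id ((eId SSet.{u} i).app m x)) PUnit.unit
  map_comp i j l := by
    ext m x
    exact φ.chainApp_comp x.1 x.2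

lemma toFunctor_ofFunctor (G : EnrichedFunctor SSet.{u} (Thick.{u} (op N)) C.Obj) :
    toFunctor (ofFunctor G) = G := by
  refine EnrichedFunctor.ext _ (fun _ ↦ rfl) fun i j ↦ ?_
  ext m y
  exact congrArg ((G.map i j).app m) (pathChain_shiftChain (add_sub_of_chain y) y)

lemma val_pathChain (φ : CoherentFamily (V := Type u) (SSet.stdSimplex.{u}.obj N) C)
    (s : Simp (SSet.stdSimplex.{u}.obj N) k (stdPoint i) (stdPoint j)) {m : SimplexCategoryᵒᵖ}
    (x : (weight (Nec.bd k)).obj m) :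
    elt (φ.chainApp (pathChain s x)) = φ.val s m x := by
  have h : (i.as.down : ℕ) + (j.as.down - i.as.down) = j.as.down :=
    add_sub_of_chain (pathChain s x)
  obtain ⟨f, hf⟩ := exists_eq_map_interval h s
  refine (φ.elt_chainApp h (pathChain s x)).trans ?_
  have e : shiftChain h (pathChain s x) = push (NecPoset.map (Nec.bdMap f)) x := by
    refine NecPoset.simplex_ext fun t ↦ Subtype.ext (Set.ext fun p ↦ ?_)
    have hs : ∀ q hq, (stdVertex s.val q hq).down.val = i.as.down + f q := fun q hq ↦ by
      rw [hf]; rfl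
    constructor
    · rintro ⟨_, ⟨q, hq, hqx, rfl⟩, hp⟩
      refine ⟨q, hqx, ?_⟩
      have h₁ := hs q hq
      have h₂ : i.as.down.val + p = (stdVertex s.val q hq).down.val := hp
      change f q = p
      omega
    · rintro ⟨q, hqx, rfl⟩
      have hq : q ≤ k := ((x.obj t).2.2 hqx).trans_eq (Nec.bd_len k)
      exact ⟨_, ⟨q, hq, hqx, rfl⟩, (hs q hq).symm⟩
  exact (congrArg (φ.val (interval h) m) e).trans ((φ.val_map f (interval h) m x).symm.trans
    (congrArg (fun s ↦ φ.val s m x) hf.symm))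

lemma ofFunctor_toFunctor (φ : CoherentFamily (V := Type u) (SSet.stdSimplex.{u}.obj N) C) :
    ofFunctor (toFunctor φ) = φ := by
  obtain ⟨obj, val, h₁, h₂, h₃, h₄⟩ := φ
  obtain ⟨g, rfl⟩ : ∃ g : Thick.{u} (op N) → C.Obj, obj = fun a ↦ g (stdVert a) :=
    ⟨fun i ↦ obj (stdPoint i), funext fun a ↦ congrArg obj (stdPoint_stdVert a).symm⟩
  refine ext' fun {k a b} s m x ↦ ?_
  obtain ⟨i, rfl⟩ : ∃ i, stdPoint i = a := ⟨_, stdPoint_stdVert a⟩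
  obtain ⟨j, rfl⟩ : ∃ i, stdPoint i = b := ⟨_, stdPoint_stdVert b⟩
  exact val_pathChain _ s x

end CoherentFamily

end Comparison

section Comparison

namespace CoherentFamily

variable {C D : SmallSimplicialCat.{u}}

/-- Coherent families indexed by `Δ^n` are the same thing as simplicial functors `ℭ[Δ^n] ⟶ C`. -/
def equivFunctor (N : SimplexCategory) (C : SmallSimplicialCat.{u}) :
    EnrichedFunctor SSet.{u} (Thick.{u} (op N)) C.Obj ≃
      CoherentFamily (V := Type u) (SSet.stdSimplex.{u}.obj N) C where
  toFun := ofFunctor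
  invFun := toFunctor
  left_inv := toFunctor_ofFunctor
  right_inv := ofFunctor_toFunctor

lemma ofFunctor_comp {N : SimplexCategory}
    (G : EnrichedFunctor SSet.{u} (Thick.{u} (op N)) C.Obj) (F : C ⟶ D) :
    ofFunctor (EnrichedFunctor.comp SSet.{u} G F) = (ofFunctor G).comp F :=
  ext' fun s m x ↦ ((ofFunctor G).comp_val F s m x).symm

lemma toHom_ofFunctor_comp {N : SimplexCategory}
    (G : EnrichedFunctor SSet.{u} (Thick.{u} (op N)) C.Obj) (F : C ⟶ D) :
    (ofFunctor (EnrichedFunctor.comp SSet.{u} G F)).toHom = (ofFunctor G).toHom ≫ nFunctor.map F := by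
  rw [ofFunctor_comp]
  exact toHom_ofHom _

lemma pathChain_image {M N : SimplexCategory} (f : M ⟶ N) {k : ℕ}
    {a b : simp (SSet.stdSimplex.{u}.obj M) 0} (s : Simp (SSet.stdSimplex.{u}.obj M) k a b)
    {m : SimplexCategoryᵒᵖ} (x : (weight (Nec.bd k)).obj m) :
    ((thickMap.{u} f.op).map (stdVert a) (stdVert b)).app m (pathChain s x) =
      pathChain (s.image (SSet.stdSimplex.map f)) x := by
  refine path_simplex_ext fun t j ↦ ?_
  constructor
  · rintro ⟨_, ⟨i, hi, h, rfl⟩, rfl⟩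
    exact ⟨i, hi, h, rfl⟩
  · rintro ⟨i, hi, h, rfl⟩
    exact ⟨_, ⟨i, hi, h, rfl⟩, rfl⟩

lemma ofFunctor_thickMap {M N : SimplexCategory} (f : M ⟶ N)
    (G : EnrichedFunctor SSet.{u} (Thick.{u} (op N)) C.Obj) :
    ofFunctor (EnrichedFunctor.comp SSet.{u} (thickMap f.op) G) =
      (ofFunctor G).restrict (SSet.stdSimplex.map f) :=
  ext' fun s m x ↦ by
    refine Eq.trans ?_ ((ofFunctor G).restrict_val (SSet.stdSimplex.map f) s m x).symm
    exact congrArg (fun y ↦ elt y ≫ (G.map _ _).app m) (pathChain_image f s x)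

lemma toHom_ofFunctor_thickMap {M N : SimplexCategory} (f : M ⟶ N)
    (G : EnrichedFunctor SSet.{u} (Thick.{u} (op N)) C.Obj) :
    (ofFunctor (EnrichedFunctor.comp SSet.{u} (thickMap f.op) G)).toHom =
      HCNerve.nec.map ((freeTemp (Type u)).map (SSet.stdSimplex.map f)) ≫ (ofFunctor G).toHom := by
  rw [ofFunctor_thickMap]
  exact toHom_ofHom _

end CoherentFamily

/-- A right adjoint of `K ↦ F(K)^nec` sends `𝔫(C)` to the homotopy coherent nerve of `C`. -/
def hcNerveIso {R : NecCat (Type u) ⥤ SSet.{u}} (adj : freeTemp (Type u) ⋙ HCNerve.nec ⊣ R) :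
    hcNerve.{u} ≅ nFunctor ⋙ R :=
  NatIso.ofComponents (fun C ↦ NatIso.ofComponents (fun n ↦
      (((CoherentFamily.equivFunctor n.unop C).trans (CoherentFamily.equivHom.trans
        ((adj.homEquiv _ _).trans SSet.yonedaEquiv))).toIso))
    fun {n m} f ↦ by
      ext G
      have h := CoherentFamily.toHom_ofFunctor_thickMap f.unop G
      refine (congrArg (fun t ↦ SSet.yonedaEquiv (adj.homEquiv _ _ t)) h).trans ?_
      refine (congrArg SSet.yonedaEquiv (adj.homEquiv_naturality_left _ _)).trans ?_
      exact (uliftYonedaEquiv_naturality (adj.homEquiv _ _ (CoherentFamily.ofFunctor G).toHom)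
        f).symm)
    fun {C D} F ↦ by
      ext n G
      have h := CoherentFamily.toHom_ofFunctor_comp G F
      refine (congrArg (fun t ↦ SSet.yonedaEquiv (adj.homEquiv _ _ t)) h).trans ?_
      refine (congrArg SSet.yonedaEquiv (adj.homEquiv_naturality_right _ _)).trans ?_
      exact uliftYonedaEquiv_comp _ _

theorem nonempty_temp_iso_hcNerve {temp : NecCat (Type u) ⥤ Templicial (Type u)}
    (adj : HCNerve.nec ⊣ temp) :
    Nonempty (nFunctor ⋙ temp ≅ hcNerve.{u} ⋙ freeTemp (Type u)) :=
  have := isEquivalence_freeTemp.{u}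
  let e := (freeTemp (Type u)).asEquivalence
  ⟨(Functor.isoWhiskerLeft (nFunctor ⋙ temp) e.counitIso).symm ≪≫
    Functor.isoWhiskerRight (hcNerveIso (e.toAdjunction.comp adj)).symm (freeTemp (Type u))⟩

end Comparison

end HCNerve

end

theorem mainTheorem1 :
    -- the functor `𝔫`, the categorification and the templicial homotopy coherent nerve
    (∀ (V : Type v) [Category.{u} V] [MonoidalCategory V] [SymmetricCategory V] [MonoidalClosed V]
        [HasLimits V] [HasColimits V],
      -- `(-)^nec` has a right adjoint `(-)^temp`
      (HCNerve.nec (V := V)).IsLeftAdjoint ∧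
      -- `𝔫` has a left adjoint `𝔰`
      (HCNerve.nFunctor (V := V)).IsRightAdjoint ∧
      -- `𝔰` is computed by weighted colimits
      (∀ (s : HCNerve.NecCat V ⥤ HCNerve.SmallEnrichedCat (SimplicialObject V))
        (adj : s ⊣ HCNerve.nFunctor) (D : HCNerve.NecCat V),
        HCNerve.IsHomwiseColimit (adj.unit.app D)) ∧
      ∀ (temp : HCNerve.NecCat V ⥤ HCNerve.Templicial V), (HCNerve.nec ⊣ temp) →
        -- the homotopy coherent nerve `(-)^temp ∘ 𝔫` is right adjoint to `𝔰 ∘ (-)^nec`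
        (∀ s : HCNerve.NecCat V ⥤ HCNerve.SmallEnrichedCat (SimplicialObject V),
          (s ⊣ HCNerve.nFunctor) →
            Nonempty (HCNerve.nec ⋙ s ⊣ HCNerve.nFunctor ⋙ temp)) ∧
        -- it sends locally Kan categories to quasi-categories in `V`
        ∀ C : HCNerve.SmallEnrichedCat (SimplicialObject V), HCNerve.LocallyKan C →
          ((HCNerve.nFunctor ⋙ temp).obj C).IsQuasicategory) ∧
    -- for `V = Type u` it recovers the classical homotopy coherent nerve
    ((HCNerve.freeTemp (Type u)).IsEquivalence ∧
      ∀ (temp : HCNerve.NecCat (Type u) ⥤ HCNerve.Templicial (Type u)), (HCNerve.nec ⊣ temp) →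
        Nonempty (HCNerve.nFunctor ⋙ temp ≅ HCNerve.hcNerve.{u} ⋙ HCNerve.freeTemp (Type u))) := by
  refine ⟨fun V _ _ _ _ _ _ ↦ ⟨HCNerve.nec_isLeftAdjoint, HCNerve.nFunctor_isRightAdjoint,
    fun s adj D ↦ HCNerve.isHomwiseColimit_unit adj D, fun temp adj ↦
      ⟨fun s adj' ↦ ⟨adj.comp adj'⟩, HCNerve.isQuasicategory_temp adj⟩⟩, ?_⟩
  exact ⟨HCNerve.isEquivalence_freeTemp, fun _ adj ↦ HCNerve.nonempty_temp_iso_hcNerve adj⟩
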